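/- Let $\sigma\in(1/\sqrt2,1)$ and $\omega>0$. For $\alpha\in\mathbb R$ let $H_\alpha$ be the three-dimensional point interaction on $L^2(\mathbb R^3)$: its domain consists of the $u=\phi+qG_0\in L^2$ with $G_0(x)=\frac1{4\pi|x|}$, $q\in\mathbb C$, $\phi\in H^2_{loc}(\mathbb R^3)$, $\Delta\phi\in L^2$, $\phi(0)=\alpha q$, and $H_\alpha u=-\Delta\phi$. Put $\alpha_1=-(2\sigma+1)\frac{\sqrt\omega}{4\pi}$, $\alpha_2=-\frac{\sqrt\omega}{4\pi}$, $L_j=H_{\alpha_j}+\omega$, and on $L^2(\mathbb R^3;\mathbb C^2)$ let $$J=\begin{pmatrix}0&1\\-1&0\end{pmatrix},\qquad L=J\begin{pmatrix}L_1&0\\0&L_2\end{pmatrix}=\begin{pmatrix}0&L_2\\-L_1&0\end{pmatrix},\qquad R(\lambda)=(L-\lambda)^{-1}.$$ Let $X^0$ be the generalized kernel of $L$, let $X^1$ be spanned by the eigenvectors of $L$ for $\pm i\xi$, $\xi=2\sigma\sqrt{1-\sigma^2}\,\omega$, let $X^c=\{u\in L^2(\mathbb R^3;\mathbb C^2):\Omega(u,v)=0\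 \forall v\in X^0\oplus X^1\}$ with $\Omega(u,v)=\int_{\mathbb R^3}(u_2v_1-u_1v_2)\,dx$, and let $P^c$ be the projection onto $X^c$ along $X^0\oplus X^1$. Let $\Pi^\pm$ be the spectral projections of $L$ onto the two branches $\mathcal C_+=\{i\eta:\eta\ge\omega\}$ and $\mathcal C_-=\{i\eta:\eta\le-\omega\}$ of the continuous spectrum, $$\Pi^\pm=-\frac1{2\pi i}\int_{\mathcal C_\pm}\big(R(\lambda+0)-R(\lambda-0)\big)\,d\lambda$$ (with $\mathcal C_\pm$ oriented upwards; this is the weak limit on $L^2$ of the integrals of $R(\lambda+\varepsilon)-R(\lambda-\varepsilon)$ over the part of $\mathcal C_\pm$ with $|\lambda|\le M$, first as $\varepsilon\to0^+$ and then as $M\to\infty$). Let $w(x)=1+\frac1{|x|}$, $\|f\|_{L^1_w}=\int_{\mathbb R^3} w|f|\,dx$ and $\|f\|_{L^\infty_{w^{-1}}}=\operatorname{ess\,sup}w^{-1}|f|$. Then $P^c$, $\Pi^+$ and $\Pi^-$ exist as bounded operators on $L^2(\mathbb R^3;\mathbb C^2)$, and there is a constant $C>0$ (depending only on $\sigma$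 and $\omega$) such that for every $h\in X^c$ with $\|h\|_{L^\infty_{w^{-1}}}<\infty$ $$\big\|[P^cJ-i(\Pi^+-\Pi^-)]h\big\|_{L^1_w}\le C\,\|h\|_{L^\infty_{w^{-1}}}.$$ -/

import Mathlib

open MeasureTheory Filter Topology

noncomputable section

namespace PointNLS

/-- Physical space, Euclidean three-space. -/
abbrev R3 := EuclideanSpace ℝ (Fin 3)

/-- The values: pairs `(u₁, u₂)`, complexified from `(Re u, Im u)`. -/
abbrev C2 := EuclideanSpace ℂ (Fin 2)

/-- The complex Hilbert space `L²(ℝ³; ℂ²)`. -/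
abbrev L2 := Lp C2 2 (volume : Measure R3)

/-! ### The linear point interaction `H_α` -/

/-- `f` is square integrable on every compact set. -/
def MemL2loc (f : R3 → ℂ) : Prop :=
  ∀ K : Set R3, IsCompact K → MemLp f 2 (volume.restrict K)

/-- `g` is the weak derivative `∂ᵢ f` on all of `ℝ³` (used for locally square integrable
functions). -/
def HasWeakDeriv (i : Fin 3) (f g : R3 → ℂ) : Prop :=
  ∀ ψ : R3 → ℝ, ContDiff ℝ (⊤ : ℕ∞) ψ → HasCompactSupport ψ →
    ∫ x, f x * ((fderiv ℝ ψ x (EuclideanSpace.single i 1) : ℝ) : ℂ) = - ∫ x, g x * (ψ x : ℂ)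

/-- `φ ∈ H²_loc(ℝ³)` and `g = Δφ`, through weak derivatives. -/
def IsH2locWithLaplacian (φ g : R3 → ℂ) : Prop :=
  MemL2loc φ ∧ ∃ (d : Fin 3 → R3 → ℂ) (d2 : Fin 3 → Fin 3 → R3 → ℂ),
    (∀ i, MemL2loc (d i) ∧ HasWeakDeriv i φ (d i)) ∧
    (∀ i j, MemL2loc (d2 i j) ∧ HasWeakDeriv j (d i) (d2 i j)) ∧
    g =ᵐ[volume] fun x => ∑ i, d2 i i x

/-- The Green function `G₀(x) = 1 / (4π|x|)`. -/
def G0 (x : R3) : ℝ := 1 / (4 * Real.pi * ‖x‖)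

/-- `u` belongs to the domain of the point interaction `H_α` and `H_α u = v`: one has
`u = φ + q G₀` with `φ ∈ H²_loc`, `Δφ ∈ L²`, `φ(0) = α q` (the value at the origin of the continuous
representative of `φ`), and `v = -Δφ`. -/
def IsPointInteraction (α : ℝ) (u v : R3 → ℂ) : Prop :=
  MemLp u 2 volume ∧ MemLp v 2 volume ∧
  ∃ (q : ℂ) (φ : R3 → ℂ), Continuous φ ∧ φ 0 = (α : ℂ) * q ∧
    (u =ᵐ[volume] fun x => φ x + q * (G0 x : ℂ)) ∧
    IsH2locWithLaplacian φ (fun x => - v x)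

/-! ### The linearization `L = [[0, L₂], [-L₁, 0]]`, `L_j = H_{α_j} + ω` -/

/-- `α₁ = -(2σ+1) √ω / (4π)`. -/
def alpha1 (σ ω : ℝ) : ℝ := -(2 * σ + 1) * (Real.sqrt ω / (4 * Real.pi))

/-- `α₂ = -√ω / (4π)`. -/
def alpha2 (ω : ℝ) : ℝ := -(Real.sqrt ω / (4 * Real.pi))

/-- The graph of `L`: `u ∈ D(L)` and `L u = v`, that is `u₁ ∈ D(H_{α₁})`, `u₂ ∈ D(H_{α₂})`,
`v₁ = (H_{α₂} + ω) u₂` and `v₂ = -(H_{α₁} + ω) u₁`. -/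
def IsL (σ ω : ℝ) (u v : L2) : Prop :=
  ∃ g₁ g₂ : R3 → ℂ,
    IsPointInteraction (alpha1 σ ω) (fun x => u x 0) g₁ ∧
    IsPointInteraction (alpha2 ω) (fun x => u x 1) g₂ ∧
    (∀ᵐ x : R3, v x 0 = g₂ x + (ω : ℂ) * u x 1) ∧
    (∀ᵐ x : R3, v x 1 = -(g₁ x + (ω : ℂ) * u x 0))

/-- `R` is a bounded two-sided inverse of `L - z`. -/
def IsResolventAt (σ ω : ℝ) (z : ℂ) (R : L2 →L[ℂ] L2) : Prop :=
  (∀ f : L2, IsL σ ω (R f) (f + z • R f)) ∧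
  (∀ u v : L2, IsL σ ω u v → R (v - z • u) = u)

open Classical in
/-- The resolvent `R(z) = (L - z)⁻¹` (with value `0` if `z` is in the spectrum of `L`). -/
def resolvent (σ ω : ℝ) (z : ℂ) : L2 →L[ℂ] L2 :=
  if h : ∃ R, IsResolventAt σ ω z R then h.choose else 0

/-! ### Symplectic structure, discrete and continuous spectral subspaces -/

/-- The matrix `J = [[0, 1], [-1, 0]]` acting pointwise on `L²(ℝ³; ℂ²)`. -/
def J : L2 →L[ℂ] L2 :=
  ContinuousLinearMap.compLpL 2 volume
    (Matrix.toEuclideanCLM (n := Fin 2) (𝕜 := ℂ) !![0, 1; -1, 0])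

/-- The (complex bilinear) symplectic form `Ω(u, v) = ∫ (u₂ v₁ - u₁ v₂) dx`. -/
def Omega (u v : L2) : ℂ := ∫ x, (u x 1 * v x 0 - u x 0 * v x 1)

/-- `ξ = 2 σ √(1 - σ²) ω`. -/
def xi (σ ω : ℝ) : ℝ := 2 * σ * Real.sqrt (1 - σ ^ 2) * ω

/-- `X⁰`, the generalized kernel of `L`: all `u` with `Lⁿ u = 0` for some `n`. -/
def X0 (σ ω : ℝ) : Submodule ℂ L2 :=
  Submodule.span ℂ {u | ∃ (n : ℕ) (c : ℕ → L2), c 0 = u ∧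
    (∀ k < n, IsL σ ω (c k) (c (k + 1))) ∧ c n = 0}

/-- `X¹`, spanned by the eigenvectors of `L` for the eigenvalues `iξ` and `-iξ`. -/
def X1 (σ ω : ℝ) : Submodule ℂ L2 :=
  Submodule.span ℂ {u | IsL σ ω u ((Complex.I * (xi σ ω : ℂ)) • u) ∨
    IsL σ ω u ((-(Complex.I * (xi σ ω : ℂ))) • u)}

/-- `u` lies in `Xᶜ`, the symplectic complement of `X⁰ ⊕ X¹`. -/
def MemXc (σ ω : ℝ) (u : L2) : Prop :=
  ∀ v ∈ X0 σ ω ⊔ X1 σ ω, Omega u v = 0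

/-- `P` is the symplectic projection `Pᶜ` onto `Xᶜ`, along `X⁰ ⊕ X¹`. -/
def IsPc (σ ω : ℝ) (P : L2 →L[ℂ] L2) : Prop :=
  ∀ f : L2, MemXc σ ω (P f) ∧ f - P f ∈ X0 σ ω ⊔ X1 σ ω

/-! ### The projections onto the two branches of the continuous spectrum -/

/-- The matrix element between `g` and `f` of
`-(1/2πi) ∫ [R(λ + ε) - R(λ - ε)] dλ`, `λ = iη` running upwards over `a ≤ η ≤ b`. -/
def contourIntegral (σ ω ε a b : ℝ) (g f : L2) : ℂ :=
  -(1 / (2 * (Real.pi : ℂ) * Complex.I)) *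
    ∫ η in a..b, inner ℂ g
      ((resolvent σ ω (Complex.I * (η : ℂ) + (ε : ℂ))
        - resolvent σ ω (Complex.I * (η : ℂ) - (ε : ℂ))) f) * Complex.I

/-- `P = Π⁺`, the spectral projection `-(1/2πi) ∫_{𝒞₊} [R(λ + 0) - R(λ - 0)] dλ` onto the branch
`𝒞₊ = {iη : η ≥ ω}`; the integral is understood weakly in `L²`. -/
def IsPiPlus (σ ω : ℝ) (P : L2 →L[ℂ] L2) : Prop :=
  ∀ g f : L2, ∃ I : ℝ → ℂ,
    (∀ M, ω < M →
      Tendsto (fun ε : ℝ => contourIntegral σ ω ε ω M g f) (𝓝[>] 0) (𝓝 (I M))) ∧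
    Tendsto I atTop (𝓝 (inner ℂ g (P f)))

/-- `P = Π⁻`, the spectral projection onto the branch `𝒞₋ = {iη : η ≤ -ω}`. -/
def IsPiMinus (σ ω : ℝ) (P : L2 →L[ℂ] L2) : Prop :=
  ∀ g f : L2, ∃ I : ℝ → ℂ,
    (∀ M, ω < M →
      Tendsto (fun ε : ℝ => contourIntegral σ ω ε (-M) (-ω) g f) (𝓝[>] 0) (𝓝 (I M))) ∧
    Tendsto I atTop (𝓝 (inner ℂ g (P f)))

/-! ### The weighted norms -/

/-- The weight `w(x) = 1 + 1/|x|`. -/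
def w (x : R3) : ℝ := 1 + 1 / ‖x‖

/-- `‖f‖_{L¹_w} = ∫ w |f| dx`, possibly infinite. -/
def normL1w (f : L2) : ENNReal := eLpNorm (fun x => w x • f x) 1 volume

/-- `‖f‖_{L^∞_{w⁻¹}} = ess sup |f| / w`, possibly infinite. -/
def normLinfw (f : L2) : ENNReal := eLpNorm (fun x => (w x)⁻¹ • f x) ⊤ volume

end PointNLS

end

open PointNLS

/-! The matrix `J` acts as `i` on the line of `(1, i)` and as `-i` on the line of `(1, -i)`. Without
the point interaction, `L` would be `J(-Δ + ω)`; the branch `𝒞₊` would belong to the first component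
and `𝒞₋` to the second, the spectral projections would be the pointwise projections onto these
lines, and `J = i(Π⁺ - Π⁻)` would hold exactly. The point interaction disturbs this only through the
two charges, so the operator to be estimated is a sum of three corrections: minus the discrete
projection applied to `J`, and the two differences between `Π^±` and their free counterparts
(`J_eq`, `combination_eq`). The reflection `(u₁, u₂) ↦ (u₁, -u₂)` anticommutes with `L` and
exchanges the two branches, so only `Π⁺` needs analysis (`isPiMinus_iff`).

The resolvent is explicit. With `κ² = ω + iz` and `μ² = ω - iz`, both roots in the right half plane,
`(L - z)⁻¹` is the free resolvent plus charges times `G_κ`, `G_μ`; the charges solve a 2 by 2 system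
with determinant `D = (κ - p)(μ - p) - d²`, where `p = (σ+1)√ω` and `d = σ√ω` (`isL_iff_cmp`,
`isResolventAt_explicitRes`). Its matrix elements are those of the free resolvent plus products of
two transforms `Φ_f(κ) = ∫ G_κ f` or `Φ_f(μ)` divided by `D` (`inner_resolvent`). On the branch `𝒞₊`
one has `κ = it` and `μ = √(2ω + t²)`; there `D` does not vanish because `σ > 1/√2` excludes a
threshold resonance at `t = 0`, and by compactness and growth `|D| ≥ c(1 + t²)` on a strip `0 ≤ Re κ
≤ δ` (`exists_det_lower_bound`).

The jump of the free part across the contour is a Poisson integral of the spectral measure of `-Δ`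
and gives the free projection. The charge part becomes, with `η = ω + t²`, an integral of `axisForm`
over the whole imaginary `κ`-axis. `Φ_f` is bounded from `L²(ℝ³)` to `L²` of that axis by
Plancherel, and its positive majorant is square integrable in `Re κ` by a Schur test. These facts
bound the contour integrals as forms; for functions of bounded support the limits in `ε` and then in
`M` are computed directly, and density gives `Π⁺` on all of `L²` together with a formula for its
matrix elements (`StripBounds.exists_isPiPlus`).

For the weighted estimate the difficulty is that `Φ_f(it)` has no bound in terms of
`‖f‖_{L^∞_{w⁻¹}}`, whereas `|Φ_f(κ)| ≤ A(1/Re κ + 1/(Re κ)²)` when `|f| ≤ A w`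
(`norm_Phi_le_of_weight`). Three kinds of terms are distinguished. In the product of two transforms
at `κ` the coefficient is `1 + p/(κ+1)` plus a remainder of order `|κ|⁻²`: the leading part is
analytic in the right half plane, so its contour can be pushed to `Re κ = ∞` and it contributes
nothing (`integral_mul_Phi_mul_Phi_eq_zero`), while the remainder is integrated over `Re κ = δ`. The
mixed terms are moved to `Re κ = δ` as well; their coefficient and their transform at `μ` each decay
like `1/|t|`. The product of two transforms at `μ` converges on the axis itself, because `Re μ`
grows like `|t|`. This is `StripBounds.exists_weighted_bound`.

The discrete subspace is spanned by four explicit vectors built from `G_κ` and exponentials: a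
kernel vector, one generalized eigenvector (the Jordan chain stops there because `σ < 1`), and the
eigenvectors for `±iξ`. They form two hyperbolic pairs for `Ω`, so `Pᶜ` exists, is unique and has a
finite rank complement with integrable kernels (`hyperbolic_formL`, `exists_Pd_bound`). Finally the
`L¹_w` norm is recovered by testing against functions bounded by `w` (`normL1w_le_of_dual`). -/

noncomputable section
namespace PointNLS
open scoped SchwartzMap FourierTransform LineDeriv Laplacian ContDiff

/-! ### Weak derivatives tested against complex functions -/

/-- The `i`-th coordinate vector. -/
abbrev ev (i : Fin 3) : R3 := EuclideanSpace.single i 1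

/-- The classical `i`-th partial derivative. -/
def pd (i : Fin 3) (ψ : R3 → ℂ) (x : R3) : ℂ := fderiv ℝ ψ x (ev i)

/-- The classical Laplacian. -/
def lap (ψ : R3 → ℂ) (x : R3) : ℂ := ∑ i, pd i (pd i ψ) x

/-- Complex test functions. -/
def IsTest (ψ : R3 → ℂ) : Prop := ContDiff ℝ (⊤ : ℕ∞) ψ ∧ HasCompactSupport ψ

theorem IsTest.continuous {ψ : R3 → ℂ} (h : IsTest ψ) : Continuous ψ := h.1.continuous

theorem contDiff_pd {ψ : R3 → ℂ} (h : ContDiff ℝ (⊤ : ℕ∞) ψ) (i : Fin 3) :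
    ContDiff ℝ (⊤ : ℕ∞) (pd i ψ) := by
  have : ContDiff ℝ (⊤ : ℕ∞) (fderiv ℝ ψ) := h.fderiv_right (m := (⊤ : ℕ∞)) (by simp)
  exact this.clm_apply contDiff_const

theorem IsTest.pd {ψ : R3 → ℂ} (h : IsTest ψ) (i : Fin 3) : IsTest (pd i ψ) :=
  ⟨contDiff_pd h.1 i, h.2.fderiv_apply (𝕜 := ℝ) (ev i)⟩

theorem pd_mul {f g : R3 → ℂ} (hf : Differentiable ℝ f) (hg : Differentiable ℝ g) (i : Fin 3) :
    pd i (fun x => f x * g x) = fun x => pd i f x * g x + f x * pd i g x := by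
  ext x
  have := ((hf x).hasFDerivAt.mul (hg x).hasFDerivAt).fderiv
  simp only [pd]
  erw [this]
  simp
  ring

theorem pd_add {f g : R3 → ℂ} (hf : Differentiable ℝ f) (hg : Differentiable ℝ g) (i : Fin 3) :
    pd i (fun x => f x + g x) = fun x => pd i f x + pd i g x := by
  ext x
  have := ((hf x).hasFDerivAt.add (hg x).hasFDerivAt).fderiv
  simp only [pd]
  erw [this]
  simp

theorem IsTest.lap_continuous {ψ : R3 → ℂ} (h : IsTest ψ) : Continuous (lap ψ) :=
  continuous_finsetSum _ fun i _ => ((h.pd i).pd i).continuous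

theorem IsTest.hasCompactSupport_lap {ψ : R3 → ℂ} (h : IsTest ψ) : HasCompactSupport (lap ψ) := by
  have : lap ψ = ∑ i, PointNLS.pd i (PointNLS.pd i ψ) := by
    ext x; simp [lap]
  rw [this]
  have h2 := fun i => ((h.pd i).pd i).2
  simp only [Fin.sum_univ_three]
  exact ((h2 0).add (h2 1)).add (h2 2)

theorem MemL2loc.locallyIntegrable {f : R3 → ℂ} (hf : MemL2loc f) : LocallyIntegrable f volume := by
  rw [locallyIntegrable_iff]
  intro K hK
  have : IsFiniteMeasure (volume.restrict K) := ⟨by simpa using hK.measure_lt_top⟩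
  exact (hf K hK).integrable (by norm_num)

theorem MemL2loc.integrable_mul {f ψ : R3 → ℂ} (hf : MemL2loc f) (h1 : Continuous ψ)
    (h2 : HasCompactSupport ψ) : Integrable (fun x => f x * ψ x) := by
  simpa [mul_comm] using hf.locallyIntegrable.integrable_smul_left_of_hasCompactSupport h1 h2

theorem MemLp.memL2loc {f : R3 → ℂ} (hf : MemLp f 2 volume) : MemL2loc f :=
  fun _ _ => hf.restrict _

theorem MemL2loc.add {f g : R3 → ℂ} (hf : MemL2loc f) (hg : MemL2loc g) :
    MemL2loc (fun x => f x + g x) := fun K hK => (hf K hK).add (hg K hK)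

theorem MemL2loc.const_mul {f : R3 → ℂ} (hf : MemL2loc f) (c : ℂ) :
    MemL2loc (fun x => c * f x) := fun K hK => (hf K hK).const_mul c

/-- Weak derivatives are defined with real test functions; splitting into real and imaginary parts
makes complex ones available, which the Fourier arguments need. -/
theorem HasWeakDeriv.integral_eq {i : Fin 3} {f g : R3 → ℂ} (h : HasWeakDeriv i f g)
    (hf : MemL2loc f) (hg : MemL2loc g) {ψ : R3 → ℂ} (hψ : IsTest ψ) :
    ∫ x, f x * pd i ψ x = - ∫ x, g x * ψ x := by
  have hre : ContDiff ℝ (⊤ : ℕ∞) (fun x => (ψ x).re) := Complex.reCLM.contDiff.comp hψ.1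
  have him : ContDiff ℝ (⊤ : ℕ∞) (fun x => (ψ x).im) := Complex.imCLM.contDiff.comp hψ.1
  have cre : HasCompactSupport (fun x => (ψ x).re) := hψ.2.comp_left (g := Complex.re) rfl
  have cim : HasCompactSupport (fun x => (ψ x).im) := hψ.2.comp_left (g := Complex.im) rfl
  have h1 := h _ hre cre
  have h2 := h _ him cim
  have hd : ∀ x, HasFDerivAt ψ (fderiv ℝ ψ x) x := fun x =>
    (hψ.1.differentiable (by simp) x).hasFDerivAt
  have dre : ∀ x, fderiv ℝ (fun x => (ψ x).re) x (ev i) = (pd i ψ x).re := fun x => by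
    have : HasFDerivAt (fun x => (ψ x).re) (Complex.reCLM.comp (fderiv ℝ ψ x)) x :=
      Complex.reCLM.hasFDerivAt.comp x (hd x)
    rw [this.fderiv]; rfl
  have dim : ∀ x, fderiv ℝ (fun x => (ψ x).im) x (ev i) = (pd i ψ x).im := fun x => by
    have : HasFDerivAt (fun x => (ψ x).im) (Complex.imCLM.comp (fderiv ℝ ψ x)) x :=
      Complex.imCLM.hasFDerivAt.comp x (hd x)
    rw [this.fderiv]; rfl
  have key : ∀ (u : R3 → ℂ) (θ : R3 → ℂ), MemL2loc u → IsTest θ →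
      ∫ x, u x * θ x = (∫ x, u x * ((θ x).re : ℂ)) + Complex.I * ∫ x, u x * ((θ x).im : ℂ) := by
    intro u θ hu hθ
    rw [← integral_const_mul, ← integral_add]
    · refine integral_congr_ae (Eventually.of_forall fun x => ?_)
      dsimp only
      conv_lhs => rw [← Complex.re_add_im (θ x)]
      ring
    · refine hu.integrable_mul (Complex.continuous_ofReal.comp (Complex.continuous_re.comp
        hθ.continuous)) ?_
      exact hθ.2.mono' (fun x hx => subset_tsupport _ fun h0 => hx (by simp [h0]))
    · refine (hu.integrable_mul (Complex.continuous_ofReal.comp (Complex.continuous_im.comp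
        hθ.continuous)) ?_).const_mul _
      exact hθ.2.mono' (fun x hx => subset_tsupport _ fun h0 => hx (by simp [h0]))
  rw [key f _ hf (hψ.pd i), key g _ hg hψ]
  simp only [← dre, ← dim]
  rw [h1, h2]
  ring

theorem IsH2locWithLaplacian.integral_lap {φ g : R3 → ℂ} (h : IsH2locWithLaplacian φ g)
    {ψ : R3 → ℂ} (hψ : IsTest ψ) : ∫ x, φ x * lap ψ x = ∫ x, g x * ψ x := by
  obtain ⟨hφ, d, d2, hd, hd2, hg⟩ := h
  have e1 : ∀ i, ∫ x, φ x * pd i (pd i ψ) x = ∫ x, d2 i i x * ψ x := fun i => by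
    rw [(hd i).2.integral_eq hφ (hd i).1 (hψ.pd i),
      (hd2 i i).2.integral_eq (hd i).1 (hd2 i i).1 hψ, neg_neg]
  have e2 : ∫ x, g x * ψ x = ∫ x, ∑ i, d2 i i x * ψ x := by
    refine integral_congr_ae ?_
    filter_upwards [hg] with x hx
    rw [hx, Finset.sum_mul]
  rw [e2, integral_finsetSum]
  · simp only [lap, Finset.mul_sum]
    rw [integral_finsetSum]
    · exact Finset.sum_congr rfl fun i _ => e1 i
    · exact fun i _ => hφ.integrable_mul ((hψ.pd i).pd i).continuous ((hψ.pd i).pd i).2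
  · exact fun i _ => (hd2 i i).1.integrable_mul hψ.continuous hψ.2

theorem HasWeakDeriv.add {i : Fin 3} {f g f' g' : R3 → ℂ} (h : HasWeakDeriv i f g)
    (h' : HasWeakDeriv i f' g') (hf : MemL2loc f) (hg : MemL2loc g) (hf' : MemL2loc f')
    (hg' : MemL2loc g') : HasWeakDeriv i (fun x => f x + f' x) (fun x => g x + g' x) := by
  intro ψ h1 h2
  have c1 : Continuous fun x => ((fderiv ℝ ψ x (EuclideanSpace.single i 1) : ℝ) : ℂ) :=
    Complex.continuous_ofReal.comp ((h1.continuous_fderiv (by simp)).clm_apply continuous_const)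
  have c2 : HasCompactSupport fun x => ((fderiv ℝ ψ x (EuclideanSpace.single i 1) : ℝ) : ℂ) :=
    (h2.fderiv_apply (𝕜 := ℝ) (ev i)).comp_left (g := fun t : ℝ => (t : ℂ)) (by simp)
  have c3 : Continuous fun x => (ψ x : ℂ) := Complex.continuous_ofReal.comp h1.continuous
  have c4 : HasCompactSupport fun x => (ψ x : ℂ) := h2.comp_left (g := fun t : ℝ => (t : ℂ)) (by simp)
  simp only [add_mul]
  rw [integral_add (hf.integrable_mul c1 c2) (hf'.integrable_mul c1 c2),
    integral_add (hg.integrable_mul c3 c4) (hg'.integrable_mul c3 c4), h ψ h1 h2, h' ψ h1 h2]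
  ring

theorem HasWeakDeriv.const_mul {i : Fin 3} {f g : R3 → ℂ} (h : HasWeakDeriv i f g) (c : ℂ) :
    HasWeakDeriv i (fun x => c * f x) (fun x => c * g x) := by
  intro ψ h1 h2
  simp only [mul_assoc, integral_const_mul, h ψ h1 h2]
  ring

theorem IsH2locWithLaplacian.add {f g f' g' : R3 → ℂ} (h : IsH2locWithLaplacian f g)
    (h' : IsH2locWithLaplacian f' g') :
    IsH2locWithLaplacian (fun x => f x + f' x) (fun x => g x + g' x) := by
  obtain ⟨hφ, d, d2, hd, hd2, hg⟩ := h
  obtain ⟨hφ', d', d2', hd', hd2', hg'⟩ := h'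
  refine ⟨hφ.add hφ', fun i x => d i x + d' i x, fun i j x => d2 i j x + d2' i j x,
    fun i => ⟨(hd i).1.add (hd' i).1, (hd i).2.add (hd' i).2 hφ (hd i).1 hφ' (hd' i).1⟩,
    fun i j => ⟨(hd2 i j).1.add (hd2' i j).1, (hd2 i j).2.add (hd2' i j).2 (hd i).1 (hd2 i j).1
      (hd' i).1 (hd2' i j).1⟩, ?_⟩
  filter_upwards [hg, hg'] with x hx hx'
  rw [hx, hx', Finset.sum_add_distrib]

theorem IsH2locWithLaplacian.const_mul {f g : R3 → ℂ} (h : IsH2locWithLaplacian f g) (c : ℂ) :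
    IsH2locWithLaplacian (fun x => c * f x) (fun x => c * g x) := by
  obtain ⟨hφ, d, d2, hd, hd2, hg⟩ := h
  refine ⟨hφ.const_mul c, fun i x => c * d i x, fun i j x => c * d2 i j x,
    fun i => ⟨(hd i).1.const_mul c, (hd i).2.const_mul c⟩,
    fun i j => ⟨(hd2 i j).1.const_mul c, (hd2 i j).2.const_mul c⟩, ?_⟩
  filter_upwards [hg] with x hx
  rw [hx, Finset.mul_sum]

theorem HasWeakDeriv.congr_left {i : Fin 3} {f f' g : R3 → ℂ} (h : HasWeakDeriv i f g)
    (hf : f =ᵐ[volume] f') : HasWeakDeriv i f' g := by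
  intro ψ h1 h2
  rw [← h ψ h1 h2]
  refine integral_congr_ae ?_
  filter_upwards [hf] with x hx
  rw [hx]

theorem IsH2locWithLaplacian.congr {f f' g g' : R3 → ℂ} (h : IsH2locWithLaplacian f g)
    (hf : f =ᵐ[volume] f') (hgg : g =ᵐ[volume] g') : IsH2locWithLaplacian f' g' := by
  obtain ⟨hφ, d, d2, hd, hd2, hg⟩ := h
  exact ⟨fun K hK => (hφ K hK).ae_eq (ae_restrict_of_ae hf), d, d2,
    fun i => ⟨(hd i).1, (hd i).2.congr_left hf⟩, hd2, hgg.symm.trans hg⟩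

end PointNLS
end

noncomputable section
namespace PointNLS
open scoped SchwartzMap FourierTransform LineDeriv Laplacian ContDiff

/-! ### Uniqueness for the Helmholtz equation in `L²` -/

theorem schwartz_laplacian_apply (ψ : 𝓢(R3, ℂ)) (x : R3) : (Δ ψ : 𝓢(R3, ℂ)) x = lap ψ x := by
  rw [SchwartzMap.laplacian_eq_sum (EuclideanSpace.basisFun (Fin 3) ℝ)]
  simp only [sum_apply, lap]
  refine Finset.sum_congr rfl fun i _ => ?_
  rw [SchwartzMap.lineDerivOp_apply_eq_fderiv]
  simp only [pd, EuclideanSpace.basisFun_apply]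
  congr 2

/-- A smooth cutoff equal to `1` on the unit ball. -/
theorem exists_cutoff : ∃ χ : R3 → ℂ, IsTest χ ∧ (∀ x, ‖x‖ ≤ 1 → χ x = 1) ∧
    (∀ x, 2 ≤ ‖x‖ → χ x = 0) ∧ ∀ x, ‖χ x‖ ≤ 1 := by
  let b : ContDiffBump (0 : R3) := ⟨1, 2, by norm_num, by norm_num⟩
  refine ⟨fun x => (b x : ℂ), ⟨Complex.ofRealCLM.contDiff.comp b.contDiff,
    b.hasCompactSupport.comp_left (g := fun t : ℝ => (t : ℂ)) (by simp)⟩, fun x hx => ?_,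
    fun x hx => ?_, fun x => ?_⟩
  · have := b.one_of_mem_closedBall (x := x) (by simpa [b] using hx)
    simp [this]
  · have := b.zero_of_le_dist (x := x) (by simpa [b] using hx)
    simp [this]
  · simpa [abs_of_nonneg b.nonneg] using b.le_one

theorem pd_comp_smul {χ : R3 → ℂ} (h : Differentiable ℝ χ) (t : ℝ) (i : Fin 3) :
    pd i (fun x => χ (t • x)) = fun x => (t : ℂ) * pd i χ (t • x) := by
  ext x
  have : HasFDerivAt (fun x => χ (t • x))
      ((fderiv ℝ χ (t • x)).comp (t • ContinuousLinearMap.id ℝ R3)) x :=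
    (h (t • x)).hasFDerivAt.comp x ((hasFDerivAt_id x).const_smul t)
  simp only [pd, this.fderiv]
  simp

theorem pd_const_mul {f : R3 → ℂ} (hf : Differentiable ℝ f) (c : ℂ) (i : Fin 3) :
    pd i (fun x => c * f x) = fun x => c * pd i f x := by
  ext x
  have : HasFDerivAt (fun x => c * f x) (c • fderiv ℝ f x) x := (hf x).hasFDerivAt.const_mul c
  simp only [pd, this.fderiv]
  simp

/-- Each derivative that falls on the dilated cutoff carries a factor `t`, so that as `t → 0` only
the Laplacian of `ψ` survives. -/
theorem lap_cutoff_mul {χ ψ : R3 → ℂ} (hχ : ContDiff ℝ (⊤ : ℕ∞) χ) (hψ : ContDiff ℝ (⊤ : ℕ∞) ψ)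
    (t : ℝ) (x : R3) : lap (fun x => χ (t • x) * ψ x) x =
      ∑ i, ((t : ℂ) * ((t : ℂ) * pd i (pd i χ) (t • x)) * ψ x +
        2 * ((t : ℂ) * pd i χ (t • x) * pd i ψ x) + χ (t • x) * pd i (pd i ψ) x) := by
  have dχ : Differentiable ℝ χ := hχ.differentiable (by simp)
  have dψ : Differentiable ℝ ψ := hψ.differentiable (by simp)
  have dχ1 : ∀ i, Differentiable ℝ (pd i χ) := fun i => (contDiff_pd hχ i).differentiable (by simp)
  have dψ1 : ∀ i, Differentiable ℝ (pd i ψ) := fun i => (contDiff_pd hψ i).differentiable (by simp)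
  have sm : ∀ {f : R3 → ℂ}, Differentiable ℝ f → Differentiable ℝ fun x => f (t • x) :=
    fun h => h.comp (differentiable_id.const_smul t)
  unfold lap
  refine Finset.sum_congr rfl fun i _ => ?_
  rw [pd_mul (sm dχ) dψ, pd_comp_smul dχ,
    pd_add (f := fun x => (t : ℂ) * pd i χ (t • x) * ψ x) (g := fun x => χ (t • x) * pd i ψ x)
      (((sm (dχ1 i)).const_mul _).mul dψ) ((sm dχ).mul (dψ1 i)),
    pd_mul (f := fun x => (t : ℂ) * pd i χ (t • x)) ((sm (dχ1 i)).const_mul _) dψ, pd_mul (sm dχ) (dψ1 i), pd_comp_smul dχ,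
    pd_const_mul (sm (dχ1 i)), pd_comp_smul (dχ1 i)]
  ring

theorem exists_bound_of_isTest {χ : R3 → ℂ} (h : IsTest χ) : ∃ C, ∀ x, ‖χ x‖ ≤ C :=
  h.2.exists_bound_of_continuous h.continuous

theorem integrable_mul_of_memLp {u v : R3 → ℂ} (hu : MemLp u 2 volume) (hv : MemLp v 2 volume) :
    Integrable fun x => u x * v x := hu.integrable_mul hv

/-- A distributional identity tested against test functions extends to Schwartz functions. -/
theorem integral_schwartz_eq_zero {u : R3 → ℂ} (hu : MemLp u 2 volume) (z : ℂ)
    (h : ∀ ψ, IsTest ψ → ∫ x, u x * (z * ψ x - lap ψ x) = 0) (ψ : 𝓢(R3, ℂ)) :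
    ∫ x, u x * (z * ψ x - lap ψ x) = 0 := by
  obtain ⟨χ, hχ, h1, -, h2⟩ := exists_cutoff
  have hψ : ContDiff ℝ (⊤ : ℕ∞) ψ := ψ.smooth ⊤
  choose C1 hC1 using fun i => exists_bound_of_isTest (hχ.pd i)
  choose C2 hC2 using fun i => exists_bound_of_isTest ((hχ.pd i).pd i)
  have mψ : MemLp ψ 2 (volume : Measure R3) := ψ.memLp 2
  have ep : ∀ (θ : 𝓢(R3, ℂ)) i, (∂_{ev i} θ : 𝓢(R3, ℂ)) = pd i θ := fun θ i => by
    ext x; rw [SchwartzMap.lineDerivOp_apply_eq_fderiv]; rfl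
  have mψ1 : ∀ i, MemLp (pd i ψ) 2 (volume : Measure R3) := fun i => by
    rw [← ep]; exact (∂_{ev i} ψ : 𝓢(R3, ℂ)).memLp 2
  have mψ2 : ∀ i, MemLp (pd i (pd i ψ)) 2 (volume : Measure R3) := fun i => by
    rw [← ep, ← ep]; exact (∂_{ev i} (∂_{ev i} ψ : 𝓢(R3, ℂ)) : 𝓢(R3, ℂ)).memLp 2
  let F : ℕ → R3 → ℂ := fun n x => u x * (z * (χ ((1 / ((n : ℝ) + 1)) • x) * ψ x) -
    lap (fun x => χ ((1 / ((n : ℝ) + 1)) • x) * ψ x) x)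
  have hF : ∀ n, ∫ x, F n x = 0 := fun n => by
    refine h _ ⟨(hχ.1.comp (contDiff_id.const_smul _)).mul hψ, ?_⟩
    refine HasCompactSupport.mul_right ?_
    exact hχ.2.comp_homeomorph (Homeomorph.smulOfNeZero (1 / ((n : ℝ) + 1)) (by positivity))
  have lim0 : Tendsto (fun n : ℕ => 1 / ((n : ℝ) + 1)) atTop (𝓝 0) := tendsto_one_div_add_atTop_nhds_zero_nat
  have t1 : ∀ n : ℕ, |1 / ((n : ℝ) + 1)| ≤ 1 := fun n => by
    rw [abs_of_nonneg (by positivity), div_le_one (by positivity)]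
    linarith [n.cast_nonneg (α := ℝ)]
  -- Removing the cutoff: since `1/(n+1) ≤ 1`, the integrands are dominated by `|u|` times `ψ` and
  -- its first two derivatives, all of which are integrable by Cauchy-Schwarz.
  have key : Tendsto (fun n => ∫ x, F n x) atTop (𝓝 (∫ x, u x * (z * ψ x - lap ψ x))) := by
    refine tendsto_integral_of_dominated_convergence
      (fun x => ‖u x * (‖z‖ * ‖ψ x‖ : ℝ)‖ + ∑ i, (C2 i * ‖u x * ψ x‖ + 2 * C1 i * ‖u x * pd i ψ x‖
        + ‖u x * pd i (pd i ψ) x‖)) (fun n => ?_) ?_ (fun n => ?_) ?_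
    · refine hu.1.mul (Continuous.aestronglyMeasurable ?_)
      have : ContDiff ℝ (⊤ : ℕ∞) (fun x => χ ((1 / ((n : ℝ) + 1)) • x) * ψ x) :=
        (hχ.1.comp (contDiff_id.const_smul _)).mul hψ
      exact (continuous_const.mul this.continuous).sub
        (continuous_finsetSum _ fun i _ => (contDiff_pd (contDiff_pd this i) i).continuous)
    · refine Integrable.add ?_ (integrable_finsetSum _ fun i _ => ?_)
      · refine (integrable_mul_of_memLp hu ?_).norm
        exact (mψ.norm.const_mul ‖z‖).ofReal
      · exact (((integrable_mul_of_memLp hu mψ).norm.const_mul _).add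
          ((integrable_mul_of_memLp hu (mψ1 i)).norm.const_mul _)).add
          (integrable_mul_of_memLp hu (mψ2 i)).norm
    · refine Eventually.of_forall fun x => ?_
      simp only [F]
      rw [lap_cutoff_mul hχ.1 hψ]
      set t := 1 / ((n : ℝ) + 1)
      have ht : ‖(t : ℂ)‖ ≤ 1 := (Complex.norm_real t).trans_le (t1 n)
      rw [mul_sub, Finset.mul_sum]
      refine (norm_sub_le _ _).trans (add_le_add ?_ ((norm_sum_le _ _).trans
        (Finset.sum_le_sum fun i _ => ?_)))
      · simp only [norm_mul, Complex.norm_real, norm_norm]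
        have := mul_le_mul_of_nonneg_right (h2 (t • x)) (norm_nonneg (ψ x))
        rw [one_mul] at this
        gcongr
      · rw [mul_add, mul_add]
        refine (norm_add₃_le).trans ?_
        simp only [norm_mul]
        have e1 : ‖(t : ℂ)‖ * (‖(t : ℂ)‖ * ‖pd i (pd i χ) (t • x)‖) ≤ C2 i := by
          have := hC2 i (t • x)
          have a := norm_nonneg (t : ℂ)
          have b := norm_nonneg (pd i (pd i χ) (t • x))
          calc _ ≤ 1 * (1 * C2 i) := by gcongr
            _ = _ := by ring
        have e2 : ‖(t : ℂ)‖ * ‖pd i χ (t • x)‖ ≤ C1 i := by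
          have := hC1 i (t • x)
          calc _ ≤ 1 * C1 i := by gcongr
            _ = _ := by ring
        have e3 := h2 (t • x)
        have n2 : ‖(2 : ℂ)‖ = 2 := by simp
        rw [n2]
        refine add_le_add (add_le_add ?_ ?_) ?_
        · calc _ = ‖(t : ℂ)‖ * (‖(t : ℂ)‖ * ‖pd i (pd i χ) (t • x)‖) * (‖u x‖ * ‖ψ x‖) := by ring
            _ ≤ _ := by gcongr
        · calc _ = 2 * (‖(t : ℂ)‖ * ‖pd i χ (t • x)‖) * (‖u x‖ * ‖pd i ψ x‖) := by ring
            _ ≤ _ := by gcongr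
        · calc _ = ‖χ (t • x)‖ * (‖u x‖ * ‖pd i (pd i ψ) x‖) := by ring
            _ ≤ 1 * (‖u x‖ * ‖pd i (pd i ψ) x‖) := by gcongr
            _ = _ := by ring
    · refine Eventually.of_forall fun x => ?_
      simp only [F]
      simp_rw [lap_cutoff_mul hχ.1 hψ]
      have tc : Tendsto (fun n : ℕ => ((1 / ((n : ℝ) + 1) : ℝ) : ℂ)) atTop (𝓝 0) := by
        have := (Complex.continuous_ofReal.tendsto 0).comp lim0
        rwa [Complex.ofReal_zero] at this
      have sx : Tendsto (fun n : ℕ => (1 / ((n : ℝ) + 1)) • x) atTop (𝓝 0) := by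
        simpa using lim0.smul_const x
      have g0 : Tendsto (fun n : ℕ => χ ((1 / ((n : ℝ) + 1)) • x)) atTop (𝓝 1) := by
        have := (hχ.continuous.tendsto 0).comp sx
        rwa [h1 0 (by simp)] at this
      have g1 : ∀ i, Tendsto (fun n : ℕ => pd i χ ((1 / ((n : ℝ) + 1)) • x)) atTop (𝓝 (pd i χ 0)) :=
        fun i => ((hχ.pd i).continuous.tendsto 0).comp sx
      have g2 : ∀ i, Tendsto (fun n : ℕ => pd i (pd i χ) ((1 / ((n : ℝ) + 1)) • x)) atTop
          (𝓝 (pd i (pd i χ) 0)) := fun i => (((hχ.pd i).pd i).continuous.tendsto 0).comp sx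
      have : z * ψ x - lap ψ x = z * (1 * ψ x) - ∑ i, ((0 : ℂ) * (0 * pd i (pd i χ) 0) * ψ x +
          2 * (0 * pd i χ 0 * pd i ψ x) + 1 * pd i (pd i ψ) x) := by
        simp [lap]
      rw [this]
      refine tendsto_const_nhds.mul ((tendsto_const_nhds.mul (g0.mul_const _)).sub
        (tendsto_finsetSum _ fun i _ => ?_))
      exact (((tc.mul (tc.mul (g2 i))).mul_const _).add
        (tendsto_const_nhds.mul ((tc.mul (g1 i)).mul_const _))).add (g0.mul_const _)
  simp only [hF] at key
  exact (tendsto_nhds_unique key tendsto_const_nhds)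

/-- The symbol of `-Δ + z`. -/
def symb (z : ℂ) (ξ : R3) : ℂ := z + ((2 * Real.pi) ^ 2 * ‖ξ‖ ^ 2 : ℝ)

theorem hasTemperateGrowth_symb (z : ℂ) : (symb z).HasTemperateGrowth := by
  unfold symb; fun_prop

theorem continuous_symb (z : ℂ) : Continuous (symb z) := (hasTemperateGrowth_symb z).1.continuous

theorem fourierInv_symb_smul (z : ℂ) (g : 𝓢(R3, ℂ)) (x : R3) :
    (𝓕⁻ (SchwartzMap.smulLeftCLM ℂ (symb z) g) : 𝓢(R3, ℂ)) x =
      z * (𝓕⁻ g : 𝓢(R3, ℂ)) x - lap (𝓕⁻ g : 𝓢(R3, ℂ)) x := by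
  have e : SchwartzMap.smulLeftCLM ℂ (symb z) g =
      z • g + ((2 * Real.pi) ^ 2 : ℝ) • SchwartzMap.smulLeftCLM ℂ (fun x : R3 => ‖x‖ ^ 2) g := by
    ext ξ
    have h2 : (fun x : R3 => ‖x‖ ^ 2).HasTemperateGrowth := by fun_prop
    simp [SchwartzMap.smulLeftCLM_apply_apply (hasTemperateGrowth_symb z),
      SchwartzMap.smulLeftCLM_apply_apply h2, symb]
    ring
  have h := SchwartzMap.laplacian_eq_fourierMultiplierCLM (𝓕⁻ g : 𝓢(R3, ℂ))
  rw [SchwartzMap.fourierMultiplierCLM_apply, FourierTransform.fourier_fourierInv_eq] at h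
  rw [← schwartz_laplacian_apply, h, e, FourierTransform.fourierInv_add,
    FourierTransform.fourierInv_smul, FourierTransform.fourierInv_smul (R := ℝ)]
  simp

theorem symb_ne_zero {z : ℂ} (hz : z ∈ Complex.slitPlane) (ξ : R3) : symb z ξ ≠ 0 := by
  intro h
  have hp : 0 ≤ (2 * Real.pi) ^ 2 * ‖ξ‖ ^ 2 := by positivity
  have h1 := congrArg Complex.re h
  have h2 := congrArg Complex.im h
  simp only [symb, Complex.add_re, Complex.ofReal_re, Complex.zero_re, Complex.add_im,
    Complex.ofReal_im, Complex.zero_im, add_zero] at h1 h2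
  rcases hz with h | h
  · linarith
  · exact h h2

/-- Scalar square integrable functions. -/
abbrev S2 := Lp ℂ 2 (volume : Measure R3)

/-- On the Fourier side the equation says that the symbol `z + 4π²|ξ|²` times the transform of `u`
vanishes against every test function. The symbol has no zero because `z` avoids the closed negative
half line, so the transform vanishes. -/
theorem ae_eq_zero_of_helmholtz {u : R3 → ℂ} (hu : MemLp u 2 volume) {z : ℂ}
    (hz : z ∈ Complex.slitPlane)
    (h : ∀ ψ, IsTest ψ → ∫ x, u x * (z * ψ x - lap ψ x) = 0) : u =ᵐ[volume] 0 := by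
  set U : S2 := hu.toLp u
  have hU : ∀ᵐ x, U x = u x := hu.coeFn_toLp
  have hloc : LocallyIntegrable (fun x => symb z x * (𝓕⁻ U : S2) x) volume := by
    have : LocallyIntegrable (fun x => (𝓕⁻ U : S2) x) volume :=
      (MemLp.memL2loc (Lp.memLp _)).locallyIntegrable
    exact this.continuous_mul (continuous_symb z)
  have h0 : ∀ᵐ x, symb z x * (𝓕⁻ U : S2) x = 0 := by
    refine ae_eq_zero_of_integral_contDiff_smul_eq_zero hloc fun g hg1 hg2 => ?_
    have c1 : HasCompactSupport (fun x => (g x : ℂ)) := hg2.comp_left (g := fun t : ℝ => (t : ℂ)) (by simp)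
    have c2 : ContDiff ℝ ∞ (fun x => (g x : ℂ)) := Complex.ofRealCLM.contDiff.comp hg1
    set G : 𝓢(R3, ℂ) := c1.toSchwartzMap c2
    have e1 : ∫ x, g x • (symb z x * (𝓕⁻ U : S2) x) =
        ((𝓕⁻ U : S2) : 𝓢'(R3, ℂ))
          (SchwartzMap.smulLeftCLM ℂ (symb z) G) := by
      rw [Lp.toTemperedDistribution_apply]
      refine integral_congr_ae (Eventually.of_forall fun x => ?_)
      simp [SchwartzMap.smulLeftCLM_apply_apply (hasTemperateGrowth_symb z), G]
      ring
    rw [e1, ← Lp.fourierInv_toTemperedDistribution_eq, TemperedDistribution.fourierInv_apply,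
      Lp.toTemperedDistribution_apply]
    rw [← integral_schwartz_eq_zero hu z h (𝓕⁻ G)]
    refine integral_congr_ae ?_
    filter_upwards [hU] with x hx
    rw [fourierInv_symb_smul, hx, smul_eq_mul, mul_comm]
  have h1 : 𝓕⁻ U = (0 : S2) := by
    rw [Lp.eq_zero_iff_ae_eq_zero]
    filter_upwards [h0] with x hx
    simpa [symb_ne_zero hz x] using hx
  have h2 : U = 0 := by
    have := congrArg (fun f : S2 => 𝓕 f) h1
    simpa using this
  rw [h2] at hU
  filter_upwards [hU, Lp.coeFn_zero ℂ 2 (volume : Measure R3)] with x h3 h4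
  rw [← h3, h4]

end PointNLS
end

noncomputable section
namespace PointNLS
open scoped SchwartzMap FourierTransform LineDeriv Laplacian ContDiff

/-! ### The free resolvent -/

/-- Compactness handles the ball `|ξ| ≤ |z| + 1`, where the symbol has no zero; outside it `4π²|ξ|²
≥ 36|ξ|²` dominates `|z|`. -/
theorem exists_symb_lower_bound {z : ℂ} (hz : z ∈ Complex.slitPlane) :
    ∃ c : ℝ, 0 < c ∧ ∀ ξ : R3, c * (1 + ‖ξ‖ ^ 2) ≤ ‖symb z ξ‖ := by
  have hs : IsCompact (Metric.closedBall (0 : R3) (‖z‖ + 1)) := isCompact_closedBall _ _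
  obtain ⟨ξ0, -, h0⟩ := hs.exists_isMinOn (f := fun ξ => ‖symb z ξ‖)
    ⟨0, by simp; positivity⟩ (continuous_symb z).norm.continuousOn
  have hp : 0 < ‖symb z ξ0‖ := norm_pos_iff.2 (symb_ne_zero hz ξ0)
  set R := ‖z‖ + 1 with hR
  have hR1 : 1 ≤ R := by have := norm_nonneg z; linarith
  have hpi : (3 : ℝ) < Real.pi := Real.pi_gt_three
  refine ⟨min 1 (‖symb z ξ0‖ / (1 + R ^ 2)), lt_min one_pos (by positivity), fun ξ => ?_⟩
  by_cases h : ‖ξ‖ ≤ R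
  · have h1 : ‖symb z ξ0‖ ≤ ‖symb z ξ‖ := h0 (by simpa using h)
    calc _ ≤ ‖symb z ξ0‖ / (1 + R ^ 2) * (1 + R ^ 2) := by
          gcongr
          exact min_le_right _ _
      _ = ‖symb z ξ0‖ := by field_simp
      _ ≤ _ := h1
  · push Not at h
    have h1 : ‖(((2 * Real.pi) ^ 2 * ‖ξ‖ ^ 2 : ℝ) : ℂ)‖ - ‖z‖ ≤ ‖symb z ξ‖ := by
      have := norm_sub_le (symb z ξ) z
      have e : symb z ξ - z = (((2 * Real.pi) ^ 2 * ‖ξ‖ ^ 2 : ℝ) : ℂ) := by simp [symb]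
      rw [e] at this; linarith
    rw [Complex.norm_real, Real.norm_of_nonneg (by positivity)] at h1
    have h2 : 36 * ‖ξ‖ ^ 2 ≤ (2 * Real.pi) ^ 2 * ‖ξ‖ ^ 2 := by
      gcongr; nlinarith
    calc _ ≤ 1 * (1 + ‖ξ‖ ^ 2) := by gcongr; exact min_le_left _ _
      _ ≤ _ := by nlinarith

theorem continuous_symb_inv {z : ℂ} (hz : z ∈ Complex.slitPlane) : Continuous fun ξ => (symb z ξ)⁻¹ :=
  (continuous_symb z).inv₀ (symb_ne_zero hz)

theorem exists_symb_inv_bound {z : ℂ} (hz : z ∈ Complex.slitPlane) :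
    ∃ C : ℝ, 0 < C ∧ ∀ ξ : R3, ‖(symb z ξ)⁻¹‖ ≤ C / (1 + ‖ξ‖ ^ 2) := by
  obtain ⟨c, hc, h⟩ := exists_symb_lower_bound hz
  refine ⟨c⁻¹, by positivity, fun ξ => ?_⟩
  rw [norm_inv, div_eq_mul_inv, ← mul_inv]
  exact inv_anti₀ (by positivity) (h ξ)

theorem memLp_top_symb_inv {z : ℂ} (hz : z ∈ Complex.slitPlane) :
    MemLp (fun ξ => (symb z ξ)⁻¹) ⊤ (volume : Measure R3) := by
  obtain ⟨C, hC, h⟩ := exists_symb_inv_bound hz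
  refine memLp_top_of_bound (continuous_symb_inv hz).aestronglyMeasurable C
    (Eventually.of_forall fun ξ => (h ξ).trans ?_)
  exact div_le_self hC.le (by nlinarith [norm_nonneg ξ])

/-- Multiplication by a bounded function on `L²`. -/
def mulOp (m : Lp ℂ ⊤ (volume : Measure R3)) : S2 →L[ℂ] S2 :=
  LinearMap.mkContinuous
    { toFun := fun f => m • f
      map_add' := fun f g => by
        refine Lp.ext ?_
        filter_upwards [Lp.coeFn_lpSMul (r := 2) m (f + g), Lp.coeFn_add f g,
          Lp.coeFn_lpSMul (r := 2) m f, Lp.coeFn_lpSMul (r := 2) m g,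
          Lp.coeFn_add (m • f : S2) (m • g : S2)] with x h1 h2 h3 h4 h5
        simp only [h1, h5, Pi.add_apply, h3, h4, Pi.smul_apply', h2, smul_add]
      map_smul' := fun c f => by
        refine Lp.ext ?_
        filter_upwards [Lp.coeFn_lpSMul (r := 2) m (c • f), Lp.coeFn_smul c f,
          Lp.coeFn_lpSMul (r := 2) m f, Lp.coeFn_smul c (m • f : S2)] with x h1 h2 h3 h4
        simp only [h1, Pi.smul_apply', h2, Pi.smul_apply, RingHom.id_apply, h4, h3, smul_eq_mul]
        ring } ‖m‖ (fun f => Lp.norm_smul_le m f)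

theorem coeFn_mulOp (m : Lp ℂ ⊤ (volume : Measure R3)) (f : S2) :
    mulOp m f =ᵐ[volume] fun x => m x * f x := Lp.coeFn_lpSMul (r := 2) m f

open Classical in
/-- `(-Δ + z)⁻¹` on `L²(ℝ³)`. -/
def freeRes (z : ℂ) : S2 →L[ℂ] S2 :=
  if hz : z ∈ Complex.slitPlane then
    (FourierTransform.fourierInvCLM ℂ S2).comp
      ((mulOp ((memLp_top_symb_inv hz).toLp _)).comp (FourierTransform.fourierCLM ℂ S2))
  else 0

theorem fourier_freeRes {z : ℂ} (hz : z ∈ Complex.slitPlane) (f : S2) :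
    (𝓕 (freeRes z f) : S2) =ᵐ[volume] fun ξ => (symb z ξ)⁻¹ * (𝓕 f : S2) ξ := by
  have : (𝓕 (freeRes z f) : S2) = mulOp ((memLp_top_symb_inv hz).toLp _) (𝓕 f) := by
    simp [freeRes, hz]
  rw [this]
  filter_upwards [coeFn_mulOp ((memLp_top_symb_inv hz).toLp _) (𝓕 f),
    (memLp_top_symb_inv hz).coeFn_toLp] with x h1 h2
  rw [h1, h2]

/-- Both sides are pairings of tempered distributions; moving the inverse transform to the test
function turns its derivative into multiplication by `-2πiξᵢ`. -/
theorem hasWeakDeriv_fourierInv (i : Fin 3) (H H1 : S2)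
    (h : ∀ᵐ ξ, H1 ξ = (2 * Real.pi * Complex.I * (ξ i : ℂ)) * H ξ) :
    HasWeakDeriv i (𝓕⁻ H : S2) (𝓕⁻ H1 : S2) := by
  intro ψ hψ1 hψ2
  have c1 : HasCompactSupport (fun x => (ψ x : ℂ)) :=
    hψ2.comp_left (g := fun t : ℝ => (t : ℂ)) (by simp)
  have c2 : ContDiff ℝ ∞ (fun x => (ψ x : ℂ)) := Complex.ofRealCLM.contDiff.comp hψ1
  set Ψ : 𝓢(R3, ℂ) := c1.toSchwartzMap c2 with hΨ
  have d : ∀ x, (∂_{ev i} Ψ : 𝓢(R3, ℂ)) x = ((fderiv ℝ ψ x (ev i) : ℝ) : ℂ) := fun x => by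
    rw [SchwartzMap.lineDerivOp_apply_eq_fderiv]
    have : HasFDerivAt (Ψ : R3 → ℂ) (Complex.ofRealCLM.comp (fderiv ℝ ψ x)) x :=
      Complex.ofRealCLM.hasFDerivAt.comp x (hψ1.differentiable (by simp) x).hasFDerivAt
    rw [this.fderiv]; rfl
  have a1 : ∫ x, (𝓕⁻ H : S2) x * ((fderiv ℝ ψ x (ev i) : ℝ) : ℂ) =
      ((𝓕⁻ H : S2) : 𝓢'(R3, ℂ)) (∂_{ev i} Ψ : 𝓢(R3, ℂ)) := by
    rw [Lp.toTemperedDistribution_apply]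
    refine integral_congr_ae (Eventually.of_forall fun x => ?_)
    simp only [d, smul_eq_mul]; ring
  have a2 : ∫ x, (𝓕⁻ H1 : S2) x * (ψ x : ℂ) = ((𝓕⁻ H1 : S2) : 𝓢'(R3, ℂ)) Ψ := by
    rw [Lp.toTemperedDistribution_apply]
    refine integral_congr_ae (Eventually.of_forall fun x => ?_)
    simp only [smul_eq_mul, hΨ, HasCompactSupport.toSchwartzMap_toFun]; ring
  have tg : (fun ξ : R3 => inner ℝ ξ (ev i)).HasTemperateGrowth := by fun_prop
  rw [a1, a2, ← Lp.fourierInv_toTemperedDistribution_eq, ← Lp.fourierInv_toTemperedDistribution_eq,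
    TemperedDistribution.fourierInv_apply, TemperedDistribution.fourierInv_apply,
    Lp.toTemperedDistribution_apply, Lp.toTemperedDistribution_apply, ← integral_neg]
  refine integral_congr_ae ?_
  filter_upwards [h] with ξ hξ
  rw [SchwartzMap.fourierInv_lineDerivOp_eq, hξ]
  have e := SchwartzMap.smulLeftCLM_apply_apply tg (𝓕⁻ Ψ : 𝓢(R3, ℂ)) ξ
  rw [smul_apply, e]
  simp [EuclideanSpace.inner_single_right]
  ring

/-- The `L²` transform, defined by extension, is identified with the Fourier integral, which is
continuous and can be evaluated at a point. It is needed on `ℝ³` for the boundary value at the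
origin and on `ℝ` for the Plancherel bound of `Φ_f`. -/
theorem fourierInv_ae_eq {E : Type*} [NormedAddCommGroup E] [InnerProductSpace ℝ E]
    [FiniteDimensional ℝ E] [MeasurableSpace E] [BorelSpace E] {H : Lp ℂ 2 (volume : Measure E)}
    (h1 : Integrable H volume) :
    (𝓕⁻ H : Lp ℂ 2 (volume : Measure E)) =ᵐ[volume] (𝓕⁻ (H : E → ℂ) : E → ℂ) := by
  have cont : Continuous (𝓕⁻ (H : E → ℂ) : E → ℂ) := by
    exact VectorFourier.fourierIntegral_continuous Real.continuous_fourierChar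
      (by exact (continuous_inner (𝕜 := ℝ) (E := E)).neg) h1
  refine ae_eq_of_integral_contDiff_smul_eq ((Lp.memLp _).locallyIntegrable (by norm_num))
    cont.locallyIntegrable fun g hg1 hg2 => ?_
  have c1 : HasCompactSupport (fun x => (g x : ℂ)) :=
    hg2.comp_left (g := fun t : ℝ => (t : ℂ)) (by simp)
  have c2 : ContDiff ℝ ∞ (fun x => (g x : ℂ)) := Complex.ofRealCLM.contDiff.comp hg1
  set G : 𝓢(E, ℂ) := c1.toSchwartzMap c2 with hG
  have a1 : ∫ x, g x • (𝓕⁻ H : Lp ℂ 2 (volume : Measure E)) x = ((𝓕⁻ H : Lp ℂ 2 (volume : Measure E)) : 𝓢'(E, ℂ)) G := by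
    rw [Lp.toTemperedDistribution_apply]
    refine integral_congr_ae (Eventually.of_forall fun x => ?_)
    simp [hG]
  rw [a1, ← Lp.fourierInv_toTemperedDistribution_eq, TemperedDistribution.fourierInv_apply,
    Lp.toTemperedDistribution_apply, SchwartzMap.fourierInv_coe]
  have a2 := VectorFourier.integral_fourierIntegral_smul_eq_flip (L := -innerₗ E)
    (μ := volume) (ν := volume) (f := (G : E → ℂ)) (g := (H : E → ℂ)) Real.continuous_fourierChar
    (by exact (continuous_inner (𝕜 := ℝ) (E := E)).neg) G.integrable h1
  have e : (-innerₗ E).flip = -innerₗ E := by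
    ext x y; simp [real_inner_comm]
  rw [e] at a2
  refine Eq.trans a2 (integral_congr_ae (Eventually.of_forall fun x => ?_))
  change (g x : ℂ) • _ = _
  rw [Complex.coe_smul]
  rfl

/-- The decay `|ξ|⁻²` is square integrable because `4 > 3`. This is why functions in the range of
the free resolvent have a continuous representative. -/
theorem memLp_two_symb_inv {z : ℂ} (hz : z ∈ Complex.slitPlane) :
    MemLp (fun ξ => (symb z ξ)⁻¹) 2 (volume : Measure R3) := by
  obtain ⟨C, hC, hb⟩ := exists_symb_inv_bound hz
  have m1 : MemLp (fun ξ : R3 => (1 + ‖ξ‖ ^ 2)⁻¹) 2 volume := by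
    have c0 : Continuous fun ξ : R3 => 1 + ‖ξ‖ ^ 2 := by fun_prop
    have c1 : AEStronglyMeasurable (fun ξ : R3 => (1 + ‖ξ‖ ^ 2)⁻¹) volume :=
      (c0.inv₀ fun ξ => by positivity).aestronglyMeasurable
    rw [memLp_two_iff_integrable_sq c1]
    refine (integrable_rpow_neg_one_add_norm_sq (E := R3) (μ := volume) (r := 4) (by simp; norm_num)).congr
      (Eventually.of_forall fun ξ => ?_)
    simp only
    rw [show (-4 / 2 : ℝ) = -((2 : ℕ) : ℝ) by norm_num, Real.rpow_neg (by positivity),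
      Real.rpow_natCast, inv_pow]
  refine m1.of_le_mul (c := C) (continuous_symb_inv hz).aestronglyMeasurable
    (Eventually.of_forall fun ξ => (hb ξ).trans_eq ?_)
  rw [Real.norm_of_nonneg (by positivity), div_eq_mul_inv]

/-- The transform `H` of the free resolvent is a product of two `L²` functions, hence integrable:
its inverse Fourier integral is the continuous representative, and the value at `0` is the integral
of `H`. The bound `(1 + |ξ|²)|H| ≤ C|F|` puts the first and second derivatives in `L²`. -/
theorem freeRes_spec {z : ℂ} (hz : z ∈ Complex.slitPlane) (f : S2) :
    ∃ φ : R3 → ℂ, Continuous φ ∧ freeRes z f =ᵐ[volume] φ ∧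
      φ 0 = ∫ ξ, (symb z ξ)⁻¹ * (𝓕 f : S2) ξ ∧
      IsH2locWithLaplacian φ (fun x => z * freeRes z f x - f x) := by
  obtain ⟨C, hC, hb⟩ := exists_symb_inv_bound hz
  set H : S2 := 𝓕 (freeRes z f)
  set F : S2 := 𝓕 f
  have hH : ∀ᵐ ξ, H ξ = (symb z ξ)⁻¹ * F ξ := fourier_freeRes hz f
  have hinv := memLp_two_symb_inv hz
  have iH : Integrable H volume :=
    (integrable_mul_of_memLp hinv (Lp.memLp F)).congr (by filter_upwards [hH] with ξ h; rw [h])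
  have mF := Lp.memLp F
  have hcoord : ∀ (ξ : R3) i, ‖(ξ i : ℂ)‖ ≤ ‖ξ‖ := fun ξ i => by
    rw [Complex.norm_real]; exact PiLp.norm_apply_le ξ i
  have bH : ∀ᵐ ξ, ‖H ξ‖ * (1 + ‖ξ‖ ^ 2) ≤ C * ‖F ξ‖ := by
    filter_upwards [hH] with ξ h
    rw [h, norm_mul]
    have := hb ξ
    rw [le_div_iff₀ (by positivity)] at this
    calc _ = ‖(symb z ξ)⁻¹‖ * (1 + ‖ξ‖ ^ 2) * ‖F ξ‖ := by ring
      _ ≤ _ := by gcongr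
  have meas1 : ∀ i, Continuous fun ξ : R3 => (2 * Real.pi * Complex.I * (ξ i : ℂ)) := fun i => by
    fun_prop
  have mH1 : ∀ i, MemLp (fun ξ : R3 => (2 * Real.pi * Complex.I * (ξ i : ℂ)) * H ξ) 2 volume := fun i => by
    refine mF.of_le_mul (c := 2 * Real.pi * C) ((meas1 i).aestronglyMeasurable.mul (Lp.memLp H).1) ?_
    filter_upwards [bH] with ξ h
    have := hcoord ξ i
    simp only [norm_mul, Complex.norm_I, Complex.norm_real, mul_one, Complex.norm_ofNat,
      Real.norm_of_nonneg Real.pi_pos.le] at this ⊢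
    have h3 : ‖(ξ i)‖ ≤ 1 + ‖ξ‖ ^ 2 := by nlinarith [sq_nonneg (‖ξ‖ - 1)]
    calc _ = 2 * Real.pi * (‖H ξ‖ * ‖ξ i‖) := by ring
      _ ≤ 2 * Real.pi * (C * ‖F ξ‖) := by
          have := mul_le_mul_of_nonneg_left h3 (norm_nonneg (H ξ))
          exact mul_le_mul_of_nonneg_left (by linarith) (by positivity)
      _ = _ := by ring
  let H1 : Fin 3 → S2 := fun i => (mH1 i).toLp _
  have hH1 : ∀ i, ∀ᵐ ξ, H1 i ξ = (2 * Real.pi * Complex.I * (ξ i : ℂ)) * H ξ := fun i =>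
    (mH1 i).coeFn_toLp
  have mH2 : ∀ i j, MemLp (fun ξ : R3 => (2 * Real.pi * Complex.I * (ξ j : ℂ)) * H1 i ξ) 2 volume :=
    fun i j => by
    refine mF.of_le_mul (c := (2 * Real.pi) ^ 2 * C)
      ((meas1 j).aestronglyMeasurable.mul (Lp.memLp (H1 i)).1) ?_
    filter_upwards [bH, hH1 i] with ξ h h'
    have hi := hcoord ξ i
    have hj := hcoord ξ j
    rw [h']
    simp only [norm_mul, Complex.norm_I, Complex.norm_real, mul_one, Complex.norm_ofNat,
      Real.norm_of_nonneg Real.pi_pos.le] at hi hj ⊢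
    have h3 : ‖ξ i‖ * ‖ξ j‖ ≤ 1 + ‖ξ‖ ^ 2 := by
      have := mul_le_mul hi hj (norm_nonneg _) (norm_nonneg _)
      nlinarith
    calc _ = (2 * Real.pi) ^ 2 * (‖H ξ‖ * (‖ξ i‖ * ‖ξ j‖)) := by ring
      _ ≤ (2 * Real.pi) ^ 2 * (C * ‖F ξ‖) := by
          have := mul_le_mul_of_nonneg_left h3 (norm_nonneg (H ξ))
          exact mul_le_mul_of_nonneg_left (by linarith) (by positivity)
      _ = _ := by ring
  let H2 : Fin 3 → Fin 3 → S2 := fun i j => (mH2 i j).toLp _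
  have hH2 : ∀ i j, ∀ᵐ ξ, H2 i j ξ = (2 * Real.pi * Complex.I * (ξ j : ℂ)) * H1 i ξ := fun i j =>
    (mH2 i j).coeFn_toLp
  have eu : (𝓕⁻ H : S2) = freeRes z f := by simp [H]
  have ae0 : freeRes z f =ᵐ[volume] (𝓕⁻ (H : R3 → ℂ) : R3 → ℂ) := by
    rw [← eu]; exact fourierInv_ae_eq iH
  refine ⟨(𝓕⁻ (H : R3 → ℂ) : R3 → ℂ), ?_, ae0, ?_, ?_⟩
  · exact VectorFourier.fourierIntegral_continuous Real.continuous_fourierChar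
      (by exact (continuous_inner (𝕜 := ℝ) (E := R3)).neg) iH
  · rw [Real.fourierInv_eq]
    simp only [inner_zero_right, AddChar.map_zero_eq_one, one_smul]
    exact integral_congr_ae hH
  · refine IsH2locWithLaplacian.congr (f := (𝓕⁻ H : S2)) (g := fun x => ∑ i, (𝓕⁻ (H2 i i) : S2) x)
      ⟨MemLp.memL2loc (Lp.memLp _), fun i => (𝓕⁻ (H1 i) : S2), fun i j => (𝓕⁻ (H2 i j) : S2),
        fun i => ⟨MemLp.memL2loc (Lp.memLp _), hasWeakDeriv_fourierInv i _ _ (hH1 i)⟩,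
        fun i j => ⟨MemLp.memL2loc (Lp.memLp _), hasWeakDeriv_fourierInv j _ _ (hH2 i j)⟩,
        ae_eq_rfl⟩ (by rw [eu]; exact ae0) ?_
    -- The sum of the factors `(2πiξᵢ)²` is `-4π²|ξ|² = z - symb z ξ`, and `symb z ξ * H` is `F`.
    have e2 : ∑ i, H2 i i = z • H - F := by
      refine Lp.ext ?_
      rw [Fin.sum_univ_three]
      filter_upwards [hH, hH1 0, hH1 1, hH1 2, hH2 0 0, hH2 1 1, hH2 2 2,
        Lp.coeFn_sub (z • H) F, Lp.coeFn_smul z H, Lp.coeFn_add (H2 0 0 + H2 1 1) (H2 2 2),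
        Lp.coeFn_add (H2 0 0) (H2 1 1)] with ξ a0 a1 a2 a3 b1 b2 b3 c1 c2 c3 c4
      simp only [c1, c2, c3, c4, Pi.add_apply, Pi.sub_apply, Pi.smul_apply, b1, b2, b3, a1, a2, a3,
        smul_eq_mul]
      have hs := symb_ne_zero hz ξ
      have hF : F ξ = symb z ξ * H ξ := by rw [a0]; field_simp
      rw [hF, symb, EuclideanSpace.real_norm_sq_eq, Fin.sum_univ_three]
      push_cast
      linear_combination (4 * Real.pi ^ 2 * ((ξ 0 : ℂ) ^ 2 + (ξ 1 : ℂ) ^ 2 + (ξ 2 : ℂ) ^ 2)) * H ξ * Complex.I_sq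
    have e3 : ∑ i, (𝓕⁻ (H2 i i) : S2) = z • freeRes z f - f := by
      have : (𝓕⁻ (z • H - F) : S2) = z • freeRes z f - f := by
        have := (FourierTransform.fourierInvCLM ℂ S2).map_sub (z • H) F
        rw [map_smul] at this
        simpa [H, F] using this
      rw [← this, ← e2]
      exact (map_sum (FourierTransform.fourierInvCLM ℂ S2) _ _).symm
    rw [Fin.sum_univ_three] at e3
    filter_upwards [Lp.coeFn_add ((𝓕⁻ (H2 0 0) : S2) + (𝓕⁻ (H2 1 1) : S2)) (𝓕⁻ (H2 2 2) : S2),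
      Lp.coeFn_add (𝓕⁻ (H2 0 0) : S2) (𝓕⁻ (H2 1 1) : S2), Lp.coeFn_sub (z • freeRes z f) f,
      Lp.coeFn_smul z (freeRes z f)] with x h1 h2 h3 h4
    rw [Fin.sum_univ_three]
    rw [e3] at h1
    rw [h1] at h3
    simp only [Pi.add_apply, h2, Pi.sub_apply, h4, Pi.smul_apply, smul_eq_mul] at h3
    exact h3

attribute [irreducible] freeRes

end PointNLS
end

noncomputable section
namespace PointNLS
open scoped ContDiff

/-! ### Radial integrals and radial functions -/

theorem integral_radial {F : Type*} [NormedAddCommGroup F] [NormedSpace ℝ F] (f : ℝ → F) :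
    ∫ x : R3, f ‖x‖ = (4 * Real.pi) • ∫ r in Set.Ioi (0 : ℝ), r ^ 2 • f r := by
  have h := integral_fun_norm_addHaar (volume : Measure R3) f
  have hv : (volume : Measure R3).real (Metric.ball 0 1) = 4 / 3 * Real.pi := by
    rw [Measure.real, InnerProductSpace.volume_ball_of_dim_odd (k := 1) (by simp)]
    simp [Nat.doubleFactorial]
    rw [ENNReal.toReal_ofReal (by positivity)]
    ring
  rw [h, hv]
  simp only [finrank_euclideanSpace, Fintype.card_fin]
  rw [← Nat.cast_smul_eq_nsmul ℝ, smul_smul]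
  congr 1
  push_cast; ring

theorem integrable_radial_iff {F : Type*} [NormedAddCommGroup F] [NormedSpace ℝ F] {f : ℝ → F} :
    Integrable (fun x : R3 => f ‖x‖) ↔ IntegrableOn (fun r => r ^ 2 • f r) (Set.Ioi 0) := by
  have := integrable_fun_norm_addHaar (volume : Measure R3) (f := f)
  simpa using this

theorem ae_ne_zero : ∀ᵐ x : R3, x ≠ 0 := by
  simp [ae_iff, measure_singleton]

theorem aestronglyMeasurable_of_continuousOn {f : R3 → ℂ} (h : ContinuousOn f {0}ᶜ) :
    AEStronglyMeasurable f volume := by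
  have := h.aestronglyMeasurable (μ := volume) (measurableSet_singleton (0 : R3)).compl
  rwa [restrict_compl_singleton] at this

theorem memL2loc_inv_norm : MemL2loc fun x : R3 => ((‖x‖⁻¹ : ℝ) : ℂ) := by
  intro K hK
  obtain ⟨R, hR⟩ := hK.isBounded.subset_ball (0 : R3)
  have meas : AEStronglyMeasurable (fun x : R3 => ((‖x‖⁻¹ : ℝ) : ℂ)) volume :=
    Measurable.aestronglyMeasurable (by fun_prop)
  refine MemLp.mono_measure (Measure.restrict_mono hR le_rfl) ?_
  rw [memLp_two_iff_integrable_sq_norm meas.restrict]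
  have h := integrableOn_fun_norm_addHaar (volume : Measure R3) (f := fun r : ℝ => (r ^ 2)⁻¹) (r := R)
  have h2 : IntegrableOn (fun x : R3 => (‖x‖ ^ 2)⁻¹) (Metric.ball 0 R) := by
    rw [h]
    have : IntegrableOn (fun _ : ℝ => (1 : ℝ)) (Set.Ioo 0 R) := by simp
    refine this.congr_fun (fun r hr => ?_) measurableSet_Ioo
    have : r ≠ 0 := hr.1.ne'
    simp [this]
  refine h2.congr (Eventually.of_forall fun x => ?_)
  simp [inv_pow]

theorem memL2loc_of_bound {f : R3 → ℂ} (hf : ContinuousOn f {0}ᶜ)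
    (hb : ∀ R : ℝ, ∃ C : ℝ, ∀ x : R3, x ≠ 0 → ‖x‖ ≤ R → ‖f x‖ ≤ C * ‖x‖⁻¹) : MemL2loc f := by
  intro K hK
  obtain ⟨R, hR⟩ := hK.isBounded.subset_closedBall (0 : R3)
  obtain ⟨C, hC⟩ := hb R
  refine (memL2loc_inv_norm K hK).of_le_mul (c := C) (aestronglyMeasurable_of_continuousOn hf).restrict ?_
  filter_upwards [ae_restrict_mem hK.measurableSet, ae_restrict_of_ae ae_ne_zero] with x hx h0
  rw [Complex.norm_real, Real.norm_of_nonneg (by positivity)]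
  exact hC x h0 (by simpa using hR hx)

/-- A function that is differentiable off the origin and locally bounded has its classical
derivative as weak derivative, provided the latter is locally square integrable. -/
theorem hasWeakDeriv_of_punctured {i : Fin 3} {f g : R3 → ℂ}
    (hf : ∀ x, x ≠ 0 → HasFDerivAt f (fderiv ℝ f x) x) (hfg : ∀ x, x ≠ 0 → fderiv ℝ f x (ev i) = g x)
    (hb : ∀ R : ℝ, ∃ C : ℝ, ∀ x : R3, ‖x‖ ≤ R → ‖f x‖ ≤ C) (hg : MemL2loc g) :
    HasWeakDeriv i f g := by
  intro ψ hψ1 hψ2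
  obtain ⟨χ, hχ, hχ1, hχ2, hχ3⟩ := exists_cutoff
  obtain ⟨Ψ, hΨ⟩ : ∃ Ψ : R3 → ℂ, Ψ = fun x => (ψ x : ℂ) := ⟨_, rfl⟩
  have tΨ : IsTest Ψ := hΨ ▸ ⟨Complex.ofRealCLM.contDiff.comp hψ1,
    hψ2.comp_left (g := fun t : ℝ => (t : ℂ)) (by simp)⟩
  have dΨ : ∀ x, ((fderiv ℝ ψ x (ev i) : ℝ) : ℂ) = pd i Ψ x := fun x => by
    have : HasFDerivAt Ψ (Complex.ofRealCLM.comp (fderiv ℝ ψ x)) x :=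
      hΨ ▸ Complex.ofRealCLM.hasFDerivAt.comp x (hψ1.differentiable (by simp) x).hasFDerivAt
    simp only [pd, this.fderiv]; rfl
  have cf : ContinuousOn f {0}ᶜ := fun x hx => (hf x hx).continuousAt.continuousWithinAt
  have mf : AEStronglyMeasurable f volume := aestronglyMeasurable_of_continuousOn cf
  obtain ⟨R, hR⟩ := tΨ.2.isBounded.subset_closedBall (0 : R3)
  have hRΨ : ∀ x, Ψ x ≠ 0 → ‖x‖ ≤ R := fun x hx => by
    simpa using hR (subset_tsupport _ hx)
  obtain ⟨R', hR'⟩ := (tΨ.pd i).2.isBounded.subset_closedBall (0 : R3)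
  have hRΨ' : ∀ x, pd i Ψ x ≠ 0 → ‖x‖ ≤ R' := fun x hx => by
    simpa using hR' (subset_tsupport _ hx)
  obtain ⟨C, hC⟩ := hb (max R R')
  obtain ⟨C1, hC1⟩ := exists_bound_of_isTest (hχ.pd i)
  have hC0 : 0 ≤ C1 := (norm_nonneg _).trans (hC1 0)
  -- The factor `η n` vanishes for `|x| ≤ 1/(n+1)`; classical integration by parts applies to `η n *
  -- Ψ`, whose support avoids the origin.
  let η : ℕ → R3 → ℂ := fun n x => 1 - χ (((n : ℝ) + 1) • x)
  have dχ : Differentiable ℝ χ := hχ.1.differentiable (by simp)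
  have ηsm : ∀ n, ContDiff ℝ (⊤ : ℕ∞) (η n) := fun n =>
    contDiff_const.sub (hχ.1.comp (contDiff_id.const_smul _))
  have tη : ∀ n, IsTest fun x => η n x * Ψ x := fun n => ⟨(ηsm n).mul tΨ.1, tΨ.2.mul_left⟩
  have dη : ∀ n x, pd i (fun x => η n x * Ψ x) x =
      η n x * pd i Ψ x - ((n : ℂ) + 1) * pd i χ (((n : ℝ) + 1) • x) * Ψ x := fun n x => by
    rw [pd_mul ((ηsm n).differentiable (by simp)) (tΨ.1.differentiable (by simp))]
    have : pd i (η n) x = - (((n : ℂ) + 1) * pd i χ (((n : ℝ) + 1) • x)) := by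
      have h2 := congrFun (pd_comp_smul dχ ((n : ℝ) + 1) i) x
      have h3 : HasFDerivAt (η n) (- fderiv ℝ (fun x => χ (((n : ℝ) + 1) • x)) x) x := by
        have := (dχ.comp (differentiable_id.const_smul ((n : ℝ) + 1)) x).hasFDerivAt.const_sub 1
        exact this
      simp only [pd] at h2 ⊢
      rw [h3.fderiv, neg_apply, h2]
      push_cast; ring
    dsimp only
    rw [this]; ring
  have bη : ∀ n x, ‖η n x‖ ≤ 2 := fun n x => by
    refine (norm_sub_le _ _).trans ?_
    have := hχ3 (((n : ℝ) + 1) • x)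
    simp; linarith
  have lη : ∀ x : R3, x ≠ 0 → ∀ᶠ n : ℕ in atTop, 2 ≤ ‖((n : ℝ) + 1) • x‖ := fun x hx => by
    obtain ⟨N, hN⟩ := exists_nat_gt (2 / ‖x‖)
    filter_upwards [eventually_ge_atTop N] with n hn
    rw [norm_smul, Real.norm_of_nonneg (by positivity)]
    rw [div_lt_iff₀ (norm_pos_iff.2 hx)] at hN
    have : (N : ℝ) ≤ n := by exact_mod_cast hn
    nlinarith [norm_nonneg x]
  have pdz : ∀ y : R3, 2 < ‖y‖ → pd i χ y = 0 := fun y hy => by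
    have : χ =ᶠ[𝓝 y] fun _ => 0 := by
      filter_upwards [continuous_norm.continuousAt.eventually (lt_mem_nhds hy)] with u hu
      exact hχ2 u hu.le
    simp [pd, this.fderiv_eq]
  have key : ∀ n, ∫ x, f x * pd i (fun x => η n x * Ψ x) x = -∫ x, g x * (η n x * Ψ x) := fun n => by
    have h0 : (0 : R3) ∉ tsupport fun x => η n x * Ψ x := by
      rw [notMem_tsupport_iff_eventuallyEq]
      have hn : (0 : ℝ) < 1 / ((n : ℝ) + 1) := by positivity
      filter_upwards [Metric.ball_mem_nhds (0 : R3) hn] with y hy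
      have : ‖((n : ℝ) + 1) • y‖ ≤ 1 := by
        rw [norm_smul, Real.norm_of_nonneg (by positivity)]
        have h4 : ‖y‖ < 1 / ((n : ℝ) + 1) := by simpa using hy
        rw [lt_div_iff₀ (by positivity)] at h4
        linarith
      simp [η, hχ1 _ this]
    have lf : MemL2loc f := memL2loc_of_bound cf fun R => by
      obtain ⟨C, hC⟩ := hb R
      refine ⟨C * R, fun x hx hxR => (hC x hxR).trans ?_⟩
      have h5 : 0 ≤ C := (norm_nonneg _).trans (hC x hxR)
      have h6 : 0 < ‖x‖ := norm_pos_iff.2 hx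
      rw [mul_assoc]
      refine le_mul_of_one_le_right h5 ?_
      rw [← div_eq_mul_inv, one_le_div h6]
      exact hxR
    have := integral_bilinear_hasLineDerivAt_right_eq_neg_left_of_integrable (μ := volume)
      (f := f) (f' := g) (g := fun x => η n x * Ψ x) (g' := pd i (fun x => η n x * Ψ x)) (v := ev i)
      (B := ContinuousLinearMap.mul ℝ ℂ) (hg.integrable_mul (tη n).continuous (tη n).2)
      (lf.integrable_mul ((tη n).pd i).continuous ((tη n).pd i).2)
      (lf.integrable_mul (tη n).continuous (tη n).2)
      (fun x hx => by
        have hx0 : x ≠ 0 := fun h => h0 (h ▸ hx)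
        rw [← hfg x hx0]; exact (hf x hx0).hasLineDerivAt _)
      (fun x _ => ((tη n).1.differentiable (by simp) x).hasFDerivAt.hasLineDerivAt _)
    exact this
  have L1 : Tendsto (fun n => ∫ x, f x * pd i (fun x => η n x * Ψ x) x) atTop
      (𝓝 (∫ x, f x * pd i Ψ x)) := by
    refine tendsto_integral_of_dominated_convergence
      (fun x => C * (2 * ‖pd i Ψ x‖ + C1 * 2 * ‖((‖x‖⁻¹ : ℝ) : ℂ) * Ψ x‖)) (fun n => ?_) ?_ (fun n => ?_) ?_
    · exact mf.mul ((tη n).pd i).continuous.aestronglyMeasurable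
    · refine ((((tΨ.pd i).continuous.integrable_of_hasCompactSupport (tΨ.pd i).2).norm.const_mul 2).add
        ((memL2loc_inv_norm.integrable_mul tΨ.continuous tΨ.2).norm.const_mul _)).const_mul C
    · filter_upwards [ae_ne_zero] with x hx
      rw [dη, norm_mul]
      have h6 : 0 < ‖x‖ := norm_pos_iff.2 hx
      have e1 : ‖η n x * pd i Ψ x‖ ≤ 2 * ‖pd i Ψ x‖ := by
        rw [norm_mul]; exact mul_le_mul_of_nonneg_right (bη n x) (norm_nonneg _)
      have e2 : ‖((n : ℂ) + 1) * pd i χ (((n : ℝ) + 1) • x) * Ψ x‖ ≤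
          C1 * 2 * ‖((‖x‖⁻¹ : ℝ) : ℂ) * Ψ x‖ := by
        have e0 : ‖((‖x‖⁻¹ : ℝ) : ℂ)‖ = ‖x‖⁻¹ := by
          rw [Complex.norm_real, Real.norm_of_nonneg (by positivity)]
        rw [norm_mul, norm_mul, norm_mul, e0]
        have e3 : ‖((n : ℂ) + 1)‖ = (n : ℝ) + 1 := by
          have : ((n : ℂ) + 1) = (((n : ℝ) + 1 : ℝ) : ℂ) := by push_cast; rfl
          rw [this, Complex.norm_real, Real.norm_of_nonneg (by positivity)]
        rw [e3]
        -- The gradient of the cutoff has size `n + 1` but lives in `|x| ≤ 2/(n+1)`; it is therefore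
        -- dominated by a multiple of `1/|x|`, which is independent of `n` and locally integrable.
        have e4 : ((n : ℝ) + 1) * ‖pd i χ (((n : ℝ) + 1) • x)‖ ≤ C1 * 2 * ‖x‖⁻¹ := by
          by_cases hy : 2 < ‖((n : ℝ) + 1) • x‖
          · rw [pdz _ hy]; simp; positivity
          · push Not at hy
            rw [norm_smul, Real.norm_of_nonneg (by positivity)] at hy
            have : (n : ℝ) + 1 ≤ 2 * ‖x‖⁻¹ := by
              rw [← div_eq_mul_inv, le_div_iff₀ h6]; exact hy
            calc _ ≤ (2 * ‖x‖⁻¹) * C1 := by gcongr; exact hC1 _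
              _ = _ := by ring
        calc _ ≤ C1 * 2 * ‖x‖⁻¹ * ‖Ψ x‖ := by gcongr
          _ = _ := by ring
      by_cases hz : pd i Ψ x = 0 ∧ Ψ x = 0
      · simp [hz.1, hz.2]
      · have hxR : ‖x‖ ≤ max R R' := by
          rw [not_and_or] at hz
          rcases hz with h | h
          · exact (hRΨ' x h).trans (le_max_right _ _)
          · exact (hRΨ x h).trans (le_max_left _ _)
        have := hC x hxR
        have h7 : 0 ≤ C := (norm_nonneg _).trans this
        refine mul_le_mul this ((norm_sub_le _ _).trans (add_le_add e1 e2)) (norm_nonneg _) h7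
    · filter_upwards [ae_ne_zero] with x hx
      refine tendsto_const_nhds.congr' ?_
      have h8 : ∀ᶠ n : ℕ in atTop, 2 < ‖((n : ℝ) + 1) • x‖ := by
        have := lη ((1 / 2 : ℝ) • x) (by simpa using hx)
        filter_upwards [this] with n hn
        rw [smul_comm, norm_smul] at hn
        norm_num at hn
        linarith
      filter_upwards [h8] with n hn
      rw [dη, pdz _ hn]
      simp [η, hχ2 _ hn.le]
  have L2 : Tendsto (fun n => -∫ x, g x * (η n x * Ψ x)) atTop (𝓝 (-∫ x, g x * Ψ x)) := by
    refine Tendsto.neg ?_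
    refine tendsto_integral_of_dominated_convergence (fun x => 2 * ‖g x * Ψ x‖) (fun n => ?_) ?_
      (fun n => Eventually.of_forall fun x => ?_) ?_
    · exact hg.locallyIntegrable.aestronglyMeasurable.mul (tη n).continuous.aestronglyMeasurable
    · exact (hg.integrable_mul tΨ.continuous tΨ.2).norm.const_mul 2
    · rw [norm_mul, norm_mul, norm_mul]
      calc _ = ‖η n x‖ * (‖g x‖ * ‖Ψ x‖) := by ring
        _ ≤ _ := by gcongr; exact bη n x
    · filter_upwards [ae_ne_zero] with x hx
      refine tendsto_const_nhds.congr' ?_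
      filter_upwards [lη x hx] with n hn
      simp [η, hχ2 _ hn]
  simp only [key] at L1
  have := tendsto_nhds_unique L1 L2
  simp only [dΨ]
  rw [hΨ] at this ⊢
  exact this

theorem hasFDerivAt_norm_punctured {x : R3} (hx : x ≠ 0) :
    HasFDerivAt (fun y : R3 => ‖y‖) (‖x‖⁻¹ • innerSL ℝ x) x := by
  have h1 : HasFDerivAt (fun y : R3 => ‖y‖ ^ 2) (2 • innerSL ℝ x) x :=
    (hasStrictFDerivAt_norm_sq x).hasFDerivAt
  have h2 := h1.sqrt (by simpa using hx)
  have e : (fun y : R3 => Real.sqrt (‖y‖ ^ 2)) = fun y => ‖y‖ := by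
    ext y; exact Real.sqrt_sq (norm_nonneg y)
  rw [e] at h2
  refine h2.congr_fderiv ?_
  rw [Real.sqrt_sq (norm_nonneg x)]
  ext v
  simp
  field_simp

theorem hasFDerivAt_radial {E : ℂ → ℂ} (hE : Differentiable ℂ E) {x : R3} (hx : x ≠ 0) :
    HasFDerivAt (fun y : R3 => E (‖y‖ : ℂ))
      ((deriv E (‖x‖ : ℂ) * ((‖x‖⁻¹ : ℝ) : ℂ)) • (Complex.ofRealCLM.comp (innerSL ℝ x))) x := by
  have h1 : HasDerivAt (fun t : ℝ => E (t : ℂ)) (deriv E (‖x‖ : ℂ)) ‖x‖ :=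
    (hE _).hasDerivAt.comp_ofReal
  have h2 := h1.hasFDerivAt.comp x (hasFDerivAt_norm_punctured hx)
  refine h2.congr_fderiv ?_
  ext v
  simp
  ring

end PointNLS
end

noncomputable section
namespace PointNLS
open scoped ContDiff

/-! ### Radial functions with an entire profile. -/

theorem exists_bound_radial {E : ℂ → ℂ} (hE : Continuous E) (R : ℝ) :
    ∃ C : ℝ, 0 ≤ C ∧ ∀ r : ℝ, 0 ≤ r → r ≤ R → ‖E (r : ℂ)‖ ≤ C := by
  obtain ⟨C, hC⟩ := (isCompact_Icc (a := (0 : ℝ)) (b := R)).exists_bound_of_continuousOn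
    (hE.comp Complex.continuous_ofReal).continuousOn
  refine ⟨max C 0, le_max_right _ _, fun r h0 h1 => (hC r ⟨h0, h1⟩).trans (le_max_left _ _)⟩

theorem norm_coord_le (x : R3) (i : Fin 3) : ‖((x i : ℝ) : ℂ)‖ ≤ ‖x‖ := by
  rw [Complex.norm_real]; exact PiLp.norm_apply_le x i

/-- Entire radial profiles give `H²_loc` functions with the expected Laplacian. -/
theorem isH2loc_radial {E : ℂ → ℂ} (hE : Differentiable ℂ E) :
    IsH2locWithLaplacian (fun x => E (‖x‖ : ℂ))
      (fun x => deriv (deriv E) (‖x‖ : ℂ) + 2 * deriv E (‖x‖ : ℂ) / (‖x‖ : ℂ)) := by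
  have hE1 : Differentiable ℂ (deriv E) := hE.deriv
  have hE2 : Differentiable ℂ (deriv (deriv E)) := hE1.deriv
  have cn : ContinuousOn (fun x : R3 => ((‖x‖⁻¹ : ℝ) : ℂ)) {0}ᶜ :=
    Complex.continuous_ofReal.comp_continuousOn (continuous_norm.continuousOn.inv₀ fun x hx =>
      norm_ne_zero_iff.2 hx)
  have cE : ∀ {F : ℂ → ℂ}, Differentiable ℂ F → Continuous fun x : R3 => F (‖x‖ : ℂ) := fun h =>
    h.continuous.comp (Complex.continuous_ofReal.comp continuous_norm)
  have cx : ∀ i, Continuous fun x : R3 => ((x i : ℝ) : ℂ) := fun i => by fun_prop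
  let d : Fin 3 → R3 → ℂ := fun i x => deriv E (‖x‖ : ℂ) * (((‖x‖⁻¹ : ℝ) : ℂ) * (x i : ℂ))
  let d2 : Fin 3 → Fin 3 → R3 → ℂ := fun i j x =>
    deriv (deriv E) (‖x‖ : ℂ) * (((‖x‖⁻¹ : ℝ) : ℂ) * (x j : ℂ)) * (((‖x‖⁻¹ : ℝ) : ℂ) * (x i : ℂ)) +
      deriv E (‖x‖ : ℂ) * (((‖x‖⁻¹ : ℝ) : ℂ) * (if i = j then 1 else 0) -
        ((‖x‖⁻¹ : ℝ) : ℂ) * (((‖x‖⁻¹ : ℝ) : ℂ) * (x j : ℂ)) * (((‖x‖⁻¹ : ℝ) : ℂ) * (x i : ℂ)))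
  have unit : ∀ (x : R3) i, ‖((‖x‖⁻¹ : ℝ) : ℂ) * (x i : ℂ)‖ ≤ 1 := fun x i => by
    rw [norm_mul, Complex.norm_real, norm_inv, norm_norm]
    by_cases h : x = 0
    · simp [h]
    · rw [inv_mul_le_one₀ (norm_pos_iff.2 h)]
      exact norm_coord_le x i
  have bd : ∀ i (R : ℝ), ∃ C : ℝ, ∀ x : R3, ‖x‖ ≤ R → ‖d i x‖ ≤ C := fun i R => by
    obtain ⟨C, hC0, hC⟩ := exists_bound_radial hE1.continuous R
    refine ⟨C, fun x hx => ?_⟩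
    rw [norm_mul]
    calc _ ≤ C * 1 := mul_le_mul (hC _ (norm_nonneg _) hx) (unit x i) (norm_nonneg _) hC0
      _ = C := mul_one C
  have weak : ∀ {C R : ℝ} {x : R3} {a : ℂ}, x ≠ 0 → ‖x‖ ≤ R → 0 ≤ C → ‖a‖ ≤ C →
      ‖a‖ ≤ C * R * ‖x‖⁻¹ := fun {C R x a} hx hR hC ha => by
    refine ha.trans ?_
    rw [mul_assoc]
    refine le_mul_of_one_le_right hC ?_
    rw [← div_eq_mul_inv, one_le_div (norm_pos_iff.2 hx)]
    exact hR
  have lE : MemL2loc fun x => E (‖x‖ : ℂ) := memL2loc_of_bound (cE hE).continuousOn fun R => by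
    obtain ⟨C, hC0, hC⟩ := exists_bound_radial hE.continuous R
    exact ⟨C * R, fun x hx hR => weak hx hR hC0 (hC _ (norm_nonneg _) hR)⟩
  have ld : ∀ i, MemL2loc (d i) := fun i => memL2loc_of_bound
      ((cE hE1).continuousOn.mul (cn.mul (cx i).continuousOn)) fun R => by
    obtain ⟨C, hC⟩ := bd i R
    refine ⟨C * R, fun x hx hR => weak hx hR ((norm_nonneg _).trans (hC x hR)) (hC x hR)⟩
  have ld2 : ∀ i j, MemL2loc (d2 i j) := fun i j => memL2loc_of_bound
      ((((cE hE2).continuousOn.mul (cn.mul (cx j).continuousOn)).mul (cn.mul (cx i).continuousOn)).add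
        ((cE hE1).continuousOn.mul ((cn.mul continuousOn_const).sub
          ((cn.mul (cn.mul (cx j).continuousOn)).mul (cn.mul (cx i).continuousOn))))) fun R => by
    obtain ⟨C2, hC20, hC2⟩ := exists_bound_radial hE2.continuous R
    obtain ⟨C1, hC10, hC1⟩ := exists_bound_radial hE1.continuous R
    -- The part with the second derivative of the profile is bounded, hence at most `C2 * R / |x|`
    -- on the ball; the part with the first derivative is genuinely of order `1/|x|`. Both are
    -- locally square integrable in dimension three.
    refine ⟨C2 * R + C1 * 2, fun x hx hR => ?_⟩
    rw [add_mul]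
    have n0 : ‖((‖x‖⁻¹ : ℝ) : ℂ)‖ = ‖x‖⁻¹ := by
      rw [Complex.norm_real, Real.norm_of_nonneg (by positivity)]
    refine (norm_add_le _ _).trans (add_le_add (weak hx hR hC20 ?_) ?_)
    · rw [norm_mul, norm_mul]
      calc _ ≤ C2 * 1 * 1 := by
            gcongr
            · exact hC2 _ (norm_nonneg _) hR
            · exact unit x j
            · exact unit x i
        _ = C2 := by ring
    · rw [norm_mul]
      have h1 : ‖((‖x‖⁻¹ : ℝ) : ℂ) * (if i = j then (1 : ℂ) else 0) -
        ((‖x‖⁻¹ : ℝ) : ℂ) * (((‖x‖⁻¹ : ℝ) : ℂ) * (x j : ℂ)) * (((‖x‖⁻¹ : ℝ) : ℂ) * (x i : ℂ))‖ ≤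
          2 * ‖x‖⁻¹ := by
        refine (norm_sub_le _ _).trans ?_
        rw [norm_mul, norm_mul, norm_mul, n0, two_mul]
        have hn : 0 ≤ ‖x‖⁻¹ := by positivity
        refine add_le_add ?_ ?_
        · refine mul_le_of_le_one_right hn ?_
          split_ifs <;> simp
        · rw [mul_assoc]
          exact mul_le_of_le_one_right hn (mul_le_one₀ (unit x j) (norm_nonneg _) (unit x i))
      calc _ ≤ C1 * (2 * ‖x‖⁻¹) := mul_le_mul (hC1 _ (norm_nonneg _) hR) h1 (norm_nonneg _) hC10
        _ = _ := by ring
  refine ⟨lE, d, d2, fun i => ⟨ld i, ?_⟩, fun i j => ⟨ld2 i j, ?_⟩, ?_⟩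
  · refine hasWeakDeriv_of_punctured (fun x hx => (hasFDerivAt_radial hE hx).differentiableAt.hasFDerivAt)
      (fun x hx => ?_) (fun R => ?_) (ld i)
    · rw [(hasFDerivAt_radial hE hx).fderiv]
      simp [d, EuclideanSpace.inner_single_right]
      ring
    · obtain ⟨C, hC0, hC⟩ := exists_bound_radial hE.continuous R
      exact ⟨C, fun x hR => hC _ (norm_nonneg _) hR⟩
  · have hd : ∀ x : R3, x ≠ 0 → HasLineDerivAt ℝ (d i) (d2 i j x) x (ev j) ∧
        DifferentiableAt ℝ (d i) x := fun x hx => by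
      have hn : (‖x‖ : ℂ) ≠ 0 := by simpa using hx
      have k1 := hasFDerivAt_radial hE1 hx
      have k2 : HasFDerivAt (fun y : R3 => ((y i : ℝ) : ℂ))
          (Complex.ofRealCLM.comp (EuclideanSpace.proj i)) x :=
        Complex.ofRealCLM.hasFDerivAt.comp x (EuclideanSpace.proj (𝕜 := ℝ) i).hasFDerivAt
      have k3 : HasFDerivAt (fun y : R3 => ((‖y‖⁻¹ : ℝ) : ℂ)) _ x :=
        Complex.ofRealCLM.hasFDerivAt.comp x
          ((hasDerivAt_inv (norm_ne_zero_iff.2 hx)).hasFDerivAt.comp x (hasFDerivAt_norm_punctured hx))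
      have k4 := k1.mul (k3.mul k2)
      refine ⟨?_, k4.differentiableAt⟩
      refine (k4.hasLineDerivAt (ev j)).congr_deriv ?_
      by_cases hij : i = j
      · simp [d2, EuclideanSpace.inner_single_right, hij]
        ring
      · simp [d2, EuclideanSpace.inner_single_right, hij]
        ring
    refine hasWeakDeriv_of_punctured (fun x hx => (hd x hx).2.hasFDerivAt) (fun x hx => ?_) (bd i)
      (ld2 i j)
    rw [← (hd x hx).2.lineDeriv_eq_fderiv]
    exact (hd x hx).1.lineDeriv
  · filter_upwards [ae_ne_zero] with x hx
    have hn : (‖x‖ : ℂ) ≠ 0 := by simpa using hx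
    have hs : ((x 0 : ℝ) : ℂ) ^ 2 + ((x 1 : ℝ) : ℂ) ^ 2 + ((x 2 : ℝ) : ℂ) ^ 2 = (‖x‖ : ℂ) ^ 2 := by
      have := EuclideanSpace.real_norm_sq_eq x
      rw [Fin.sum_univ_three] at this
      exact_mod_cast this.symm
    simp only [d2, Fin.sum_univ_three, if_true]
    push_cast
    field_simp
    linear_combination (deriv E (‖x‖ : ℂ) - deriv (deriv E) (‖x‖ : ℂ) * (‖x‖ : ℂ)) * hs

/-! ### The Green function `G_κ` -/

/-- `G_κ(x) = e^{-κ|x|} / (4π|x|)`. -/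
def Gf (κ : ℂ) (x : R3) : ℂ := Complex.exp (-κ * ‖x‖) / (4 * Real.pi * ‖x‖)

/-- The entire profile of `G_κ - G_0`. -/
def Ef (κ : ℂ) : ℂ → ℂ := dslope (fun z => Complex.exp (-κ * z) / (4 * Real.pi)) 0

theorem differentiable_Ef (κ : ℂ) : Differentiable ℂ (Ef κ) := by
  rw [← differentiableOn_univ]
  refine (Complex.differentiableOn_dslope (by simp)).2 ?_
  exact Differentiable.differentiableOn (by fun_prop)

theorem Ef_of_ne {κ z : ℂ} (hz : z ≠ 0) :
    Ef κ z = (Complex.exp (-κ * z) - 1) / (4 * Real.pi * z) := by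
  rw [Ef, dslope_of_ne _ hz, slope_def_field]
  simp
  field_simp

theorem Ef_zero (κ : ℂ) : Ef κ 0 = -κ / (4 * Real.pi) := by
  rw [Ef, dslope_same]
  have : HasDerivAt (fun z => Complex.exp (-κ * z) / (4 * Real.pi)) (-κ / (4 * Real.pi)) 0 := by
    have := (((hasDerivAt_id (0 : ℂ)).const_mul (-κ)).cexp).div_const (4 * (Real.pi : ℂ))
    simpa using this
  exact this.deriv

/-- Two derivatives of `z E(z) = (e^{-κz} - 1)/(4π)` give `z E'' + 2 E' = κ² e^{-κz}/(4π)`; the left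
side over `z` is the radial Laplacian in dimension three. -/
theorem Ef_laplacian (κ : ℂ) {z : ℂ} (hz : z ≠ 0) :
    deriv (deriv (Ef κ)) z + 2 * deriv (Ef κ) z / z =
      κ ^ 2 * (Complex.exp (-κ * z) / (4 * Real.pi * z)) := by
  have hpi : (Real.pi : ℂ) ≠ 0 := by exact_mod_cast Real.pi_ne_zero
  have h0 : (fun z => z * Ef κ z) = fun z => (Complex.exp (-κ * z) - 1) / (4 * Real.pi) := by
    ext z
    by_cases h : z = 0
    · simp [h]
    · rw [Ef_of_ne h]; field_simp
  have d0 := differentiable_Ef κ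
  have d1 : Differentiable ℂ (deriv (Ef κ)) := d0.deriv
  have h1 : ∀ z, Ef κ z + z * deriv (Ef κ) z = -κ * Complex.exp (-κ * z) / (4 * Real.pi) := fun z => by
    have a : HasDerivAt (fun z => z * Ef κ z) (1 * Ef κ z + z * deriv (Ef κ) z) z :=
      (hasDerivAt_id z).mul (d0 z).hasDerivAt
    have b : HasDerivAt (fun z => (Complex.exp (-κ * z) - 1) / (4 * Real.pi))
        (Complex.exp (-κ * z) * (-κ * 1) / (4 * Real.pi)) z :=
      ((((hasDerivAt_id z).const_mul (-κ)).cexp).sub_const 1).div_const _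
    rw [h0] at a
    have := a.unique b
    rw [one_mul] at this
    rw [this]; ring
  have a : HasDerivAt (fun z => Ef κ z + z * deriv (Ef κ) z)
      (deriv (Ef κ) z + (1 * deriv (Ef κ) z + z * deriv (deriv (Ef κ)) z)) z :=
    (d0 z).hasDerivAt.add ((hasDerivAt_id z).mul (d1 z).hasDerivAt)
  have b : HasDerivAt (fun z => -κ * Complex.exp (-κ * z) / (4 * Real.pi))
        (-κ * (Complex.exp (-κ * z) * (-κ * 1)) / (4 * Real.pi)) z :=
      ((((hasDerivAt_id z).const_mul (-κ)).cexp).const_mul _).div_const _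
  rw [funext h1] at a
  have := a.unique b
  field_simp
  field_simp at this
  linear_combination this

theorem isH2loc_Ef (κ : ℂ) :
    IsH2locWithLaplacian (fun x => Ef κ (‖x‖ : ℂ)) (fun x => κ ^ 2 * Gf κ x) := by
  refine (isH2loc_radial (differentiable_Ef κ)).congr ae_eq_rfl ?_
  filter_upwards [ae_ne_zero] with x hx
  exact Ef_laplacian κ (by simpa using hx)

theorem Gf_eq (κ : ℂ) : Gf κ =ᵐ[volume] fun x => Ef κ (‖x‖ : ℂ) + (G0 x : ℂ) := by
  filter_upwards [ae_ne_zero] with x hx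
  have hn : (‖x‖ : ℂ) ≠ 0 := by simpa using hx
  have hpi : (Real.pi : ℂ) ≠ 0 := by exact_mod_cast Real.pi_ne_zero
  rw [Ef_of_ne hn, Gf, G0]
  push_cast
  field_simp
  ring

theorem continuous_Ef_norm (κ : ℂ) : Continuous fun x : R3 => Ef κ (‖x‖ : ℂ) :=
  (differentiable_Ef κ).continuous.comp (Complex.continuous_ofReal.comp continuous_norm)

theorem measurable_Gf (κ : ℂ) : Measurable (Gf κ) := by
  unfold Gf; fun_prop

theorem norm_Gf (κ : ℂ) (x : R3) : ‖Gf κ x‖ = Real.exp (-κ.re * ‖x‖) / (4 * Real.pi * ‖x‖) := by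
  rw [Gf, norm_div, Complex.norm_exp]
  congr 1
  · simp
  · rw [show (4 * Real.pi * ‖x‖ : ℂ) = ((4 * Real.pi * ‖x‖ : ℝ) : ℂ) by push_cast; rfl,
      Complex.norm_real, Real.norm_of_nonneg (by positivity)]

theorem memLp_Gf {κ : ℂ} (hκ : 0 < κ.re) : MemLp (Gf κ) 2 volume := by
  rw [memLp_two_iff_integrable_sq_norm (measurable_Gf κ).aestronglyMeasurable]
  simp only [norm_Gf]
  rw [integrable_radial_iff (f := fun r => (Real.exp (-κ.re * r) / (4 * Real.pi * r)) ^ 2)]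
  have h := (integrableOn_exp_mul_Ioi (a := -(2 * κ.re)) (by linarith) 0).const_mul (1 / (4 * Real.pi) ^ 2)
  refine IntegrableOn.congr_fun h (fun r hr => ?_) measurableSet_Ioi
  have hr0 : r ≠ 0 := (Set.mem_Ioi.1 hr).ne'
  have : Real.exp (-(2 * κ.re) * r) = Real.exp (-κ.re * r) ^ 2 := by
    rw [← Real.exp_nat_mul]; congr 1; push_cast; ring
  simp only [smul_eq_mul, this]
  field_simp

theorem integral_Gf_mul_Gf {κ κ' : ℂ} (hκ : 0 < κ.re) (hκ' : 0 < κ'.re) :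
    ∫ x, Gf κ x * Gf κ' x = 1 / (4 * Real.pi * (κ + κ')) := by
  have h := integral_radial (fun r : ℝ => Complex.exp (-κ * r) / (4 * Real.pi * r) *
    (Complex.exp (-κ' * r) / (4 * Real.pi * r)))
  have hs : κ + κ' ≠ 0 := fun h0 => by
    have := congrArg Complex.re h0
    simp at this; linarith
  have hpi : (Real.pi : ℂ) ≠ 0 := by exact_mod_cast Real.pi_ne_zero
  have h2 : ∫ r in Set.Ioi (0 : ℝ), r ^ 2 • (Complex.exp (-κ * r) / (4 * Real.pi * r) *
      (Complex.exp (-κ' * r) / (4 * Real.pi * r))) =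
      ∫ r in Set.Ioi (0 : ℝ), 1 / (4 * Real.pi : ℂ) ^ 2 * Complex.exp (-(κ + κ') * r) := by
    refine setIntegral_congr_fun measurableSet_Ioi fun r hr => ?_
    have hr0 : (r : ℂ) ≠ 0 := by exact_mod_cast (Set.mem_Ioi.1 hr).ne'
    have : Complex.exp (-(κ + κ') * r) = Complex.exp (-κ * r) * Complex.exp (-κ' * r) := by
      rw [← Complex.exp_add]; congr 1; ring
    rw [this, Complex.real_smul]
    push_cast
    field_simp
  have h3 := integral_exp_mul_complex_Ioi (a := -(κ + κ')) (by simp; linarith) 0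
  rw [integral_const_mul, h3, Complex.ofReal_zero, mul_zero, Complex.exp_zero, neg_div_neg_eq] at h2
  refine h.trans ?_
  rw [h2, Complex.real_smul]
  push_cast
  field_simp

theorem integral_exp_mul_Gf {κ κ' : ℝ} (hκ : 0 < κ) (hκ' : 0 < κ') :
    ∫ x : R3, Complex.exp (-κ * ‖x‖) * Gf κ' x = 1 / (κ + κ') ^ 2 := by
  have h := integral_radial (fun r : ℝ => Complex.exp (-κ * r) *
    (Complex.exp (-κ' * r) / (4 * Real.pi * r)))
  have hs : ((κ : ℂ) + κ') ≠ 0 := by exact_mod_cast (add_pos hκ hκ').ne'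
  have hpi : (Real.pi : ℂ) ≠ 0 := by exact_mod_cast Real.pi_ne_zero
  have h3 := Complex.integral_cpow_mul_exp_neg_mul_Ioi (a := 2) (r := κ + κ') (by simp) (by linarith)
  have h2 : ∫ r in Set.Ioi (0 : ℝ), r ^ 2 • (Complex.exp (-κ * r) *
      (Complex.exp (-κ' * r) / (4 * Real.pi * r))) =
      ∫ r in Set.Ioi (0 : ℝ), 1 / (4 * Real.pi : ℂ) *
        ((r : ℂ) ^ ((2 : ℂ) - 1) * Complex.exp (-(((κ + κ' : ℝ) : ℂ) * r))) := by
    refine setIntegral_congr_fun measurableSet_Ioi fun r hr => ?_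
    have hr0 : (r : ℂ) ≠ 0 := by exact_mod_cast (Set.mem_Ioi.1 hr).ne'
    have : Complex.exp (-(((κ + κ' : ℝ) : ℂ) * r)) = Complex.exp (-κ * r) * Complex.exp (-κ' * r) := by
      rw [← Complex.exp_add]; congr 1; push_cast; ring
    have e1 : (r : ℂ) ^ ((2 : ℂ) - 1) = r := by norm_num
    rw [this, e1, Complex.real_smul]
    push_cast
    field_simp
  rw [integral_const_mul, h3] at h2
  refine h.trans ?_
  rw [h2, Complex.real_smul]
  have : Complex.Gamma 2 = 1 := by
    have := Complex.Gamma_nat_eq_factorial 1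
    rw [← one_add_one_eq_two]
    simpa using this
  rw [this]
  have e2 : (1 / ((κ + κ' : ℝ) : ℂ)) ^ (2 : ℂ) = (1 / (κ + κ')) ^ 2 := by
    rw [show (2 : ℂ) = ((2 : ℕ) : ℂ) by norm_num, Complex.cpow_natCast]; push_cast; rfl
  rw [e2]
  push_cast
  field_simp

end PointNLS
end

noncomputable section
namespace PointNLS
open scoped ContDiff FourierTransform SchwartzMap

/-! ### Fundamental solution and the value of the free resolvent at the origin -/

theorem integrable_Gf_one : Integrable (Gf 1) volume := by
  rw [← integrable_norm_iff (measurable_Gf 1).aestronglyMeasurable]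
  simp only [norm_Gf]
  rw [integrable_radial_iff (f := fun r => Real.exp (-(1 : ℂ).re * r) / (4 * Real.pi * r))]
  have h := (Real.GammaIntegral_convergent (s := 2) (by norm_num)).const_mul (1 / (4 * Real.pi))
  refine IntegrableOn.congr_fun h (fun r hr => ?_) measurableSet_Ioi
  have hr0 : r ≠ 0 := (Set.mem_Ioi.1 hr).ne'
  have e1 : r ^ ((2 : ℝ) - 1) = r := by norm_num
  simp only [smul_eq_mul, e1, Complex.one_re, neg_mul, one_mul]
  field_simp

theorem integral_Gf_one : ∫ x, Gf 1 x = 1 := by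
  have h := integral_radial (fun r : ℝ => Complex.exp (-1 * r) / (4 * Real.pi * r))
  have hpi : (Real.pi : ℂ) ≠ 0 := by exact_mod_cast Real.pi_ne_zero
  have h3 := Complex.integral_cpow_mul_exp_neg_mul_Ioi (a := 2) (r := 1) (by simp) one_pos
  have h2 : ∫ r in Set.Ioi (0 : ℝ), r ^ 2 • (Complex.exp (-1 * r) / (4 * Real.pi * r)) =
      ∫ r in Set.Ioi (0 : ℝ), 1 / (4 * Real.pi : ℂ) *
        ((r : ℂ) ^ ((2 : ℂ) - 1) * Complex.exp (-(((1 : ℝ) : ℂ) * r))) := by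
    refine setIntegral_congr_fun measurableSet_Ioi fun r hr => ?_
    have hr0 : (r : ℂ) ≠ 0 := by exact_mod_cast (Set.mem_Ioi.1 hr).ne'
    have e1 : (r : ℂ) ^ ((2 : ℂ) - 1) = r := by norm_num
    rw [e1, Complex.real_smul]
    push_cast
    rw [neg_one_mul, one_mul]
    field_simp
  have : Complex.Gamma 2 = 1 := by
    have := Complex.Gamma_nat_eq_factorial 1
    rw [← one_add_one_eq_two]
    simpa using this
  rw [integral_const_mul, h3, this] at h2
  refine h.trans ?_
  rw [h2, Complex.real_smul]
  simp
  field_simp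

theorem memL2loc_G0 : MemL2loc fun x => (G0 x : ℂ) := by
  refine memL2loc_of_bound ?_ fun R => ⟨1 / (4 * Real.pi), fun x _ _ => ?_⟩
  · refine Complex.continuous_ofReal.comp_continuousOn ?_
    refine ContinuousOn.div continuousOn_const (by fun_prop) fun x hx => ?_
    have : ‖x‖ ≠ 0 := norm_ne_zero_iff.2 hx
    have := Real.pi_ne_zero
    positivity
  · rw [Complex.norm_real, G0, Real.norm_of_nonneg (by positivity)]
    apply le_of_eq
    rw [one_div, mul_inv, one_div]

/-- The profile `E_κ = (e^{-κr} - 1)G₀` tends to `-G₀` as `κ → ∞`, while its Laplacian `κ²G_κ(x) =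
κ³G₁(κx)` is an approximate identity because `∫ G₁ = 1`. The sequence `κ = n + 1` suffices. -/
theorem neg_integral_G0_mul_lap {ψ : R3 → ℂ} (hψ : IsTest ψ) :
    ∫ x, (G0 x : ℂ) * lap ψ x = - ψ 0 := by
  have hn : ∀ n : ℕ, ∫ x, Ef ((n : ℂ) + 1) (‖x‖ : ℂ) * lap ψ x =
      ∫ y, Gf 1 y * ψ ((1 / ((n : ℝ) + 1)) • y) := fun n => by
    rw [(isH2loc_Ef ((n : ℂ) + 1)).integral_lap hψ]
    have hp : (0 : ℝ) < (n : ℝ) + 1 := by positivity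
    have h := Measure.integral_comp_smul (volume : Measure R3)
      (fun y => Gf 1 y * ψ ((1 / ((n : ℝ) + 1)) • y)) ((n : ℝ) + 1)
    have e : ∀ x : R3, Gf 1 (((n : ℝ) + 1) • x) * ψ ((1 / ((n : ℝ) + 1)) • ((n : ℝ) + 1) • x) =
        (((n : ℂ) + 1) ^ 3)⁻¹ * (((n : ℂ) + 1) ^ 2 * Gf ((n : ℂ) + 1) x * ψ x) := fun x => by
      rw [smul_smul, one_div_mul_cancel hp.ne', one_smul, Gf, Gf, norm_smul,
        Real.norm_of_nonneg hp.le]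
      have hc : ((n : ℂ) + 1) ≠ 0 := by exact_mod_cast hp.ne'
      have : (-1 * (((n : ℝ) + 1) * ‖x‖ : ℝ) : ℂ) = -((n : ℂ) + 1) * ‖x‖ := by push_cast; ring
      rw [this]
      push_cast
      by_cases hx : x = 0
      · simp [hx]
      · have hx' : (‖x‖ : ℂ) ≠ 0 := by simpa using hx
        have hpi : (Real.pi : ℂ) ≠ 0 := by exact_mod_cast Real.pi_ne_zero
        field_simp
    simp only [e] at h
    rw [integral_const_mul] at h
    simp only [finrank_euclideanSpace, Fintype.card_fin] at h
    rw [abs_of_nonneg (by positivity), Complex.real_smul] at h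
    push_cast at h
    have hc : (((n : ℂ) + 1) ^ 3)⁻¹ ≠ 0 := by
      have : ((n : ℂ) + 1) ≠ 0 := by exact_mod_cast hp.ne'
      positivity
    exact mul_left_cancel₀ hc h
  obtain ⟨C, hC⟩ := exists_bound_of_isTest hψ
  have L1 : Tendsto (fun n : ℕ => ∫ y, Gf 1 y * ψ ((1 / ((n : ℝ) + 1)) • y)) atTop (𝓝 (ψ 0)) := by
    have : ψ 0 = ∫ y, Gf 1 y * ψ 0 := by rw [integral_mul_const, integral_Gf_one, one_mul]
    rw [this]
    refine tendsto_integral_of_dominated_convergence (fun y => ‖Gf 1 y‖ * C) (fun n => ?_)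
      (integrable_Gf_one.norm.mul_const C) (fun n => Eventually.of_forall fun y => ?_)
      (Eventually.of_forall fun y => ?_)
    · exact (measurable_Gf 1).aestronglyMeasurable.mul
        (hψ.continuous.comp (continuous_const_smul _)).aestronglyMeasurable
    · rw [norm_mul]; gcongr; exact hC _
    · have lim0 : Tendsto (fun n : ℕ => 1 / ((n : ℝ) + 1)) atTop (𝓝 0) :=
        tendsto_one_div_add_atTop_nhds_zero_nat
      have sx : Tendsto (fun n : ℕ => (1 / ((n : ℝ) + 1)) • y) atTop (𝓝 0) := by
        simpa using lim0.smul_const y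
      exact tendsto_const_nhds.mul ((hψ.continuous.tendsto 0).comp sx)
  have L2 : Tendsto (fun n : ℕ => ∫ x, Ef ((n : ℂ) + 1) (‖x‖ : ℂ) * lap ψ x) atTop
      (𝓝 (∫ x, -(G0 x : ℂ) * lap ψ x)) := by
    have hform : ∀ n : ℕ, ∀ x : R3, x ≠ 0 → Ef ((n : ℂ) + 1) (‖x‖ : ℂ) =
        ((Real.exp (-((n : ℝ) + 1) * ‖x‖) - 1 : ℝ) : ℂ) * (G0 x : ℂ) := fun n x hx => by
      rw [Ef_of_ne (by simpa using hx), G0]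
      push_cast
      ring
    refine tendsto_integral_of_dominated_convergence (fun x => ‖(G0 x : ℂ) * lap ψ x‖) (fun n => ?_)
      (memL2loc_G0.integrable_mul hψ.lap_continuous hψ.hasCompactSupport_lap).norm (fun n => ?_) ?_
    · exact ((continuous_Ef_norm _).mul hψ.lap_continuous).aestronglyMeasurable
    · filter_upwards [ae_ne_zero] with x hx
      rw [hform n x hx, norm_mul, norm_mul, norm_mul, Complex.norm_real]
      have h1 : Real.exp (-((n : ℝ) + 1) * ‖x‖) ≤ 1 := by
        rw [Real.exp_le_one_iff]
        have : 0 ≤ ((n : ℝ) + 1) * ‖x‖ := by positivity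
        linarith
      have h2 := Real.exp_pos (-((n : ℝ) + 1) * ‖x‖)
      have h3 : ‖Real.exp (-((n : ℝ) + 1) * ‖x‖) - 1‖ ≤ 1 := by
        rw [Real.norm_eq_abs, abs_le]; constructor <;> linarith
      calc _ ≤ 1 * ‖(G0 x : ℂ)‖ * ‖lap ψ x‖ := by gcongr
        _ = _ := by ring
    · filter_upwards [ae_ne_zero] with x hx
      simp only [hform _ x hx]
      refine Tendsto.mul_const _ ?_
      have h0 : Tendsto (fun n : ℕ => Real.exp (-((n : ℝ) + 1) * ‖x‖) - 1) atTop (𝓝 (0 - 1)) := by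
        refine Tendsto.sub_const ?_ 1
        refine Real.tendsto_exp_atBot.comp ?_
        have : Tendsto (fun n : ℕ => ((n : ℝ) + 1) * ‖x‖) atTop atTop :=
          (tendsto_atTop_add_const_right _ 1 tendsto_natCast_atTop_atTop).atTop_mul_const
            (norm_pos_iff.2 hx)
        simp only [neg_mul]
        exact tendsto_neg_atTop_atBot.comp this
      have h1 := ((Complex.continuous_ofReal.tendsto _).comp h0).mul_const (G0 x : ℂ)
      simpa using h1
  simp only [hn] at L2
  have := tendsto_nhds_unique L2 L1
  simp only [neg_mul, integral_neg] at this
  rw [← this, neg_neg]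

/-- With `G_κ = E_κ + G₀`, the Laplacian of `E_κ` is `κ²G_κ` and cancels the zeroth order term,
while `G₀` contributes the delta function. -/
theorem integral_Gf_helmholtz {κ : ℂ} (hκ : 0 < κ.re) {ψ : R3 → ℂ} (hψ : IsTest ψ) :
    ∫ x, Gf κ x * (κ ^ 2 * ψ x - lap ψ x) = ψ 0 := by
  have hG : MemL2loc (Gf κ) := MemLp.memL2loc (memLp_Gf hκ)
  have hE : MemL2loc fun x => Ef κ (‖x‖ : ℂ) := (isH2loc_Ef κ).1
  have h1 := (isH2loc_Ef κ).integral_lap hψ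
  have h2 := neg_integral_G0_mul_lap hψ
  have i1 := hG.integrable_mul (hψ.continuous.const_mul (κ ^ 2)) (hψ.2.mul_left (f := fun _ => κ ^ 2))
  have i2 := hE.integrable_mul hψ.lap_continuous hψ.hasCompactSupport_lap
  have i3 := memL2loc_G0.integrable_mul hψ.lap_continuous hψ.hasCompactSupport_lap
  have e : ∫ x, Gf κ x * (κ ^ 2 * ψ x - lap ψ x) = ∫ x, (Gf κ x * (κ ^ 2 * ψ x) -
      (Ef κ (‖x‖ : ℂ) * lap ψ x + (G0 x : ℂ) * lap ψ x)) := by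
    refine integral_congr_ae ?_
    filter_upwards [Gf_eq κ] with x hx
    rw [mul_sub]
    congr 1
    rw [hx]; ring
  have e3 := integral_sub i1 (i2.add i3)
  simp only [Pi.add_apply] at e3
  rw [e, e3, integral_add i2 i3, h1, h2]
  have : ∫ x, Gf κ x * (κ ^ 2 * ψ x) = ∫ x, κ ^ 2 * Gf κ x * ψ x := by
    congr 1; ext x; ring
  rw [this]; ring

/-- `G_κ` as an element of `L²`, and `0` if `Re κ ≤ 0`. -/
def Gs (κ : ℂ) : S2 := open Classical in if h : 0 < κ.re then (memLp_Gf h).toLp (Gf κ) else 0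

theorem coeFn_Gs {κ : ℂ} (h : 0 < κ.re) : Gs κ =ᵐ[volume] Gf κ := by
  rw [Gs, dif_pos h]; exact (memLp_Gf h).coeFn_toLp

theorem conj_Gf (κ : ℂ) (x : R3) : (starRingEnd ℂ) (Gf κ x) = Gf ((starRingEnd ℂ) κ) x := by
  rw [Gf, Gf, map_div₀, ← Complex.exp_conj]
  simp only [map_mul, map_neg, Complex.conj_ofReal, map_ofNat]

/-- The functional `f ↦ ∫ G_κ f`. -/
def ell (κ : ℂ) : S2 →L[ℂ] ℂ := innerSL ℂ (Gs ((starRingEnd ℂ) κ))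

theorem ell_apply {κ : ℂ} (h : 0 < κ.re) (f : S2) : ell κ f = ∫ x, Gf κ x * f x := by
  rw [ell, innerSL_apply_apply, L2.inner_def]
  refine integral_congr_ae ?_
  filter_upwards [coeFn_Gs (κ := (starRingEnd ℂ) κ) (by simpa using h)] with x hx
  rw [hx, RCLike.inner_apply, conj_Gf, Complex.conj_conj, mul_comm]

theorem sq_mem_slitPlane {κ : ℂ} (h : 0 < κ.re) : κ ^ 2 ∈ Complex.slitPlane := by
  rw [Complex.mem_slitPlane_iff]
  by_contra! hc
  obtain ⟨h1, h2⟩ := hc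
  simp only [sq, Complex.mul_re, Complex.mul_im] at h1 h2
  have : κ.im = 0 := by
    have : 2 * (κ.re * κ.im) = 0 := by linarith
    rcases mul_eq_zero.1 (by linarith : κ.re * κ.im = 0) with h3 | h3
    · linarith
    · exact h3
  rw [this] at h1
  nlinarith

/-- The value at the origin of the continuous representative of `(-Δ + κ²)⁻¹ f`. -/
theorem integral_symb_inv_mul_fourier {κ : ℂ} (h : 0 < κ.re) (f : S2) :
    ∫ ξ, (symb (κ ^ 2) ξ)⁻¹ * (𝓕 f : S2) ξ = ell κ f := by
  have hz := sq_mem_slitPlane h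
  have m1 : MemLp (fun ξ => (starRingEnd ℂ) (symb (κ ^ 2) ξ)⁻¹) 2 (volume : Measure R3) :=
    (memLp_two_symb_inv hz).of_le_mul (c := 1)
      (Complex.continuous_conj.comp (continuous_symb_inv hz)).aestronglyMeasurable
      (Eventually.of_forall fun ξ => by simp)
  set k : S2 := m1.toLp _
  have hk : ∀ᵐ ξ, k ξ = (starRingEnd ℂ) (symb (κ ^ 2) ξ)⁻¹ := m1.coeFn_toLp
  -- `m` represents the functional `f ↦ ∫ f̂ / symb` in `L²`. Showing that its conjugate is `G_κ` by
  -- uniqueness avoids computing the Fourier transform of `G_κ`.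
  set m : S2 := 𝓕⁻ k with hm
  have hrep : ∀ g : S2, ∫ ξ, (symb (κ ^ 2) ξ)⁻¹ * (𝓕 g : S2) ξ = inner ℂ m g := fun g => by
    have e1 : inner ℂ m g = inner ℂ k (𝓕 g) := by
      rw [← Lp.inner_fourier_eq m g, hm, FourierTransform.fourier_fourierInv_eq]
    rw [e1, L2.inner_def]
    refine integral_congr_ae ?_
    filter_upwards [hk] with ξ h1
    rw [h1, RCLike.inner_apply, Complex.conj_conj, mul_comm]
  have hmc : ∀ g : S2, inner ℂ m g = ∫ x, (starRingEnd ℂ) (m x) * g x := fun g => by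
    rw [L2.inner_def]
    refine integral_congr_ae (Eventually.of_forall fun x => ?_)
    simp only [RCLike.inner_apply]
    rw [mul_comm]
  have mm : MemLp (fun x => (starRingEnd ℂ) (m x)) 2 (volume : Measure R3) :=
    (Lp.memLp m).of_le_mul (c := 1)
      (Complex.continuous_conj.comp_aestronglyMeasurable (Lp.memLp m).1)
      (Eventually.of_forall fun ξ => by simp)
  -- Both functions are square integrable and satisfy `(-Δ + κ²)(·) = δ`: for `G_κ` this is
  -- `integral_Gf_helmholtz`, and for the conjugate of `m` it is Fourier inversion at the origin.
  have key : (fun x => (starRingEnd ℂ) (m x) - Gf κ x) =ᵐ[volume] 0 := by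
    refine ae_eq_zero_of_helmholtz (mm.sub (memLp_Gf h)) hz fun ψ hψ => ?_
    set Ψ : 𝓢(R3, ℂ) := hψ.2.toSchwartzMap hψ.1
    have eΨ : ∀ x, Ψ x = ψ x := fun x => rfl
    set F : 𝓢(R3, ℂ) := SchwartzMap.smulLeftCLM ℂ (symb (κ ^ 2)) (𝓕 Ψ)
    set f : 𝓢(R3, ℂ) := 𝓕⁻ F with hf
    have ef : ∀ x, f x = κ ^ 2 * ψ x - lap ψ x := fun x => by
      rw [hf, fourierInv_symb_smul, FourierTransform.fourierInv_fourier_eq]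
      rfl
    have e1 : ∫ x, (starRingEnd ℂ) (m x) * (κ ^ 2 * ψ x - lap ψ x) = ψ 0 := by
      have a1 : ∫ x, (starRingEnd ℂ) (m x) * (κ ^ 2 * ψ x - lap ψ x) = inner ℂ m (f.toLp 2) := by
        rw [hmc]
        refine integral_congr_ae ?_
        filter_upwards [f.coeFn_toLp 2] with x hx
        rw [hx, ef]
      rw [a1, ← hrep, SchwartzMap.toLp_fourier_eq, hf, FourierTransform.fourier_fourierInv_eq]
      have a2 : ∫ ξ, (symb (κ ^ 2) ξ)⁻¹ * (F.toLp 2 volume : S2) ξ = ∫ ξ, (𝓕 Ψ : 𝓢(R3, ℂ)) ξ := by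
        refine integral_congr_ae ?_
        filter_upwards [F.coeFn_toLp 2] with x hx
        rw [hx, SchwartzMap.smulLeftCLM_apply_apply (hasTemperateGrowth_symb _), smul_eq_mul,
          inv_mul_cancel_left₀ (symb_ne_zero hz x)]
      rw [a2]
      have a3 : (𝓕⁻ (𝓕 Ψ) : 𝓢(R3, ℂ)) 0 = Ψ 0 := by rw [FourierTransform.fourierInv_fourier_eq]
      rw [SchwartzMap.fourierInv_coe, Real.fourierInv_eq] at a3
      rw [← eΨ 0]
      simpa only [inner_zero_right, AddChar.map_zero_eq_one, one_smul] using a3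
    have e2 := integral_Gf_helmholtz h hψ
    have c1 : Continuous fun x => κ ^ 2 * ψ x - lap ψ x :=
      (hψ.continuous.const_mul _).sub hψ.lap_continuous
    have c2 : HasCompactSupport fun x => κ ^ 2 * ψ x - lap ψ x :=
      (hψ.2.mul_left (f := fun _ => κ ^ 2)).sub hψ.hasCompactSupport_lap
    have i1 := (MemLp.memL2loc mm).integrable_mul c1 c2
    have i2 := (MemLp.memL2loc (memLp_Gf h)).integrable_mul c1 c2
    simp only [sub_mul _ (Gf κ _)]
    rw [integral_sub i1 i2, e1, e2, sub_self]
  rw [hrep, hmc, ell_apply h]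
  refine integral_congr_ae ?_
  filter_upwards [key] with x hx
  rw [sub_eq_zero.1 hx]

attribute [irreducible] Gs ell

end PointNLS
end

noncomputable section
namespace PointNLS

/-! ### Point interactions with prescribed charge and boundary value -/

/-- `u = φ + q G₀` with `φ ∈ H²_loc` continuous, `φ(0) = φ₀` and `-Δφ = v`. -/
def HasCharge (q φ₀ : ℂ) (u v : R3 → ℂ) : Prop :=
  ∃ φ : R3 → ℂ, Continuous φ ∧ φ 0 = φ₀ ∧
    (u =ᵐ[volume] fun x => φ x + q * (G0 x : ℂ)) ∧
    IsH2locWithLaplacian φ (fun x => - v x)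

theorem HasCharge.congr {q φ₀ : ℂ} {u u' v v' : R3 → ℂ} (h : HasCharge q φ₀ u v)
    (hu : u =ᵐ[volume] u') (hv : v =ᵐ[volume] v') : HasCharge q φ₀ u' v' := by
  obtain ⟨φ, h1, h2, h3, h4⟩ := h
  refine ⟨φ, h1, h2, hu.symm.trans h3, h4.congr (ae_eq_refl _) ?_⟩
  filter_upwards [hv] with x hx
  rw [hx]

theorem HasCharge.add {q q' φ₀ φ₀' : ℂ} {u u' v v' : R3 → ℂ} (h : HasCharge q φ₀ u v)
    (h' : HasCharge q' φ₀' u' v') :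
    HasCharge (q + q') (φ₀ + φ₀') (fun x => u x + u' x) (fun x => v x + v' x) := by
  obtain ⟨φ, h1, h2, h3, h4⟩ := h
  obtain ⟨φ', h1', h2', h3', h4'⟩ := h'
  refine ⟨fun x => φ x + φ' x, h1.add h1', by simp only [h2, h2'], ?_, ?_⟩
  · filter_upwards [h3, h3'] with x hx hx'
    rw [hx, hx']; ring
  · exact (h4.add h4').congr (ae_eq_refl _) (Eventually.of_forall fun x => by simp only; ring)

theorem HasCharge.const_mul {q φ₀ : ℂ} {u v : R3 → ℂ} (h : HasCharge q φ₀ u v) (c : ℂ) :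
    HasCharge (c * q) (c * φ₀) (fun x => c * u x) (fun x => c * v x) := by
  obtain ⟨φ, h1, h2, h3, h4⟩ := h
  refine ⟨fun x => c * φ x, h1.const_mul c, by simp only [h2], ?_, ?_⟩
  · filter_upwards [h3] with x hx
    rw [hx]; ring
  · exact (h4.const_mul c).congr (ae_eq_refl _) (Eventually.of_forall fun x => by simp only; ring)

theorem hasCharge_freeRes {κ : ℂ} (hκ : 0 < κ.re) (f : S2) :
    HasCharge 0 (ell κ f) (freeRes (κ ^ 2) f) (fun x => f x - κ ^ 2 * freeRes (κ ^ 2) f x) := by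
  obtain ⟨φ, h1, h2, h3, h4⟩ := freeRes_spec (sq_mem_slitPlane hκ) f
  refine ⟨φ, h1, by rw [h3, integral_symb_inv_mul_fourier hκ], ?_, ?_⟩
  · filter_upwards [h2] with x hx
    rw [hx]; ring
  · exact h4.congr (ae_eq_refl _) (Eventually.of_forall fun x => by simp only; ring)

/-- The regular part of `G_κ` is `E_κ(|x|)`, with value `-κ/(4π)` at the origin. This number is how
`κ` enters the boundary conditions and hence the determinant. -/
theorem hasCharge_Gs {κ : ℂ} (hκ : 0 < κ.re) :
    HasCharge 1 (-κ / (4 * Real.pi)) (Gs κ) (fun x => - (κ ^ 2 * Gs κ x)) := by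
  refine ⟨fun x => Ef κ (‖x‖ : ℂ), continuous_Ef_norm κ, ?_, ?_, ?_⟩
  · simp [Ef_zero]
  · filter_upwards [coeFn_Gs hκ, Gf_eq κ] with x h1 h2
    rw [h1, h2]; ring
  · refine (isH2loc_Ef κ).congr (ae_eq_refl _) ?_
    filter_upwards [coeFn_Gs hκ] with x h1
    rw [h1, neg_neg]

theorem hasCharge_freeRes_add {κ : ℂ} (hκ : 0 < κ.re) (f : S2) (q : ℂ) :
    HasCharge q (ell κ f - q * κ / (4 * Real.pi)) (freeRes (κ ^ 2) f + q • Gs κ : S2)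
      (fun x => f x - κ ^ 2 * (freeRes (κ ^ 2) f + q • Gs κ : S2) x) := by
  have h := (hasCharge_freeRes hκ f).add ((hasCharge_Gs hκ).const_mul q)
  have e1 : (0 : ℂ) + q * 1 = q := by ring
  have e2 : ell κ f + q * (-κ / (4 * Real.pi)) = ell κ f - q * κ / (4 * Real.pi) := by ring
  rw [e1, e2] at h
  have e3 : ∀ᵐ x, (freeRes (κ ^ 2) f + q • Gs κ : S2) x = freeRes (κ ^ 2) f x + q * Gs κ x := by
    filter_upwards [Lp.coeFn_add (freeRes (κ ^ 2) f) (q • Gs κ), Lp.coeFn_smul q (Gs κ)] with x h1 h2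
    rw [h1, Pi.add_apply, h2, Pi.smul_apply, smul_eq_mul]
  refine h.congr ?_ ?_
  · filter_upwards [e3] with x hx
    rw [hx]
  · filter_upwards [e3] with x hx
    rw [hx]; ring

/-- Without charge there is no singular part, so `u` solves the homogeneous Helmholtz equation on
all of `ℝ³` and must vanish; then so does its continuous representative at every point. -/
theorem HasCharge.eq_zero {κ φ₀ : ℂ} (hκ : 0 < κ.re) {u : R3 → ℂ} (hu : MemLp u 2 volume)
    (h : HasCharge 0 φ₀ u (fun x => - (κ ^ 2 * u x))) : u =ᵐ[volume] 0 ∧ φ₀ = 0 := by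
  obtain ⟨φ, h1, h2, h3, h4⟩ := h
  have h3' : u =ᵐ[volume] φ := by
    filter_upwards [h3] with x hx
    rw [hx]; ring
  have h0 : u =ᵐ[volume] 0 := by
    refine ae_eq_zero_of_helmholtz hu (sq_mem_slitPlane hκ) fun ψ hψ => ?_
    have e := h4.integral_lap hψ
    have hl := MemLp.memL2loc hu
    have i1 := hl.integrable_mul (hψ.continuous.const_mul (κ ^ 2))
      (hψ.2.mul_left (f := fun _ => κ ^ 2))
    have i2 := hl.integrable_mul hψ.lap_continuous hψ.hasCompactSupport_lap
    simp only [mul_sub]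
    rw [integral_sub i1 i2, sub_eq_zero]
    have e1 : ∫ x, u x * lap ψ x = ∫ x, φ x * lap ψ x := by
      refine integral_congr_ae ?_
      filter_upwards [h3'] with x hx
      rw [hx]
    rw [e1, e]
    congr 1; ext x; ring
  refine ⟨h0, ?_⟩
  have : φ = fun _ => 0 := by
    refine (Continuous.ae_eq_iff_eq volume h1 continuous_const).1 ?_
    filter_upwards [h0, h3'] with x hx hx'
    rw [← hx', hx]; rfl
  rw [← h2, this]

/-- Linear superposition gives one solution with charge `q`, and `HasCharge.eq_zero` shows that
there is no other. Every later statement on the domain of `L` becomes algebra in the charges through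
this equivalence. -/
theorem hasCharge_iff {κ : ℂ} (hκ : 0 < κ.re) (q φ₀ : ℂ) (u f : S2) :
    HasCharge q φ₀ u (fun x => f x - κ ^ 2 * u x) ↔
      u = freeRes (κ ^ 2) f + q • Gs κ ∧ φ₀ = ell κ f - q * κ / (4 * Real.pi) := by
  have h' := hasCharge_freeRes_add hκ f q
  constructor
  · intro h
    set u' : S2 := freeRes (κ ^ 2) f + q • Gs κ
    have hd := h.add (h'.const_mul (-1))
    have hs := Lp.coeFn_sub u u'
    have hd' : HasCharge 0 (φ₀ + -1 * (ell κ f - q * κ / (4 * Real.pi))) (u - u' : S2)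
        (fun x => - (κ ^ 2 * (u - u' : S2) x)) := by
      have e : q + -1 * q = 0 := by ring
      rw [e] at hd
      refine hd.congr ?_ ?_
      · filter_upwards [hs] with x hx
        rw [hx, Pi.sub_apply]; ring
      · filter_upwards [hs] with x hx
        rw [hx, Pi.sub_apply]; ring
    obtain ⟨h1, h2⟩ := hd'.eq_zero hκ (Lp.memLp _)
    refine ⟨sub_eq_zero.1 ((Lp.eq_zero_iff_ae_eq_zero).2 h1), ?_⟩
    linear_combination h2
  · rintro ⟨rfl, rfl⟩
    exact h'

/-! ### Components -/

/-- The linear form `u ↦ (u₁ - c i u₂) / 2` on `ℂ²`. -/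
def cmpAux (c : ℂ) : C2 →L[ℂ] ℂ :=
  (1 / 2 : ℂ) • (EuclideanSpace.proj 0 - (c * Complex.I) • EuclideanSpace.proj 1)

/-- The map `z ↦ z (1, c i)` to `ℂ²`. -/
def embAux (c : ℂ) : ℂ →L[ℂ] C2 :=
  ContinuousLinearMap.toSpanSingleton ℂ (!₂[1, c * Complex.I] : C2)

/-- The component `(u₁ - c i u₂) / 2`; for `c = ±1` the component along `(1, ±i)`. -/
def cmp (c : ℂ) : L2 →L[ℂ] S2 := ContinuousLinearMap.compLpL 2 volume (cmpAux c)

/-- The embedding `g ↦ g (1, c i)`. -/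
def emb (c : ℂ) : S2 →L[ℂ] L2 := ContinuousLinearMap.compLpL 2 volume (embAux c)

/-- The coordinates of an element of `L²(ℝ³; ℂ²)`. -/
def coord (i : Fin 2) : L2 →L[ℂ] S2 :=
  ContinuousLinearMap.compLpL 2 volume (EuclideanSpace.proj i : C2 →L[ℂ] ℂ)

theorem coeFn_coord (i : Fin 2) (u : L2) : ∀ᵐ x, coord i u x = u x i :=
  (ContinuousLinearMap.coeFn_compLpL (p := 2) (μ := volume) (EuclideanSpace.proj i : C2 →L[ℂ] ℂ) u)

theorem coeFn_cmp (c : ℂ) (u : L2) : ∀ᵐ x, cmp c u x = (u x 0 - c * Complex.I * u x 1) / 2 := by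
  filter_upwards [ContinuousLinearMap.coeFn_compLpL (p := 2) (μ := volume) (cmpAux c) u] with x hx
  rw [cmp, hx]
  simp [cmpAux]
  ring

theorem coeFn_emb (c : ℂ) (g : S2) :
    ∀ᵐ x, emb c g x 0 = g x ∧ emb c g x 1 = c * Complex.I * g x := by
  filter_upwards [ContinuousLinearMap.coeFn_compLpL (p := 2) (μ := volume) (embAux c) g] with x hx
  rw [emb, hx]
  simp [embAux]
  ring

theorem ext_coord {u v : L2} (h0 : coord 0 u = coord 0 v) (h1 : coord 1 u = coord 1 v) : u = v := by
  refine Lp.ext ?_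
  filter_upwards [coeFn_coord 0 u, coeFn_coord 1 u, coeFn_coord 0 v, coeFn_coord 1 v] with x a b c d
  ext i
  fin_cases i
  · simp only [Fin.zero_eta]; rw [← a, ← c, h0]
  · simp only [Fin.mk_one]; rw [← b, ← d, h1]

theorem coord_zero_eq (u : L2) : coord 0 u = cmp 1 u + cmp (-1) u := by
  refine Lp.ext ?_
  filter_upwards [coeFn_coord 0 u, coeFn_cmp 1 u, coeFn_cmp (-1) u,
    Lp.coeFn_add (cmp 1 u) (cmp (-1) u)] with x a b c d
  rw [d, a, Pi.add_apply, b, c]; ring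

theorem coord_one_eq (u : L2) : coord 1 u = Complex.I • (cmp 1 u - cmp (-1) u) := by
  refine Lp.ext ?_
  filter_upwards [coeFn_coord 1 u, coeFn_cmp 1 u, coeFn_cmp (-1) u,
    Lp.coeFn_sub (cmp 1 u) (cmp (-1) u), Lp.coeFn_smul Complex.I (cmp 1 u - cmp (-1) u)] with x a b c d e
  rw [e, Pi.smul_apply, d, a, Pi.sub_apply, b, c, smul_eq_mul]
  linear_combination (u x 1) * Complex.I_sq

theorem coeFn_coord_zero (u : L2) : ∀ᵐ x, coord 0 u x = cmp 1 u x + cmp (-1) u x := by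
  rw [coord_zero_eq]; exact Lp.coeFn_add _ _

theorem coeFn_coord_one (u : L2) :
    ∀ᵐ x, coord 1 u x = Complex.I * (cmp 1 u x - cmp (-1) u x) := by
  rw [coord_one_eq]
  filter_upwards [Lp.coeFn_smul Complex.I (cmp 1 u - cmp (-1) u),
    Lp.coeFn_sub (cmp 1 u) (cmp (-1) u)] with x h1 h2
  rw [h1, Pi.smul_apply, h2, Pi.sub_apply, smul_eq_mul]

theorem coeFn_coord_add_smul (i : Fin 2) (f u : L2) (z : ℂ) :
    ∀ᵐ x, coord i (f + z • u) x = coord i f x + z * coord i u x := by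
  rw [map_add, map_smul]
  filter_upwards [Lp.coeFn_add (coord i f) (z • coord i u), Lp.coeFn_smul z (coord i u)] with x h1 h2
  rw [h1, Pi.add_apply, h2, Pi.smul_apply, smul_eq_mul]

theorem ext_cmp {u v : L2} (h0 : cmp 1 u = cmp 1 v) (h1 : cmp (-1) u = cmp (-1) v) : u = v :=
  ext_coord (by rw [coord_zero_eq, coord_zero_eq, h0, h1])
    (by rw [coord_one_eq, coord_one_eq, h0, h1])

theorem cmp_emb (c c' : ℂ) (g : S2) : cmp c (emb c' g) = ((1 + c * c') / 2) • g := by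
  refine Lp.ext ?_
  filter_upwards [coeFn_cmp c (emb c' g), coeFn_emb c' g, Lp.coeFn_smul ((1 + c * c') / 2) g]
    with x a b d
  rw [a, b.1, b.2, d, Pi.smul_apply, smul_eq_mul]
  linear_combination (-c * c' * g x / 2) * Complex.I_sq

theorem eq_emb_add (u : L2) : u = emb 1 (cmp 1 u) + emb (-1) (cmp (-1) u) := by
  refine ext_cmp ?_ ?_ <;> rw [map_add, cmp_emb, cmp_emb] <;> norm_num

theorem inner_emb (g : L2) (c : ℝ) (a : S2) : inner ℂ g (emb c a) = 2 * inner ℂ (cmp c g) a := by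
  rw [L2.inner_def, L2.inner_def, ← integral_const_mul]
  refine integral_congr_ae ?_
  filter_upwards [coeFn_emb c a, coeFn_cmp c g] with x h1 h2
  rw [h2, PiLp.inner_apply, Fin.sum_univ_two, h1.1, h1.2]
  simp only [RCLike.inner_apply, map_div₀, map_sub, map_mul, Complex.conj_I, Complex.conj_ofReal,
    map_ofNat]
  ring

attribute [irreducible] cmp emb coord

/-- The relation `v = L u` in terms of charges. -/
theorem isL_iff (σ ω : ℝ) (u v : L2) : IsL σ ω u v ↔ ∃ q₁ q₂ : ℂ,
    HasCharge q₁ (alpha1 σ ω * q₁) (coord 0 u) (fun x => - coord 1 v x - ω * coord 0 u x) ∧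
    HasCharge q₂ (alpha2 ω * q₂) (coord 1 u) (fun x => coord 0 v x - ω * coord 1 u x) := by
  have a := coeFn_coord 0 u
  have b := coeFn_coord 1 u
  have c := coeFn_coord 0 v
  have d := coeFn_coord 1 v
  constructor
  · rintro ⟨g₁, g₂, ⟨-, -, q₁, h1⟩, ⟨-, -, q₂, h2⟩, e1, e2⟩
    refine ⟨q₁, q₂, HasCharge.congr (u := fun x => u x 0) (v := g₁) h1 ?_ ?_,
      HasCharge.congr (u := fun x => u x 1) (v := g₂) h2 ?_ ?_⟩
    · filter_upwards [a] with x a; rw [a]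
    · filter_upwards [a, d, e2] with x a d e; rw [a, d, e]; ring
    · filter_upwards [b] with x b; rw [b]
    · filter_upwards [b, c, e1] with x b c e; rw [b, c, e]; ring
  · rintro ⟨q₁, q₂, h1, h2⟩
    have m : ∀ (w : L2) i, MemLp (fun x => w x i) 2 volume := fun w i =>
      (memLp_congr_ae (coeFn_coord i w)).1 (Lp.memLp (coord i w))
    refine ⟨fun x => - v x 1 - ω * u x 0, fun x => v x 0 - ω * u x 1,
      ⟨m u 0, (m v 1).neg.sub ((m u 0).const_mul _), q₁, HasCharge.congr h1 ?_ ?_⟩,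
      ⟨m u 1, (m v 0).sub ((m u 1).const_mul _), q₂, HasCharge.congr h2 ?_ ?_⟩, ?_, ?_⟩
    · filter_upwards [a] with x a; rw [a]
    · filter_upwards [a, d] with x a d; rw [a, d]
    · filter_upwards [b] with x b; rw [b]
    · filter_upwards [b, c] with x b c; rw [b, c]
    · exact Eventually.of_forall fun x => by ring
    · exact Eventually.of_forall fun x => by ring

/-- `p = (σ + 1) √ω`. -/
def pp (σ ω : ℝ) : ℝ := (σ + 1) * Real.sqrt ω

/-- `d = σ √ω`. -/
def dd (σ ω : ℝ) : ℝ := σ * Real.sqrt ω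

set_option maxHeartbeats 1000000 in
/-- The equation `L u = f + z u` in the components along `(1, ±i)`. -/
theorem isL_iff_cmp (σ ω : ℝ) {z κ μ : ℂ} (hκ : 0 < κ.re) (hμ : 0 < μ.re)
    (hκz : κ ^ 2 = ω + Complex.I * z) (hμz : μ ^ 2 = ω - Complex.I * z) (u f : L2) :
    IsL σ ω u (f + z • u) ↔ ∃ c c' : ℂ,
      cmp 1 u = -Complex.I • freeRes (κ ^ 2) (cmp 1 f) + c • Gs κ ∧
      cmp (-1) u = Complex.I • freeRes (μ ^ 2) (cmp (-1) f) + c' • Gs μ ∧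
      (κ - pp σ ω) * c - dd σ ω * c' = -(4 * Real.pi * Complex.I * ell κ (cmp 1 f)) ∧
      (μ - pp σ ω) * c' - dd σ ω * c = 4 * Real.pi * Complex.I * ell μ (cmp (-1) f) := by
  have hpi : (Real.pi : ℂ) ≠ 0 := by exact_mod_cast Real.pi_ne_zero
  have hI := Complex.I_sq
  rw [isL_iff]
  have eu0 := coeFn_coord_zero u
  have eu1 := coeFn_coord_one u
  have ev := fun i => coeFn_coord_add_smul i f u z
  have ef0 := coeFn_coord_zero f
  have ef1 := coeFn_coord_one f
  generalize cmp 1 u = u1 at *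
  generalize cmp (-1) u = u2 at *
  generalize cmp 1 f = f1 at *
  generalize cmp (-1) f = f2 at *
  have hF : ∀ᵐ x, (-Complex.I • f1 : S2) x = -Complex.I * f1 x := Lp.coeFn_smul _ _
  have hF' : ∀ᵐ x, (Complex.I • f2 : S2) x = Complex.I * f2 x := Lp.coeFn_smul _ _
  have ea : (alpha1 σ ω : ℂ) = -((2 * σ + 1) * Real.sqrt ω / (4 * Real.pi)) := by
    rw [alpha1]; push_cast; ring
  have eb : (alpha2 ω : ℂ) = -(Real.sqrt ω / (4 * Real.pi)) := by
    rw [alpha2]; push_cast; ring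
  have ep : (pp σ ω : ℂ) = (σ + 1) * Real.sqrt ω := by rw [pp]; push_cast; ring
  have ed : (dd σ ω : ℂ) = σ * Real.sqrt ω := by rw [dd]; push_cast; ring
  rw [ep, ed]
  constructor
  · rintro ⟨q₁, q₂, h1, h2⟩
    -- The combinations `(u₁ ∓ i u₂)/2` diagonalize `J` and decouple the differential equations;
    -- only the boundary conditions still couple the two components.
    have k1 := (h1.const_mul (1 / 2)).add (h2.const_mul (-Complex.I / 2))
    have k2 := (h1.const_mul (1 / 2)).add (h2.const_mul (Complex.I / 2))
    have k1' := HasCharge.congr (u' := u1) (v' := fun x => (-Complex.I • f1 : S2) x - κ ^ 2 * u1 x) k1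
      (by
        filter_upwards [eu0, eu1] with x h3 h4
        rw [h3, h4]; linear_combination (-(u1 x - u2 x) / 2) * hI)
      (by
        filter_upwards [eu0, eu1, ev 0, ev 1, ef0, ef1, hF] with x h3 h4 h5 h6 h7 h8 h9
        rw [h5, h6, h3, h4, h7, h8, h9, hκz]
        linear_combination (ω * (u1 x - u2 x) / 2) * hI)
    have k2' := HasCharge.congr (u' := u2) (v' := fun x => (Complex.I • f2 : S2) x - μ ^ 2 * u2 x) k2
      (by
        filter_upwards [eu0, eu1] with x h3 h4
        rw [h3, h4]; linear_combination ((u1 x - u2 x) / 2) * hI)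
      (by
        filter_upwards [eu0, eu1, ev 0, ev 1, ef0, ef1, hF'] with x h3 h4 h5 h6 h7 h8 h9
        rw [h5, h6, h3, h4, h7, h8, h9, hμz]
        linear_combination (-ω * (u1 x - u2 x) / 2) * hI)
    rw [hasCharge_iff hκ] at k1'
    rw [hasCharge_iff hμ] at k2'
    obtain ⟨a1, a2⟩ := k1'
    obtain ⟨b1, b2⟩ := k2'
    refine ⟨_, _, by rw [a1, map_smul], by rw [b1, map_smul], ?_, ?_⟩
    -- The numbers `pp` and `dd` are half the sum and half the difference of `-4πα₁ = (2σ+1)√ω` and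
    -- `-4πα₂ = √ω`: this is the boundary matrix rotated into the components along `(1, ±i)`.
    · rw [map_smul, smul_eq_mul, ea, eb] at a2
      field_simp at a2
      linear_combination a2 / 2
    · rw [map_smul, smul_eq_mul, ea, eb] at b2
      field_simp at b2
      linear_combination b2 / 2
  · rintro ⟨c, c', a1, b1, a2, b2⟩
    have k1 := (hasCharge_iff hκ c _ u1 (-Complex.I • f1)).2 ⟨by rw [a1, map_smul], rfl⟩
    have k2 := (hasCharge_iff hμ c' _ u2 (Complex.I • f2)).2 ⟨by rw [b1, map_smul], rfl⟩
    refine ⟨c + c', Complex.I * (c - c'), ?_, ?_⟩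
    · have := k1.add k2
      have e : (ell κ) (-Complex.I • f1) - c * κ / (4 * Real.pi) +
          ((ell μ) (Complex.I • f2) - c' * μ / (4 * Real.pi)) = alpha1 σ ω * (c + c') := by
        rw [map_smul, map_smul, smul_eq_mul, smul_eq_mul, ea]
        field_simp
        linear_combination -a2 - b2
      rw [e] at this
      refine this.congr ?_ ?_
      · filter_upwards [eu0] with x h3; rw [h3]
      · filter_upwards [eu0, eu1, ev 1, ef1, hF, hF'] with x h3 h4 h5 h6 h7 h8
        rw [h5, h6, h3, h4, h7, h8, hκz, hμz]
        ring
    · have := (k1.const_mul Complex.I).add (k2.const_mul (-Complex.I))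
      have e : Complex.I * ((ell κ) (-Complex.I • f1) - c * κ / (4 * Real.pi)) +
          -Complex.I * ((ell μ) (Complex.I • f2) - c' * μ / (4 * Real.pi)) =
            alpha2 ω * (Complex.I * (c - c')) := by
        rw [map_smul, map_smul, smul_eq_mul, smul_eq_mul, eb]
        field_simp
        linear_combination -a2 + b2
      rw [e] at this
      have e' : Complex.I * c + -Complex.I * c' = Complex.I * (c - c') := by ring
      rw [e'] at this
      refine this.congr ?_ ?_
      · filter_upwards [eu1] with x h3; rw [h3]; ring
      · filter_upwards [eu0, eu1, ev 0, ef0, hF, hF'] with x h3 h4 h5 h6 h7 h8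
        rw [h5, h6, h3, h4, h7, h8, hκz, hμz]
        linear_combination (-(f1 x + f2 x) - z * (u1 x + u2 x)) * hI

end PointNLS
end

noncomputable section
namespace PointNLS


/-! ### The resolvent of `L` -/

/-- The determinant of the boundary conditions. -/
def det (σ ω : ℝ) (κ μ : ℂ) : ℂ := (κ - pp σ ω) * (μ - pp σ ω) - (dd σ ω : ℂ) ^ 2

/-- The charge functional of the component along `(1, i)`. -/
def chargeP (σ ω : ℝ) (κ μ : ℂ) : L2 →L[ℂ] ℂ :=
  (4 * Real.pi * Complex.I / det σ ω κ μ) •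
    (-(μ - pp σ ω) • (ell κ).comp (cmp 1) + (dd σ ω : ℂ) • (ell μ).comp (cmp (-1)))

/-- The charge functional of the component along `(1, -i)`. -/
def chargeM (σ ω : ℝ) (κ μ : ℂ) : L2 →L[ℂ] ℂ :=
  (4 * Real.pi * Complex.I / det σ ω κ μ) •
    ((κ - pp σ ω) • (ell μ).comp (cmp (-1)) - (dd σ ω : ℂ) • (ell κ).comp (cmp 1))

/-- The explicit resolvent, where `κ² = ω + i z` and `μ² = ω - i z`. -/
def explicitRes (σ ω : ℝ) (κ μ : ℂ) : L2 →L[ℂ] L2 :=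
  (emb 1).comp (-Complex.I • (freeRes (κ ^ 2)).comp (cmp 1) + (chargeP σ ω κ μ).smulRight (Gs κ)) +
  (emb (-1)).comp (Complex.I • (freeRes (μ ^ 2)).comp (cmp (-1)) +
    (chargeM σ ω κ μ).smulRight (Gs μ))

theorem explicitRes_apply (σ ω : ℝ) (κ μ : ℂ) (f : L2) : explicitRes σ ω κ μ f =
    emb 1 (-Complex.I • freeRes (κ ^ 2) (cmp 1 f) + chargeP σ ω κ μ f • Gs κ) +
    emb (-1) (Complex.I • freeRes (μ ^ 2) (cmp (-1) f) + chargeM σ ω κ μ f • Gs μ) := rfl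

theorem chargeP_apply (σ ω : ℝ) (κ μ : ℂ) (f : L2) : chargeP σ ω κ μ f =
    (4 * Real.pi * Complex.I / det σ ω κ μ) *
      (-(μ - pp σ ω) * ell κ (cmp 1 f) + (dd σ ω : ℂ) * ell μ (cmp (-1) f)) := rfl

theorem chargeM_apply (σ ω : ℝ) (κ μ : ℂ) (f : L2) : chargeM σ ω κ μ f =
    (4 * Real.pi * Complex.I / det σ ω κ μ) *
      ((κ - pp σ ω) * ell μ (cmp (-1) f) - (dd σ ω : ℂ) * ell κ (cmp 1 f)) := rfl

theorem cmp_emb_add (a b : S2) : cmp 1 (emb 1 a + emb (-1) b) = a ∧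
    cmp (-1) (emb 1 a + emb (-1) b) = b := by
  constructor <;> rw [map_add, cmp_emb, cmp_emb] <;> norm_num

theorem cmp_explicitRes (σ ω : ℝ) (κ μ : ℂ) (f : L2) :
    cmp 1 (explicitRes σ ω κ μ f) =
      -Complex.I • freeRes (κ ^ 2) (cmp 1 f) + chargeP σ ω κ μ f • Gs κ ∧
    cmp (-1) (explicitRes σ ω κ μ f) =
      Complex.I • freeRes (μ ^ 2) (cmp (-1) f) + chargeM σ ω κ μ f • Gs μ := by
  rw [explicitRes_apply]
  exact cmp_emb_add _ _

/-- By `isL_iff_cmp`, inverting `L - z` amounts to solving the linear system for the two charges;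
`chargeP` and `chargeM` are its solution by Cramer's rule. -/
theorem isResolventAt_explicitRes (σ ω : ℝ) {z κ μ : ℂ} (hκ : 0 < κ.re) (hμ : 0 < μ.re)
    (hκz : κ ^ 2 = ω + Complex.I * z) (hμz : μ ^ 2 = ω - Complex.I * z)
    (hD : det σ ω κ μ ≠ 0) : IsResolventAt σ ω z (explicitRes σ ω κ μ) := by
  refine ⟨fun f => ?_, fun u v h => ?_⟩
  · rw [isL_iff_cmp σ ω hκ hμ hκz hμz]
    obtain ⟨h1, h2⟩ := cmp_explicitRes σ ω κ μ f
    refine ⟨_, _, h1, h2, ?_, ?_⟩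
    · rw [chargeP_apply, chargeM_apply]
      field_simp
      rw [det]; ring
    · rw [chargeP_apply, chargeM_apply]
      field_simp
      rw [det]; ring
  · have e : v = (v - z • u) + z • u := by rw [sub_add_cancel]
    rw [e, isL_iff_cmp σ ω hκ hμ hκz hμz] at h
    set f := v - z • u
    obtain ⟨c, c', h1, h2, h3, h4⟩ := h
    obtain ⟨k1, k2⟩ := cmp_explicitRes σ ω κ μ f
    have ec : chargeP σ ω κ μ f = c := by
      rw [chargeP_apply]
      field_simp
      rw [det]
      linear_combination (-(μ - pp σ ω)) * h3 - (dd σ ω : ℂ) * h4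
    have ec' : chargeM σ ω κ μ f = c' := by
      rw [chargeM_apply]
      field_simp
      rw [det]
      linear_combination (-(κ - pp σ ω)) * h4 - (dd σ ω : ℂ) * h3
    exact ext_cmp (by rw [k1, h1, ec]) (by rw [k2, h2, ec'])

theorem IsResolventAt.unique {σ ω : ℝ} {z : ℂ} {R R' : L2 →L[ℂ] L2} (h : IsResolventAt σ ω z R)
    (h' : IsResolventAt σ ω z R') : R = R' := by
  ext1 f
  have := h'.2 _ _ (h.1 f)
  rw [add_sub_cancel_right] at this
  exact this.symm

theorem IsResolventAt.resolvent_eq {σ ω : ℝ} {z : ℂ} {R : L2 →L[ℂ] L2} (h : IsResolventAt σ ω z R) :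
    resolvent σ ω z = R := by
  have hex : ∃ R, IsResolventAt σ ω z R := ⟨R, h⟩
  rw [resolvent, dif_pos hex]
  exact hex.choose_spec.unique h

/-- `Φ_f(κ) = ∫ G_κ f`. -/
def Phi (f : R3 → ℂ) (κ : ℂ) : ℂ := ∫ x, Gf κ x * f x

theorem inner_Gs {κ : ℂ} (h : 0 < κ.re) (g : S2) :
    inner ℂ g (Gs κ) = Phi (fun x => (starRingEnd ℂ) (g x)) κ := by
  rw [L2.inner_def, Phi]
  refine integral_congr_ae ?_
  filter_upwards [coeFn_Gs h] with x hx
  rw [hx, RCLike.inner_apply]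

/-- The part of the matrix element of the resolvent which comes from the charges. -/
def singPart (σ ω : ℝ) (F₁ F₂ G₁ G₂ : R3 → ℂ) (κ μ : ℂ) : ℂ :=
  8 * Real.pi * Complex.I / det σ ω κ μ *
    ((-(μ - pp σ ω) * Phi F₁ κ + dd σ ω * Phi F₂ μ) * Phi G₁ κ +
      ((κ - pp σ ω) * Phi F₂ μ - dd σ ω * Phi F₁ κ) * Phi G₂ μ)

theorem inner_emb_add (g : L2) (a b : S2) : inner ℂ g (emb 1 a + emb (-1) b) =
    2 * (inner ℂ (cmp 1 g) a + inner ℂ (cmp (-1) g) b) := by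
  have h1 := inner_emb g 1 a
  have h2 := inner_emb g (-1) b
  push_cast at h1 h2
  rw [inner_add_right, h1, h2]; ring

theorem inner_smul_add_smul (g x y : S2) (a b : ℂ) :
    inner ℂ g (a • x + b • y) = a * inner ℂ g x + b * inner ℂ g y := by
  rw [inner_add_right, inner_smul_right, inner_smul_right]

/-- The free part and the charge part are separated here for good: the former yields the free
projection in the limit, the latter the whole correction to it. -/
theorem inner_resolvent (σ ω : ℝ) {z κ μ : ℂ} (hκ : 0 < κ.re) (hμ : 0 < μ.re)
    (hκz : κ ^ 2 = ω + Complex.I * z) (hμz : μ ^ 2 = ω - Complex.I * z)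
    (hD : det σ ω κ μ ≠ 0) (g f : L2) :
    inner ℂ g (resolvent σ ω z f) =
      2 * (Complex.I * inner ℂ (cmp (-1) g) (freeRes (μ ^ 2) (cmp (-1) f)) -
        Complex.I * inner ℂ (cmp 1 g) (freeRes (κ ^ 2) (cmp 1 f))) +
      singPart σ ω (cmp 1 f) (cmp (-1) f) (fun x => (starRingEnd ℂ) (cmp 1 g x))
        (fun x => (starRingEnd ℂ) (cmp (-1) g x)) κ μ := by
  have e1 : ell κ (cmp 1 f) = Phi (cmp 1 f) κ := ell_apply hκ _
  have e2 : ell μ (cmp (-1) f) = Phi (cmp (-1) f) μ := ell_apply hμ _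
  have c1 := chargeP_apply σ ω κ μ f
  have c2 := chargeM_apply σ ω κ μ f
  rw [e1, e2] at c1 c2
  have t := inner_emb_add g (-Complex.I • freeRes (κ ^ 2) (cmp 1 f) + chargeP σ ω κ μ f • Gs κ)
    (Complex.I • freeRes (μ ^ 2) (cmp (-1) f) + chargeM σ ω κ μ f • Gs μ)
  rw [← explicitRes_apply, ← (isResolventAt_explicitRes σ ω hκ hμ hκz hμz hD).resolvent_eq] at t
  have aux : ∀ X Y Y' A A' B B' c c' p p' m n r r' k : ℂ, X = 2 * (Y + Y') →
      Y = -Complex.I * A + c * B → Y' = Complex.I * A' + c' * B' → B = p → B' = p' →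
      c = 4 * Real.pi * Complex.I / k * (-m * r + dd σ ω * r') →
      c' = 4 * Real.pi * Complex.I / k * (n * r' - dd σ ω * r) →
      X = 2 * (Complex.I * A' - Complex.I * A) + 8 * Real.pi * Complex.I / k *
        ((-m * r + dd σ ω * r') * p + (n * r' - dd σ ω * r) * p') := by
    intro X Y Y' A A' B B' c c' p p' m n r r' k h1 h2 h3 h4 h5 h6 h7
    rw [h1, h2, h3, h4, h5, h6, h7]
    ring
  exact aux _ _ _ _ _ _ _ _ _ _ _ _ _ _ _ _ t (inner_smul_add_smul _ _ _ _ _)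
    (inner_smul_add_smul _ _ _ _ _) (inner_Gs hκ _) (inner_Gs hμ _) c1 c2

theorem Phi_conj (f : R3 → ℂ) (κ : ℂ) : Phi f ((starRingEnd ℂ) κ) =
    (starRingEnd ℂ) (Phi (fun x => (starRingEnd ℂ) (f x)) κ) := by
  rw [Phi, Phi, ← integral_conj]
  congr 1; ext x
  rw [map_mul, conj_Gf, Complex.conj_conj]

theorem det_conj (σ ω : ℝ) (κ μ : ℂ) : det σ ω ((starRingEnd ℂ) κ) ((starRingEnd ℂ) μ) =
    (starRingEnd ℂ) (det σ ω κ μ) := by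
  simp [det]

/-- Reflecting `z` to `-z̄`, across the imaginary axis, conjugates both `κ` and `μ`. Values on the
left of the contour are thereby reduced to values on the right with conjugated data. -/
theorem singPart_conj (σ ω : ℝ) (F₁ F₂ G₁ G₂ : R3 → ℂ) (κ μ : ℂ) :
    singPart σ ω F₁ F₂ G₁ G₂ ((starRingEnd ℂ) κ) ((starRingEnd ℂ) μ) =
      -(starRingEnd ℂ) (singPart σ ω (fun x => (starRingEnd ℂ) (F₁ x)) (fun x => (starRingEnd ℂ) (F₂ x))
        (fun x => (starRingEnd ℂ) (G₁ x)) (fun x => (starRingEnd ℂ) (G₂ x)) κ μ) := by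
  simp only [singPart, det_conj, Phi_conj, map_mul, map_div₀, map_add, map_sub, map_neg,
    Complex.conj_I, Complex.conj_ofReal, map_ofNat]
  ring

/-! ### The reflection `(u₁, u₂) ↦ (u₁, -u₂)` -/

/-- The reflection `(u₁, u₂) ↦ (u₁, -u₂)`. -/
def refl : L2 →L[ℂ] L2 := (emb 1).comp (cmp (-1)) + (emb (-1)).comp (cmp 1)

theorem refl_apply (u : L2) : refl u = emb 1 (cmp (-1) u) + emb (-1) (cmp 1 u) := rfl

attribute [irreducible] refl

theorem cmp_refl (u : L2) : cmp 1 (refl u) = cmp (-1) u ∧ cmp (-1) (refl u) = cmp 1 u := by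
  rw [refl_apply]
  exact cmp_emb_add _ _

theorem refl_refl (u : L2) : refl (refl u) = u := by
  obtain ⟨h1, h2⟩ := cmp_refl u
  obtain ⟨h3, h4⟩ := cmp_refl (refl u)
  exact ext_cmp (by rw [h3, h2]) (by rw [h4, h1])

theorem inner_refl (g f : L2) : inner ℂ g (refl f) = inner ℂ (refl g) f := by
  obtain ⟨k1, k2⟩ := cmp_refl g
  rw [refl_apply, inner_emb_add]
  conv_rhs => rw [eq_emb_add f, inner_emb_add, k1, k2]
  ring

theorem coord_refl (u : L2) : coord 0 (refl u) = coord 0 u ∧ coord 1 (refl u) = - coord 1 u := by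
  obtain ⟨h1, h2⟩ := cmp_refl u
  rw [coord_zero_eq, coord_one_eq, coord_zero_eq, coord_one_eq, h1, h2, ← smul_neg, neg_sub]
  exact ⟨add_comm _ _, rfl⟩

theorem coeFn_neg_apply (u : S2) : ∀ᵐ x, (-u : S2) x = - u x := Lp.coeFn_neg u

/-- `L` is off-diagonal, so changing the sign of the second coordinate changes the sign of `L`. This
symmetry relates the two branches of the spectrum and the two eigenvalues `±iξ`. -/
theorem IsL.refl {σ ω : ℝ} {u v : L2} (h : IsL σ ω u v) : IsL σ ω (refl u) (-refl v) := by
  rw [isL_iff] at h ⊢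
  obtain ⟨q₁, q₂, h1, h2⟩ := h
  obtain ⟨a1, a2⟩ := coord_refl u
  obtain ⟨b1, b2⟩ := coord_refl v
  rw [map_neg, map_neg, a1, a2, b1, b2]
  refine ⟨q₁, -q₂, ?_, ?_⟩
  · rw [neg_neg]
    exact h1
  · have := h2.const_mul (-1)
    have e : -1 * (alpha2 ω * q₂) = alpha2 ω * -q₂ := by ring
    rw [e, neg_one_mul] at this
    refine this.congr ?_ ?_
    · filter_upwards [coeFn_neg_apply (coord 1 u)] with x hx
      rw [hx]; ring
    · filter_upwards [coeFn_neg_apply (coord 1 u), coeFn_neg_apply (coord 0 v)] with x hx hx'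
      have aux : ∀ a b c d : ℂ, b = -a → d = -c → -1 * (c - ω * a) = d - ω * b := by
        intro a b c d h h'
        rw [h, h']; ring
      exact aux _ _ _ _ hx hx'

theorem IsResolventAt.refl {σ ω : ℝ} {z : ℂ} {R : L2 →L[ℂ] L2} (h : IsResolventAt σ ω z R) :
    IsResolventAt σ ω (-z) (-(PointNLS.refl.comp (R.comp PointNLS.refl))) := by
  refine ⟨fun f => ?_, fun u v huv => ?_⟩
  · have := (h.1 (-PointNLS.refl f)).refl
    simp only [neg_apply, ContinuousLinearMap.comp_apply]
    simp only [map_add, map_neg, map_smul, refl_refl] at this ⊢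
    convert this using 1
    rw [smul_neg, neg_add, neg_neg, neg_smul, neg_neg, smul_neg, neg_neg]
  · have := h.2 _ _ huv.refl
    simp only [neg_apply, ContinuousLinearMap.comp_apply]
    have e : PointNLS.refl (v - -z • u) = -(-PointNLS.refl v - z • PointNLS.refl u) := by
      rw [neg_smul, sub_neg_eq_add, map_add, map_smul]
      abel
    rw [e, map_neg, this, map_neg, neg_neg, refl_refl]

theorem resolvent_neg (σ ω : ℝ) (z : ℂ) :
    resolvent σ ω (-z) = -(refl.comp ((resolvent σ ω z).comp refl)) := by
  by_cases h : ∃ R, IsResolventAt σ ω z R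
  · obtain ⟨R, h⟩ := h
    rw [h.resolvent_eq, h.refl.resolvent_eq]
  -- The spectrum is symmetric under `z ↦ -z`, so the default value `0` is taken at both points
  -- together.
  · have h' : ¬ ∃ R, IsResolventAt σ ω (-z) R := by
      rintro ⟨R, hR⟩
      have := hR.refl
      rw [neg_neg] at this
      exact h ⟨_, this⟩
    rw [resolvent, resolvent, dif_neg h, dif_neg h']
    simp

theorem contourIntegral_refl (σ ω ε M : ℝ) (g f : L2) :
    contourIntegral σ ω ε (-M) (-ω) g f = contourIntegral σ ω ε ω M (refl g) (refl f) := by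
  rw [contourIntegral, contourIntegral, ← intervalIntegral.integral_comp_neg]
  congr 1
  refine intervalIntegral.integral_congr fun η _ => ?_
  have e1 : Complex.I * ((-η : ℝ) : ℂ) + ε = -(Complex.I * η - ε) := by push_cast; ring
  have e2 : Complex.I * ((-η : ℝ) : ℂ) - ε = -(Complex.I * η + ε) := by push_cast; ring
  simp only [e1, e2, resolvent_neg, ← inner_refl]
  congr 2
  rw [sub_apply, sub_apply, neg_apply, neg_apply, map_sub, ContinuousLinearMap.comp_apply,
    ContinuousLinearMap.comp_apply, ContinuousLinearMap.comp_apply, ContinuousLinearMap.comp_apply,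
    neg_sub_neg]

theorem isPiMinus_iff (σ ω : ℝ) (P : L2 →L[ℂ] L2) :
    IsPiMinus σ ω P ↔ IsPiPlus σ ω (refl.comp (P.comp refl)) := by
  simp only [IsPiMinus, IsPiPlus, contourIntegral_refl, ContinuousLinearMap.comp_apply]
  constructor
  · intro h g f
    obtain ⟨I, h1, h2⟩ := h (refl g) (refl f)
    rw [refl_refl, refl_refl] at h1
    refine ⟨I, h1, ?_⟩
    rwa [inner_refl]
  · intro h g f
    obtain ⟨I, h1, h2⟩ := h (refl g) (refl f)
    refine ⟨I, h1, ?_⟩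
    rwa [inner_refl, refl_refl, refl_refl] at h2

end PointNLS
end

noncomputable section
namespace PointNLS

/-! ### Laplace type bounds for `Φ_f` -/

/-- The squared `L²` norm. -/
def sqn (f : R3 → ℂ) : ℝ := ∫ x, ‖f x‖ ^ 2

theorem sqn_nonneg (f : R3 → ℂ) : 0 ≤ sqn f := integral_nonneg fun _ => by positivity

theorem integrable_sq_norm {f : R3 → ℂ} (hf : MemLp f 2 volume) :
    Integrable (fun x => ‖f x‖ ^ 2) volume := (memLp_two_iff_integrable_sq_norm hf.1).1 hf

theorem sq_integral_mul_le {α : Type*} [MeasurableSpace α] {ν : Measure α} {a b : α → ℝ}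
    (ha0 : ∀ x, 0 ≤ a x) (hb0 : ∀ x, 0 ≤ b x) (ha : MemLp a 2 ν) (hb : MemLp b 2 ν) :
    (∫ x, a x * b x ∂ν) ^ 2 ≤ (∫ x, a x ^ 2 ∂ν) * ∫ x, b x ^ 2 ∂ν := by
  have h := integral_mul_le_Lp_mul_Lq_of_nonneg (p := 2) (q := 2) Real.HolderConjugate.two_two
    (Eventually.of_forall ha0) (Eventually.of_forall hb0) (by simpa using ha) (by simpa using hb)
  have e : ∀ c : ℝ, c ^ (2 : ℝ) = c ^ 2 := fun c => by norm_cast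
  simp only [e] at h
  have h0 : 0 ≤ ∫ x, a x * b x ∂ν := integral_nonneg fun x => mul_nonneg (ha0 x) (hb0 x)
  have A0 : 0 ≤ ∫ x, a x ^ 2 ∂ν := integral_nonneg fun x => by positivity
  have B0 : 0 ≤ ∫ x, b x ^ 2 ∂ν := integral_nonneg fun x => by positivity
  rw [← Real.sqrt_eq_rpow, ← Real.sqrt_eq_rpow, ← Real.sqrt_mul A0] at h
  calc _ ≤ (√((∫ x, a x ^ 2 ∂ν) * ∫ x, b x ^ 2 ∂ν)) ^ 2 := by gcongr
    _ = _ := Real.sq_sqrt (by positivity)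

/-- The positive majorant of `Φ_f` on the line `Re κ = t`. -/
def Psi (f : R3 → ℂ) (t : ℝ) : ℝ := ∫ x, Real.exp (-t * ‖x‖) / (4 * Real.pi * ‖x‖) * ‖f x‖

theorem norm_Phi_le (f : R3 → ℂ) (κ : ℂ) : ‖Phi f κ‖ ≤ Psi f κ.re := by
  refine (norm_integral_le_integral_norm _).trans_eq ?_
  simp only [norm_mul, norm_Gf, Psi]

theorem memLp_exp_div {t : ℝ} (ht : 0 < t) :
    MemLp (fun x : R3 => Real.exp (-t * ‖x‖) / (4 * Real.pi * ‖x‖)) 2 volume := by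
  have := (memLp_Gf (κ := (t : ℂ)) (by simpa using ht)).norm
  simpa only [norm_Gf, Complex.ofReal_re] using this

theorem integrable_Psi {f : R3 → ℂ} (hf : MemLp f 2 volume) {t : ℝ} (ht : 0 < t) :
    Integrable (fun x => Real.exp (-t * ‖x‖) / (4 * Real.pi * ‖x‖) * ‖f x‖) volume :=
  (memLp_exp_div ht).integrable_mul hf.norm

theorem integral_sq_exp_div {t : ℝ} (ht : 0 < t) :
    ∫ x : R3, (Real.exp (-t * ‖x‖) / (4 * Real.pi * ‖x‖)) ^ 2 = 1 / (8 * Real.pi * t) := by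
  have h := integral_Gf_mul_Gf (κ := t) (κ' := t) (by simpa using ht) (by simpa using ht)
  have e : ∀ x : R3, Gf t x * Gf t x =
      (((Real.exp (-t * ‖x‖) / (4 * Real.pi * ‖x‖)) ^ 2 : ℝ) : ℂ) := fun x => by
    rw [Gf]; push_cast; ring
  simp only [e] at h
  rw [integral_complex_ofReal] at h
  have h2 : (1 / (4 * (Real.pi : ℂ) * (t + t))) = ((1 / (8 * Real.pi * t) : ℝ) : ℂ) := by
    push_cast; ring
  rw [h2] at h
  exact_mod_cast h

theorem sq_Psi_le {f : R3 → ℂ} (hf : MemLp f 2 volume) {t : ℝ} (ht : 0 < t) :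
    Psi f t ^ 2 ≤ 1 / (8 * Real.pi * t) * sqn f := by
  have h := sq_integral_mul_le (fun x => by positivity) (fun x => norm_nonneg (f x))
    (memLp_exp_div ht) hf.norm
  rw [integral_sq_exp_div ht] at h
  exact h

theorem Psi_antitone {f : R3 → ℂ} (hf : MemLp f 2 volume) {s t : ℝ} (hs : 0 < s) (h : s ≤ t) :
    Psi f t ≤ Psi f s := by
  refine integral_mono (integrable_Psi hf (hs.trans_le h)) (integrable_Psi hf hs) fun x => ?_
  simp only
  gcongr

theorem exp_mul_sqrt_le {t r : ℝ} (ht : 0 < t) (hr : 0 ≤ r) :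
    Real.exp (-t * r) * r ^ (1 / 2 : ℝ) ≤ 1 + 1 / t := by
  have h1 : r ^ (1 / 2 : ℝ) ≤ 1 + r := by
    rw [← Real.sqrt_eq_rpow, Real.sqrt_le_left (by positivity)]
    nlinarith
  have h2 : t * r + 1 ≤ Real.exp (t * r) := Real.add_one_le_exp _
  have h3 : Real.exp (-t * r) * Real.exp (t * r) = 1 := by rw [← Real.exp_add]; simp
  have h4 : Real.exp (-t * r) ≤ 1 := by
    rw [Real.exp_le_one_iff]; have := mul_nonneg ht.le hr; linarith
  have h5 : Real.exp (-t * r) * (t * r) ≤ 1 := by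
    rw [← h3]
    gcongr
    linarith
  have h6 : Real.exp (-t * r) * r ≤ 1 / t := by
    rw [le_div_iff₀ ht]; linarith
  calc _ ≤ Real.exp (-t * r) * (1 + r) := by gcongr
    _ ≤ _ := by linarith

/-- Schur's test: the factor `1/r` of the kernel is split as `r^{1/4} r^{-5/4}` before
Cauchy-Schwarz. The second factor integrates to a multiple of `t^{-1/2}`, and the power `r^{1/2}`
left with `|f|²` is the one that integration in `t` will cancel. -/
theorem sq_Psi_le_schur {f : R3 → ℂ} (hf : MemLp f 2 volume) {t : ℝ} (ht : 0 < t) :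
    Psi f t ^ 2 ≤ √Real.pi / (4 * Real.pi) *
      ∫ x, t ^ (-(1 / 2) : ℝ) * (Real.exp (-t * ‖x‖) * ‖x‖ ^ (1 / 2 : ℝ) * ‖f x‖ ^ 2) := by
  set a : R3 → ℝ := fun x => Real.exp (-t / 2 * ‖x‖) * ‖x‖ ^ (1 / 4 : ℝ) * ‖f x‖
  set b : R3 → ℝ := fun x => Real.exp (-t / 2 * ‖x‖) * ‖x‖ ^ (-(5 / 4) : ℝ) / (4 * Real.pi)
  have hab : ∀ᵐ x : R3, Real.exp (-t * ‖x‖) / (4 * Real.pi * ‖x‖) * ‖f x‖ = a x * b x := by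
    filter_upwards [ae_ne_zero] with x hx
    have hr : 0 < ‖x‖ := norm_pos_iff.2 hx
    have e1 : Real.exp (-t * ‖x‖) = Real.exp (-t / 2 * ‖x‖) * Real.exp (-t / 2 * ‖x‖) := by
      rw [← Real.exp_add]; ring_nf
    have e2 : ‖x‖ ^ (1 / 4 : ℝ) * ‖x‖ ^ (-(5 / 4) : ℝ) = ‖x‖⁻¹ := by
      rw [← Real.rpow_add hr, ← Real.rpow_neg_one]; norm_num
    simp only [a, b]
    rw [e1, mul_comm (4 * Real.pi), ← div_div, div_eq_mul_inv _ ‖x‖, ← e2]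
    ring
  have ha2 : ∀ x, a x ^ 2 = Real.exp (-t * ‖x‖) * ‖x‖ ^ (1 / 2 : ℝ) * ‖f x‖ ^ 2 := fun x => by
    have e1 : Real.exp (-t * ‖x‖) = Real.exp (-t / 2 * ‖x‖) ^ 2 := by
      rw [← Real.exp_nat_mul]; push_cast; ring_nf
    have e2 : ‖x‖ ^ (1 / 2 : ℝ) = (‖x‖ ^ (1 / 4 : ℝ)) ^ 2 := by
      rw [← Real.rpow_natCast, ← Real.rpow_mul (norm_nonneg x)]; norm_num
    simp only [a]
    rw [e1, e2]; ring
  have hb2 : ∀ x : R3, x ≠ 0 → b x ^ 2 =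
      Real.exp (-t * ‖x‖) * ‖x‖ ^ (-(5 / 2) : ℝ) / (4 * Real.pi) ^ 2 := fun x hx => by
    have e1 : Real.exp (-t * ‖x‖) = Real.exp (-t / 2 * ‖x‖) ^ 2 := by
      rw [← Real.exp_nat_mul]; push_cast; ring_nf
    have e2 : ‖x‖ ^ (-(5 / 2) : ℝ) = (‖x‖ ^ (-(5 / 4) : ℝ)) ^ 2 := by
      rw [← Real.rpow_natCast, ← Real.rpow_mul (norm_nonneg x)]; norm_num
    simp only [b]
    rw [e1, e2]; ring
  have hma : MemLp a 2 volume := by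
    have m : AEStronglyMeasurable a volume := by
      have : Measurable fun x : R3 => Real.exp (-t / 2 * ‖x‖) * ‖x‖ ^ (1 / 4 : ℝ) := by fun_prop
      exact this.aestronglyMeasurable.mul hf.1.norm
    rw [memLp_two_iff_integrable_sq m]
    simp only [ha2]
    refine ((integrable_sq_norm hf).const_mul (1 + 1 / t)).mono' ?_ (Eventually.of_forall fun x => ?_)
    · have : Measurable fun x : R3 => Real.exp (-t * ‖x‖) * ‖x‖ ^ (1 / 2 : ℝ) := by fun_prop
      exact this.aestronglyMeasurable.mul (hf.1.norm.pow 2)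
    · rw [Real.norm_of_nonneg (by positivity)]
      exact mul_le_mul_of_nonneg_right (exp_mul_sqrt_le ht (norm_nonneg x)) (by positivity)
  have hrad := integral_radial (fun r : ℝ => Real.exp (-t * r) * r ^ (-(5 / 2) : ℝ) / (4 * Real.pi) ^ 2)
  have hr2 : ∀ r ∈ Set.Ioi (0 : ℝ), r ^ 2 • (Real.exp (-t * r) * r ^ (-(5 / 2) : ℝ) / (4 * Real.pi) ^ 2) =
      1 / (4 * Real.pi) ^ 2 * (r ^ ((1 / 2 : ℝ) - 1) * Real.exp (-(t * r))) := fun r hr => by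
    have e : r ^ 2 * r ^ (-(5 / 2) : ℝ) = r ^ ((1 / 2 : ℝ) - 1) := by
      rw [← Real.rpow_natCast, ← Real.rpow_add hr]; norm_num
    rw [← e, smul_eq_mul, neg_mul]; ring
  have hint := Real.integral_rpow_mul_exp_neg_mul_Ioi (a := 1 / 2) (r := t) (by norm_num) ht
  have hmb : MemLp b 2 volume := by
    have m : AEStronglyMeasurable b volume := by
      have : Measurable b := by fun_prop
      exact this.aestronglyMeasurable
    rw [memLp_two_iff_integrable_sq m]
    have : Integrable (fun x : R3 => Real.exp (-t * ‖x‖) * ‖x‖ ^ (-(5 / 2) : ℝ) / (4 * Real.pi) ^ 2)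
        volume := by
      rw [integrable_radial_iff (f := fun r => Real.exp (-t * r) * r ^ (-(5 / 2) : ℝ) / (4 * Real.pi) ^ 2)]
      have hi : IntegrableOn (fun r : ℝ => 1 / (4 * Real.pi) ^ 2 *
          (r ^ ((1 / 2 : ℝ) - 1) * Real.exp (-(t * r)))) (Set.Ioi 0) := by
        refine Integrable.const_mul ?_ _
        -- A function that is not integrable has integral `0` by convention, whereas the Gamma
        -- integral `hint` is positive; its value therefore already implies integrability.
        by_contra hc
        rw [integral_undef hc] at hint
        have : 0 < (1 / t) ^ (1 / 2 : ℝ) * Real.Gamma (1 / 2) := by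
          rw [Real.Gamma_one_half_eq]; positivity
        linarith
      exact hi.congr_fun (fun r hr => (hr2 r hr).symm) measurableSet_Ioi
    refine this.congr ?_
    filter_upwards [ae_ne_zero] with x hx
    rw [hb2 x hx]
  have hbint : ∫ x, b x ^ 2 = √Real.pi / (4 * Real.pi) * t ^ (-(1 / 2) : ℝ) := by
    have : ∫ x, b x ^ 2 = ∫ x : R3, Real.exp (-t * ‖x‖) * ‖x‖ ^ (-(5 / 2) : ℝ) / (4 * Real.pi) ^ 2 := by
      refine integral_congr_ae ?_
      filter_upwards [ae_ne_zero] with x hx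
      rw [hb2 x hx]
    rw [this, hrad, setIntegral_congr_fun measurableSet_Ioi hr2, integral_const_mul, hint,
      Real.Gamma_one_half_eq, one_div t, Real.inv_rpow ht.le, ← Real.rpow_neg ht.le, smul_eq_mul]
    have := Real.pi_pos
    field_simp
  have h := sq_integral_mul_le (ν := (volume : Measure R3)) (a := a) (b := b)
    (fun x => by positivity) (fun x => by positivity) hma hmb
  have e : Psi f t = ∫ x, a x * b x := integral_congr_ae hab
  rw [e]
  refine h.trans_eq ?_
  rw [hbint, integral_const_mul]
  simp only [ha2]
  ring

/-- Tonelli applied to the Schur bound: `∫ t^{-1/2} e^{-tr} dt = √π r^{-1/2}` cancels the weight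
`r^{1/2}`, and `√π · √π/(4π) = 1/4`. This controls `Φ_f` along horizontal segments that approach the
imaginary axis. -/
theorem integrableOn_sq_Psi {f : R3 → ℂ} (hf : MemLp f 2 volume) :
    IntegrableOn (fun t => Psi f t ^ 2) (Set.Ioi 0) ∧
      ∫ t in Set.Ioi 0, Psi f t ^ 2 ≤ 1 / 4 * sqn f := by
  set ν : Measure ℝ := volume.restrict (Set.Ioi 0)
  set K : ℝ × R3 → ℝ := fun p =>
    p.1 ^ (-(1 / 2) : ℝ) * (Real.exp (-p.1 * ‖p.2‖) * ‖p.2‖ ^ (1 / 2 : ℝ) * ‖f p.2‖ ^ 2)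
  have hint : ∀ r : ℝ, 0 < r → IntegrableOn (fun t : ℝ => t ^ ((1 / 2 : ℝ) - 1) * Real.exp (-(r * t)))
      (Set.Ioi 0) ∧ ∫ t in Set.Ioi (0 : ℝ), t ^ ((1 / 2 : ℝ) - 1) * Real.exp (-(r * t)) =
        r ^ (-(1 / 2) : ℝ) * √Real.pi := fun r hr => by
    have h := Real.integral_rpow_mul_exp_neg_mul_Ioi (a := 1 / 2) (r := r) (by norm_num) hr
    rw [Real.Gamma_one_half_eq, one_div r, Real.inv_rpow hr.le, ← Real.rpow_neg hr.le] at h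
    refine ⟨?_, h⟩
    by_contra hc
    rw [integral_undef hc] at h
    have : 0 < r ^ (-(1 / 2) : ℝ) * √Real.pi := by positivity
    linarith
  have eK : ∀ (x : R3) (t : ℝ), K (t, x) = (‖x‖ ^ (1 / 2 : ℝ) * ‖f x‖ ^ 2) *
      (t ^ ((1 / 2 : ℝ) - 1) * Real.exp (-(‖x‖ * t))) := fun x t => by
    simp only [K]
    rw [show (1 / 2 : ℝ) - 1 = -(1 / 2) by norm_num, show -t * ‖x‖ = -(‖x‖ * t) by ring]
    ring
  have mK : AEStronglyMeasurable K (ν.prod volume) := by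
    have m1 : Measurable fun p : ℝ × R3 => p.1 ^ (-(1 / 2) : ℝ) * (Real.exp (-p.1 * ‖p.2‖) *
      ‖p.2‖ ^ (1 / 2 : ℝ)) := by fun_prop
    have m2 : AEStronglyMeasurable (fun p : ℝ × R3 => ‖f p.2‖ ^ 2) (ν.prod volume) :=
      (hf.1.norm.pow 2).comp_snd
    refine (m1.aestronglyMeasurable.mul m2).congr (Eventually.of_forall fun p => ?_)
    simp only [K, Pi.mul_apply]; ring
  have hx : ∀ x : R3, x ≠ 0 → ∫ t, K (t, x) ∂ν = √Real.pi * ‖f x‖ ^ 2 := fun x hx => by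
    have hr : 0 < ‖x‖ := norm_pos_iff.2 hx
    simp only [eK]
    rw [integral_const_mul, (hint ‖x‖ hr).2]
    have : ‖x‖ ^ (1 / 2 : ℝ) * ‖x‖ ^ (-(1 / 2) : ℝ) = 1 := by
      rw [← Real.rpow_add hr]; norm_num
    linear_combination (‖f x‖ ^ 2 * √Real.pi) * this
  have K0 : ∀ t ∈ Set.Ioi (0 : ℝ), ∀ x, 0 ≤ K (t, x) := fun t ht x => by
    have : (0 : ℝ) < t := ht
    positivity
  have iK : Integrable K (ν.prod volume) := by
    rw [integrable_prod_iff' mK]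
    constructor
    · filter_upwards [ae_ne_zero] with x h0
      simp only [eK]
      exact (hint ‖x‖ (norm_pos_iff.2 h0)).1.const_mul _
    · refine ((integrable_sq_norm hf).const_mul √Real.pi).congr ?_
      filter_upwards [ae_ne_zero] with x h0
      rw [← hx x h0]
      refine setIntegral_congr_fun measurableSet_Ioi fun t ht => ?_
      rw [Real.norm_of_nonneg (K0 t ht x)]
  have iT : Integrable (fun t => √Real.pi / (4 * Real.pi) * ∫ x, K (t, x)) ν :=
    iK.integral_prod_left.const_mul _
  have hle : ∀ t ∈ Set.Ioi (0 : ℝ), Psi f t ^ 2 ≤ √Real.pi / (4 * Real.pi) * ∫ x, K (t, x) :=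
    fun t ht => sq_Psi_le_schur hf ht
  have hval : ∫ t, (√Real.pi / (4 * Real.pi) * ∫ x, K (t, x)) ∂ν = 1 / 4 * sqn f := by
    rw [integral_const_mul, integral_integral_swap iK]
    have : ∫ x, (∫ t, K (t, x) ∂ν) = ∫ x, √Real.pi * ‖f x‖ ^ 2 := by
      refine integral_congr_ae ?_
      filter_upwards [ae_ne_zero] with x h0
      exact hx x h0
    rw [this, integral_const_mul, sqn]
    have hp := Real.pi_pos
    have := Real.mul_self_sqrt hp.le
    field_simp
    linear_combination (∫ x, ‖f x‖ ^ 2) * this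
  have meas : AEStronglyMeasurable (fun t => Psi f t ^ 2) ν := by
    have hanti : AntitoneOn (Psi f) (Set.Ioi 0) := fun s hs t _ h => Psi_antitone hf hs h
    exact ((aemeasurable_restrict_of_antitoneOn measurableSet_Ioi hanti).pow_const 2).aestronglyMeasurable
  have iP : IntegrableOn (fun t => Psi f t ^ 2) (Set.Ioi 0) := by
    refine Integrable.mono' iT meas ?_
    filter_upwards [ae_restrict_mem measurableSet_Ioi] with t ht
    rw [Real.norm_of_nonneg (by positivity)]
    exact hle t ht
  exact ⟨iP, (setIntegral_mono_on iP iT measurableSet_Ioi hle).trans_eq hval⟩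

end PointNLS
end

noncomputable section
namespace PointNLS
open scoped FourierTransform

/-! ### Regularity of `Φ_f` and the Plancherel bound -/

/-- The integral defining `Φ_f(κ)` converges absolutely for `Re κ > a`. -/
def LapInt (a : ℝ) (f : R3 → ℂ) : Prop :=
  AEStronglyMeasurable f volume ∧
    ∀ T, a < T → Integrable (fun x : R3 => Real.exp (-T * ‖x‖) / (4 * Real.pi * ‖x‖) * ‖f x‖) volume

theorem MemLp.lapInt {f : R3 → ℂ} (hf : MemLp f 2 volume) : LapInt 0 f :=
  ⟨hf.1, fun _ ht => integrable_Psi hf ht⟩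

theorem lapInt_of_bounded_support {f : R3 → ℂ} (hf : MemLp f 2 volume) {N : ℝ}
    (h : ∀ x, N < ‖x‖ → f x = 0) (a : ℝ) : LapInt a f := by
  refine ⟨hf.1, fun T _ => ?_⟩
  refine ((integrable_Psi hf one_pos).const_mul (Real.exp (|1 - T| * |N|))).mono' ?_
    (Eventually.of_forall fun x => ?_)
  · have : Measurable fun x : R3 => Real.exp (-T * ‖x‖) / (4 * Real.pi * ‖x‖) := by fun_prop
    exact this.aestronglyMeasurable.mul hf.1.norm
  · rw [Real.norm_of_nonneg (by positivity)]
    by_cases hx : N < ‖x‖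
    · simp [h x hx]
    · push Not at hx
      have e : Real.exp (-T * ‖x‖) ≤ Real.exp (|1 - T| * |N|) * Real.exp (-1 * ‖x‖) := by
        rw [← Real.exp_add, Real.exp_le_exp]
        have h1 : (1 - T) * ‖x‖ ≤ |1 - T| * ‖x‖ :=
          mul_le_mul_of_nonneg_right (le_abs_self _) (norm_nonneg x)
        have h2 : |1 - T| * ‖x‖ ≤ |1 - T| * |N| :=
          mul_le_mul_of_nonneg_left (hx.trans (le_abs_self N)) (abs_nonneg _)
        linarith
      calc _ ≤ (Real.exp (|1 - T| * |N|) * Real.exp (-1 * ‖x‖)) / (4 * Real.pi * ‖x‖) * ‖f x‖ := by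
            gcongr
        _ = _ := by ring

theorem LapInt.integrable {a : ℝ} {f : R3 → ℂ} (hf : LapInt a f) {κ : ℂ} (h : a < κ.re) :
    Integrable (fun x => Gf κ x * f x) volume := by
  have m : AEStronglyMeasurable (fun x => Gf κ x * f x) volume :=
    (measurable_Gf κ).aestronglyMeasurable.mul hf.1
  rw [← integrable_norm_iff m]
  simp only [norm_mul, norm_Gf]
  exact hf.2 _ h

theorem LapInt.differentiableAt {a : ℝ} {f : R3 → ℂ} (hf : LapInt a f) {κ : ℂ} (h : a < κ.re) :
    DifferentiableAt ℂ (Phi f) κ := by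
  -- Two abscissas `a < T' < T < Re κ`: near `κ` the real part exceeds `T`, and the gap `T - T'`
  -- absorbs the factor `|x|` produced by differentiation.
  obtain ⟨T, hT1, hT2⟩ := exists_between h
  obtain ⟨T', hT3, hT4⟩ := exists_between hT1
  have hδ : 0 < T - T' := by linarith
  have hs : {z : ℂ | T < z.re} ∈ 𝓝 κ :=
    (isOpen_lt continuous_const Complex.continuous_re).mem_nhds hT2
  have hm : ∀ z, AEStronglyMeasurable (fun x => Gf z x * f x) volume := fun z =>
    (measurable_Gf z).aestronglyMeasurable.mul hf.1
  have hm' : AEStronglyMeasurable (fun x => -(‖x‖ : ℂ) * (Gf κ x * f x)) volume := by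
    have : Measurable fun x : R3 => -(‖x‖ : ℂ) := by fun_prop
    exact this.aestronglyMeasurable.mul (hm κ)
  refine (hasDerivAt_integral_of_dominated_loc_of_deriv_le
    (F := fun z x => Gf z x * f x) (F' := fun z x => -(‖x‖ : ℂ) * (Gf z x * f x))
    (bound := fun x => 1 / (T - T') * (Real.exp (-T' * ‖x‖) / (4 * Real.pi * ‖x‖) * ‖f x‖))
    hs (Eventually.of_forall hm) (hf.integrable h) hm' (Eventually.of_forall fun x z hz => ?_)
    ((hf.2 T' hT3).const_mul _) (Eventually.of_forall fun x z _ => ?_)).2.differentiableAt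
  · rw [norm_mul, norm_neg, Complex.norm_real, norm_norm, norm_mul, norm_Gf]
    have hz' : T < z.re := hz
    have e : ‖x‖ * Real.exp (-z.re * ‖x‖) ≤ 1 / (T - T') * Real.exp (-T' * ‖x‖) := by
      have h1 : (T - T') * ‖x‖ + 1 ≤ Real.exp ((T - T') * ‖x‖) := Real.add_one_le_exp _
      have h2 : Real.exp (-z.re * ‖x‖) ≤ Real.exp (-T * ‖x‖) := by
        rw [Real.exp_le_exp]
        have := mul_le_mul_of_nonneg_right hz'.le (norm_nonneg x)
        linarith
      have h3 : Real.exp (-T' * ‖x‖) = Real.exp ((T - T') * ‖x‖) * Real.exp (-T * ‖x‖) := by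
        rw [← Real.exp_add]; ring_nf
      rw [h3, one_div, ← div_eq_inv_mul, le_div_iff₀ hδ]
      calc _ = ((T - T') * ‖x‖) * Real.exp (-z.re * ‖x‖) := by ring
        _ ≤ Real.exp ((T - T') * ‖x‖) * Real.exp (-T * ‖x‖) := by gcongr; linarith
    calc _ = ‖x‖ * Real.exp (-z.re * ‖x‖) * (‖f x‖ / (4 * Real.pi * ‖x‖)) := by ring
      _ ≤ 1 / (T - T') * Real.exp (-T' * ‖x‖) * (‖f x‖ / (4 * Real.pi * ‖x‖)) := by gcongr
      _ = _ := by ring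
  · have h1 : HasDerivAt (fun z : ℂ => Complex.exp (-z * ‖x‖)) (Complex.exp (-z * ‖x‖) * (-1 * ‖x‖)) z :=
      (((hasDerivAt_id z).neg).mul_const (‖x‖ : ℂ)).cexp
    have h2 := (h1.div_const (4 * Real.pi * ‖x‖ : ℂ)).mul_const (f x)
    refine h2.congr_deriv ?_
    simp only [Gf]; ring

theorem LapInt.continuous_line {a T : ℝ} {f : R3 → ℂ} (hf : LapInt a f) (h : a < T) :
    Continuous fun t : ℝ => Phi f (T + t * Complex.I) := by
  refine continuous_iff_continuousAt.2 fun t => ?_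
  refine ContinuousAt.comp (f := fun t : ℝ => (T : ℂ) + t * Complex.I) (g := Phi f)
    (hf.differentiableAt (by simpa using h)).continuousAt ?_
  fun_prop

theorem integral_norm_sq_Lp {α : Type*} [MeasurableSpace α] {ν : Measure α} (u : Lp ℂ 2 ν) :
    ∫ x, ‖u x‖ ^ 2 ∂ν = ‖u‖ ^ 2 := by
  have h := L2.inner_def (𝕜 := ℂ) u u
  rw [inner_self_eq_norm_sq_to_K] at h
  have e : ∀ x, inner ℂ (u x) (u x) = ((‖u x‖ ^ 2 : ℝ) : ℂ) := fun x => by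
    rw [inner_self_eq_norm_sq_to_K]; push_cast; rfl
  simp only [e] at h
  rw [integral_complex_ofReal] at h
  have h' : (((‖u‖ ^ 2 : ℝ)) : ℂ) = ((∫ x, ‖u x‖ ^ 2 ∂ν : ℝ) : ℂ) := by
    rw [← h]; push_cast; rfl
  exact (Complex.ofReal_injective h').symm

theorem integral_norm_sq_fourierInv {h : ℝ → ℂ} (h1 : Integrable h volume) (h2 : MemLp h 2 volume) :
    Integrable (fun y => ‖(𝓕⁻ h : ℝ → ℂ) y‖ ^ 2) volume ∧
      ∫ y, ‖(𝓕⁻ h : ℝ → ℂ) y‖ ^ 2 = ∫ t, ‖h t‖ ^ 2 := by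
  set H : Lp ℂ 2 (volume : Measure ℝ) := h2.toLp h
  have hH : ∀ᵐ t, H t = h t := h2.coeFn_toLp
  have i1 : Integrable H volume := h1.congr (by filter_upwards [hH] with t ht; exact ht.symm)
  have e1 : (𝓕⁻ (H : ℝ → ℂ) : ℝ → ℂ) = 𝓕⁻ h := by
    ext y
    rw [Real.fourierInv_eq, Real.fourierInv_eq]
    refine integral_congr_ae ?_
    filter_upwards [hH] with t ht
    rw [ht]
  have e2 := fourierInv_ae_eq i1
  rw [e1] at e2
  have hn : ‖(𝓕⁻ H : Lp ℂ 2 (volume : Measure ℝ))‖ = ‖H‖ := by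
    have := Lp.norm_fourier_eq (𝓕⁻ H : Lp ℂ 2 (volume : Measure ℝ))
    rw [FourierTransform.fourier_fourierInv_eq] at this
    exact this.symm
  have i2 : Integrable (fun y => ‖(𝓕⁻ H : Lp ℂ 2 (volume : Measure ℝ)) y‖ ^ 2) volume :=
    (memLp_two_iff_integrable_sq_norm (Lp.memLp _).1).1 (Lp.memLp _)
  refine ⟨i2.congr ?_, ?_⟩
  · filter_upwards [e2] with y hy
    rw [hy]
  · have a1 : ∫ y, ‖(𝓕⁻ h : ℝ → ℂ) y‖ ^ 2 = ∫ y, ‖(𝓕⁻ H : Lp ℂ 2 (volume : Measure ℝ)) y‖ ^ 2 := by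
      refine integral_congr_ae ?_
      filter_upwards [e2] with y hy
      rw [hy]
    have a2 : ∫ t, ‖h t‖ ^ 2 = ∫ t, ‖H t‖ ^ 2 := by
      refine integral_congr_ae ?_
      filter_upwards [hH] with y hy
      rw [hy]
    rw [a1, a2, integral_norm_sq_Lp, integral_norm_sq_Lp, hn]

/-- A duality form of Plancherel. The integral `S` equals `∫ hP` with `h` the conjugate of `P` cut
off to `[-N, N]`; Fubini makes it a pairing of `e^{-T|x|} f` with `c/(4π|x|)`, where `c` is the
inverse Fourier transform of `h` at `-|x|/2π`. In polar coordinates the Jacobian cancels the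
`1/|x|²`, and one-dimensional Plancherel bounds the second factor by `S/2`. Hence `S² ≤ ‖e^{-T|x|}
f‖² S/2`, and the bound does not depend on `N`. -/
theorem LapInt.integral_Icc_le {a T : ℝ} {f : R3 → ℂ} (hf : LapInt a f) (hT : a < T)
    (h2 : MemLp (fun x => (Real.exp (-T * ‖x‖) : ℂ) * f x) 2 volume) (N : ℝ) :
    ∫ t in Set.Icc (-N) N, ‖Phi f (T + t * Complex.I)‖ ^ 2 ≤
      1 / 2 * sqn (fun x => (Real.exp (-T * ‖x‖) : ℂ) * f x) := by
  have hpi := Real.pi_pos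
  set P : ℝ → ℂ := fun t => Phi f (T + t * Complex.I)
  have cP : Continuous P := hf.continuous_line hT
  set h : ℝ → ℂ := (Set.Icc (-N) N).indicator fun t => (starRingEnd ℂ) (P t)
  have cP' : Continuous fun t => (starRingEnd ℂ) (P t) := Complex.continuous_conj.comp cP
  have i1 : Integrable h volume :=
    (cP'.continuousOn.integrableOn_compact isCompact_Icc).integrable_indicator measurableSet_Icc
  have i2 : MemLp h 2 volume := by
    rw [memLp_indicator_iff_restrict measurableSet_Icc]
    rw [memLp_two_iff_integrable_sq_norm cP'.aestronglyMeasurable]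
    exact (cP'.norm.pow 2).continuousOn.integrableOn_compact isCompact_Icc
  obtain ⟨iF, hF⟩ := integral_norm_sq_fourierInv i1 i2
  set c : ℝ → ℂ := 𝓕⁻ h
  have hc : ∀ r : ℝ, c (-(r / (2 * Real.pi))) = ∫ t : ℝ, Complex.exp (-(t * r) * Complex.I) * h t :=
    fun r => by
    rw [show c = 𝓕⁻ h from rfl, Real.fourierInv_eq']
    refine integral_congr_ae (Eventually.of_forall fun t => ?_)
    simp only [smul_eq_mul]
    congr 2
    simp
    have : (Real.pi : ℂ) ≠ 0 := by exact_mod_cast hpi.ne'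
    field_simp
  have cc : Continuous c := by
    exact VectorFourier.fourierIntegral_continuous Real.continuous_fourierChar
      (by exact (continuous_inner (𝕜 := ℝ) (E := ℝ)).neg) i1
  set S := ∫ t in Set.Icc (-N) N, ‖P t‖ ^ 2
  have hS : ∫ t, ‖h t‖ ^ 2 = S := by
    rw [show S = ∫ t in Set.Icc (-N) N, ‖P t‖ ^ 2 from rfl, ← integral_indicator measurableSet_Icc]
    congr 1; ext t
    by_cases ht : t ∈ Set.Icc (-N) N
    · simp [h, ht]
    · simp [h, ht]
  have hS0 : 0 ≤ S := integral_nonneg fun t => by positivity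
  have hS' : (S : ℂ) = ∫ t, h t * P t := by
    rw [← integral_complex_ofReal, ← integral_indicator measurableSet_Icc]
    congr 1; ext t
    by_cases ht : t ∈ Set.Icc (-N) N
    · simp only [h, ht, Set.indicator_of_mem]
      rw [mul_comm, Complex.mul_conj, Complex.normSq_eq_norm_sq]
    · simp [h, ht]
  have hfub : ∫ t, h t * P t =
      ∫ x, (Gf 0 x * (Real.exp (-T * ‖x‖) * f x)) * c (-(‖x‖ / (2 * Real.pi))) := by
    have eG : ∀ (t : ℝ) (x : R3), h t * (Gf (T + t * Complex.I) x * f x) =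
        (Gf 0 x * (Real.exp (-T * ‖x‖) * f x)) * (Complex.exp (-(t * ‖x‖) * Complex.I) * h t) := by
      intro t x
      have : Complex.exp (-(T + t * Complex.I) * ‖x‖) =
          (Real.exp (-T * ‖x‖) : ℂ) * Complex.exp (-(t * ‖x‖) * Complex.I) := by
        rw [Complex.ofReal_exp, ← Complex.exp_add]; congr 1; push_cast; ring
      simp only [Gf, this, neg_zero, zero_mul, Complex.exp_zero]; ring
    have i3 : Integrable (fun p : ℝ × R3 => h p.1 * (Gf (T + p.1 * Complex.I) p.2 * f p.2))
        (volume.prod volume) := by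
      have k1 := i1.mul_prod (hf.integrable (κ := (T : ℂ)) (by simpa using hT))
      refine k1.mono ?_ (Eventually.of_forall fun p => ?_)
      · have m1 : Measurable fun p : ℝ × R3 => Gf (T + p.1 * Complex.I) p.2 := by
          unfold Gf; fun_prop
        exact i1.1.comp_fst.mul (m1.aestronglyMeasurable.mul hf.1.comp_snd)
      · rw [norm_mul, norm_mul, norm_mul, norm_mul, norm_Gf, norm_Gf]
        simp
    calc ∫ t, h t * P t = ∫ t, ∫ x, h t * (Gf (T + t * Complex.I) x * f x) := by
          congr 1; ext t; rw [integral_const_mul]; rfl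
      _ = ∫ x, ∫ t, h t * (Gf (T + t * Complex.I) x * f x) := integral_integral_swap i3
      _ = _ := by
          congr 1; ext x
          simp only [eG]
          rw [integral_const_mul, hc]
  have hrad : Integrable (fun x : R3 => (‖c (-(‖x‖ / (2 * Real.pi)))‖ / (4 * Real.pi * ‖x‖)) ^ 2) volume ∧
      ∫ x : R3, (‖c (-(‖x‖ / (2 * Real.pi)))‖ / (4 * Real.pi * ‖x‖)) ^ 2 ≤ 1 / 2 * S := by
    have e : ∀ r ∈ Set.Ioi (0 : ℝ), r ^ 2 • (‖c (-(r / (2 * Real.pi)))‖ / (4 * Real.pi * r)) ^ 2 =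
        1 / (4 * Real.pi) ^ 2 * ‖c (-(2 * Real.pi)⁻¹ * r)‖ ^ 2 := fun r hr => by
      have : r ≠ 0 := (Set.mem_Ioi.1 hr).ne'
      rw [show -(r / (2 * Real.pi)) = -(2 * Real.pi)⁻¹ * r by ring, smul_eq_mul]
      field_simp
    have hne : -(2 * Real.pi)⁻¹ ≠ 0 := neg_ne_zero.2 (by positivity)
    have i4 : Integrable (fun r => ‖c (-(2 * Real.pi)⁻¹ * r)‖ ^ 2) volume :=
      (integrable_comp_mul_left_iff (fun y => ‖c y‖ ^ 2) hne).2 iF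
    have v4 := Measure.integral_comp_mul_left (fun y => ‖c y‖ ^ 2) (-(2 * Real.pi)⁻¹)
    constructor
    · rw [integrable_radial_iff (f := fun r => (‖c (-(r / (2 * Real.pi)))‖ / (4 * Real.pi * r)) ^ 2)]
      exact (i4.const_mul _).integrableOn.congr_fun (fun r hr => (e r hr).symm) measurableSet_Ioi
    · rw [integral_radial (fun r => (‖c (-(r / (2 * Real.pi)))‖ / (4 * Real.pi * r)) ^ 2),
        setIntegral_congr_fun measurableSet_Ioi e, integral_const_mul, smul_eq_mul]
      have h5 : ∫ r in Set.Ioi 0, ‖c (-(2 * Real.pi)⁻¹ * r)‖ ^ 2 ≤ 2 * Real.pi * S := by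
        refine (setIntegral_le_integral i4 (Eventually.of_forall fun r => by positivity)).trans_eq ?_
        rw [v4, hF, hS, smul_eq_mul, inv_neg, inv_inv, abs_neg, abs_of_pos (by positivity)]
      calc _ ≤ 4 * Real.pi * (1 / (4 * Real.pi) ^ 2 * (2 * Real.pi * S)) := by gcongr
        _ = _ := by field_simp; ring
  set F : R3 → ℂ := fun x => (Real.exp (-T * ‖x‖) : ℂ) * f x
  have hb : MemLp (fun x : R3 => ‖c (-(‖x‖ / (2 * Real.pi)))‖ / (4 * Real.pi * ‖x‖)) 2 volume := by
    rw [memLp_two_iff_integrable_sq]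
    · exact hrad.1
    · have m1 : Measurable c := cc.measurable
      have : Measurable fun x : R3 => ‖c (-(‖x‖ / (2 * Real.pi)))‖ / (4 * Real.pi * ‖x‖) := by fun_prop
      exact this.aestronglyMeasurable
  have hCS := sq_integral_mul_le (fun x => norm_nonneg (F x)) (fun x => by positivity) h2.norm hb
  have hle : S ≤ ∫ x, ‖F x‖ * (‖c (-(‖x‖ / (2 * Real.pi)))‖ / (4 * Real.pi * ‖x‖)) := by
    have : ‖(S : ℂ)‖ = S := by rw [Complex.norm_real, Real.norm_of_nonneg hS0]
    rw [← this, hS', hfub]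
    refine (norm_integral_le_integral_norm _).trans_eq ?_
    congr 1; ext x
    rw [norm_mul, norm_mul, norm_Gf]
    simp only [F, Complex.zero_re, neg_zero, zero_mul, Real.exp_zero]
    ring
  have h6 : S ^ 2 ≤ sqn F * (1 / 2 * S) := by
    calc S ^ 2 ≤ _ := pow_le_pow_left₀ hS0 hle 2
      _ ≤ _ := hCS
      _ ≤ _ := mul_le_mul_of_nonneg_left hrad.2 (sqn_nonneg F)
  rcases hS0.eq_or_lt with h0 | h0
  · rw [← h0]
    have := sqn_nonneg F
    positivity
  · nlinarith

theorem LapInt.plancherel {a T : ℝ} {f : R3 → ℂ} (hf : LapInt a f) (hT : a < T)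
    (h2 : MemLp (fun x => (Real.exp (-T * ‖x‖) : ℂ) * f x) 2 volume) :
    Integrable (fun t : ℝ => ‖Phi f (T + t * Complex.I)‖ ^ 2) volume ∧
    ∫ t : ℝ, ‖Phi f (T + t * Complex.I)‖ ^ 2 ≤
      1 / 2 * sqn (fun x => (Real.exp (-T * ‖x‖) : ℂ) * f x) := by
  have cP := (hf.continuous_line hT).norm.pow 2
  have hb : ∀ N : ℕ, ∫ t in (-(N : ℝ))..N, ‖Phi f (T + t * Complex.I)‖ ^ 2 ≤
      1 / 2 * sqn (fun x => (Real.exp (-T * ‖x‖) : ℂ) * f x) := fun N => by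
    rw [intervalIntegral.integral_of_le (by linarith [N.cast_nonneg (α := ℝ)]),
      ← integral_Icc_eq_integral_Ioc]
    exact hf.integral_Icc_le hT h2 N
  have t1 : Tendsto (fun N : ℕ => -(N : ℝ)) atTop atBot :=
    tendsto_neg_atTop_atBot.comp tendsto_natCast_atTop_atTop
  have hi : Integrable (fun t : ℝ => ‖Phi f (T + t * Complex.I)‖ ^ 2) volume := by
    refine integrable_of_intervalIntegral_norm_bounded
      (1 / 2 * sqn (fun x => (Real.exp (-T * ‖x‖) : ℂ) * f x)) (fun N : ℕ => cP.integrableOn_Ioc)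
      t1 tendsto_natCast_atTop_atTop (Eventually.of_forall fun N => ?_)
    simpa using hb N
  exact ⟨hi, le_of_tendsto (intervalIntegral_tendsto_integral hi t1 tendsto_natCast_atTop_atTop)
    (Eventually.of_forall hb)⟩

/-- The weighted bound for `Φ_f`. -/
theorem norm_Phi_le_of_weight {f : R3 → ℂ} {A : ℝ} (hf : AEStronglyMeasurable f volume)
    (hA : ∀ᵐ x, ‖f x‖ ≤ A * w x) {κ : ℂ} (hκ : 0 < κ.re) :
    ‖Phi f κ‖ ≤ A * (1 / κ.re + 1 / κ.re ^ 2) := by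
  have hpi := Real.pi_pos
  set T := κ.re
  have e : ∀ r ∈ Set.Ioi (0 : ℝ), r ^ 2 • (Real.exp (-T * r) / (4 * Real.pi * r) * (1 + 1 / r)) =
      1 / (4 * Real.pi) * (r ^ ((1 : ℝ) - 1) * Real.exp (-(T * r)) +
        r ^ ((2 : ℝ) - 1) * Real.exp (-(T * r))) := fun r hr => by
    have : r ≠ 0 := (Set.mem_Ioi.1 hr).ne'
    have e1 : r ^ ((1 : ℝ) - 1) = 1 := by norm_num
    have e2 : r ^ ((2 : ℝ) - 1) = r := by norm_num
    rw [e1, e2, smul_eq_mul, neg_mul]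
    field_simp
    ring
  have v1 := Real.integral_rpow_mul_exp_neg_mul_Ioi (a := 1) (r := T) one_pos hκ
  have v2 := Real.integral_rpow_mul_exp_neg_mul_Ioi (a := 2) (r := T) two_pos hκ
  rw [Real.Gamma_one] at v1
  rw [Real.Gamma_two] at v2
  have j1 : IntegrableOn (fun r : ℝ => r ^ ((1 : ℝ) - 1) * Real.exp (-(T * r))) (Set.Ioi 0) := by
    by_contra hc
    rw [integral_undef hc] at v1
    have : 0 < (1 / T) ^ (1 : ℝ) * 1 := by positivity
    linarith
  have j2 : IntegrableOn (fun r : ℝ => r ^ ((2 : ℝ) - 1) * Real.exp (-(T * r))) (Set.Ioi 0) := by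
    by_contra hc
    rw [integral_undef hc] at v2
    have : 0 < (1 / T) ^ (2 : ℝ) * 1 := by positivity
    linarith
  have hint : Integrable (fun x : R3 => Real.exp (-T * ‖x‖) / (4 * Real.pi * ‖x‖) * w x) volume := by
    unfold w
    rw [integrable_radial_iff (f := fun r => Real.exp (-T * r) / (4 * Real.pi * r) * (1 + 1 / r))]
    exact IntegrableOn.congr_fun ((j1.add j2).const_mul _) (fun r hr => (e r hr).symm) measurableSet_Ioi
  have hval : ∫ x : R3, Real.exp (-T * ‖x‖) / (4 * Real.pi * ‖x‖) * w x = 1 / T + 1 / T ^ 2 := by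
    unfold w
    rw [integral_radial (fun r => Real.exp (-T * r) / (4 * Real.pi * r) * (1 + 1 / r)),
      setIntegral_congr_fun measurableSet_Ioi e, integral_const_mul, integral_add j1 j2, v1, v2,
      smul_eq_mul]
    rw [Real.rpow_one, Real.rpow_two]
    field_simp
  refine (norm_Phi_le f κ).trans ?_
  have hle : ∀ᵐ x : R3, Real.exp (-T * ‖x‖) / (4 * Real.pi * ‖x‖) * ‖f x‖ ≤
      A * (Real.exp (-T * ‖x‖) / (4 * Real.pi * ‖x‖) * w x) := by
    filter_upwards [hA] with x hx
    calc _ ≤ Real.exp (-T * ‖x‖) / (4 * Real.pi * ‖x‖) * (A * w x) := by gcongr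
      _ = _ := by ring
  rw [← hval, ← integral_const_mul]
  refine integral_mono_ae ((hint.const_mul A).mono' ?_ ?_) (hint.const_mul A) hle
  · have : Measurable fun x : R3 => Real.exp (-T * ‖x‖) / (4 * Real.pi * ‖x‖) := by fun_prop
    exact this.aestronglyMeasurable.mul hf.norm
  · filter_upwards [hle] with x hx
    rwa [Real.norm_of_nonneg (by positivity)]

end PointNLS
end

noncomputable section
namespace PointNLS

/-! ### Square roots -/

/-- The principal square root. -/
def csq (z : ℂ) : ℂ := z ^ (2⁻¹ : ℂ)

theorem csq_sq (z : ℂ) : csq z ^ 2 = z := Complex.cpow_nat_inv_pow z two_ne_zero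

theorem re_csq_nonneg (z : ℂ) : 0 ≤ (csq z).re := by
  by_cases hz : z = 0
  · simp [csq, hz]
  · rw [csq, Complex.cpow_def_of_ne_zero hz, Complex.exp_re]
    refine mul_nonneg (Real.exp_pos _).le (Real.cos_nonneg_of_mem_Icc ?_)
    have e : (Complex.log z * 2⁻¹).im = z.arg / 2 := by
      rw [show (2⁻¹ : ℂ) = ((2⁻¹ : ℝ) : ℂ) by push_cast; rfl, Complex.im_mul_ofReal, Complex.log_im]
      ring
    rw [e]
    have h1 := Complex.neg_pi_lt_arg z
    have h2 := Complex.arg_le_pi z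
    constructor <;> linarith

theorem re_csq_sq_sub (z : ℂ) : (csq z).re ^ 2 - (csq z).im ^ 2 = z.re := by
  have := congrArg Complex.re (csq_sq z)
  simp only [sq, Complex.mul_re] at this
  linarith

theorem re_mul_im_csq (z : ℂ) : 2 * ((csq z).re * (csq z).im) = z.im := by
  have := congrArg Complex.im (csq_sq z)
  simp only [sq, Complex.mul_im] at this
  linarith

theorem sqrt_re_le_re_csq {z : ℂ} {a : ℝ} (h : a ^ 2 ≤ z.re) : a ≤ (csq z).re := by
  have h1 := re_csq_sq_sub z
  exact abs_le_of_sq_le_sq' (by nlinarith [sq_nonneg (csq z).im]) (re_csq_nonneg z) |>.2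

theorem norm_csq_sq (z : ℂ) : ‖csq z‖ ^ 2 = ‖z‖ := by rw [← norm_pow, csq_sq]

theorem continuousAt_csq {z : ℂ} (h : 0 ≤ z.re) : ContinuousAt csq z :=
  Complex.continuousAt_cpow_const_of_re_pos (Or.inl h) (by norm_num)

theorem differentiableAt_csq {z : ℂ} (h : 0 < z.re) : DifferentiableAt ℂ csq z :=
  differentiableAt_id.cpow_const (Or.inl h)

theorem csq_ofReal {a : ℝ} (h : 0 ≤ a) : csq a = (√a : ℂ) := by
  rw [csq, Real.sqrt_eq_rpow, Complex.ofReal_cpow h]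
  congr 1
  push_cast; norm_num

/-! ### The determinant near the imaginary axis -/

/-- `μ` as a function of `κ`, from `κ² + μ² = 2ω`. -/
def muK (ω : ℝ) (κ : ℂ) : ℂ := csq (2 * ω - κ ^ 2)

theorem re_two_mul_sub_sq (ω : ℝ) (κ : ℂ) :
    (2 * (ω : ℂ) - κ ^ 2).re = 2 * ω - κ.re ^ 2 + κ.im ^ 2 := by
  simp [sq]
  ring

/-- With `κ = it` and `μ` real, the imaginary part of the determinant is `t(μ - p)`. If `μ = p`, the
determinant is `-d² ≠ 0`. If `t = 0`, then `μ = √2 √ω` and it equals `ω(√2 - 1)(√2σ - 1)`, which is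
positive precisely because `σ > 1/√2`. -/
theorem det_imaginary_ne_zero {σ ω : ℝ} (hσ : 1 / Real.sqrt 2 < σ) (hω : 0 < ω)
    (t : ℝ) : det σ ω (t * Complex.I) (√(2 * ω + t ^ 2) : ℝ) ≠ 0 := by
  have h2 : (0 : ℝ) < √2 := by positivity
  have hs2 : √2 * √2 = 2 := Real.mul_self_sqrt (by norm_num)
  have hσ' : 1 < σ * √2 := by rwa [div_lt_iff₀ h2] at hσ
  have h2' : 1 < √2 := by nlinarith
  have hσ0 : 0 < σ := by
    by_contra hc
    nlinarith
  have hs : 0 < √ω := by positivity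
  intro h0
  have hre := congrArg Complex.re h0
  have him := congrArg Complex.im h0
  simp only [det, pp, dd, Complex.sub_re, Complex.mul_re, Complex.ofReal_re, Complex.I_re, mul_zero,
    Complex.ofReal_im, Complex.I_im, mul_one, sub_self, zero_sub, Complex.sub_im, Complex.mul_im,
    sub_zero, zero_mul, add_zero, sq, Complex.zero_re, Complex.zero_im, zero_add] at hre him
  have hd : 0 < σ * √ω * (σ * √ω) := by positivity
  rcases mul_eq_zero.1 him with ht | hm
  · rw [ht] at hre
    have e : √(2 * ω + 0 * 0) = √2 * √ω := by
      rw [← Real.sqrt_mul (by norm_num)]; simp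
    rw [e] at hre
    have e2 : √ω * √ω * ((√2 - 1) * (σ * √2 - 1)) = 0 := by
      linear_combination hre + σ * √ω * √ω * (hs2)
    have : 0 < √ω * √ω * ((√2 - 1) * (σ * √2 - 1)) := by
      have a1 : 0 < √2 - 1 := by linarith
      have a2 : 0 < σ * √2 - 1 := by linarith
      positivity
    linarith
  · rw [hm] at hre
    linarith

theorem muK_imaginary {ω : ℝ} (hω : 0 < ω) (t : ℝ) :
    muK ω (t * Complex.I) = (√(2 * ω + t ^ 2) : ℝ) := by
  rw [muK, ← csq_ofReal (by positivity)]
  congr 1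
  push_cast
  linear_combination (-(t : ℂ) ^ 2) * Complex.I_sq

/-- Here `Re μ² = 2ω - (Re κ)² + (Im κ)² ≥ ω + (Im κ)²`, and a principal square root satisfies `(Re
μ)² ≥ Re μ²`. The growth of `Re μ` makes all transforms at `μ` harmless. -/
theorem re_muK_ge {ω : ℝ} {κ : ℂ} (h : κ.re ^ 2 ≤ ω) : √ω ≤ (muK ω κ).re ∧ |κ.im| ≤ (muK ω κ).re := by
  have hω : 0 ≤ ω := (sq_nonneg _).trans h
  have e := re_two_mul_sub_sq ω κ
  constructor
  · refine sqrt_re_le_re_csq ?_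
    rw [e, Real.sq_sqrt hω]
    nlinarith [sq_nonneg κ.im]
  · refine sqrt_re_le_re_csq ?_
    rw [e, sq_abs]
    nlinarith

theorem norm_muK_le {ω : ℝ} {κ : ℂ} (h : κ.re ^ 2 ≤ ω) : ‖muK ω κ‖ ≤ 2 * √ω + |κ.im| := by
  have hω : 0 ≤ ω := (sq_nonneg _).trans h
  have h1 : ‖muK ω κ‖ ^ 2 ≤ 3 * ω + |κ.im| ^ 2 := by
    rw [muK, norm_csq_sq]
    have h2 : ‖κ ^ 2‖ = κ.re ^ 2 + |κ.im| ^ 2 := by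
      rw [norm_pow, ← Complex.normSq_eq_norm_sq, Complex.normSq_apply, sq_abs]; ring
    have h3 : ‖(2 * (ω : ℂ))‖ = 2 * ω := by
      rw [norm_mul, Complex.norm_real, Real.norm_of_nonneg hω]; simp
    have := norm_sub_le (2 * (ω : ℂ)) (κ ^ 2)
    linarith
  have hs := Real.sq_sqrt hω
  refine (abs_le_of_sq_le_sq' (h1.trans ?_) (by positivity)).2
  nlinarith [mul_nonneg (Real.sqrt_nonneg ω) (abs_nonneg κ.im)]

theorem differentiableAt_muK {ω : ℝ} (hω : 0 < ω) {κ : ℂ} (h : κ.re ^ 2 ≤ ω) :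
    DifferentiableAt ℂ (muK ω) κ := by
  have : 0 < (2 * (ω : ℂ) - κ ^ 2).re := by
    rw [re_two_mul_sub_sq]; nlinarith [sq_nonneg κ.im]
  exact (differentiableAt_csq this).comp κ (by fun_prop : DifferentiableAt ℂ (fun κ => 2 * (ω : ℂ) - κ ^ 2) κ)

theorem pp_pos {σ ω : ℝ} (hσ : 0 < σ) (hω : 0 < ω) : 0 < pp σ ω := by unfold pp; positivity

theorem dd_pos {σ ω : ℝ} (hσ : 0 < σ) (hω : 0 < ω) : 0 < dd σ ω := by unfold dd; positivity

theorem pos_of_one_div_sqrt_lt {σ : ℝ} (hσ : 1 / Real.sqrt 2 < σ) : 0 < σ :=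
  lt_trans (by positivity) hσ

/-- Writing `t = |Im κ|`, the product in the determinant is at least `t(t - p) ≥ t²/2`, and `d² ≤
t²/4`; what remains is at least `t²/4 ≥ (1 + t²)/8` since `t ≥ 1`. -/
theorem norm_det_ge_of_large {σ ω : ℝ} (hσ : 0 < σ) (hω : 0 < ω) {κ : ℂ} (h : κ.re ^ 2 ≤ ω)
    (ht : 2 * pp σ ω + 2 * dd σ ω + 1 ≤ |κ.im|) :
    1 / 8 * (1 + |κ.im| ^ 2) ≤ ‖det σ ω κ (muK ω κ)‖ := by
  have hp := pp_pos hσ hω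
  have hd := dd_pos hσ hω
  have h1 : |κ.im| ≤ ‖κ - pp σ ω‖ := by
    have := Complex.abs_im_le_norm (κ - pp σ ω)
    simpa using this
  have h2 : |κ.im| - pp σ ω ≤ ‖muK ω κ - pp σ ω‖ := by
    have h3 := Complex.re_le_norm (muK ω κ - pp σ ω)
    have h4 := (re_muK_ge h).2
    rw [Complex.sub_re, Complex.ofReal_re] at h3
    linarith
  have h3 : ‖κ - pp σ ω‖ * ‖muK ω κ - pp σ ω‖ - dd σ ω ^ 2 ≤ ‖det σ ω κ (muK ω κ)‖ := by
    have := norm_sub_norm_le ((κ - pp σ ω) * (muK ω κ - pp σ ω)) ((dd σ ω : ℂ) ^ 2)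
    rw [norm_mul, norm_pow, Complex.norm_real, Real.norm_of_nonneg hd.le] at this
    exact this
  have h4 : |κ.im| * (|κ.im| - pp σ ω) ≤ ‖κ - pp σ ω‖ * ‖muK ω κ - pp σ ω‖ := by
    apply mul_le_mul h1 h2 (by linarith) (norm_nonneg _)
  nlinarith

/-- Nonvanishing on the compact segment `κ = it`, `|t| ≤ T0`, extends to a thin rectangle by the
tube lemma, and the modulus has a positive minimum there. Larger `|t|` is covered by
`norm_det_ge_of_large` for every admissible width. -/
theorem exists_det_lower_bound {σ ω : ℝ} (hσ : 1 / Real.sqrt 2 < σ) (hω : 0 < ω) :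
    ∃ δ c : ℝ, 0 < δ ∧ δ ^ 2 ≤ ω ∧ 0 < c ∧ ∀ κ : ℂ, 0 ≤ κ.re → κ.re ≤ δ →
      c * (1 + |κ.im| ^ 2) ≤ ‖det σ ω κ (muK ω κ)‖ := by
  have hσ0 := pos_of_one_div_sqrt_lt hσ
  have hp := pp_pos hσ0 hω
  have hd := dd_pos hσ0 hω
  set T0 := 2 * pp σ ω + 2 * dd σ ω + 1
  set N : ℝ × ℝ → ℂ := fun q => det σ ω (q.1 + q.2 * Complex.I) (muK ω (q.1 + q.2 * Complex.I))
  set U : Set (ℝ × ℝ) := {q | q.1 ^ 2 < ω}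
  have hU : IsOpen U := isOpen_lt (by fun_prop) continuous_const
  have hN : ContinuousOn N U := by
    intro q hq
    have hq' : ((q.1 : ℂ) + q.2 * Complex.I).re ^ 2 ≤ ω := by
      have : q.1 ^ 2 < ω := hq
      simpa using this.le
    have c1 : ContinuousAt (fun q : ℝ × ℝ => (q.1 : ℂ) + q.2 * Complex.I) q := by fun_prop
    have c2 : ContinuousAt (fun q : ℝ × ℝ => muK ω (q.1 + q.2 * Complex.I)) q :=
      ContinuousAt.comp (g := muK ω) (f := fun q : ℝ × ℝ => (q.1 : ℂ) + q.2 * Complex.I)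
        (differentiableAt_muK hω hq').continuousAt c1
    exact (((c1.sub continuousAt_const).mul (c2.sub continuousAt_const)).sub
      continuousAt_const).continuousWithinAt
  have hopen := hN.isOpen_inter_preimage hU (isOpen_compl_singleton (x := (0 : ℂ)))
  have hsub : ({0} : Set ℝ) ×ˢ Set.Icc (-T0) T0 ⊆ U ∩ N ⁻¹' {0}ᶜ := by
    rintro ⟨x, t⟩ ⟨hx, -⟩
    obtain rfl : x = 0 := hx
    refine ⟨by simpa [U] using hω, ?_⟩
    have := det_imaginary_ne_zero hσ hω t
    simpa [N, muK_imaginary hω] using this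
  obtain ⟨u, v, hu, hv, hu0, hvT, huv⟩ :=
    generalized_tube_lemma isCompact_singleton isCompact_Icc hopen hsub
  obtain ⟨r, hr, hru⟩ := Metric.isOpen_iff.1 hu 0 (hu0 rfl)
  set δ := min (r / 2) (√ω / 2)
  have hδ : 0 < δ := by positivity
  have hδω : δ ^ 2 ≤ ω := by
    have h1 : δ ≤ √ω / 2 := min_le_right _ _
    have := Real.sq_sqrt hω.le
    nlinarith
  have hK : Set.Icc 0 δ ×ˢ Set.Icc (-T0) T0 ⊆ U ∩ N ⁻¹' {0}ᶜ := by
    refine subset_trans (Set.prod_mono (fun x hx => hru ?_) hvT) huv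
    rw [Metric.mem_ball, dist_zero_right, Real.norm_of_nonneg hx.1]
    have := min_le_left (r / 2) (√ω / 2)
    have := hx.2
    linarith
  have hT0 : 0 < T0 := by positivity
  obtain ⟨q0, hq0, hmin⟩ := (isCompact_Icc.prod isCompact_Icc).exists_isMinOn
    (s := Set.Icc 0 δ ×ˢ Set.Icc (-T0) T0) ⟨(0, 0), by constructor <;> constructor <;> simp <;> positivity⟩
    ((hN.mono (hK.trans Set.inter_subset_left)).norm)
  have hc : 0 < ‖N q0‖ := norm_pos_iff.2 (hK hq0).2
  refine ⟨δ, min (1 / 8) (‖N q0‖ / (1 + T0 ^ 2)), hδ, hδω, by positivity, fun κ h1 h2 => ?_⟩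
  have hκ : κ.re ^ 2 ≤ ω := by nlinarith
  by_cases ht : T0 ≤ |κ.im|
  · refine le_trans ?_ (norm_det_ge_of_large hσ0 hω hκ ht)
    gcongr
    exact min_le_left _ _
  · push Not at ht
    have hmem : (κ.re, κ.im) ∈ Set.Icc 0 δ ×ˢ Set.Icc (-T0) T0 :=
      ⟨⟨h1, h2⟩, abs_le.1 ht.le⟩
    have h3 : ‖N q0‖ ≤ ‖N (κ.re, κ.im)‖ := hmin hmem
    have e : N (κ.re, κ.im) = det σ ω κ (muK ω κ) := by simp only [N, Complex.re_add_im]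
    rw [e] at h3
    calc _ ≤ ‖N q0‖ / (1 + T0 ^ 2) * (1 + T0 ^ 2) := by
          gcongr
          exact min_le_right _ _
      _ = ‖N q0‖ := by field_simp
      _ ≤ _ := h3

/-! ### Shifting a vertical line of integration -/

/-- Cauchy's theorem on tall rectangles, without pointwise decay of `F`. By the uniform bound on
vertical lines, `F` is integrable over the strip, so the contribution `g` of the horizontal sides is
an integrable function of the height and cannot stay bounded below. -/
theorem integral_vertical_eq {F : ℂ → ℂ} {x₀ x₁ C : ℝ} (h : x₀ ≤ x₁)
    (hc : ContinuousOn F {κ | x₀ ≤ κ.re ∧ κ.re ≤ x₁})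
    (hd : ∀ κ : ℂ, x₀ < κ.re → κ.re < x₁ → DifferentiableAt ℂ F κ)
    (hi : ∀ x, x₀ ≤ x → x ≤ x₁ → Integrable (fun t : ℝ => F (x + t * Complex.I)) volume ∧
      ∫ t : ℝ, ‖F (x + t * Complex.I)‖ ≤ C) :
    ∫ t : ℝ, F (x₀ + t * Complex.I) = ∫ t : ℝ, F (x₁ + t * Complex.I) := by
  set ν : Measure ℝ := volume.restrict (Set.Icc x₀ x₁)
  set P : ℝ × ℝ → ℂ := fun q => F (q.1 + q.2 * Complex.I)
  have mP : AEStronglyMeasurable P (ν.prod volume) := by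
    have e : ν.prod (volume : Measure ℝ) =
        ((volume : Measure ℝ).prod volume).restrict (Set.Icc x₀ x₁ ×ˢ Set.univ) := by
      rw [← Measure.prod_restrict, Measure.restrict_univ]
    rw [e]
    refine ContinuousOn.aestronglyMeasurable ?_ (measurableSet_Icc.prod MeasurableSet.univ)
    refine hc.comp (by fun_prop) fun q hq => ?_
    simpa using hq.1
  have iP : Integrable P (ν.prod volume) := by
    rw [integrable_prod_iff mP]
    constructor
    · filter_upwards [ae_restrict_mem measurableSet_Icc] with x hx
      exact (hi x hx.1 hx.2).1
    · have : IsFiniteMeasure ν := ⟨by simp [ν]⟩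
      refine Integrable.mono' (integrable_const C) mP.norm.integral_prod_right' ?_
      filter_upwards [ae_restrict_mem measurableSet_Icc] with x hx
      rw [Real.norm_of_nonneg (integral_nonneg fun t => norm_nonneg _)]
      exact (hi x hx.1 hx.2).2
  set g : ℝ → ℝ := fun t => ∫ x, ‖P (x, t)‖ ∂ν
  have ig : Integrable g volume := iP.norm.integral_prod_right
  have hg0 : ∀ t, 0 ≤ g t := fun t => integral_nonneg fun x => norm_nonneg _
  have hhor : ∀ t : ℝ, ‖∫ x in x₀..x₁, F (x + t * Complex.I)‖ ≤ g t := fun t => by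
    refine (intervalIntegral.norm_integral_le_integral_norm h).trans_eq ?_
    rw [intervalIntegral.integral_of_le h, ← integral_Icc_eq_integral_Ioc]
  set L₀ : ℝ → ℂ := fun N => ∫ t in (-N)..N, F (x₀ + t * Complex.I)
  set L₁ : ℝ → ℂ := fun N => ∫ t in (-N)..N, F (x₁ + t * Complex.I)
  have hrect : ∀ N, 0 ≤ N → ‖L₁ N - L₀ N‖ ≤ g N + g (-N) := fun N hN => by
    have hr := Complex.integral_boundary_rect_eq_zero_of_continuousOn_of_differentiableOn F
      (x₀ + (-N : ℝ) * Complex.I) (x₁ + N * Complex.I) ?_ ?_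
    · simp only [Complex.add_re, Complex.ofReal_re, Complex.mul_re, Complex.I_re, mul_zero,
        Complex.ofReal_im, Complex.I_im, mul_one, sub_self, add_zero, Complex.add_im, Complex.mul_im,
        zero_add, smul_eq_mul] at hr
      have h1 := hhor N
      have h2 := hhor (-N)
      have e : Complex.I * (L₁ N - L₀ N) = (∫ x in x₀..x₁, F (x + N * Complex.I)) -
          ∫ x in x₀..x₁, F (x + (-N : ℝ) * Complex.I) := by
        linear_combination hr
      have e2 : ‖L₁ N - L₀ N‖ = ‖Complex.I * (L₁ N - L₀ N)‖ := by
        rw [norm_mul, Complex.norm_I, one_mul]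
      rw [e2, e]
      exact (norm_sub_le _ _).trans (add_le_add h1 h2)
    · refine hc.mono fun κ hκ => ?_
      have := hκ.1
      simp only [Complex.add_re, Complex.ofReal_re, Complex.mul_re, Complex.I_re, mul_zero,
        Complex.ofReal_im, Complex.I_im, mul_one, sub_self, add_zero, Set.uIcc_of_le h] at this
      exact this
    · intro κ hκ
      have := hκ.1
      simp only [Complex.add_re, Complex.ofReal_re, Complex.mul_re, Complex.I_re, mul_zero,
        Complex.ofReal_im, Complex.I_im, mul_one, sub_self, add_zero, min_eq_left h, max_eq_right h] at this
      exact (hd κ this.1 this.2).differentiableWithinAt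
  have T₀ : Tendsto L₀ atTop (𝓝 (∫ t : ℝ, F (x₀ + t * Complex.I))) :=
    intervalIntegral_tendsto_integral (hi x₀ le_rfl h).1 tendsto_neg_atTop_atBot tendsto_id
  have T₁ : Tendsto L₁ atTop (𝓝 (∫ t : ℝ, F (x₁ + t * Complex.I))) :=
    intervalIntegral_tendsto_integral (hi x₁ h le_rfl).1 tendsto_neg_atTop_atBot tendsto_id
  have T := (T₁.sub T₀).norm
  by_contra hne
  have hpos : 0 < ‖(∫ t : ℝ, F (x₁ + t * Complex.I)) - ∫ t : ℝ, F (x₀ + t * Complex.I)‖ :=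
    norm_pos_iff.2 (sub_ne_zero.2 (Ne.symm hne))
  set l := ‖(∫ t : ℝ, F (x₁ + t * Complex.I)) - ∫ t : ℝ, F (x₀ + t * Complex.I)‖
  have hev := (T.eventually (lt_mem_nhds (half_lt_self hpos))).and (eventually_ge_atTop (0 : ℝ))
  obtain ⟨N₀, hN₀⟩ := eventually_atTop.1 hev
  have ig2 : IntegrableOn (fun t => g t + g (-t)) (Set.Ioi N₀) := (ig.add ig.comp_neg).integrableOn
  have : IntegrableOn (fun _ : ℝ => l / 2) (Set.Ioi N₀) := by
    refine Integrable.mono' ig2 aestronglyMeasurable_const ?_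
    filter_upwards [ae_restrict_mem measurableSet_Ioi] with t ht
    rw [Real.norm_of_nonneg (by positivity)]
    obtain ⟨h1, h2⟩ := hN₀ t (Set.mem_Ioi.1 ht).le
    exact h1.le.trans (hrect t h2)
  rw [integrableOn_const_iff (by simp)] at this
  rcases this with h1 | h1
  · rw [enorm_eq_zero] at h1
    linarith
  · simp at h1

end PointNLS
end

noncomputable section
namespace PointNLS

/-! ### The limit form on the imaginary axis -/

/-- Square integrable and of bounded support. -/
def Tame (f : R3 → ℂ) : Prop := MemLp f 2 volume ∧ ∃ N : ℝ, ∀ x, N < ‖x‖ → f x = 0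

theorem Tame.lapInt {f : R3 → ℂ} (h : Tame f) (a : ℝ) : LapInt a f := by
  obtain ⟨h1, N, h2⟩ := h
  exact lapInt_of_bounded_support h1 h2 a

theorem memLp_exp_mul {f : R3 → ℂ} (hf : MemLp f 2 volume) {T : ℝ} (hT : 0 ≤ T) :
    MemLp (fun x => (Real.exp (-T * ‖x‖) : ℂ) * f x) 2 volume ∧
      sqn (fun x => (Real.exp (-T * ‖x‖) : ℂ) * f x) ≤ sqn f := by
  have hb : ∀ x : R3, ‖(Real.exp (-T * ‖x‖) : ℂ) * f x‖ ≤ ‖f x‖ := fun x => by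
    rw [norm_mul, Complex.norm_real, Real.norm_of_nonneg (Real.exp_pos _).le]
    refine mul_le_of_le_one_left (norm_nonneg _) ?_
    rw [Real.exp_le_one_iff]
    have := mul_nonneg hT (norm_nonneg x)
    linarith
  have m : MemLp (fun x => (Real.exp (-T * ‖x‖) : ℂ) * f x) 2 volume := by
    refine hf.of_le ?_ (Eventually.of_forall hb)
    have : Measurable fun x : R3 => (Real.exp (-T * ‖x‖) : ℂ) := by fun_prop
    exact this.aestronglyMeasurable.mul hf.1
  refine ⟨m, integral_mono (integrable_sq_norm m) (integrable_sq_norm hf) fun x => ?_⟩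
  simp only
  gcongr
  exact hb x

theorem Tame.integral_line_le {f : R3 → ℂ} (hf : Tame f) {x : ℝ} (hx : 0 ≤ x) :
    Integrable (fun t : ℝ => ‖Phi f (x + t * Complex.I)‖ ^ 2) volume ∧
    ∫ t : ℝ, ‖Phi f (x + t * Complex.I)‖ ^ 2 ≤ 1 / 2 * sqn f := by
  obtain ⟨h1, h2⟩ := memLp_exp_mul hf.1 hx
  -- For bounded support the transform converges in the whole plane; the abscissa `-1` leaves room
  -- to include the imaginary axis `x = 0` itself.
  obtain ⟨h3, h4⟩ := (hf.lapInt (-1)).plancherel (by linarith) h1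
  exact ⟨h3, h4.trans (by gcongr)⟩

theorem integrable_comp_abs {f : ℝ → ℝ} (hf : IntegrableOn f (Set.Ioi 0)) :
    Integrable (fun x => f |x|) volume := by
  have h1 : IntegrableOn (fun x => f |x|) (Set.Ioi 0) :=
    hf.congr_fun (fun x hx => by rw [abs_of_pos (Set.mem_Ioi.1 hx)]) measurableSet_Ioi
  have h2 : IntegrableOn (fun x => f |x|) (Set.Iic 0) := by
    rw [← Measure.map_neg_eq_self (volume : Measure ℝ)]
    have m : MeasurableEmbedding fun x : ℝ => -x := (Homeomorph.neg ℝ).measurableEmbedding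
    rw [m.integrableOn_map_iff]
    simp_rw [Function.comp_def, abs_neg, Set.neg_preimage, Set.neg_Iic, neg_zero]
    exact Iff.mpr integrableOn_Ici_iff_integrableOn_Ioi h1
  rw [← integrableOn_univ, ← Set.Iic_union_Ioi (a := (0 : ℝ))]
  exact h2.union h1

theorem integral_sq_Psi_abs {f : R3 → ℂ} (hf : MemLp f 2 volume) :
    Integrable (fun t : ℝ => Psi f |t| ^ 2) volume ∧ ∫ t : ℝ, Psi f |t| ^ 2 ≤ 1 / 2 * sqn f := by
  obtain ⟨h1, h2⟩ := integrableOn_sq_Psi hf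
  refine ⟨(integrable_comp_abs h1), ?_⟩
  rw [integral_comp_abs (f := fun t => Psi f t ^ 2)]
  linarith

theorem continuous_vertical (x : ℝ) : Continuous fun t : ℝ => (x : ℂ) + t * Complex.I := by fun_prop

theorem re_vertical (x t : ℝ) : ((x : ℂ) + t * Complex.I).re = x := by simp

theorem im_vertical (x t : ℝ) : ((x : ℂ) + t * Complex.I).im = t := by simp

/-- Since `Re μ ≥ |t|` on the line, the transform at `μ` is at most `Psi f |t|`, which is square
integrable by the Schur bound; no Plancherel argument is needed for this half. -/
theorem integral_muK_le {f : R3 → ℂ} (hf : MemLp f 2 volume) {ω x : ℝ} (hω : 0 < ω)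
    (hx : x ^ 2 ≤ ω) :
    Integrable (fun t : ℝ => ‖Phi f (muK ω (x + t * Complex.I))‖ ^ 2) volume ∧
    ∫ t : ℝ, ‖Phi f (muK ω (x + t * Complex.I))‖ ^ 2 ≤ 1 / 2 * sqn f := by
  obtain ⟨h1, h2⟩ := integral_sq_Psi_abs hf
  have hre : ∀ t : ℝ, ((x : ℂ) + t * Complex.I).re ^ 2 ≤ ω := fun t => by rwa [re_vertical]
  have hpos : ∀ t : ℝ, 0 < (muK ω (x + t * Complex.I)).re := fun t =>
    lt_of_lt_of_le (Real.sqrt_pos.2 hω) (re_muK_ge (hre t)).1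
  have hc : Continuous fun t : ℝ => Phi f (muK ω (x + t * Complex.I)) := by
    refine continuous_iff_continuousAt.2 fun t => ?_
    refine ContinuousAt.comp (g := Phi f) (f := fun t : ℝ => muK ω (x + t * Complex.I))
      ((MemLp.lapInt hf).differentiableAt (hpos t)).continuousAt ?_
    exact ContinuousAt.comp (g := muK ω) (f := fun t : ℝ => (x : ℂ) + t * Complex.I)
      (differentiableAt_muK hω (hre t)).continuousAt (continuous_vertical x).continuousAt
  have hle : ∀ᵐ t : ℝ, ‖Phi f (muK ω (x + t * Complex.I))‖ ^ 2 ≤ Psi f |t| ^ 2 := by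
    have h0 : ∀ᵐ t : ℝ, t ≠ 0 := by simp [ae_iff, measure_singleton]
    filter_upwards [h0] with t ht
    have h3 := norm_Phi_le f (muK ω (x + t * Complex.I))
    have h4 := Psi_antitone hf (abs_pos.2 ht)
      (by simpa using (re_muK_ge (hre t)).2 : |t| ≤ (muK ω (x + t * Complex.I)).re)
    gcongr
    exact h3.trans h4
  have hi : Integrable (fun t : ℝ => ‖Phi f (muK ω (x + t * Complex.I))‖ ^ 2) volume :=
    h1.mono' (hc.norm.pow 2).aestronglyMeasurable
      (by filter_upwards [hle] with t ht; rwa [Real.norm_of_nonneg (by positivity)])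
  exact ⟨hi, (integral_mono_ae hi h1 hle).trans h2⟩

/-- The sum of the squares of the four transforms. -/
def energy (ω : ℝ) (F₁ F₂ G₁ G₂ : R3 → ℂ) (κ : ℂ) : ℝ :=
  ‖Phi F₁ κ‖ ^ 2 + ‖Phi F₂ (muK ω κ)‖ ^ 2 + ‖Phi G₁ κ‖ ^ 2 + ‖Phi G₂ (muK ω κ)‖ ^ 2

theorem integral_energy_le {F₁ F₂ G₁ G₂ : R3 → ℂ} (h1 : Tame F₁) (h2 : Tame F₂) (h3 : Tame G₁)
    (h4 : Tame G₂) {ω x : ℝ} (hω : 0 < ω) (hx0 : 0 ≤ x) (hx : x ^ 2 ≤ ω) :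
    Integrable (fun t : ℝ => energy ω F₁ F₂ G₁ G₂ (x + t * Complex.I)) volume ∧
    ∫ t : ℝ, energy ω F₁ F₂ G₁ G₂ (x + t * Complex.I) ≤
      1 / 2 * (sqn F₁ + sqn F₂ + sqn G₁ + sqn G₂) := by
  obtain ⟨a1, b1⟩ := h1.integral_line_le hx0
  obtain ⟨a2, b2⟩ := integral_muK_le h2.1 hω hx
  obtain ⟨a3, b3⟩ := h3.integral_line_le hx0
  obtain ⟨a4, b4⟩ := integral_muK_le h4.1 hω hx
  refine ⟨((a1.add a2).add a3).add a4, ?_⟩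
  have e := integral_add ((a1.add a2).add a3) a4
  have e' := integral_add (a1.add a2) a3
  have e'' := integral_add a1 a2
  simp only [Pi.add_apply] at e e' e''
  unfold energy
  rw [e, e', e'']
  linarith

/-- A strip to the right of the imaginary axis on which all coefficients are under control. -/
structure StripBounds (σ ω δ K : ℝ) : Prop where
  δ_pos : 0 < δ
  δ_sq : δ ^ 2 ≤ ω
  K_ge : 1 ≤ K
  bound : ∀ κ : ℂ, 0 ≤ κ.re → κ.re ≤ δ →
    ‖κ‖ ≤ K * (1 + |κ.im|) ∧ ‖κ - pp σ ω‖ ≤ K * (1 + |κ.im|) ∧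
    ‖muK ω κ - pp σ ω‖ ≤ K * (1 + |κ.im|) ∧ ‖κ + 1 + pp σ ω‖ ≤ K * (1 + |κ.im|) ∧
    (1 + |κ.im|) ^ 2 ≤ K * ‖det σ ω κ (muK ω κ)‖ ∧ 1 + |κ.im| ≤ K * (muK ω κ).re ∧
    1 + |κ.im| ≤ 2 * ‖κ + 1‖

theorem exists_stripBounds {σ ω : ℝ} (hσ : 1 / Real.sqrt 2 < σ) (hω : 0 < ω) :
    ∃ δ K, StripBounds σ ω δ K := by
  obtain ⟨δ, c, hδ, hδω, hc, hD⟩ := exists_det_lower_bound hσ hω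
  have hσ0 := pos_of_one_div_sqrt_lt hσ
  have hp := pp_pos hσ0 hω
  have hs : 0 < √ω := Real.sqrt_pos.2 hω
  set K := 2 + δ + pp σ ω + 2 * √ω + 2 / c + 1 / √ω
  have hK : 0 < 2 / c ∧ 0 < 1 / √ω := ⟨by positivity, by positivity⟩
  refine ⟨δ, K, hδ, hδω, by simp only [K]; linarith [hK.1, hK.2], fun κ h1 h2 => ?_⟩
  have hκ : κ.re ^ 2 ≤ ω := by nlinarith
  have ht := abs_nonneg κ.im
  have hn : ‖κ‖ ≤ δ + |κ.im| := by
    have := Complex.norm_le_abs_re_add_abs_im κ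
    rw [abs_of_nonneg h1] at this
    linarith
  have hnp : ‖(pp σ ω : ℂ)‖ = pp σ ω := by rw [Complex.norm_real, Real.norm_of_nonneg hp.le]
  have hKt : ∀ a, a ≤ K → a + |κ.im| ≤ K * (1 + |κ.im|) := fun a ha => by
    have : 1 ≤ K := by simp only [K]; linarith [hK.1, hK.2]
    nlinarith
  refine ⟨hn.trans (hKt _ ?_), ?_, ?_, ?_, ?_, ?_, ?_⟩
  · simp only [K]; linarith [hK.1, hK.2]
  · refine (norm_sub_le _ _).trans ?_
    rw [hnp]
    refine le_trans ?_ (hKt (δ + pp σ ω) (by simp only [K]; linarith [hK.1, hK.2]))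
    linarith
  · refine (norm_sub_le _ _).trans ?_
    rw [hnp]
    refine le_trans ?_ (hKt (2 * √ω + pp σ ω) (by simp only [K]; linarith [hK.1, hK.2]))
    linarith [norm_muK_le hκ]
  · refine (norm_add_le _ _).trans ?_
    rw [hnp]
    have := norm_add_le κ 1
    rw [norm_one] at this
    refine le_trans ?_ (hKt (δ + 1 + pp σ ω) (by simp only [K]; linarith [hK.1, hK.2]))
    linarith
  · have h3 := hD κ h1 h2
    have h4 : (1 + |κ.im|) ^ 2 ≤ 2 / c * ‖det σ ω κ (muK ω κ)‖ := by
      have : (1 + |κ.im|) ^ 2 ≤ 2 * (1 + |κ.im| ^ 2) := by nlinarith [sq_nonneg (1 - |κ.im|)]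
      calc _ ≤ 2 * (1 + |κ.im| ^ 2) := this
        _ = 2 / c * (c * (1 + |κ.im| ^ 2)) := by field_simp
        _ ≤ _ := by gcongr
    refine h4.trans ?_
    gcongr
    simp only [K]; linarith [hK.1, hK.2]
  · obtain ⟨h3, h4⟩ := re_muK_ge hκ
    have h5 : 1 ≤ 1 / √ω * (muK ω κ).re := by
      rw [one_div, ← div_eq_inv_mul, le_div_iff₀ hs]; linarith
    have h6 : 0 < (muK ω κ).re := hs.trans_le h3
    have h7 : (1 / √ω + 1) * (muK ω κ).re ≤ K * (muK ω κ).re := by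
      gcongr
      simp only [K]; linarith [hK.1, hK.2]
    linarith
  · have h3 : |κ.im| ≤ ‖κ + 1‖ := by simpa using Complex.abs_im_le_norm (κ + 1)
    have h4 : 1 ≤ ‖κ + 1‖ := by
      have := Complex.re_le_norm (κ + 1)
      simp at this
      linarith
    linarith

/-- The boundary values of the charge part of the resolvent, times `κ`. -/
def axisForm (σ ω : ℝ) (F₁ F₂ G₁ G₂ : R3 → ℂ) (κ : ℂ) : ℂ :=
  κ * singPart σ ω F₁ F₂ G₁ G₂ κ (muK ω κ)

theorem norm_bilin_le (a b c d p q r s : ℂ) {K : ℝ} (hp : ‖p‖ ≤ K) (hq : ‖q‖ ≤ K) (hr : ‖r‖ ≤ K)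
    (hs : ‖s‖ ≤ K) :
    ‖p * (a * c) + q * (b * c) + r * (a * d) + s * (b * d)‖ ≤
      K * (‖a‖ ^ 2 + ‖b‖ ^ 2 + ‖c‖ ^ 2 + ‖d‖ ^ 2) := by
  have hK : 0 ≤ K := (norm_nonneg p).trans hp
  have key : ∀ u v z : ℂ, ‖z‖ ≤ K → ‖z * (u * v)‖ ≤ K * (‖u‖ ^ 2 + ‖v‖ ^ 2) / 2 := fun u v z hz => by
    rw [norm_mul, norm_mul]
    have h1 : ‖u‖ * ‖v‖ ≤ (‖u‖ ^ 2 + ‖v‖ ^ 2) / 2 := by nlinarith [sq_nonneg (‖u‖ - ‖v‖)]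
    calc _ ≤ K * ((‖u‖ ^ 2 + ‖v‖ ^ 2) / 2) := mul_le_mul hz h1 (by positivity) hK
      _ = _ := by ring
  have h1 := norm_add_le (p * (a * c) + q * (b * c) + r * (a * d)) (s * (b * d))
  have h2 := norm_add_le (p * (a * c) + q * (b * c)) (r * (a * d))
  have h3 := norm_add_le (p * (a * c)) (q * (b * c))
  have k1 := key a c p hp
  have k2 := key b c q hq
  have k3 := key a d r hr
  have k4 := key b d s hs
  linarith

namespace StripBounds

theorem det_ne {σ ω δ K : ℝ} (hB : StripBounds σ ω δ K) {κ : ℂ} (h0 : 0 ≤ κ.re) (h1 : κ.re ≤ δ) : det σ ω κ (muK ω κ) ≠ 0 := by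
  intro h
  have := (hB.bound κ h0 h1).2.2.2.2.1
  rw [h, norm_zero, mul_zero] at this
  have := abs_nonneg κ.im
  nlinarith

theorem omega_pos {σ ω δ K : ℝ} (hB : StripBounds σ ω δ K) : 0 < ω := lt_of_lt_of_le (by have := hB.δ_pos; positivity) hB.δ_sq

theorem re_sq_le {σ ω δ K : ℝ} (hB : StripBounds σ ω δ K) {κ : ℂ} (h0 : 0 ≤ κ.re) (h1 : κ.re ≤ δ) : κ.re ^ 2 ≤ ω := by
  have := hB.δ_sq
  nlinarith

/-- Two factors of linear growth are compensated by the quadratic growth of the determinant. -/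
theorem norm_mul_div_det {σ ω δ K : ℝ} (hB : StripBounds σ ω δ K) {κ a b : ℂ} (h0 : 0 ≤ κ.re) (h1 : κ.re ≤ δ) {A : ℝ}
    (ha : ‖a‖ ≤ A * (1 + |κ.im|)) (hb : ‖b‖ ≤ K * (1 + |κ.im|)) (hA : 0 ≤ A) :
    ‖a * b / det σ ω κ (muK ω κ)‖ ≤ A * K ^ 2 := by
  obtain ⟨-, -, -, -, h, -⟩ := hB.bound κ h0 h1
  have hd : 0 < ‖det σ ω κ (muK ω κ)‖ := norm_pos_iff.2 (hB.det_ne h0 h1)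
  have hK := hB.K_ge
  have ht := abs_nonneg κ.im
  rw [norm_div, norm_mul, div_le_iff₀ hd]
  calc _ ≤ (A * (1 + |κ.im|)) * (K * (1 + |κ.im|)) := by gcongr
    _ = A * K * (1 + |κ.im|) ^ 2 := by ring
    _ ≤ A * K * (K * ‖det σ ω κ (muK ω κ)‖) := by gcongr
    _ = _ := by ring

theorem norm_axisForm_le {σ ω δ K : ℝ} (hB : StripBounds σ ω δ K) (F₁ F₂ G₁ G₂ : R3 → ℂ) {κ : ℂ} (h0 : 0 ≤ κ.re) (h1 : κ.re ≤ δ) :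
    ‖axisForm σ ω F₁ F₂ G₁ G₂ κ‖ ≤
      8 * Real.pi * (K ^ 3 * (1 + |dd σ ω|)) * energy ω F₁ F₂ G₁ G₂ κ := by
  obtain ⟨b1, b2, b3, b4, b5, b6, b7⟩ := hB.bound κ h0 h1
  have hK := hB.K_ge
  have ht := abs_nonneg κ.im
  set D := det σ ω κ (muK ω κ)
  have e : axisForm σ ω F₁ F₂ G₁ G₂ κ = 8 * Real.pi * Complex.I *
      ((-(κ * (muK ω κ - pp σ ω) / D)) * (Phi F₁ κ * Phi G₁ κ) +
        (κ * dd σ ω / D) * (Phi F₂ (muK ω κ) * Phi G₁ κ) +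
        (-(κ * dd σ ω / D)) * (Phi F₁ κ * Phi G₂ (muK ω κ)) +
        (κ * (κ - pp σ ω) / D) * (Phi F₂ (muK ω κ) * Phi G₂ (muK ω κ))) := by
    simp only [axisForm, singPart, D]; ring
  have hd : ‖(dd σ ω : ℂ)‖ ≤ |dd σ ω| * (1 + |κ.im|) := by
    rw [Complex.norm_real, Real.norm_eq_abs]
    nlinarith [abs_nonneg (dd σ ω)]
  have hC : K * K ^ 2 ≤ K ^ 3 * (1 + |dd σ ω|) := by
    have := abs_nonneg (dd σ ω)
    have : 0 ≤ K ^ 3 * |dd σ ω| := by positivity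
    nlinarith
  have hC' : |dd σ ω| * K ^ 2 ≤ K ^ 3 * (1 + |dd σ ω|) := by
    have h := abs_nonneg (dd σ ω)
    have : K ^ 2 ≤ K ^ 3 := pow_le_pow_right₀ hK (by norm_num)
    have h3 : 0 ≤ K ^ 3 := by positivity
    nlinarith
  have c1 : ‖-(κ * (muK ω κ - pp σ ω) / D)‖ ≤ K ^ 3 * (1 + |dd σ ω|) := by
    rw [norm_neg]
    exact (hB.norm_mul_div_det h0 h1 b1 b3 (by linarith)).trans hC
  have c2 : ‖κ * dd σ ω / D‖ ≤ K ^ 3 * (1 + |dd σ ω|) := by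
    rw [mul_comm κ]
    exact (hB.norm_mul_div_det h0 h1 hd b1 (abs_nonneg _)).trans hC'
  have c3 : ‖-(κ * dd σ ω / D)‖ ≤ K ^ 3 * (1 + |dd σ ω|) := by rwa [norm_neg]
  have c4 : ‖κ * (κ - pp σ ω) / D‖ ≤ K ^ 3 * (1 + |dd σ ω|) :=
    (hB.norm_mul_div_det h0 h1 b1 b2 (by linarith)).trans hC
  rw [e, norm_mul, mul_assoc (8 * Real.pi)]
  have e8 : ‖(8 * Real.pi * Complex.I : ℂ)‖ = 8 * Real.pi := by
    rw [norm_mul, Complex.norm_I, mul_one, norm_mul, Complex.norm_real,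
      Real.norm_of_nonneg Real.pi_pos.le]; simp
  rw [e8]
  have hpi := Real.pi_pos
  gcongr
  exact norm_bilin_le _ _ _ _ _ _ _ _ c1 c2 c3 c4

theorem differentiableAt_Phi_muK {σ ω δ K : ℝ} (hB : StripBounds σ ω δ K) {F : R3 → ℂ} (hF : MemLp F 2 volume) {κ : ℂ} (h0 : 0 ≤ κ.re)
    (h1 : κ.re ≤ δ) : DifferentiableAt ℂ (fun κ => Phi F (muK ω κ)) κ := by
  have hω := hB.omega_pos
  have h := hB.re_sq_le h0 h1
  exact DifferentiableAt.comp (g := Phi F) (f := muK ω) κ ((MemLp.lapInt hF).differentiableAt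
    (lt_of_lt_of_le (Real.sqrt_pos.2 hω) (re_muK_ge h).1)) (differentiableAt_muK hω h)

theorem differentiableAt_det {σ ω δ K : ℝ} (hB : StripBounds σ ω δ K) {κ : ℂ} (h0 : 0 ≤ κ.re) (h1 : κ.re ≤ δ) :
    DifferentiableAt ℂ (fun κ => det σ ω κ (muK ω κ)) κ := by
  have := differentiableAt_muK hB.omega_pos (hB.re_sq_le h0 h1)
  unfold det
  fun_prop

theorem differentiableAt_axisForm {σ ω δ K : ℝ} (hB : StripBounds σ ω δ K) {F₁ F₂ G₁ G₂ : R3 → ℂ} (h1 : Tame F₁) (h2 : Tame F₂)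
    (h3 : Tame G₁) (h4 : Tame G₂) {κ : ℂ} (k0 : 0 ≤ κ.re) (k1 : κ.re ≤ δ) :
    DifferentiableAt ℂ (axisForm σ ω F₁ F₂ G₁ G₂) κ := by
  have hm := differentiableAt_muK hB.omega_pos (hB.re_sq_le k0 k1)
  have hD := hB.differentiableAt_det k0 k1
  have hD0 := hB.det_ne k0 k1
  have p1 := (h1.lapInt (-1)).differentiableAt (show (-1 : ℝ) < κ.re by linarith)
  have p2 := hB.differentiableAt_Phi_muK h2.1 k0 k1
  have p3 := (h3.lapInt (-1)).differentiableAt (show (-1 : ℝ) < κ.re by linarith)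
  have p4 := hB.differentiableAt_Phi_muK h4.1 k0 k1
  unfold axisForm singPart
  fun_prop (disch := assumption)

/-- All coefficients of the form stay bounded, so the `L²` bounds on the four transforms suffice.
The constant involves only `L²` norms and not the supports, which is what makes the limit `M → ∞` a
bounded form on `L²`. -/
theorem integral_axisForm_le {σ ω δ K : ℝ} (hB : StripBounds σ ω δ K) {F₁ F₂ G₁ G₂ : R3 → ℂ} (h1 : Tame F₁) (h2 : Tame F₂)
    (h3 : Tame G₁) (h4 : Tame G₂) :
    Integrable (fun t : ℝ => axisForm σ ω F₁ F₂ G₁ G₂ (t * Complex.I)) volume ∧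
    ∫ t : ℝ, ‖axisForm σ ω F₁ F₂ G₁ G₂ (t * Complex.I)‖ ≤
      4 * Real.pi * (K ^ 3 * (1 + |dd σ ω|)) * (sqn F₁ + sqn F₂ + sqn G₁ + sqn G₂) := by
  have hω := hB.omega_pos
  have hK := hB.K_ge
  obtain ⟨i1, i2⟩ := integral_energy_le h1 h2 h3 h4 hω (le_refl 0) (by simpa using hω.le)
  simp only [Complex.ofReal_zero, zero_add] at i1 i2
  have hc : Continuous fun t : ℝ => axisForm σ ω F₁ F₂ G₁ G₂ (t * Complex.I) := by
    refine continuous_iff_continuousAt.2 fun t => ?_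
    exact ContinuousAt.comp (g := axisForm σ ω F₁ F₂ G₁ G₂) (f := fun t : ℝ => (t : ℂ) * Complex.I)
      (hB.differentiableAt_axisForm h1 h2 h3 h4 (by simp) (by simpa using hB.δ_pos.le)).continuousAt
      (by fun_prop)
  have hle : ∀ t : ℝ, ‖axisForm σ ω F₁ F₂ G₁ G₂ (t * Complex.I)‖ ≤
      8 * Real.pi * (K ^ 3 * (1 + |dd σ ω|)) * energy ω F₁ F₂ G₁ G₂ (t * Complex.I) := fun t =>
    hB.norm_axisForm_le _ _ _ _ (by simp) (by simpa using hB.δ_pos.le)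
  have hi := (i1.const_mul (8 * Real.pi * (K ^ 3 * (1 + |dd σ ω|)))).mono' hc.aestronglyMeasurable
    (Eventually.of_forall hle)
  refine ⟨hi, (integral_mono hi.norm (i1.const_mul _) hle).trans ?_⟩
  rw [integral_const_mul]
  have : 0 ≤ 8 * Real.pi * (K ^ 3 * (1 + |dd σ ω|)) := by positivity
  calc _ ≤ 8 * Real.pi * (K ^ 3 * (1 + |dd σ ω|)) * (1 / 2 * (sqn F₁ + sqn F₂ + sqn G₁ + sqn G₂)) := by
        gcongr
    _ = _ := by ring

end StripBounds

end PointNLS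
end

noncomputable section
namespace PointNLS

/-! ### The weighted estimate of the limit form -/

theorem tendsto_sqn_exp {f : R3 → ℂ} (hf : MemLp f 2 volume) :
    Tendsto (fun T : ℝ => sqn (fun x => (Real.exp (-T * ‖x‖) : ℂ) * f x)) atTop (𝓝 0) := by
  have h0 : (0 : ℝ) = ∫ _ : R3, (0 : ℝ) := by simp
  rw [h0]
  refine tendsto_integral_filter_of_dominated_convergence (fun x => ‖f x‖ ^ 2) ?_ ?_
    (integrable_sq_norm hf) ?_
  · filter_upwards [eventually_ge_atTop (0 : ℝ)] with T hT
    exact ((memLp_exp_mul hf hT).1.1.norm.pow 2)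
  · filter_upwards [eventually_ge_atTop (0 : ℝ)] with T hT
    refine Eventually.of_forall fun x => ?_
    rw [Real.norm_of_nonneg (by positivity)]
    gcongr
    rw [norm_mul, Complex.norm_real, Real.norm_of_nonneg (Real.exp_pos _).le]
    refine mul_le_of_le_one_left (norm_nonneg _) ?_
    rw [Real.exp_le_one_iff]
    have := mul_nonneg hT (norm_nonneg x)
    linarith
  · filter_upwards [ae_ne_zero] with x hx
    have h1 : Tendsto (fun T : ℝ => Real.exp (-T * ‖x‖)) atTop (𝓝 0) := by
      refine Real.tendsto_exp_atBot.comp ?_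
      simp only [neg_mul]
      exact tendsto_neg_atTop_atBot.comp (tendsto_id.atTop_mul_const (norm_pos_iff.2 hx))
    have h2 : Tendsto (fun T : ℝ => ‖(Real.exp (-T * ‖x‖) : ℂ) * f x‖ ^ 2) atTop
        (𝓝 (‖((0 : ℝ) : ℂ) * f x‖ ^ 2)) :=
      ((((Complex.continuous_ofReal.tendsto _).comp h1).mul_const (f x)).norm).pow 2
    simpa using h2

/-- Products of two transforms with a coefficient analytic in the right half plane integrate to
zero over the imaginary axis. -/
theorem integral_mul_Phi_mul_Phi_eq_zero {F G : R3 → ℂ} (hF : Tame F) (hG : Tame G) {m : ℂ → ℂ}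
    {C : ℝ} (hm : ∀ κ : ℂ, 0 ≤ κ.re → DifferentiableAt ℂ m κ ∧ ‖m κ‖ ≤ C) :
    ∫ t : ℝ, m (t * Complex.I) * (Phi F (t * Complex.I) * Phi G (t * Complex.I)) = 0 := by
  set P : ℂ → ℂ := fun κ => m κ * (Phi F κ * Phi G κ)
  have hC : 0 ≤ C := (norm_nonneg _).trans (hm 0 (by simp)).2
  have hdiff : ∀ κ : ℂ, 0 ≤ κ.re → DifferentiableAt ℂ P κ := fun κ h =>
    (hm κ h).1.mul (((hF.lapInt (-1)).differentiableAt (by linarith)).mul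
      ((hG.lapInt (-1)).differentiableAt (by linarith)))
  have hline : ∀ x : ℝ, 0 ≤ x → Integrable (fun t : ℝ => P (x + t * Complex.I)) volume ∧
      ∫ t : ℝ, ‖P (x + t * Complex.I)‖ ≤ C / 4 * (sqn (fun y => (Real.exp (-x * ‖y‖) : ℂ) * F y) +
        sqn (fun y => (Real.exp (-x * ‖y‖) : ℂ) * G y)) := fun x hx => by
    obtain ⟨i1, b1⟩ := (hF.lapInt (-1)).plancherel (T := x) (by linarith) (memLp_exp_mul hF.1 hx).1
    obtain ⟨i2, b2⟩ := (hG.lapInt (-1)).plancherel (T := x) (by linarith) (memLp_exp_mul hG.1 hx).1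
    have hc : Continuous fun t : ℝ => P (x + t * Complex.I) := continuous_iff_continuousAt.2 fun t =>
      ContinuousAt.comp (g := P) (f := fun t : ℝ => (x : ℂ) + t * Complex.I)
        (hdiff _ (by simpa using hx)).continuousAt (continuous_vertical x).continuousAt
    have hle : ∀ t : ℝ, ‖P (x + t * Complex.I)‖ ≤ C / 2 * (‖Phi F (x + t * Complex.I)‖ ^ 2 +
        ‖Phi G (x + t * Complex.I)‖ ^ 2) := fun t => by
      have h1 := (hm (x + t * Complex.I) (by simpa using hx)).2
      simp only [P, norm_mul]
      set u := ‖Phi F (x + t * Complex.I)‖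
      set v := ‖Phi G (x + t * Complex.I)‖
      calc _ ≤ C * ((u ^ 2 + v ^ 2) / 2) :=
            mul_le_mul h1 (by nlinarith [sq_nonneg (u - v)]) (by positivity) hC
        _ = _ := by ring
    have hi := ((i1.add i2).const_mul (C / 2)).mono' hc.aestronglyMeasurable (Eventually.of_forall hle)
    refine ⟨hi, (integral_mono hi.norm ((i1.add i2).const_mul (C / 2)) hle).trans ?_⟩
    have e := integral_add i1 i2
    simp only [Pi.add_apply]
    rw [integral_const_mul, e]
    calc _ ≤ C / 2 * (1 / 2 * sqn (fun y => (Real.exp (-x * ‖y‖) : ℂ) * F y) +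
          1 / 2 * sqn (fun y => (Real.exp (-x * ‖y‖) : ℂ) * G y)) := by gcongr
      _ = _ := by ring
  have hshift : ∀ T : ℝ, 0 ≤ T → ∫ t : ℝ, P (((0 : ℝ) : ℂ) + t * Complex.I) =
      ∫ t : ℝ, P (T + t * Complex.I) := fun T hT =>
    integral_vertical_eq (C := C / 4 * (sqn F + sqn G)) hT
      (fun κ hκ => (hdiff κ hκ.1).continuousAt.continuousWithinAt) (fun κ h _ => hdiff κ h.le)
      fun x h0 _ => ⟨(hline x h0).1, (hline x h0).2.trans (by
        have := (memLp_exp_mul hF.1 h0).2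
        have := (memLp_exp_mul hG.1 h0).2
        gcongr)⟩
  have hlim : Tendsto (fun T : ℝ => C / 4 * (sqn (fun y => (Real.exp (-T * ‖y‖) : ℂ) * F y) +
      sqn (fun y => (Real.exp (-T * ‖y‖) : ℂ) * G y))) atTop (𝓝 0) := by
    simpa using ((tendsto_sqn_exp hF.1).add (tendsto_sqn_exp hG.1)).const_mul (C / 4)
  -- The integral does not depend on the abscissa `T`, and as `T → ∞` the damping `e^{-T|x|}` sends
  -- the Plancherel bound to zero.
  have hn : ‖∫ t : ℝ, P (((0 : ℝ) : ℂ) + t * Complex.I)‖ ≤ 0 := by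
    refine ge_of_tendsto hlim ?_
    filter_upwards [eventually_ge_atTop (0 : ℝ)] with T hT
    rw [hshift T hT]
    exact (norm_integral_le_integral_norm _).trans (hline T hT).2
  have := norm_le_zero_iff.1 hn
  simpa using this

/-- The coefficient of the `++` term after subtraction of its leading part. -/
def remCoef (σ ω : ℝ) (κ : ℂ) : ℂ :=
  (pp σ ω * (1 + pp σ ω) * (muK ω κ - pp σ ω) + (dd σ ω : ℂ) ^ 2 * (κ + 1 + pp σ ω)) /
    (det σ ω κ (muK ω κ) * (κ + 1))

/-- The part of the form that is integrated along a shifted line. -/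
def shiftForm (σ ω : ℝ) (F₁ F₂ G₁ G₂ : R3 → ℂ) (κ : ℂ) : ℂ :=
  (-remCoef σ ω κ) * (Phi F₁ κ * Phi G₁ κ) +
    (κ * dd σ ω / det σ ω κ (muK ω κ)) * (Phi F₂ (muK ω κ) * Phi G₁ κ) +
    (-(κ * dd σ ω / det σ ω κ (muK ω κ))) * (Phi F₁ κ * Phi G₂ (muK ω κ)) +
    0 * (Phi F₂ (muK ω κ) * Phi G₂ (muK ω κ))

/-- The part of the form that is integrated along the imaginary axis. -/
def decayForm (σ ω : ℝ) (F₂ G₂ : R3 → ℂ) (κ : ℂ) : ℂ :=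
  (κ * (κ - pp σ ω) / det σ ω κ (muK ω κ)) * (Phi F₂ (muK ω κ) * Phi G₂ (muK ω κ))

namespace StripBounds

/-- The decomposition behind the weighted estimate. The coefficient of the product of two transforms
at `κ` is expanded to second order, `κ(μ - p)/D = 1 + p/(κ+1) + O(|κ|⁻²)`; taking `κ + 1` instead of
`κ` keeps the leading part analytic and bounded on the closed right half plane. -/
theorem axisForm_eq {σ ω δ K : ℝ} (hB : StripBounds σ ω δ K) (F₁ F₂ G₁ G₂ : R3 → ℂ) {κ : ℂ}
    (h0 : 0 ≤ κ.re) (h1 : κ.re ≤ δ) :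
    axisForm σ ω F₁ F₂ G₁ G₂ κ = 8 * Real.pi * Complex.I *
      (-((1 + pp σ ω / (κ + 1)) * (Phi F₁ κ * Phi G₁ κ)) + shiftForm σ ω F₁ F₂ G₁ G₂ κ +
        decayForm σ ω F₂ G₂ κ) := by
  have hD := hB.det_ne h0 h1
  have hκ : κ + 1 ≠ 0 := fun h => by
    have := congrArg Complex.re h
    simp at this
    linarith
  have key : κ * (muK ω κ - pp σ ω) / det σ ω κ (muK ω κ) =
      1 + pp σ ω / (κ + 1) + remCoef σ ω κ := by
    rw [remCoef]
    field_simp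
    rw [det]
    ring
  have e : axisForm σ ω F₁ F₂ G₁ G₂ κ = 8 * Real.pi * Complex.I *
      ((-(κ * (muK ω κ - pp σ ω) / det σ ω κ (muK ω κ))) * (Phi F₁ κ * Phi G₁ κ) +
        (κ * dd σ ω / det σ ω κ (muK ω κ)) * (Phi F₂ (muK ω κ) * Phi G₁ κ) +
        (-(κ * dd σ ω / det σ ω κ (muK ω κ))) * (Phi F₁ κ * Phi G₂ (muK ω κ)) +
        (κ * (κ - pp σ ω) / det σ ω κ (muK ω κ)) * (Phi F₂ (muK ω κ) * Phi G₂ (muK ω κ))) := by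
    simp only [axisForm, singPart]; ring
  rw [e, key, shiftForm, decayForm]
  ring

/-- The numerator grows linearly and the denominator cubically. One order less in the expansion
would leave `1/|κ|`, which is not integrable. -/
theorem norm_remCoef_le {σ ω δ K : ℝ} (hB : StripBounds σ ω δ K) {κ : ℂ}
    (h0 : 0 ≤ κ.re) (h1 : κ.re ≤ δ) :
    ‖remCoef σ ω κ‖ ≤ 2 * K ^ 2 * (|pp σ ω| * (1 + |pp σ ω|) + |dd σ ω| ^ 2) / (1 + |κ.im|) ^ 2 := by
  obtain ⟨-, -, b3, b4, b5, -, b7⟩ := hB.bound κ h0 h1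
  have hK := hB.K_ge
  have ht := abs_nonneg κ.im
  set q := 1 + |κ.im|
  have hq : 0 < q := by positivity
  have hd : 0 < ‖det σ ω κ (muK ω κ)‖ := norm_pos_iff.2 (hB.det_ne h0 h1)
  have hk : 0 < ‖κ + 1‖ := by linarith
  have hnum : ‖pp σ ω * (1 + pp σ ω) * (muK ω κ - pp σ ω) + (dd σ ω : ℂ) ^ 2 * (κ + 1 + pp σ ω)‖ ≤
      (|pp σ ω| * (1 + |pp σ ω|) + |dd σ ω| ^ 2) * (K * q) := by
    refine (norm_add_le _ _).trans ?_
    rw [norm_mul, norm_mul, norm_mul, norm_pow, Complex.norm_real, Complex.norm_real,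
      Real.norm_eq_abs, Real.norm_eq_abs]
    have h2 : ‖(1 : ℂ) + pp σ ω‖ ≤ 1 + |pp σ ω| := by
      refine (norm_add_le _ _).trans ?_
      rw [norm_one, Complex.norm_real, Real.norm_eq_abs]
    calc _ ≤ |pp σ ω| * (1 + |pp σ ω|) * (K * q) + |dd σ ω| ^ 2 * (K * q) := by gcongr
      _ = _ := by ring
  rw [remCoef, norm_div, norm_mul, div_le_div_iff₀ (by positivity) (by positivity)]
  set A := |pp σ ω| * (1 + |pp σ ω|) + |dd σ ω| ^ 2
  have hA : 0 ≤ A := by positivity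
  calc _ ≤ A * (K * q) * q ^ 2 := by gcongr
    _ = A * K * (q * q ^ 2) := by ring
    _ ≤ A * K * (2 * ‖κ + 1‖ * (K * ‖det σ ω κ (muK ω κ)‖)) := by gcongr
    _ = _ := by ring

theorem norm_offdiag_le {σ ω δ K : ℝ} (hB : StripBounds σ ω δ K) {κ : ℂ}
    (h0 : 0 ≤ κ.re) (h1 : κ.re ≤ δ) :
    ‖κ * dd σ ω / det σ ω κ (muK ω κ)‖ ≤ K ^ 2 * |dd σ ω| / (1 + |κ.im|) := by
  obtain ⟨b1, -, -, -, b5, -, -⟩ := hB.bound κ h0 h1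
  have hK := hB.K_ge
  have ht := abs_nonneg κ.im
  set q := 1 + |κ.im|
  have hq : 0 < q := by positivity
  have hd : 0 < ‖det σ ω κ (muK ω κ)‖ := norm_pos_iff.2 (hB.det_ne h0 h1)
  rw [norm_div, norm_mul, Complex.norm_real, Real.norm_eq_abs, div_le_div_iff₀ hd hq]
  calc _ ≤ K * q * |dd σ ω| * q := by gcongr
    _ = K * |dd σ ω| * q ^ 2 := by ring
    _ ≤ K * |dd σ ω| * (K * ‖det σ ω κ (muK ω κ)‖) := by gcongr
    _ = _ := by ring

theorem differentiableAt_shiftForm {σ ω δ K : ℝ} (hB : StripBounds σ ω δ K)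
    {F₁ F₂ G₁ G₂ : R3 → ℂ} (h1 : Tame F₁) (h2 : Tame F₂)
    (h3 : Tame G₁) (h4 : Tame G₂) {κ : ℂ} (k0 : 0 ≤ κ.re) (k1 : κ.re ≤ δ) :
    DifferentiableAt ℂ (shiftForm σ ω F₁ F₂ G₁ G₂) κ := by
  have hm := differentiableAt_muK hB.omega_pos (hB.re_sq_le k0 k1)
  have hD := hB.differentiableAt_det k0 k1
  have hD0 := hB.det_ne k0 k1
  have p1 := (h1.lapInt (-1)).differentiableAt (show (-1 : ℝ) < κ.re by linarith)
  have p2 := hB.differentiableAt_Phi_muK h2.1 k0 k1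
  have p3 := (h3.lapInt (-1)).differentiableAt (show (-1 : ℝ) < κ.re by linarith)
  have p4 := hB.differentiableAt_Phi_muK h4.1 k0 k1
  have hκ : det σ ω κ (muK ω κ) * (κ + 1) ≠ 0 := by
    refine mul_ne_zero hD0 fun h => ?_
    have := congrArg Complex.re h
    simp at this
    linarith
  unfold shiftForm remCoef
  fun_prop (disch := assumption)

/-- The terms that contain a transform at `κ` are moved off the axis to `Re κ = δ`, where such
transforms are bounded in the weighted norm. The strip is free of zeros of the determinant, and the
`L²` energy bound justifies the shift. -/
theorem integral_shiftForm_eq {σ ω δ K : ℝ} (hB : StripBounds σ ω δ K)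
    {F₁ F₂ G₁ G₂ : R3 → ℂ} (h1 : Tame F₁) (h2 : Tame F₂) (h3 : Tame G₁) (h4 : Tame G₂) :
    Integrable (fun t : ℝ => shiftForm σ ω F₁ F₂ G₁ G₂ (t * Complex.I)) volume ∧
    ∫ t : ℝ, shiftForm σ ω F₁ F₂ G₁ G₂ (t * Complex.I) =
      ∫ t : ℝ, shiftForm σ ω F₁ F₂ G₁ G₂ (δ + t * Complex.I) := by
  have hω := hB.omega_pos
  have hδ := hB.δ_pos
  have hK := hB.K_ge
  set M := 2 * K ^ 2 * (|pp σ ω| * (1 + |pp σ ω|) + |dd σ ω| ^ 2) + K ^ 2 * |dd σ ω|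
  have hM : 0 ≤ M := by positivity
  have hle : ∀ κ : ℂ, 0 ≤ κ.re → κ.re ≤ δ → ‖shiftForm σ ω F₁ F₂ G₁ G₂ κ‖ ≤
      M * energy ω F₁ F₂ G₁ G₂ κ := fun κ k0 k1 => by
    have hq : 1 ≤ 1 + |κ.im| := by linarith [abs_nonneg κ.im]
    have c1 : ‖-remCoef σ ω κ‖ ≤ M := by
      rw [norm_neg]
      refine (hB.norm_remCoef_le k0 k1).trans ?_
      refine (div_le_self (by positivity) (one_le_pow₀ hq)).trans ?_
      simp only [M]
      have : 0 ≤ K ^ 2 * |dd σ ω| := by positivity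
      linarith
    have c2 : ‖κ * dd σ ω / det σ ω κ (muK ω κ)‖ ≤ M := by
      refine (hB.norm_offdiag_le k0 k1).trans ?_
      refine (div_le_self (by positivity) hq).trans ?_
      simp only [M]
      have : 0 ≤ 2 * K ^ 2 * (|pp σ ω| * (1 + |pp σ ω|) + |dd σ ω| ^ 2) := by positivity
      linarith
    exact norm_bilin_le _ _ _ _ _ _ _ _ c1 c2 (by rwa [norm_neg]) (by simpa using hM)
  have hline : ∀ x : ℝ, 0 ≤ x → x ≤ δ →
      Integrable (fun t : ℝ => shiftForm σ ω F₁ F₂ G₁ G₂ (x + t * Complex.I)) volume ∧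
      ∫ t : ℝ, ‖shiftForm σ ω F₁ F₂ G₁ G₂ (x + t * Complex.I)‖ ≤
        M * (1 / 2 * (sqn F₁ + sqn F₂ + sqn G₁ + sqn G₂)) := fun x k0 k1 => by
    obtain ⟨i1, i2⟩ := integral_energy_le h1 h2 h3 h4 hω k0 (by nlinarith [hB.δ_sq])
    have hc : Continuous fun t : ℝ => shiftForm σ ω F₁ F₂ G₁ G₂ (x + t * Complex.I) :=
      continuous_iff_continuousAt.2 fun t =>
        ContinuousAt.comp (g := shiftForm σ ω F₁ F₂ G₁ G₂) (f := fun t : ℝ => (x : ℂ) + t * Complex.I)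
        (hB.differentiableAt_shiftForm h1 h2 h3 h4 (by simpa using k0) (by simpa using k1)).continuousAt
        (continuous_vertical x).continuousAt
    have hle' := fun t : ℝ => hle (x + t * Complex.I) (by simpa using k0) (by simpa using k1)
    have hi := (i1.const_mul M).mono' hc.aestronglyMeasurable (Eventually.of_forall hle')
    refine ⟨hi, (integral_mono hi.norm (i1.const_mul M) hle').trans ?_⟩
    rw [integral_const_mul]
    gcongr
  have h := integral_vertical_eq (F := shiftForm σ ω F₁ F₂ G₁ G₂) hδ.le
    (fun κ hκ => (hB.differentiableAt_shiftForm h1 h2 h3 h4 hκ.1 hκ.2).continuousAt.continuousWithinAt)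
    (fun κ k0 k1 => hB.differentiableAt_shiftForm h1 h2 h3 h4 k0.le k1.le) hline
  have h0 := (hline 0 le_rfl hδ.le).1
  simp only [Complex.ofReal_zero, zero_add] at h h0
  exact ⟨h0, h⟩

/-- The weighted bound `A(1/Re μ + 1/(Re μ)²)` inherits decay from `Re μ ≥ (1 + |Im κ|)/K`,
uniformly up to the imaginary `κ`-axis. -/
theorem norm_Phi_muK_le {σ ω δ K : ℝ} (hB : StripBounds σ ω δ K) {F : R3 → ℂ} {A : ℝ}
    (hF : AEStronglyMeasurable F volume) (hA : ∀ᵐ x, ‖F x‖ ≤ A * w x) (hA0 : 0 ≤ A) {κ : ℂ}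
    (k0 : 0 ≤ κ.re) (k1 : κ.re ≤ δ) : ‖Phi F (muK ω κ)‖ ≤ 2 * K ^ 2 * A / (1 + |κ.im|) := by
  obtain ⟨-, -, -, -, -, b6, -⟩ := hB.bound κ k0 k1
  have hK := hB.K_ge
  have ht := abs_nonneg κ.im
  set q := 1 + |κ.im|
  have hq : 1 ≤ q := by simp only [q]; linarith
  have hr : 0 < (muK ω κ).re := by
    by_contra hc
    push Not at hc
    nlinarith
  refine (norm_Phi_le_of_weight hF hA hr).trans ?_
  have e1 : 1 / (muK ω κ).re ≤ K / q := by
    rw [div_le_div_iff₀ hr (by positivity)]; linarith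
  have e2 : 1 / (muK ω κ).re ^ 2 ≤ K ^ 2 / q := by
    calc 1 / (muK ω κ).re ^ 2 = (1 / (muK ω κ).re) ^ 2 := by rw [div_pow, one_pow]
      _ ≤ (K / q) ^ 2 := by gcongr
      _ = K ^ 2 / q / q := by rw [div_pow, sq q, div_div]
      _ ≤ _ := div_le_self (by positivity) hq
  have e3 : K / q ≤ K ^ 2 / q := by
    gcongr
    nlinarith
  calc _ ≤ A * (K ^ 2 / q + K ^ 2 / q) :=
        mul_le_mul_of_nonneg_left (add_le_add (e1.trans e3) e2) hA0
    _ = _ := by ring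

theorem integrable_inv_sq : Integrable (fun t : ℝ => 1 / (1 + |t|) ^ 2) volume := by
  have h := integrable_inv_one_add_sq
  refine h.mono' ?_ (Eventually.of_forall fun t => ?_)
  · have : Measurable fun t : ℝ => 1 / (1 + |t|) ^ 2 := by fun_prop
    exact this.aestronglyMeasurable
  · rw [Real.norm_of_nonneg (by positivity), one_div]
    refine inv_anti₀ (by positivity) ?_
    have := abs_nonneg t
    nlinarith [sq_abs t]

/-- The estimate of the form in the weighted sup norms. -/
theorem exists_weighted_bound {σ ω δ K : ℝ} (hB : StripBounds σ ω δ K) :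
    ∃ C : ℝ, 0 ≤ C ∧ ∀ (F₁ F₂ G₁ G₂ : R3 → ℂ) (A B : ℝ), Tame F₁ → Tame F₂ → Tame G₁ → Tame G₂ →
      0 ≤ A → 0 ≤ B → (∀ᵐ x, ‖F₁ x‖ ≤ A * w x) → (∀ᵐ x, ‖F₂ x‖ ≤ A * w x) →
      (∀ᵐ x, ‖G₁ x‖ ≤ B * w x) → (∀ᵐ x, ‖G₂ x‖ ≤ B * w x) →
      ‖∫ t : ℝ, axisForm σ ω F₁ F₂ G₁ G₂ (t * Complex.I)‖ ≤ C * (A * B) := by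
  have hω := hB.omega_pos
  have hδ := hB.δ_pos
  have hK := hB.K_ge
  -- `m` is the constant of `norm_Phi_le_of_weight` on the line `Re κ = δ`.
  set m := 1 / δ + 1 / δ ^ 2
  have hm : 0 < m := by positivity
  set c₁ := 2 * K ^ 2 * (|pp σ ω| * (1 + |pp σ ω|) + |dd σ ω| ^ 2)
  have hc₁ : 0 ≤ c₁ := by positivity
  set c₂ := K ^ 2 * |dd σ ω|
  have hc₂ : 0 ≤ c₂ := by positivity
  set I₀ := ∫ t : ℝ, 1 / (1 + |t|) ^ 2
  have hI₀ : 0 ≤ I₀ := integral_nonneg fun t => by positivity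
  -- `Q₁` collects the remainder and the two mixed terms on the shifted line, and `Q₂` the product
  -- of two transforms at `μ` on the axis; each multiplies the integrable function `1/(1 + |t|)²`.
  set Q₁ := c₁ * m ^ 2 + 2 * (c₂ * (2 * K ^ 2) * m)
  set Q₂ := K ^ 3 * (2 * K ^ 2) ^ 2
  refine ⟨8 * Real.pi * (Q₁ * I₀ + Q₂ * I₀), by positivity, ?_⟩
  intro F₁ F₂ G₁ G₂ A B h1 h2 h3 h4 hA hB0 w1 w2 w3 w4
  have hcd : ∀ t : ℝ, 0 ≤ ((t : ℂ) * Complex.I).re ∧ ((t : ℂ) * Complex.I).re ≤ δ := fun t => by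
    simp [hδ.le]
  obtain ⟨i1, e1⟩ := hB.integral_shiftForm_eq h1 h2 h3 h4
  -- the shifted part
  have s1 : ‖∫ t : ℝ, shiftForm σ ω F₁ F₂ G₁ G₂ (δ + t * Complex.I)‖ ≤ Q₁ * (A * B) * I₀ := by
    rw [← integral_const_mul]
    refine norm_integral_le_of_norm_le (integrable_inv_sq.const_mul _) (Eventually.of_forall fun t => ?_)
    set κ : ℂ := δ + t * Complex.I
    have k0 : 0 ≤ κ.re := by simp [κ, hδ.le]
    have k1 : κ.re ≤ δ := by simp [κ]
    have kr : κ.re = δ := by simp [κ]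
    have ki : κ.im = t := by simp [κ]
    have a1 := hB.norm_remCoef_le k0 k1
    have a2 := hB.norm_offdiag_le k0 k1
    have p1 := norm_Phi_le_of_weight h1.1.1 w1 (κ := κ) (by rw [kr]; exact hδ)
    have p3 := norm_Phi_le_of_weight h3.1.1 w3 (κ := κ) (by rw [kr]; exact hδ)
    have p2 := hB.norm_Phi_muK_le h2.1.1 w2 hA k0 k1
    have p4 := hB.norm_Phi_muK_le h4.1.1 w4 hB0 k0 k1
    rw [kr] at p1 p3
    rw [ki] at a1 a2 p2 p4
    set q := 1 + |t|
    have hq : 0 < q := by have := abs_nonneg t; positivity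
    rw [shiftForm, zero_mul, add_zero]
    have t1 : ‖-remCoef σ ω κ * (Phi F₁ κ * Phi G₁ κ)‖ ≤ c₁ / q ^ 2 * ((A * m) * (B * m)) := by
      rw [norm_mul, norm_mul, norm_neg]
      gcongr
    have t2 : ‖κ * dd σ ω / det σ ω κ (muK ω κ) * (Phi F₂ (muK ω κ) * Phi G₁ κ)‖ ≤
        c₂ / q * ((2 * K ^ 2 * A / q) * (B * m)) := by
      rw [norm_mul, norm_mul]
      gcongr
    have t3 : ‖-(κ * dd σ ω / det σ ω κ (muK ω κ)) * (Phi F₁ κ * Phi G₂ (muK ω κ))‖ ≤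
        c₂ / q * ((A * m) * (2 * K ^ 2 * B / q)) := by
      rw [norm_mul, norm_mul, norm_neg]
      gcongr
    refine (norm_add_le _ _).trans ((add_le_add (norm_add_le _ _) le_rfl).trans ?_)
    refine (add_le_add (add_le_add t1 t2) t3).trans (le_of_eq ?_)
    simp only [Q₁]
    field_simp
    ring
  -- the part on the axis
  have d0 : ∀ t : ℝ, ‖decayForm σ ω F₂ G₂ (t * Complex.I)‖ ≤ Q₂ * (A * B) * (1 / (1 + |t|) ^ 2) :=
    fun t => by
    obtain ⟨k0, k1⟩ := hcd t
    have ki : ((t : ℂ) * Complex.I).im = t := by simp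
    have p2 := hB.norm_Phi_muK_le h2.1.1 w2 hA k0 k1
    have p4 := hB.norm_Phi_muK_le h4.1.1 w4 hB0 k0 k1
    obtain ⟨b1, b2, -⟩ := hB.bound _ k0 k1
    have a1 := hB.norm_mul_div_det k0 k1 b1 b2 (by linarith)
    rw [ki] at p2 p4
    set q := 1 + |t|
    have hq : 0 < q := by have := abs_nonneg t; positivity
    rw [decayForm, norm_mul, norm_mul]
    calc _ ≤ K * K ^ 2 * ((2 * K ^ 2 * A / q) * (2 * K ^ 2 * B / q)) := by gcongr
      _ = _ := by simp only [Q₂]; field_simp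
  have dc : Continuous fun t : ℝ => decayForm σ ω F₂ G₂ (t * Complex.I) := by
    refine continuous_iff_continuousAt.2 fun t => ?_
    refine ContinuousAt.comp (g := decayForm σ ω F₂ G₂) (f := fun t : ℝ => (t : ℂ) * Complex.I)
      (DifferentiableAt.continuousAt (𝕜 := ℂ) ?_) (by fun_prop)
    obtain ⟨k0, k1⟩ := hcd t
    have hD := hB.differentiableAt_det k0 k1
    have hD0 := hB.det_ne k0 k1
    have p2 := hB.differentiableAt_Phi_muK h2.1 k0 k1
    have p4 := hB.differentiableAt_Phi_muK h4.1 k0 k1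
    unfold decayForm
    fun_prop (disch := assumption)
  have di : Integrable (fun t : ℝ => decayForm σ ω F₂ G₂ (t * Complex.I)) volume :=
    (integrable_inv_sq.const_mul (Q₂ * (A * B))).mono' dc.aestronglyMeasurable (Eventually.of_forall d0)
  have s2 : ‖∫ t : ℝ, decayForm σ ω F₂ G₂ (t * Complex.I)‖ ≤ Q₂ * (A * B) * I₀ := by
    rw [← integral_const_mul]
    exact norm_integral_le_of_norm_le (integrable_inv_sq.const_mul _) (Eventually.of_forall d0)
  -- the vanishing part
  have z0 := integral_mul_Phi_mul_Phi_eq_zero h1 h3 (m := fun κ => 1 + pp σ ω / (κ + 1))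
    (C := 1 + |pp σ ω|) (fun κ hκ => by
      have hne : κ + 1 ≠ 0 := fun h => by
        have := congrArg Complex.re h
        simp at this
        linarith
      refine ⟨by fun_prop (disch := assumption), (norm_add_le _ _).trans ?_⟩
      rw [norm_one, norm_div, Complex.norm_real, Real.norm_eq_abs]
      have h5 : 1 ≤ ‖κ + 1‖ := by
        have := Complex.re_le_norm (κ + 1)
        simp at this
        linarith
      have := div_le_self (abs_nonneg (pp σ ω)) h5
      linarith)
  have ia := (hB.integral_axisForm_le h1 h2 h3 h4).1
  have hpt := fun t : ℝ => hB.axisForm_eq F₁ F₂ G₁ G₂ (hcd t).1 (hcd t).2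
  have hne : (8 * Real.pi * Complex.I : ℂ) ≠ 0 := by
    have : (Real.pi : ℂ) ≠ 0 := by exact_mod_cast Real.pi_ne_zero
    simp [this]
  -- Integrability of the vanishing part is read off from the decomposition, the other three
  -- functions in it being integrable.
  have iz : Integrable (fun t : ℝ => (1 + pp σ ω / ((t : ℂ) * Complex.I + 1)) *
      (Phi F₁ (t * Complex.I) * Phi G₁ (t * Complex.I))) volume := by
    refine ((i1.add di).sub (ia.const_mul (8 * Real.pi * Complex.I)⁻¹)).congr
      (Eventually.of_forall fun t => ?_)
    simp only [Pi.add_apply, Pi.sub_apply, hpt]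
    rw [inv_mul_cancel_left₀ hne]
    ring
  have etot : ∫ t : ℝ, axisForm σ ω F₁ F₂ G₁ G₂ (t * Complex.I) = 8 * Real.pi * Complex.I *
      ((∫ t : ℝ, shiftForm σ ω F₁ F₂ G₁ G₂ (t * Complex.I)) +
        ∫ t : ℝ, decayForm σ ω F₂ G₂ (t * Complex.I)) := by
    simp only [hpt]
    have x1 := integral_add (iz.neg.add i1) di
    have x2 := integral_add iz.neg i1
    simp only [Pi.add_apply, Pi.neg_apply] at x1 x2
    rw [integral_const_mul, x1, x2, integral_neg, z0, neg_zero, zero_add]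
  rw [etot, norm_mul, e1]
  have e8 : ‖(8 * Real.pi * Complex.I : ℂ)‖ = 8 * Real.pi := by
    rw [norm_mul, Complex.norm_I, mul_one, norm_mul, Complex.norm_real,
      Real.norm_of_nonneg Real.pi_pos.le]; simp
  rw [e8]
  have hpi := Real.pi_pos
  calc _ ≤ 8 * Real.pi * (Q₁ * (A * B) * I₀ + Q₂ * (A * B) * I₀) := by
        gcongr
        exact (norm_add_le _ _).trans (add_le_add s1 s2)
    _ = _ := by ring

end StripBounds

end PointNLS
end

noncomputable section
namespace PointNLS

/-! ### The parameter `κ` as a function of the spectral parameter -/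

/-- The root `κ` of `κ² = ω + iλ` in the right half plane, for `λ` in the right half plane. -/
def kL (ω : ℝ) (z : ℂ) : ℂ := (1 + Complex.I) / (√2 : ℝ) * csq (z - ω * Complex.I)

theorem kL_sq (ω : ℝ) (z : ℂ) : kL ω z ^ 2 = ω + Complex.I * z := by
  have h2 : ((√2 : ℝ) : ℂ) ^ 2 = 2 := by
    rw [← Complex.ofReal_pow, Real.sq_sqrt (by norm_num)]; norm_num
  rw [kL, mul_pow, csq_sq, div_pow, h2]
  linear_combination ((z - ω * Complex.I) / 2 - ω) * Complex.I_sq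

theorem continuousAt_kL (ω : ℝ) {z : ℂ} (h : 0 ≤ z.re) : ContinuousAt (kL ω) z := by
  have h1 : ContinuousAt csq (z - ω * Complex.I) := continuousAt_csq (by simpa using h)
  exact continuousAt_const.mul (ContinuousAt.comp (g := csq) (f := fun z => z - ω * Complex.I) h1
    (by fun_prop))

theorem differentiableAt_kL (ω : ℝ) {z : ℂ} (h : 0 < z.re) : DifferentiableAt ℂ (kL ω) z := by
  have h1 : DifferentiableAt ℂ csq (z - ω * Complex.I) := differentiableAt_csq (by simpa using h)
  exact (DifferentiableAt.comp (g := csq) (f := fun z => z - ω * Complex.I) z h1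
    (by fun_prop)).const_mul _

/-- The position of `κ` in the quadrant, for `λ` to the right of the upper branch. -/
theorem kL_re_im {ω : ℝ} {z : ℂ} (h : 0 ≤ z.re) (hω : ω ≤ z.im) :
    0 ≤ (kL ω z).re ∧ 0 ≤ (kL ω z).im ∧ 2 * ((kL ω z).re * (kL ω z).im) = z.re ∧
      (kL ω z).im ^ 2 - (kL ω z).re ^ 2 = z.im - ω := by
  set c := csq (z - ω * Complex.I) with hc
  have a0 : 0 ≤ c.re := re_csq_nonneg _
  have e1 : c.re ^ 2 - c.im ^ 2 = z.re := by rw [hc, re_csq_sq_sub]; simp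
  have e2 : 2 * (c.re * c.im) = z.im - ω := by rw [hc, re_mul_im_csq]; simp
  have b0 : 0 ≤ c.im := by
    by_contra hneg
    push Not at hneg
    rcases a0.lt_or_eq with ha | ha
    · nlinarith [mul_pos ha (neg_pos.2 hneg)]
    · rw [← ha] at e1; nlinarith
  have hba : c.im ≤ c.re := by nlinarith
  have hs : (0 : ℝ) < √2 := by positivity
  have hs2 : √2 ^ 2 = 2 := Real.sq_sqrt (by norm_num)
  have er : (kL ω z).re = (c.re - c.im) / √2 := by
    rw [kL, ← hc, div_mul_eq_mul_div, Complex.div_ofReal_re]; simp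
  have ei : (kL ω z).im = (c.re + c.im) / √2 := by
    rw [kL, ← hc, div_mul_eq_mul_div, Complex.div_ofReal_im]; simp; ring
  have hsq := kL_sq ω z
  have s1 := congrArg Complex.re hsq
  have s2 := congrArg Complex.im hsq
  simp [sq] at s1 s2
  refine ⟨?_, ?_, ?_, ?_⟩
  · rw [er]; apply div_nonneg <;> linarith
  · rw [ei]; apply div_nonneg <;> linarith
  · linarith
  · nlinarith

theorem re_kL_sq_le {ω : ℝ} {z : ℂ} (h : 0 ≤ z.re) (hω : ω ≤ z.im) : (kL ω z).re ^ 2 ≤ z.re := by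
  obtain ⟨h1, h2, h3, h4⟩ := kL_re_im h hω
  have : (kL ω z).re ≤ (kL ω z).im := by nlinarith
  nlinarith [mul_nonneg h1 h2]

theorem re_kL_le {ω δ : ℝ} (hδ : 0 ≤ δ) {z : ℂ} (h : 0 ≤ z.re) (hω : ω ≤ z.im) (hz : z.re ≤ δ ^ 2) :
    (kL ω z).re ≤ δ := abs_le_of_sq_le_sq' ((re_kL_sq_le h hω).trans hz) hδ |>.2

/-- From `2 Re κ Im κ = Re z` and `Im κ ≤ S`, the latter because `(Im κ)² = (Re κ)² + Im z - ω ≤ Re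
z + Im z - ω`. Thus at bounded height `Re κ` is at least proportional to the distance from the
contour, even near the threshold. -/
theorem re_kL_ge {ω S : ℝ} {z : ℂ} (h : 0 ≤ z.re) (hω : ω ≤ z.im) (hS : 0 < S)
    (hz : z.im - ω + z.re ≤ S ^ 2) : z.re / (2 * S) ≤ (kL ω z).re := by
  obtain ⟨h1, h2, h3, h4⟩ := kL_re_im h hω
  have h5 := re_kL_sq_le h hω
  have : (kL ω z).im ≤ S := abs_le_of_sq_le_sq' (by linarith) hS.le |>.2
  rw [div_le_iff₀ (by positivity), ← h3]
  nlinarith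

theorem re_kL_pos {ω : ℝ} {z : ℂ} (h : 0 < z.re) (hω : ω ≤ z.im) : 0 < (kL ω z).re := by
  obtain ⟨h1, h2, h3, h4⟩ := kL_re_im h.le hω
  rcases h1.lt_or_eq with h' | h'
  · exact h'
  · rw [← h'] at h3; simp at h3; linarith

theorem kL_boundary {ω η : ℝ} (h : ω ≤ η) : kL ω (η * Complex.I) = (√(η - ω) : ℝ) * Complex.I := by
  obtain ⟨h1, h2, h3, h4⟩ := kL_re_im (ω := ω) (z := η * Complex.I) (by simp) (by simpa using h)
  have e : ((η : ℂ) * Complex.I).im = η := by simp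
  have e' : ((η : ℂ) * Complex.I).re = 0 := by simp
  rw [e] at h4
  rw [e'] at h3
  have hr : (kL ω (η * Complex.I)).re = 0 := by
    rcases mul_eq_zero.1 (by linarith : (kL ω (η * Complex.I)).re * (kL ω (η * Complex.I)).im = 0)
      with h0 | h0
    · exact h0
    · rw [h0] at h4; nlinarith
  rw [hr] at h4
  have hi : (kL ω (η * Complex.I)).im = √(η - ω) := by
    rw [← h4]; simp [Real.sqrt_sq h2]
  apply Complex.ext
  · rw [hr]; simp
  · rw [hi]; simp

theorem muK_kL_sq (ω : ℝ) (z : ℂ) : muK ω (kL ω z) ^ 2 = ω - Complex.I * z := by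
  rw [muK, csq_sq, kL_sq]; ring

/-- The charge part of the resolvent as a function of the spectral parameter. -/
def singL (σ ω : ℝ) (F₁ F₂ G₁ G₂ : R3 → ℂ) (z : ℂ) : ℂ :=
  singPart σ ω F₁ F₂ G₁ G₂ (kL ω z) (muK ω (kL ω z))

theorem energy_le {ω : ℝ} {F₁ F₂ G₁ G₂ : R3 → ℂ} (h1 : MemLp F₁ 2 volume)
    (h2 : MemLp F₂ 2 volume) (h3 : MemLp G₁ 2 volume) (h4 : MemLp G₂ 2 volume) (hω : 0 < ω)
    {κ : ℂ} (hκ : κ.re ^ 2 ≤ ω) {t : ℝ} (ht : 0 < t) (htκ : t ≤ κ.re) :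
    energy ω F₁ F₂ G₁ G₂ κ ≤ Psi F₁ t ^ 2 + Psi G₁ t ^ 2 +
      1 / (8 * Real.pi * √ω) * (sqn F₂ + sqn G₂) := by
  have hs : 0 < √ω := Real.sqrt_pos.2 hω
  have key : ∀ {F : R3 → ℂ}, MemLp F 2 volume → ‖Phi F κ‖ ^ 2 ≤ Psi F t ^ 2 := fun hF =>
    pow_le_pow_left₀ (norm_nonneg _) ((norm_Phi_le _ _).trans (Psi_antitone hF ht htκ)) 2
  have key' : ∀ {F : R3 → ℂ}, MemLp F 2 volume →
      ‖Phi F (muK ω κ)‖ ^ 2 ≤ 1 / (8 * Real.pi * √ω) * sqn F := fun {F} hF =>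
    (pow_le_pow_left₀ (norm_nonneg _) ((norm_Phi_le _ _).trans
      (Psi_antitone hF hs (re_muK_ge hκ).1)) 2).trans (sq_Psi_le hF hs)
  have := key h1
  have := key h3
  have := key' h2
  have := key' h4
  unfold energy
  linarith

namespace StripBounds

theorem norm_singPart_le {σ ω δ K : ℝ} (hB : StripBounds σ ω δ K) (F₁ F₂ G₁ G₂ : R3 → ℂ) {κ : ℂ}
    (h0 : 0 ≤ κ.re) (h1 : κ.re ≤ δ) :
    ‖singPart σ ω F₁ F₂ G₁ G₂ κ (muK ω κ)‖ ≤
      8 * Real.pi * ((1 + |dd σ ω|) * K ^ 2) * energy ω F₁ F₂ G₁ G₂ κ := by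
  obtain ⟨b1, b2, b3, b4, b5, b6, b7⟩ := hB.bound κ h0 h1
  have hK := hB.K_ge
  have ht := abs_nonneg κ.im
  have hd0 := abs_nonneg (dd σ ω)
  set D := det σ ω κ (muK ω κ)
  have e : singPart σ ω F₁ F₂ G₁ G₂ κ (muK ω κ) = 8 * Real.pi * Complex.I *
      ((-(1 * (muK ω κ - pp σ ω) / D)) * (Phi F₁ κ * Phi G₁ κ) +
        (dd σ ω * 1 / D) * (Phi F₂ (muK ω κ) * Phi G₁ κ) +
        (-(dd σ ω * 1 / D)) * (Phi F₁ κ * Phi G₂ (muK ω κ)) +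
        (1 * (κ - pp σ ω) / D) * (Phi F₂ (muK ω κ) * Phi G₂ (muK ω κ))) := by
    simp only [singPart, D]; ring
  have hd : ‖(dd σ ω : ℂ)‖ ≤ |dd σ ω| * (1 + |κ.im|) := by
    rw [Complex.norm_real, Real.norm_eq_abs]
    nlinarith [abs_nonneg (dd σ ω)]
  have h1' : ‖(1 : ℂ)‖ ≤ 1 * (1 + |κ.im|) := by rw [norm_one]; linarith
  have h1K : ‖(1 : ℂ)‖ ≤ K * (1 + |κ.im|) := by rw [norm_one]; nlinarith
  have hC : 1 * K ^ 2 ≤ (1 + |dd σ ω|) * K ^ 2 := by gcongr; linarith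
  have hC' : |dd σ ω| * K ^ 2 ≤ (1 + |dd σ ω|) * K ^ 2 := by gcongr; linarith
  have c1 : ‖-(1 * (muK ω κ - pp σ ω) / D)‖ ≤ (1 + |dd σ ω|) * K ^ 2 := by
    rw [norm_neg]
    exact (hB.norm_mul_div_det h0 h1 h1' b3 zero_le_one).trans hC
  have c2 : ‖dd σ ω * 1 / D‖ ≤ (1 + |dd σ ω|) * K ^ 2 :=
    (hB.norm_mul_div_det h0 h1 hd h1K (abs_nonneg _)).trans hC'
  have c3 : ‖-(dd σ ω * 1 / D)‖ ≤ (1 + |dd σ ω|) * K ^ 2 := by rwa [norm_neg]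
  have c4 : ‖1 * (κ - pp σ ω) / D‖ ≤ (1 + |dd σ ω|) * K ^ 2 :=
    (hB.norm_mul_div_det h0 h1 h1' b2 zero_le_one).trans hC
  rw [e, norm_mul, mul_assoc (8 * Real.pi)]
  have e8 : ‖(8 * Real.pi * Complex.I : ℂ)‖ = 8 * Real.pi := by
    rw [norm_mul, Complex.norm_I, mul_one, norm_mul, Complex.norm_real,
      Real.norm_of_nonneg Real.pi_pos.le]; simp
  rw [e8]
  have hpi := Real.pi_pos
  gcongr
  exact norm_bilin_le _ _ _ _ _ _ _ _ c1 c2 c3 c4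

theorem differentiableAt_singPart {σ ω δ K : ℝ} (hB : StripBounds σ ω δ K) {F₁ F₂ G₁ G₂ : R3 → ℂ}
    {a : ℝ} (h1 : LapInt a F₁) (h2 : MemLp F₂ 2 volume) (h3 : LapInt a G₁) (h4 : MemLp G₂ 2 volume)
    {κ : ℂ} (ka : a < κ.re) (k0 : 0 ≤ κ.re) (k1 : κ.re ≤ δ) :
    DifferentiableAt ℂ (fun κ => singPart σ ω F₁ F₂ G₁ G₂ κ (muK ω κ)) κ := by
  have hm := differentiableAt_muK hB.omega_pos (hB.re_sq_le k0 k1)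
  have hD := hB.differentiableAt_det k0 k1
  have hD0 := hB.det_ne k0 k1
  have p1 := h1.differentiableAt ka
  have p2 := hB.differentiableAt_Phi_muK h2 k0 k1
  have p3 := h3.differentiableAt ka
  have p4 := hB.differentiableAt_Phi_muK h4 k0 k1
  unfold singPart
  fun_prop (disch := assumption)

theorem differentiableAt_singL {σ ω δ K : ℝ} (hB : StripBounds σ ω δ K) {F₁ F₂ G₁ G₂ : R3 → ℂ}
    (h1 : MemLp F₁ 2 volume) (h2 : MemLp F₂ 2 volume) (h3 : MemLp G₁ 2 volume)
    (h4 : MemLp G₂ 2 volume) {z : ℂ} (z0 : 0 < z.re) (z1 : z.re ≤ δ ^ 2) (hz : ω ≤ z.im) :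
    DifferentiableAt ℂ (singL σ ω F₁ F₂ G₁ G₂) z := by
  have k0 := re_kL_pos z0 hz
  exact DifferentiableAt.comp (g := fun κ => singPart σ ω F₁ F₂ G₁ G₂ κ (muK ω κ)) (f := kL ω) z
    (hB.differentiableAt_singPart (MemLp.lapInt h1) h2 (MemLp.lapInt h3) h4 k0 k0.le
      (re_kL_le hB.δ_pos.le z0.le hz z1)) (differentiableAt_kL ω z0)

theorem continuousAt_singL {σ ω δ K : ℝ} (hB : StripBounds σ ω δ K) {F₁ F₂ G₁ G₂ : R3 → ℂ}
    (h1 : Tame F₁) (h2 : Tame F₂) (h3 : Tame G₁) (h4 : Tame G₂) {z : ℂ} (z0 : 0 ≤ z.re)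
    (z1 : z.re ≤ δ ^ 2) (hz : ω ≤ z.im) : ContinuousAt (singL σ ω F₁ F₂ G₁ G₂) z := by
  have k0 := (kL_re_im z0 hz).1
  exact ContinuousAt.comp (g := fun κ => singPart σ ω F₁ F₂ G₁ G₂ κ (muK ω κ)) (f := kL ω)
    (hB.differentiableAt_singPart (h1.lapInt (-1)) h2.1 (h3.lapInt (-1)) h4.1
      (show (-1 : ℝ) < (kL ω z).re by linarith) k0
      (re_kL_le hB.δ_pos.le z0 hz z1)).continuousAt (continuousAt_kL ω z0)

theorem norm_singL_le {σ ω δ K : ℝ} (hB : StripBounds σ ω δ K) {F₁ F₂ G₁ G₂ : R3 → ℂ}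
    (h1 : MemLp F₁ 2 volume) (h2 : MemLp F₂ 2 volume) (h3 : MemLp G₁ 2 volume)
    (h4 : MemLp G₂ 2 volume) {z : ℂ} {S : ℝ} (z0 : 0 < z.re) (z1 : z.re ≤ δ ^ 2) (hz : ω ≤ z.im)
    (hS : 0 < S) (hzS : z.im - ω + z.re ≤ S ^ 2) :
    ‖singL σ ω F₁ F₂ G₁ G₂ z‖ ≤ 8 * Real.pi * ((1 + |dd σ ω|) * K ^ 2) *
      (Psi F₁ (z.re / (2 * S)) ^ 2 + Psi G₁ (z.re / (2 * S)) ^ 2 +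
        1 / (8 * Real.pi * √ω) * (sqn F₂ + sqn G₂)) := by
  have k0 := re_kL_pos z0 hz
  have k1 := re_kL_le hB.δ_pos.le z0.le hz z1
  have hK := hB.K_ge
  refine (hB.norm_singPart_le _ _ _ _ k0.le k1).trans ?_
  have := abs_nonneg (dd σ ω)
  gcongr
  exact energy_le h1 h2 h3 h4 hB.omega_pos (hB.re_sq_le k0.le k1) (by positivity)
    (re_kL_ge z0.le hz hS hzS)

end StripBounds

/-- The lower bound `Re κ ≥ x/(2S)` enters through the rescaled majorant; the resulting bound is
independent of `a`, hence of the distance `ε` to the contour. -/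
theorem setIntegral_sq_Psi_comp_le {f : R3 → ℂ} (hf : MemLp f 2 volume) {S a b : ℝ} (hS : 0 < S)
    (ha : 0 < a) (hab : a ≤ b) :
    IntervalIntegrable (fun x => Psi f (x / (2 * S)) ^ 2) volume a b ∧
    ∫ x in a..b, Psi f (x / (2 * S)) ^ 2 ≤ S / 2 * sqn f := by
  obtain ⟨i1, i2⟩ := integrableOn_sq_Psi hf
  have h2S : 0 < 2 * S := by positivity
  have hpos : 0 < a / (2 * S) := by positivity
  have hle : a / (2 * S) ≤ b / (2 * S) := by gcongr
  have hsub : Set.Ioc (a / (2 * S)) (b / (2 * S)) ⊆ Set.Ioi 0 := fun x hx => hpos.trans hx.1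
  refine ⟨?_, ?_⟩
  · have h : IntervalIntegrable (fun t => Psi f t ^ 2) volume (a / (2 * S)) (b / (2 * S)) :=
      (intervalIntegrable_iff_integrableOn_Ioc_of_le hle).2 (i1.mono_set hsub)
    have := h.comp_mul_right (c := (2 * S)⁻¹) 
    simpa [div_eq_mul_inv, h2S.ne', hS.ne', mul_assoc] using this
  · rw [intervalIntegral.integral_comp_div (fun t => Psi f t ^ 2) h2S.ne', smul_eq_mul,
      intervalIntegral.integral_of_le hle]
    have : ∫ t in Set.Ioc (a / (2 * S)) (b / (2 * S)), Psi f t ^ 2 ≤ ∫ t in Set.Ioi 0, Psi f t ^ 2 :=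
      setIntegral_mono_set i1 (Eventually.of_forall fun t => sq_nonneg _) hsub.eventuallyLE
    calc _ ≤ 2 * S * (1 / 4 * sqn f) := by gcongr; linarith
      _ = _ := by ring

end PointNLS
end

noncomputable section
namespace PointNLS

/-! ### The charge part of the contour integral -/

namespace StripBounds

/-- For general `L²` data the integrand has no bound uniform in `ε` on the line `Re z = ε`. Cauchy's
theorem replaces that side of a rectangle by the other three: on the horizontal sides the square
integrability of `Psi` in `Re κ` gives a bound independent of `ε`, and the far side `Re z = δ²` is
at a fixed distance. -/
theorem exists_integral_singL_bound {σ ω δ K : ℝ} (hB : StripBounds σ ω δ K) {M : ℝ} (hM : ω < M) :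
    ∃ C : ℝ, 0 ≤ C ∧ ∀ ε : ℝ, 0 < ε → ε ≤ δ ^ 2 → ∀ F₁ F₂ G₁ G₂ : R3 → ℂ, MemLp F₁ 2 volume →
      MemLp F₂ 2 volume → MemLp G₁ 2 volume → MemLp G₂ 2 volume →
      ‖∫ η in ω..M, singL σ ω F₁ F₂ G₁ G₂ (ε + η * Complex.I)‖ ≤
        C * (sqn F₁ + sqn F₂ + sqn G₁ + sqn G₂) := by
  have hδ := hB.δ_pos
  have hω := hB.omega_pos
  have hK := hB.K_ge
  have hsω : 0 < √ω := Real.sqrt_pos.2 hω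
  set e₀ := δ ^ 2
  have he₀ : 0 < e₀ := by positivity
  -- This `S` is at least `1`, so `S²` dominates `M - ω + e₀`, as required by `re_kL_ge` on the
  -- whole rectangle.
  set S := 1 + (M - ω) + e₀ with hS
  have hS1 : 1 ≤ S := by rw [hS]; linarith
  have hSS : M - ω + e₀ ≤ S ^ 2 := by nlinarith
  set Q := 8 * Real.pi * ((1 + |dd σ ω|) * K ^ 2)
  have hpi := Real.pi_pos
  have hQ : 0 ≤ Q := by have := abs_nonneg (dd σ ω); positivity
  set c := 1 / (8 * Real.pi * √ω)
  have hc : 0 ≤ c := by positivity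
  set q := 1 / (8 * Real.pi * (e₀ / (2 * S)))
  have hq : 0 ≤ q := by positivity
  set R := S / 2 + e₀ * c + (q + c) * (M - ω)
  have hR1 : S / 2 + e₀ * c ≤ R := by
    have : 0 ≤ (q + c) * (M - ω) := by apply mul_nonneg <;> linarith
    simp only [R]; linarith
  have hR2 : (q + c) * (M - ω) ≤ R := by
    have : 0 ≤ S / 2 + e₀ * c := by positivity
    simp only [R]; linarith
  have hR0 : 0 ≤ R := le_trans (by positivity) hR1
  refine ⟨3 * (Q * R), by positivity, ?_⟩
  intro ε hε hεe F₁ F₂ G₁ G₂ h1 h2 h3 h4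
  set f := singL σ ω F₁ F₂ G₁ G₂
  have n1 := sqn_nonneg F₁
  have n2 := sqn_nonneg F₂
  have n3 := sqn_nonneg G₁
  have n4 := sqn_nonneg G₂
  set N := sqn F₁ + sqn F₂ + sqn G₁ + sqn G₂ with hN
  have hN0 : 0 ≤ N := by rw [hN]; linarith
  -- horizontal sides
  have horiz : ∀ y : ℝ, ω ≤ y → y ≤ M → ‖∫ x in ε..e₀, f (x + y * Complex.I)‖ ≤ Q * R * N := by
    intro y y0 y1
    obtain ⟨i1, j1⟩ := setIntegral_sq_Psi_comp_le h1 (S := S) (by linarith) hε hεe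
    obtain ⟨i3, j3⟩ := setIntegral_sq_Psi_comp_le h3 (S := S) (by linarith) hε hεe
    have hle : ∀ x ∈ Set.Ioc ε e₀, ‖f (x + y * Complex.I)‖ ≤ Q * (Psi F₁ (x / (2 * S)) ^ 2 +
        Psi G₁ (x / (2 * S)) ^ 2 + c * (sqn F₂ + sqn G₂)) := by
      intro x hx
      have hx0 : 0 < x := hε.trans hx.1
      have := hB.norm_singL_le (S := S) h1 h2 h3 h4 (z := x + y * Complex.I) (by simpa using hx0)
        (by rw [re_vertical]; exact hx.2) (by rw [im_vertical]; exact y0) (by linarith)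
        (by rw [re_vertical, im_vertical]; have := hx.2; linarith)
      rwa [re_vertical] at this
    refine (intervalIntegral.norm_integral_le_of_norm_le hεe
      (Eventually.of_forall hle) (((i1.add i3).add intervalIntegrable_const).const_mul Q)).trans ?_
    have e1 := intervalIntegral.integral_add (i1.add i3)
      (intervalIntegrable_const (c := c * (sqn F₂ + sqn G₂)))
    have e2 := intervalIntegral.integral_add i1 i3
    rw [intervalIntegral.integral_const_mul, e1, e2, intervalIntegral.integral_const, smul_eq_mul,
      mul_assoc Q]
    refine mul_le_mul_of_nonneg_left ?_ hQ
    have hs2 : 0 ≤ S / 2 := by linarith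
    have t1 : (e₀ - ε) * (c * (sqn F₂ + sqn G₂)) ≤ e₀ * (c * (sqn F₂ + sqn G₂)) := by
      gcongr; linarith
    have t2 : (S / 2 + e₀ * c) * N ≤ R * N := by gcongr
    have t3 : 0 ≤ S / 2 * (sqn F₂ + sqn G₂) := by positivity
    have t4 : 0 ≤ e₀ * c * (sqn F₁ + sqn G₁) := by positivity
    rw [hN] at t2 ⊢
    linarith
  have vert : ‖∫ y in ω..M, f (e₀ + y * Complex.I)‖ ≤ Q * R * N := by
    have hle : ∀ y ∈ Set.uIoc ω M, ‖f (e₀ + y * Complex.I)‖ ≤ Q * ((q + c) * N) := by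
      intro y hy
      rw [Set.uIoc_of_le hM.le] at hy
      have := hB.norm_singL_le (S := S) h1 h2 h3 h4 (z := e₀ + y * Complex.I) (by simpa using he₀)
        (by rw [re_vertical]) (by rw [im_vertical]; exact hy.1.le) (by linarith)
        (by rw [re_vertical, im_vertical]; have := hy.2; linarith)
      rw [re_vertical] at this
      refine this.trans ?_
      have k1 := sq_Psi_le h1 (t := e₀ / (2 * S)) (by positivity)
      have k3 := sq_Psi_le h3 (t := e₀ / (2 * S)) (by positivity)
      change _ ≤ Q * ((q + c) * N)
      gcongr
      have t3 : 0 ≤ q * (sqn F₂ + sqn G₂) := by positivity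
      have t4 : 0 ≤ c * (sqn F₁ + sqn G₁) := by positivity
      rw [hN]
      simp only [q] at *
      linarith
    refine (intervalIntegral.norm_integral_le_of_norm_le_const hle).trans ?_
    rw [abs_of_pos (by linarith)]
    calc _ = Q * ((q + c) * (M - ω)) * N := by ring
      _ ≤ _ := by gcongr
  have hmem : ∀ z : ℂ, z ∈ Set.uIcc ε e₀ ×ℂ Set.uIcc ω M → 0 < z.re ∧ z.re ≤ δ ^ 2 ∧ ω ≤ z.im := by
    intro z hz
    rw [Set.uIcc_of_le hεe, Set.uIcc_of_le hM.le] at hz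
    exact ⟨hε.trans_le hz.1.1, hz.1.2, hz.2.1⟩
  have rect := Complex.integral_boundary_rect_eq_zero_of_differentiableOn f
    (ε + ω * Complex.I) (e₀ + M * Complex.I) (by
      have a1 := re_vertical ε ω
      have a2 := im_vertical ε ω
      have a3 := re_vertical e₀ M
      have a4 := im_vertical e₀ M
      rw [a1, a2, a3, a4]
      intro z hz
      obtain ⟨z1, z2, z3⟩ := hmem z hz
      exact (hB.differentiableAt_singL h1 h2 h3 h4 z1 z2 z3).differentiableWithinAt)
  have a1 := re_vertical ε ω
  have a2 := im_vertical ε ω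
  have a3 := re_vertical e₀ M
  have a4 := im_vertical e₀ M
  rw [a1, a2, a3, a4] at rect
  have hH1 := horiz ω le_rfl hM.le
  have hH2 := horiz M hM.le le_rfl
  generalize (∫ x in ε..e₀, f (x + ω * Complex.I)) = A1 at *
  generalize (∫ x in ε..e₀, f (x + M * Complex.I)) = A2 at *
  generalize (∫ x in ω..M, f (e₀ + x * Complex.I)) = A3 at *
  generalize (∫ x in ω..M, f (ε + x * Complex.I)) = A4 at *
  have e : Complex.I * A4 = A1 - A2 + Complex.I * A3 := by
    simp only [smul_eq_mul] at rect
    linear_combination -rect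
  have : ‖A4‖ = ‖A1 - A2 + Complex.I * A3‖ := by rw [← e, norm_mul, Complex.norm_I, one_mul]
  rw [this]
  have b1 := norm_add_le (A1 - A2) (Complex.I * A3)
  have b2 := norm_sub_le A1 A2
  rw [norm_mul, Complex.norm_I, one_mul] at b1
  linarith

theorem tendsto_integral_singL {σ ω δ K : ℝ} (hB : StripBounds σ ω δ K) {M : ℝ} (hM : ω < M)
    {F₁ F₂ G₁ G₂ : R3 → ℂ} (h1 : Tame F₁) (h2 : Tame F₂) (h3 : Tame G₁) (h4 : Tame G₂) :
    Tendsto (fun ε : ℝ => ∫ η in ω..M, singL σ ω F₁ F₂ G₁ G₂ (ε + η * Complex.I)) (𝓝[>] 0)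
      (𝓝 (∫ η in ω..M, singL σ ω F₁ F₂ G₁ G₂ (η * Complex.I))) := by
  have hδ := hB.δ_pos
  -- Clamping both variables to the region where `singL` is known to be continuous yields a globally
  -- continuous integrand, whose parametric integral is continuous at `ε = 0`.
  set p : ℝ → ℝ := fun x => min (max x 0) (δ ^ 2)
  have hp : Continuous p := by fun_prop
  set h : ℝ → ℝ → ℂ := fun x y => singL σ ω F₁ F₂ G₁ G₂ ((p x : ℂ) + (max y ω : ℝ) * Complex.I)
  have hc : Continuous (Function.uncurry h) := by
    refine continuous_iff_continuousAt.2 fun v => ?_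
    exact ContinuousAt.comp (g := singL σ ω F₁ F₂ G₁ G₂)
      (f := fun v : ℝ × ℝ => ((p v.1 : ℝ) : ℂ) + ((max v.2 ω : ℝ) : ℂ) * Complex.I)
      (hB.continuousAt_singL h1 h2 h3 h4 (by simp [p]; positivity) (by simp [p]) (by simp))
      (by fun_prop)
  have hi := (intervalIntegral.continuous_parametric_intervalIntegral_of_continuous' (μ := volume) hc ω M).tendsto 0
  have key : ∀ x : ℝ, 0 ≤ x → x ≤ δ ^ 2 → ∫ η in ω..M, h x η =
      ∫ η in ω..M, singL σ ω F₁ F₂ G₁ G₂ (x + η * Complex.I) := by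
    intro x x0 x1
    refine intervalIntegral.integral_congr fun y hy => ?_
    rw [Set.uIcc_of_le hM.le] at hy
    simp only [h, p, max_eq_left x0, min_eq_left x1, max_eq_left hy.1]
  have k0 := key 0 le_rfl (by positivity)
  simp only [Complex.ofReal_zero, zero_add] at k0
  rw [k0] at hi
  refine (hi.mono_left nhdsWithin_le_nhds).congr' ?_
  have : Set.Ioo (0 : ℝ) (δ ^ 2) ∈ 𝓝[>] (0 : ℝ) := Ioo_mem_nhdsGT (by positivity)
  filter_upwards [this] with x hx
  exact key x hx.1.le hx.2.le

/-- The change of variables `η = ω + t²`. -/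
theorem integral_singL_boundary {σ ω δ K : ℝ} (hB : StripBounds σ ω δ K) {M : ℝ} (hM : ω < M)
    {F₁ F₂ G₁ G₂ : R3 → ℂ} (h1 : Tame F₁) (h2 : Tame F₂) (h3 : Tame G₁) (h4 : Tame G₂) :
    ∫ η in ω..M, singL σ ω F₁ F₂ G₁ G₂ (η * Complex.I) =
      -(2 * Complex.I) * ∫ t in (0 : ℝ)..√(M - ω), axisForm σ ω F₁ F₂ G₁ G₂ (t * Complex.I) := by
  have hδ := hB.δ_pos
  set f := fun η : ℝ => singL σ ω F₁ F₂ G₁ G₂ (η * Complex.I)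
  have hs : √(M - ω) ^ 2 = M - ω := Real.sq_sqrt (by linarith)
  have := intervalIntegral.integral_deriv_smul_comp' (a := 0) (b := √(M - ω))
    (f := fun t : ℝ => ω + t ^ 2) (f' := fun t => 2 * t) (g := f)
    (fun t _ => by simpa using ((hasDerivAt_pow 2 t).const_add ω)) (by fun_prop) (by
      rintro _ ⟨t, ht, rfl⟩
      refine ContinuousAt.continuousWithinAt ?_
      have r1 := re_vertical 0 (ω + t ^ 2)
      have r2 := im_vertical 0 (ω + t ^ 2)
      rw [Complex.ofReal_zero, zero_add] at r1 r2
      exact ContinuousAt.comp (g := singL σ ω F₁ F₂ G₁ G₂) (f := fun η : ℝ => (η : ℂ) * Complex.I)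
        (hB.continuousAt_singL h1 h2 h3 h4 (by rw [r1]) (by rw [r1]; positivity)
          (by rw [r2]; nlinarith)) (by fun_prop))
  simp only [ne_eq, OfNat.ofNat_ne_zero, not_false_eq_true, zero_pow, add_zero, hs,
    add_sub_cancel] at this
  rw [← this, ← intervalIntegral.integral_const_mul]
  refine intervalIntegral.integral_congr fun t ht => ?_
  rw [Set.uIcc_of_le (Real.sqrt_nonneg _)] at ht
  have e : kL ω ((ω + t ^ 2 : ℝ) * Complex.I) = t * Complex.I := by
    rw [kL_boundary (by nlinarith), add_sub_cancel_left, Real.sqrt_sq ht.1]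
  simp only [Function.comp, f, singL, e, axisForm, Complex.real_smul]
  push_cast
  -- With `κ = it` the Jacobian is `dη = 2t dt = -2iκ dt`; this is the origin of the factor `κ` in
  -- `axisForm`.
  linear_combination ((2 * t * singPart σ ω F₁ F₂ G₁ G₂ (t * Complex.I) (muK ω (t * Complex.I)))) *
    Complex.I_sq

end StripBounds

end PointNLS
end

noncomputable section
namespace PointNLS

open scoped FourierTransform

/-! ### The free part of the contour integral -/

/-- The Poisson kernel, up to a factor `1/π`. -/
def poisson (ε y : ℝ) : ℝ := ε / (y ^ 2 + ε ^ 2)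

theorem poisson_nonneg {ε : ℝ} (hε : 0 < ε) (y : ℝ) : 0 ≤ poisson ε y := by
  unfold poisson; positivity

theorem poisson_le {ε : ℝ} (hε : 0 < ε) (y : ℝ) : poisson ε y ≤ 1 / ε := by
  unfold poisson
  rw [div_le_div_iff₀ (by positivity) hε]
  nlinarith [sq_nonneg y]

theorem continuous_poisson {ε : ℝ} (hε : 0 < ε) : Continuous (poisson ε) := by
  unfold poisson
  exact continuous_const.div (by fun_prop) fun y => by positivity

theorem hasDerivAt_arctan_div {ε : ℝ} (hε : 0 < ε) (y : ℝ) :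
    HasDerivAt (fun y => Real.arctan (y / ε)) (poisson ε y) y := by
  have := ((hasDerivAt_id y).div_const ε).arctan
  refine HasDerivAt.congr_deriv (f := fun y => Real.arctan (y / ε)) this ?_
  change 1 / (1 + (y / ε) ^ 2) * (1 / ε) = ε / (y ^ 2 + ε ^ 2)
  have : y ^ 2 + ε ^ 2 ≠ 0 := by positivity
  have : (1 : ℝ) + (y / ε) ^ 2 ≠ 0 := by positivity
  field_simp
  ring

theorem integral_poisson {ε : ℝ} (hε : 0 < ε) (a b : ℝ) :
    ∫ y in a..b, poisson ε y = Real.arctan (b / ε) - Real.arctan (a / ε) :=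
  intervalIntegral.integral_eq_sub_of_hasDerivAt (fun y _ => hasDerivAt_arctan_div hε y)
    ((continuous_poisson hε).intervalIntegrable _ _)

theorem tendsto_arctan_div_pos {y : ℝ} (hy : 0 < y) :
    Tendsto (fun ε : ℝ => Real.arctan (y / ε)) (𝓝[>] 0) (𝓝 (Real.pi / 2)) := by
  have h : Tendsto (fun ε : ℝ => y / ε) (𝓝[>] 0) atTop := by
    simpa [div_eq_mul_inv] using tendsto_inv_nhdsGT_zero.const_mul_atTop hy
  exact (Real.tendsto_arctan_atTop.mono_right nhdsWithin_le_nhds).comp h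

theorem tendsto_arctan_div_neg {y : ℝ} (hy : y < 0) :
    Tendsto (fun ε : ℝ => Real.arctan (y / ε)) (𝓝[>] 0) (𝓝 (-(Real.pi / 2))) := by
  have h := (tendsto_arctan_div_pos (neg_pos.2 hy)).neg
  refine h.congr fun ε => ?_
  rw [neg_div, Real.arctan_neg, neg_neg]

/-- The symbol of `-Δ`. -/
def freq (ξ : R3) : ℝ := (2 * Real.pi) ^ 2 * ‖ξ‖ ^ 2

theorem continuous_freq : Continuous freq := by unfold freq; fun_prop

/-- The spectral density of `-Δ` in the momentum representation. -/
def spec (a b : S2) (ξ : R3) : ℂ := (𝓕 b : S2) ξ * (starRingEnd ℂ) ((𝓕 a : S2) ξ)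

theorem spec_eq_inner (a b : S2) (ξ : R3) : spec a b ξ = inner ℂ ((𝓕 a : S2) ξ) ((𝓕 b : S2) ξ) := by
  rw [spec, RCLike.inner_apply]

theorem integrable_spec (a b : S2) : Integrable (spec a b) volume := by
  have := L2.integrable_inner (𝕜 := ℂ) (𝓕 a : S2) (𝓕 b : S2)
  simpa only [← spec_eq_inner] using this

theorem integral_spec (a b : S2) : ∫ ξ, spec a b ξ = inner ℂ a b := by
  rw [← Lp.inner_fourier_eq a b, L2.inner_def]
  exact integral_congr_ae (Eventually.of_forall fun ξ => spec_eq_inner a b ξ)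

theorem sqn_coe (a : S2) : sqn a = ‖a‖ ^ 2 := integral_norm_sq_Lp a

theorem integral_norm_spec_le (a b : S2) : ∫ ξ, ‖spec a b ξ‖ ≤ ‖a‖ ^ 2 + ‖b‖ ^ 2 := by
  have ha := integrable_sq_norm (Lp.memLp (𝓕 a : S2))
  have hb := integrable_sq_norm (Lp.memLp (𝓕 b : S2))
  have e1 : ∫ ξ, ‖(𝓕 a : S2) ξ‖ ^ 2 = ‖a‖ ^ 2 := by
    rw [integral_norm_sq_Lp, Lp.norm_fourier_eq]
  have e2 : ∫ ξ, ‖(𝓕 b : S2) ξ‖ ^ 2 = ‖b‖ ^ 2 := by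
    rw [integral_norm_sq_Lp, Lp.norm_fourier_eq]
  have e3 := integral_add ha hb
  rw [← e1, ← e2, ← e3]
  refine integral_mono (integrable_spec a b).norm (ha.add hb) fun ξ => ?_
  simp only [spec, norm_mul, RCLike.norm_conj]
  nlinarith [sq_nonneg (‖(𝓕 a : S2) ξ‖ - ‖(𝓕 b : S2) ξ‖), sq_nonneg ‖(𝓕 a : S2) ξ‖,
    sq_nonneg ‖(𝓕 b : S2) ξ‖]

theorem inner_freeRes {z : ℂ} (hz : z ∈ Complex.slitPlane) (a b : S2) :
    inner ℂ a (freeRes z b) = ∫ ξ, (symb z ξ)⁻¹ * spec a b ξ := by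
  rw [← Lp.inner_fourier_eq, L2.inner_def]
  refine integral_congr_ae ?_
  filter_upwards [fourier_freeRes hz b] with ξ hξ
  rw [hξ, RCLike.inner_apply, spec]; ring

theorem integrable_symb_inv_mul_spec {z : ℂ} (hz : z ∈ Complex.slitPlane) (a b : S2) :
    Integrable (fun ξ => (symb z ξ)⁻¹ * spec a b ξ) volume := by
  have h := L2.integrable_inner (𝕜 := ℂ) (𝓕 a : S2) (𝓕 (freeRes z b) : S2)
  refine h.congr ?_
  filter_upwards [fourier_freeRes hz b] with ξ hξ
  rw [hξ, RCLike.inner_apply, spec]; ring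

/-- The Poisson integral of the spectral density. -/
def poissonInt (ε y : ℝ) (a b : S2) : ℂ := ∫ ξ, (poisson ε (freq ξ + y) : ℂ) * spec a b ξ

/-- In momentum space this is `1/(s + iε) - 1/(s - iε) = -2iε/(s² + ε²)` with `s = freq ξ + y`, that
is, Stone's formula before the limit. -/
theorem inner_freeRes_sub {ε : ℝ} (hε : 0 < ε) (y : ℝ) (a b : S2) :
    inner ℂ a (freeRes (y + ε * Complex.I) b) - inner ℂ a (freeRes (y - ε * Complex.I) b) =
      -(2 * Complex.I) * poissonInt ε y a b := by
  have h1 : (y + ε * Complex.I : ℂ) ∈ Complex.slitPlane := Or.inr (by simpa using hε.ne')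
  have h2 : (y - ε * Complex.I : ℂ) ∈ Complex.slitPlane := Or.inr (by simpa using hε.ne')
  rw [inner_freeRes h1, inner_freeRes h2, ← integral_sub (integrable_symb_inv_mul_spec h1 a b)
    (integrable_symb_inv_mul_spec h2 a b), poissonInt, ← integral_const_mul]
  refine integral_congr_ae (Eventually.of_forall fun ξ => ?_)
  have e1 := symb_ne_zero h1 ξ
  have e2 := symb_ne_zero h2 ξ
  have f1 : symb (y + ε * Complex.I) ξ = (freq ξ + y : ℝ) + ε * Complex.I := by
    simp only [symb, freq]; push_cast; ring
  have f2 : symb (y - ε * Complex.I) ξ = (freq ξ + y : ℝ) - ε * Complex.I := by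
    simp only [symb, freq]; push_cast; ring
  have f3 : (((freq ξ + y : ℝ) : ℂ) ^ 2 + (ε : ℂ) ^ 2) = symb (y + ε * Complex.I) ξ * symb (y - ε * Complex.I) ξ := by
    rw [f1, f2]
    linear_combination ((ε : ℂ) ^ 2) * Complex.I_sq
  have e3 : (poisson ε (freq ξ + y) : ℂ) = ε / (symb (y + ε * Complex.I) ξ * symb (y - ε * Complex.I) ξ) := by
    rw [← f3, poisson]; push_cast; rfl
  simp only [e3]
  have f4 : symb (y - ε * Complex.I) ξ - symb (y + ε * Complex.I) ξ = - (2 * Complex.I) * ε := by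
    rw [f1, f2]; ring
  rw [← sub_mul, inv_sub_inv e1 e2, f4]
  ring

theorem norm_poisson_mul_le {ε : ℝ} (hε : 0 < ε) (y : ℝ) (c : ℂ) :
    ‖(poisson ε y : ℂ) * c‖ ≤ 1 / ε * ‖c‖ := by
  rw [norm_mul, Complex.norm_real, Real.norm_of_nonneg (poisson_nonneg hε y)]
  exact mul_le_mul_of_nonneg_right (poisson_le hε y) (norm_nonneg c)

theorem continuous_poissonInt {ε : ℝ} (hε : 0 < ε) (a b : S2) :
    Continuous fun y => poissonInt ε y a b := by
  have hc := continuous_poisson hε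
  have hf := continuous_freq
  refine continuous_of_dominated (bound := fun ξ => 1 / ε * ‖spec a b ξ‖) (fun y => ?_)
    (fun y => Eventually.of_forall fun ξ => norm_poisson_mul_le hε _ _)
    ((integrable_spec a b).norm.const_mul _) (Eventually.of_forall fun ξ => ?_)
  · exact (Continuous.aestronglyMeasurable (by fun_prop)).mul (integrable_spec a b).1
  · fun_prop

/-- The integral of a Poisson integral over an interval. -/
theorem integral_poissonInt {ε : ℝ} (hε : 0 < ε) {p : ℝ → ℝ} (hp : Continuous p) (A B : ℝ) (a b : S2) :
    ∫ η in A..B, poissonInt ε (p η) a b =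
      ∫ ξ, ((∫ η in A..B, poisson ε (freq ξ + p η) : ℝ) : ℂ) * spec a b ξ := by
  have hc := continuous_poisson hε
  have hf := continuous_freq
  unfold poissonInt
  rw [intervalIntegral_integral_swap]
  · refine integral_congr_ae (Eventually.of_forall fun ξ => ?_)
    simp only
    rw [intervalIntegral.integral_mul_const, intervalIntegral.integral_ofReal]
  · have h1 : Integrable (fun q : ℝ × R3 => (1 : ℂ) * spec a b q.2)
        ((volume.restrict (Set.uIoc A B)).prod volume) :=
      Integrable.mul_prod (f := fun _ : ℝ => (1 : ℂ))
        (intervalIntegrable_iff.1 intervalIntegrable_const) (integrable_spec a b)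
    refine (h1.norm.const_mul (1 / ε)).mono' ?_ (Eventually.of_forall fun q => ?_)
    · refine AEStronglyMeasurable.mul (Continuous.aestronglyMeasurable (by fun_prop)) ?_
      simpa using h1.1
    · simpa [Function.uncurry] using norm_poisson_mul_le hε (freq q.2 + p q.1) (spec a b q.2)

end PointNLS
end

noncomputable section
namespace PointNLS

open scoped FourierTransform

/-! ### The contour integral as a form -/

theorem norm_sq_eq (u : L2) : ‖u‖ ^ 2 = 2 * (‖cmp 1 u‖ ^ 2 + ‖cmp (-1) u‖ ^ 2) := by
  have h := inner_emb_add u (cmp 1 u) (cmp (-1) u)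
  rw [← eq_emb_add u, inner_self_eq_norm_sq_to_K, inner_self_eq_norm_sq_to_K,
    inner_self_eq_norm_sq_to_K] at h
  generalize ‖cmp 1 u‖ = a at *
  generalize ‖cmp (-1) u‖ = b at *
  have h' : ((‖u‖ ^ 2 : ℝ) : ℂ) = ((2 * (a ^ 2 + b ^ 2) : ℝ) : ℂ) := by push_cast; exact h
  exact Complex.ofReal_injective h'

theorem sqn_conj (f : R3 → ℂ) : sqn (fun x => (starRingEnd ℂ) (f x)) = sqn f := by
  simp [sqn]

theorem memLp_conj {f : R3 → ℂ} (hf : MemLp f 2 volume) :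
    MemLp (fun x => (starRingEnd ℂ) (f x)) 2 volume := hf.star

theorem sqn_sum_eq (g f : L2) :
    sqn (cmp 1 f) + sqn (cmp (-1) f) + sqn (cmp 1 g) + sqn (cmp (-1) g) =
      1 / 2 * (‖g‖ ^ 2 + ‖f‖ ^ 2) := by
  rw [sqn_coe, sqn_coe, sqn_coe, sqn_coe, norm_sq_eq g, norm_sq_eq f]; ring

/-- The charge part of the matrix elements of the resolvent to the right of the contour. -/
def singR (σ ω : ℝ) (g f : L2) (z : ℂ) : ℂ :=
  singL σ ω (cmp 1 f) (cmp (-1) f) (fun x => (starRingEnd ℂ) (cmp 1 g x))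
    (fun x => (starRingEnd ℂ) (cmp (-1) g x)) z

/-- The conjugate of the charge part to the left of the contour. -/
def singLf (σ ω : ℝ) (g f : L2) (z : ℂ) : ℂ :=
  singL σ ω (fun x => (starRingEnd ℂ) (cmp 1 f x)) (fun x => (starRingEnd ℂ) (cmp (-1) f x))
    (cmp 1 g) (cmp (-1) g) z

theorem jump_aux (a b c d a' b' s s' p q : ℂ)
    (h1 : a - b = -(2 * Complex.I) * p) (h2 : c - d = -(2 * Complex.I) * q)
    (ha : a' = 2 * (Complex.I * d - Complex.I * a) + s)
    (hb : b' = 2 * (Complex.I * c - Complex.I * b) + -s') :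
    a' - b' = -4 * p - 4 * q + (s + s') := by
  have e1 : a = b + -(2 * Complex.I) * p := by rw [← h1]; ring
  have e2 : c = d + -(2 * Complex.I) * q := by rw [← h2]; ring
  rw [ha, hb, e1, e2]
  linear_combination (4 * p + 4 * q) * Complex.I_sq

/-- The point `iη - ε` is `-z̄` for `z = ε + iη`, and its square roots are the conjugates of `κ` and
`μ`. The free parts therefore combine into Poisson integrals, and the charge part on the left
becomes a conjugate of one on the right. -/
theorem StripBounds.inner_jump {σ ω δ K : ℝ} (hB : StripBounds σ ω δ K) {ε : ℝ} (hε : 0 < ε)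
    (hεδ : ε ≤ δ ^ 2) {η : ℝ} (hη : ω ≤ η) (g f : L2) :
    inner ℂ g ((resolvent σ ω (Complex.I * (η : ℂ) + (ε : ℂ))
        - resolvent σ ω (Complex.I * (η : ℂ) - (ε : ℂ))) f) =
      -4 * poissonInt ε (ω - η) (cmp 1 g) (cmp 1 f) -
        4 * poissonInt ε (ω + η) (cmp (-1) g) (cmp (-1) f) +
        (singR σ ω g f (ε + η * Complex.I) +
          (starRingEnd ℂ) (singLf σ ω g f (ε + η * Complex.I))) := by
  set z : ℂ := ε + η * Complex.I with hz
  have z1 : z.re = ε := re_vertical ε η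
  have z2 : z.im = η := im_vertical ε η
  set κ := kL ω z with hκ
  set μ := muK ω κ with hμ
  have k0 : 0 < κ.re := re_kL_pos (by rw [z1]; exact hε) (by rw [z2]; exact hη)
  have k1 : κ.re ≤ δ := re_kL_le hB.δ_pos.le (by rw [z1]; exact hε.le) (by rw [z2]; exact hη)
    (by rw [z1]; exact hεδ)
  have m0 : 0 < μ.re := (Real.sqrt_pos.2 hB.omega_pos).trans_le (re_muK_ge (hB.re_sq_le k0.le k1)).1
  have hD := hB.det_ne k0.le k1
  have eκ : κ ^ 2 = ω + Complex.I * z := kL_sq ω z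
  have eμ : μ ^ 2 = ω - Complex.I * z := muK_kL_sq ω z
  have hz1 : Complex.I * (η : ℂ) + (ε : ℂ) = z := by rw [hz]; ring
  have hz2 : Complex.I * (η : ℂ) - (ε : ℂ) = -(starRingEnd ℂ) z := by
    rw [hz]; simp; ring
  have cκ : (starRingEnd ℂ) κ ^ 2 = ω + Complex.I * -(starRingEnd ℂ) z := by
    rw [← map_pow, eκ]; simp
  have cμ : (starRingEnd ℂ) μ ^ 2 = ω - Complex.I * -(starRingEnd ℂ) z := by
    rw [← map_pow, eμ]; simp
  have r1 := inner_resolvent σ ω k0 m0 eκ eμ hD g f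
  have r2 := inner_resolvent σ ω (κ := (starRingEnd ℂ) κ) (μ := (starRingEnd ℂ) μ) (by simpa using k0)
    (by simpa using m0) cκ cμ (by rw [det_conj]; simpa using hD) g f
  rw [singPart_conj] at r2
  simp only [Complex.conj_conj] at r2
  have p1 := inner_freeRes_sub hε (ω - η) (cmp 1 g) (cmp 1 f)
  have p2 := inner_freeRes_sub hε (ω + η) (cmp (-1) g) (cmp (-1) f)
  have w1 : (((ω - η : ℝ) : ℂ) + ε * Complex.I) = κ ^ 2 := by
    rw [eκ, hz]; push_cast; linear_combination -(η : ℂ) * Complex.I_sq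
  have w2 : (((ω - η : ℝ) : ℂ) - ε * Complex.I) = (starRingEnd ℂ) κ ^ 2 := by
    rw [cκ, hz]; simp; linear_combination -(η : ℂ) * Complex.I_sq
  have w3 : (((ω + η : ℝ) : ℂ) + ε * Complex.I) = (starRingEnd ℂ) μ ^ 2 := by
    rw [cμ, hz]; simp; linear_combination (η : ℂ) * Complex.I_sq
  have w4 : (((ω + η : ℝ) : ℂ) - ε * Complex.I) = μ ^ 2 := by
    rw [eμ, hz]; push_cast; linear_combination (η : ℂ) * Complex.I_sq
  rw [w1, w2] at p1
  rw [w3, w4] at p2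
  rw [hz1, hz2, sub_apply, inner_sub_right]
  exact jump_aux _ _ _ _ _ _ _ _ _ _ p1 p2 r1 r2

theorem StripBounds.continuousOn_singL_vertical {σ ω δ K : ℝ} (hB : StripBounds σ ω δ K)
    {ε : ℝ} (hε : 0 < ε) (hεδ : ε ≤ δ ^ 2) {F₁ F₂ G₁ G₂ : R3 → ℂ}
    (h1 : MemLp F₁ 2 volume) (h2 : MemLp F₂ 2 volume) (h3 : MemLp G₁ 2 volume)
    (h4 : MemLp G₂ 2 volume) :
    ContinuousOn (fun η : ℝ => singL σ ω F₁ F₂ G₁ G₂ (ε + η * Complex.I)) (Set.Ici ω) := by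
  intro η hη
  refine ContinuousAt.continuousWithinAt ?_
  refine ContinuousAt.comp (g := singL σ ω F₁ F₂ G₁ G₂)
    (f := fun η : ℝ => (ε : ℂ) + η * Complex.I) ?_ (by fun_prop)
  exact (hB.differentiableAt_singL h1 h2 h3 h4 (by rw [re_vertical]; exact hε)
    (by rw [re_vertical]; exact hεδ) (by rw [im_vertical]; exact hη)).continuousAt

theorem StripBounds.intervalIntegrable_sing {σ ω δ K : ℝ} (hB : StripBounds σ ω δ K)
    {ε : ℝ} (hε : 0 < ε) (hεδ : ε ≤ δ ^ 2) {M : ℝ} (hM : ω < M) (g f : L2) :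
    IntervalIntegrable (fun η : ℝ => singR σ ω g f (ε + η * Complex.I)) volume ω M ∧
    IntervalIntegrable (fun η : ℝ => (starRingEnd ℂ) (singLf σ ω g f (ε + η * Complex.I))) volume ω M := by
  have hs : Set.uIcc ω M ⊆ Set.Ici ω := by
    rw [Set.uIcc_of_le hM.le]; exact Set.Icc_subset_Ici_self
  constructor
  · exact ((hB.continuousOn_singL_vertical hε hεδ (Lp.memLp _) (Lp.memLp _) (memLp_conj (Lp.memLp _))
      (memLp_conj (Lp.memLp _))).mono hs).intervalIntegrable
  · exact (Complex.continuous_conj.comp_continuousOn ((hB.continuousOn_singL_vertical hε hεδ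
      (memLp_conj (Lp.memLp _)) (memLp_conj (Lp.memLp _)) (Lp.memLp _) (Lp.memLp _)).mono hs)).intervalIntegrable

theorem StripBounds.intervalIntegrable_jump {σ ω δ K : ℝ} (hB : StripBounds σ ω δ K)
    {ε : ℝ} (hε : 0 < ε) (hεδ : ε ≤ δ ^ 2) {M : ℝ} (hM : ω < M) (g f : L2) :
    IntervalIntegrable (fun η : ℝ => inner ℂ g ((resolvent σ ω (Complex.I * (η : ℂ) + (ε : ℂ))
        - resolvent σ ω (Complex.I * (η : ℂ) - (ε : ℂ))) f)) volume ω M := by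
  obtain ⟨s1, s2⟩ := hB.intervalIntegrable_sing hε hεδ hM g f
  have c1 : Continuous fun η : ℝ => -4 * poissonInt ε (ω - η) (cmp 1 g) (cmp 1 f) -
      4 * poissonInt ε (ω + η) (cmp (-1) g) (cmp (-1) f) :=
    (continuous_const.mul ((continuous_poissonInt hε _ _).comp (by fun_prop))).sub
      (continuous_const.mul ((continuous_poissonInt hε _ _).comp (by fun_prop)))
  refine ((c1.intervalIntegrable ω M).add (s1.add s2)).congr fun η hη => ?_
  rw [Set.uIoc_of_le hM.le] at hη
  exact (hB.inner_jump hε hεδ hη.1.le g f).symm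

/-- The weights which the contour integral gives to the free parts. -/
def cutP (ω ε M : ℝ) (ξ : R3) : ℝ := Real.arctan (freq ξ / ε) - Real.arctan ((freq ξ + ω - M) / ε)

/-- The weights which the contour integral gives to the free parts. -/
def cutM (ω ε M : ℝ) (ξ : R3) : ℝ :=
  Real.arctan ((freq ξ + ω + M) / ε) - Real.arctan ((freq ξ + ω + ω) / ε)

theorem contour_aux (p q s : ℂ) :
    -(1 / (2 * (Real.pi : ℂ) * Complex.I)) * ((-4 * p - 4 * q + s) * Complex.I) =
      2 / Real.pi * (p + q) - 1 / (2 * Real.pi) * s := by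
  have hpi : (Real.pi : ℂ) ≠ 0 := by exact_mod_cast Real.pi_ne_zero
  have := Complex.I_ne_zero
  field_simp
  ring

/-- After exchanging the integrals over `η` and `ξ`, the Poisson kernel integrates to differences of
arctangents. The weights `cutP` and `cutM` are bounded by `π` uniformly in `ε` and `M`. -/
theorem StripBounds.contourIntegral_eq {σ ω δ K : ℝ} (hB : StripBounds σ ω δ K)
    {ε : ℝ} (hε : 0 < ε) (hεδ : ε ≤ δ ^ 2) {M : ℝ} (hM : ω < M) (g f : L2) :
    contourIntegral σ ω ε ω M g f =
      2 / Real.pi * ((∫ ξ, (cutP ω ε M ξ : ℂ) * spec (cmp 1 g) (cmp 1 f) ξ) +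
        ∫ ξ, (cutM ω ε M ξ : ℂ) * spec (cmp (-1) g) (cmp (-1) f) ξ) -
      1 / (2 * Real.pi) * ((∫ η in ω..M, singR σ ω g f (ε + η * Complex.I)) +
        (starRingEnd ℂ) (∫ η in ω..M, singLf σ ω g f (ε + η * Complex.I))) := by
  obtain ⟨s1, s2⟩ := hB.intervalIntegrable_sing hε hεδ hM g f
  have c1 : Continuous fun η : ℝ => -4 * poissonInt ε (ω - η) (cmp 1 g) (cmp 1 f) :=
    continuous_const.mul ((continuous_poissonInt hε _ _).comp (by fun_prop))
  have c2 : Continuous fun η : ℝ => 4 * poissonInt ε (ω + η) (cmp (-1) g) (cmp (-1) f) :=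
    continuous_const.mul ((continuous_poissonInt hε _ _).comp (by fun_prop))
  have hj : ∫ η in ω..M, inner ℂ g ((resolvent σ ω (Complex.I * (η : ℂ) + (ε : ℂ))
        - resolvent σ ω (Complex.I * (η : ℂ) - (ε : ℂ))) f) =
      ∫ η in ω..M, ((-4 * poissonInt ε (ω - η) (cmp 1 g) (cmp 1 f) -
        4 * poissonInt ε (ω + η) (cmp (-1) g) (cmp (-1) f)) +
        (singR σ ω g f (ε + η * Complex.I) +
          (starRingEnd ℂ) (singLf σ ω g f (ε + η * Complex.I)))) := by
    refine intervalIntegral.integral_congr fun η hη => ?_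
    rw [Set.uIcc_of_le hM.le] at hη
    exact hB.inner_jump hε hεδ hη.1 g f
  have e1 := intervalIntegral.integral_add (μ := volume) ((c1.intervalIntegrable ω M).sub
    (c2.intervalIntegrable ω M)) (s1.add s2)
  have e2 := intervalIntegral.integral_sub (μ := volume) (c1.intervalIntegrable ω M) (c2.intervalIntegrable ω M)
  have e3 := intervalIntegral.integral_add s1 s2
  have e4 : ∫ η in ω..M, (starRingEnd ℂ) (singLf σ ω g f (ε + η * Complex.I)) =
      (starRingEnd ℂ) (∫ η in ω..M, singLf σ ω g f (ε + η * Complex.I)) := by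
    rw [intervalIntegral.integral_of_le hM.le, intervalIntegral.integral_of_le hM.le, integral_conj]
  have e5 : ∫ η in ω..M, poissonInt ε (ω - η) (cmp 1 g) (cmp 1 f) =
      ∫ ξ, (cutP ω ε M ξ : ℂ) * spec (cmp 1 g) (cmp 1 f) ξ := by
    rw [integral_poissonInt hε (p := fun η => ω - η) (by fun_prop)]
    congr 1; ext ξ
    have := intervalIntegral.integral_comp_sub_left (a := ω) (b := M) (poisson ε) (freq ξ + ω)
    rw [integral_poisson hε, add_sub_cancel_right] at this
    rw [cutP, ← this]
    congr 4; ext η; ring_nf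
  have e6 : ∫ η in ω..M, poissonInt ε (ω + η) (cmp (-1) g) (cmp (-1) f) =
      ∫ ξ, (cutM ω ε M ξ : ℂ) * spec (cmp (-1) g) (cmp (-1) f) ξ := by
    rw [integral_poissonInt hε (p := fun η => ω + η) (by fun_prop)]
    congr 1; ext ξ
    have := intervalIntegral.integral_comp_add_left (a := ω) (b := M) (poisson ε) (freq ξ + ω)
    rw [integral_poisson hε] at this
    rw [cutM, ← this]
    congr 4; ext η; ring_nf
  rw [intervalIntegral.integral_const_mul, intervalIntegral.integral_const_mul, e5, e6] at e2
  rw [e4] at e3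
  rw [contourIntegral, intervalIntegral.integral_mul_const, hj, e1, e2, e3]
  exact contour_aux _ _ _

theorem abs_arctan_sub_le (a b : ℝ) : |Real.arctan a - Real.arctan b| ≤ Real.pi := by
  have := Real.arctan_lt_pi_div_two a
  have := Real.arctan_lt_pi_div_two b
  have := Real.neg_pi_div_two_lt_arctan a
  have := Real.neg_pi_div_two_lt_arctan b
  rw [abs_le]; constructor <;> linarith

theorem norm_weight_mul_le {m : ℝ} (hm : |m| ≤ Real.pi) (c : ℂ) : ‖(m : ℂ) * c‖ ≤ Real.pi * ‖c‖ := by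
  rw [norm_mul, Complex.norm_real, Real.norm_eq_abs]
  gcongr

theorem norm_integral_weight_le {m : R3 → ℝ} (hm : ∀ ξ, |m ξ| ≤ Real.pi) (a b : S2) :
    ‖∫ ξ, (m ξ : ℂ) * spec a b ξ‖ ≤ Real.pi * (‖a‖ ^ 2 + ‖b‖ ^ 2) := by
  refine (norm_integral_le_of_norm_le ((integrable_spec a b).norm.const_mul _)
    (Eventually.of_forall fun ξ => norm_weight_mul_le (hm ξ) _)).trans ?_
  rw [integral_const_mul]
  exact mul_le_mul_of_nonneg_left (integral_norm_spec_le a b) Real.pi_pos.le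

theorem StripBounds.exists_contourIntegral_bound {σ ω δ K : ℝ} (hB : StripBounds σ ω δ K)
    {M : ℝ} (hM : ω < M) : ∃ C : ℝ, 0 ≤ C ∧ ∀ ε : ℝ, 0 < ε → ε ≤ δ ^ 2 → ∀ g f : L2,
      ‖contourIntegral σ ω ε ω M g f‖ ≤ C * (‖g‖ ^ 2 + ‖f‖ ^ 2) := by
  obtain ⟨C, hC, hb⟩ := hB.exists_integral_singL_bound hM
  have hpi := Real.pi_pos
  refine ⟨1 + 1 / (2 * Real.pi) * C, by positivity, fun ε hε hεδ g f => ?_⟩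
  rw [hB.contourIntegral_eq hε hεδ hM]
  have b1 := norm_integral_weight_le (m := cutP ω ε M) (fun ξ => abs_arctan_sub_le _ _)
    (cmp 1 g) (cmp 1 f)
  have b2 := norm_integral_weight_le (m := cutM ω ε M) (fun ξ => abs_arctan_sub_le _ _)
    (cmp (-1) g) (cmp (-1) f)
  have b3 := hb ε hε hεδ (cmp 1 f) (cmp (-1) f) (fun x => (starRingEnd ℂ) (cmp 1 g x))
    (fun x => (starRingEnd ℂ) (cmp (-1) g x)) (Lp.memLp _) (Lp.memLp _) (memLp_conj (Lp.memLp _))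
    (memLp_conj (Lp.memLp _))
  have b4 := hb ε hε hεδ (fun x => (starRingEnd ℂ) (cmp 1 f x))
    (fun x => (starRingEnd ℂ) (cmp (-1) f x)) (cmp 1 g) (cmp (-1) g) (memLp_conj (Lp.memLp _))
    (memLp_conj (Lp.memLp _)) (Lp.memLp _) (Lp.memLp _)
  simp only [sqn_conj] at b3 b4
  rw [sqn_sum_eq] at b3 b4
  have n1 := norm_sq_eq g
  have n2 := norm_sq_eq f
  change ‖∫ η in ω..M, singR σ ω g f (ε + η * Complex.I)‖ ≤ _ at b3
  change ‖∫ η in ω..M, singLf σ ω g f (ε + η * Complex.I)‖ ≤ _ at b4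
  generalize (∫ η in ω..M, singR σ ω g f (ε + η * Complex.I)) = X at *
  generalize (∫ η in ω..M, singLf σ ω g f (ε + η * Complex.I)) = Y at *
  generalize (∫ ξ, (cutP ω ε M ξ : ℂ) * spec (cmp 1 g) (cmp 1 f) ξ) = U at *
  generalize (∫ ξ, (cutM ω ε M ξ : ℂ) * spec (cmp (-1) g) (cmp (-1) f) ξ) = V at *
  have t1 : ‖(2 / Real.pi * (U + V) : ℂ)‖ ≤ ‖g‖ ^ 2 + ‖f‖ ^ 2 := by
    rw [norm_mul, norm_div, Complex.norm_real, Real.norm_of_nonneg hpi.le]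
    have := norm_add_le U V
    rw [Complex.norm_ofNat, div_mul_eq_mul_div, div_le_iff₀ hpi]
    have h1 : Real.pi * (‖cmp 1 g‖ ^ 2 + ‖cmp 1 f‖ ^ 2) + Real.pi * (‖cmp (-1) g‖ ^ 2 + ‖cmp (-1) f‖ ^ 2) =
        (‖g‖ ^ 2 + ‖f‖ ^ 2) * Real.pi / 2 := by rw [n1, n2]; ring
    linarith
  have t2 : ‖(1 / (2 * Real.pi) * (X + (starRingEnd ℂ) Y) : ℂ)‖ ≤
      1 / (2 * Real.pi) * C * (‖g‖ ^ 2 + ‖f‖ ^ 2) := by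
    have h1 : ‖(1 / (2 * Real.pi) : ℂ)‖ = 1 / (2 * Real.pi) := by
      rw [norm_div, norm_mul, Complex.norm_real, Real.norm_of_nonneg hpi.le]; simp
    have := norm_add_le X ((starRingEnd ℂ) Y)
    rw [RCLike.norm_conj] at this
    rw [norm_mul, h1, mul_assoc]
    gcongr
    linarith
  calc _ ≤ _ := norm_sub_le _ _
    _ ≤ _ := add_le_add t1 t2
    _ = _ := by ring

end PointNLS
end

noncomputable section
namespace PointNLS

/-! ### Bounded forms and their weak limits -/

/-- A sesquilinear form with `|B(g, f)| ≤ C (‖g‖² + ‖f‖²)`. -/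
structure IsForm (C : ℝ) (B : L2 → L2 → ℂ) : Prop where
  add_left : ∀ g g' f, B (g + g') f = B g f + B g' f
  add_right : ∀ g f f', B g (f + f') = B g f + B g f'
  smul_left : ∀ (c : ℂ) g f, B (c • g) f = (starRingEnd ℂ) c * B g f
  smul_right : ∀ (c : ℂ) g f, B g (c • f) = c * B g f
  bound : ∀ g f, ‖B g f‖ ≤ C * (‖g‖ ^ 2 + ‖f‖ ^ 2)

namespace IsForm

/-- Homogeneity turns the bound by a sum of squares into a bound by a product: it is applied to `‖f‖
g` and `‖g‖ f`, which have equal norms. -/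
theorem norm_le {C : ℝ} {B : L2 → L2 → ℂ} (h : IsForm C B) (g f : L2) :
    ‖B g f‖ ≤ 2 * C * ‖g‖ * ‖f‖ := by
  rcases eq_or_ne g 0 with rfl | hg
  · have := h.smul_left 0 0 f
    rw [smul_zero, map_zero, zero_mul] at this
    simp [this]
  rcases eq_or_ne f 0 with rfl | hf
  · have := h.smul_right 0 g 0
    rw [smul_zero, zero_mul] at this
    simp [this]
  have g0 : 0 < ‖g‖ := norm_pos_iff.2 hg
  have f0 : 0 < ‖f‖ := norm_pos_iff.2 hf
  have key := h.bound (((‖f‖ : ℝ) : ℂ) • g) (((‖g‖ : ℝ) : ℂ) • f)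
  rw [h.smul_left, h.smul_right, Complex.conj_ofReal, norm_mul, norm_mul, norm_smul, norm_smul,
    Complex.norm_real, Complex.norm_real, norm_norm, norm_norm] at key
  have hp : 0 < ‖f‖ * ‖g‖ := by positivity
  have : (‖f‖ * ‖g‖) * ‖B g f‖ ≤ (‖f‖ * ‖g‖) * (2 * C * ‖g‖ * ‖f‖) := by
    calc _ = ‖f‖ * (‖g‖ * ‖B g f‖) := by ring
      _ ≤ _ := key
      _ = _ := by ring
  exact le_of_mul_le_mul_left this hp

theorem nonneg {C : ℝ} {B : L2 → L2 → ℂ} (h : IsForm C B) (g f : L2) : 0 ≤ 2 * C * ‖g‖ * ‖f‖ :=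
  (norm_nonneg _).trans (h.norm_le g f)

theorem exists_clm {C : ℝ} {B : L2 → L2 → ℂ} (h : IsForm C B) :
    ∃ T : L2 →L[ℂ] L2, ∀ g f, inner ℂ g (T f) = B g f := by
  set A : L2 →ₗ⋆[ℂ] L2 →ₗ[ℂ] ℂ := LinearMap.mk₂'ₛₗ (starRingEnd ℂ) (RingHom.id ℂ) B h.add_left
    h.smul_left h.add_right h.smul_right
  set S := InnerProductSpace.continuousLinearMapOfBilin (A.mkContinuous₂ (2 * C) h.norm_le)
  refine ⟨ContinuousLinearMap.adjoint S, fun g f => ?_⟩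
  rw [ContinuousLinearMap.adjoint_inner_right, InnerProductSpace.continuousLinearMapOfBilin_apply]
  rfl

theorem sub_eq {C : ℝ} {B : L2 → L2 → ℂ} (h : IsForm C B) (g f g' f' : L2) :
    B g f - B g' f' = B (g - g') f + B g' (f - f') := by
  have e1 := h.add_left (g - g') g' f
  have e2 := h.add_right g' (f - f') f'
  rw [sub_add_cancel] at e1 e2
  rw [e1, e2]; ring

theorem norm_sub_le {C : ℝ} {B : L2 → L2 → ℂ} (h : IsForm C B) (g f g' f' : L2) :
    ‖B g f - B g' f'‖ ≤ 2 * C * ‖g - g'‖ * ‖f‖ + 2 * C * ‖g'‖ * ‖f - f'‖ := by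
  rw [h.sub_eq]
  exact (norm_add_le _ _).trans (add_le_add (h.norm_le _ _) (h.norm_le _ _))

theorem tendsto {C : ℝ} {B : L2 → L2 → ℂ} (h : IsForm C B) {g f : L2} {gn fn : ℕ → L2}
    (hg : Tendsto gn atTop (𝓝 g)) (hf : Tendsto fn atTop (𝓝 f)) :
    Tendsto (fun n => B (gn n) (fn n)) atTop (𝓝 (B g f)) := by
  obtain ⟨T, hT⟩ := h.exists_clm
  simp only [← hT]
  exact hg.inner ((T.continuous.tendsto f).comp hf)

/-- A form already known to be continuous inherits any better constant that holds on truncated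
functions. It trades a constant depending on `M` for a uniform one. -/
theorem of_bound {C C' : ℝ} {B : L2 → L2 → ℂ} (h : IsForm C B) {tr : ℕ → L2 → L2}
    (htr : ∀ u, Tendsto (fun n => tr n u) atTop (𝓝 u))
    (hb : ∀ n m g f, ‖B (tr n g) (tr m f)‖ ≤ C' * (‖tr n g‖ ^ 2 + ‖tr m f‖ ^ 2)) : IsForm C' B := by
  refine ⟨h.add_left, h.add_right, h.smul_left, h.smul_right, fun g f => ?_⟩
  exact le_of_tendsto_of_tendsto (h.tendsto (htr g) (htr f)).norm
    ((((htr g).norm.pow 2).add ((htr f).norm.pow 2)).const_mul C') (Eventually.of_forall fun n => hb n n g f)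

/-- Weak convergence on a dense set implies weak convergence. -/
theorem exists_limit {ι : Type*} {l : Filter ι} [l.NeBot] {C : ℝ} {B : ι → L2 → L2 → ℂ}
    (h : ∀ᶠ i in l, IsForm C (B i)) {tr : ℕ → L2 → L2}
    (htr : ∀ u, Tendsto (fun n => tr n u) atTop (𝓝 u))
    (hl : ∀ n m g f, ∃ a, Tendsto (fun i => B i (tr n g) (tr m f)) l (𝓝 a)) :
    ∃ A : L2 → L2 → ℂ, IsForm C A ∧ ∀ g f, Tendsto (fun i => B i g f) l (𝓝 (A g f)) := by
  have key : ∀ g f, ∃ a, Tendsto (fun i => B i g f) l (𝓝 a) := by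
    intro g f
    -- Equicontinuity: the truncation error is below `ε/4` uniformly in the index, and the truncated
    -- values converge, so the values are eventually in one ball of radius `ε/2`.
    rw [← cauchy_map_iff_exists_tendsto, Metric.cauchy_iff]
    refine ⟨inferInstance, fun ε hε => ?_⟩
    have hlim : Tendsto (fun n => 2 * C * ‖g - tr n g‖ * ‖f‖ + 2 * C * ‖tr n g‖ * ‖f - tr n f‖) atTop
        (𝓝 (2 * C * ‖g - g‖ * ‖f‖ + 2 * C * ‖g‖ * ‖f - f‖)) :=
      ((((htr g).const_sub g).norm.const_mul _).mul_const _).add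
        (((htr g).norm.const_mul _).mul ((htr f).const_sub f).norm)
    simp only [sub_self, norm_zero, mul_zero, zero_mul, add_zero] at hlim
    obtain ⟨n, hn⟩ := (hlim.eventually_lt_const (show 0 < ε / 4 by positivity)).exists
    obtain ⟨a, ha⟩ := hl n n g f
    refine ⟨Metric.ball a (ε / 2), ?_, fun x hx y hy => ?_⟩
    · have h2 : ∀ᶠ i in l, dist (B i (tr n g) (tr n f)) a < ε / 4 :=
        ha.eventually (Metric.ball_mem_nhds a (by positivity))
      refine Filter.mem_map.2 ?_
      filter_upwards [h, h2] with i h1 h2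
      have h3 := h1.norm_sub_le g f (tr n g) (tr n f)
      rw [← dist_eq_norm] at h3
      have h4 := dist_triangle (B i g f) (B i (tr n g) (tr n f)) a
      change dist (B i g f) a < ε / 2
      linarith
    · have := dist_triangle_right x y a
      have := Metric.mem_ball.1 hx
      have := Metric.mem_ball.1 hy
      linarith
  choose A hA using key
  refine ⟨A, ⟨fun g g' f => ?_, fun g f f' => ?_, fun c g f => ?_, fun c g f => ?_, fun g f => ?_⟩, hA⟩
  · refine tendsto_nhds_unique (hA (g + g') f) (((hA g f).add (hA g' f)).congr' ?_)
    filter_upwards [h] with i hi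
    exact (hi.add_left g g' f).symm
  · refine tendsto_nhds_unique (hA g (f + f')) (((hA g f).add (hA g f')).congr' ?_)
    filter_upwards [h] with i hi
    exact (hi.add_right g f f').symm
  · refine tendsto_nhds_unique (hA (c • g) f) (((hA g f).const_mul _).congr' ?_)
    filter_upwards [h] with i hi
    exact (hi.smul_left c g f).symm
  · refine tendsto_nhds_unique (hA g (c • f)) (((hA g f).const_mul _).congr' ?_)
    filter_upwards [h] with i hi
    exact (hi.smul_right c g f).symm
  · refine le_of_tendsto (hA g f).norm ?_
    filter_upwards [h] with i hi
    exact hi.bound g f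

end IsForm

/-! ### Truncation -/

/-- The restriction of an `L²` function to a ball. -/
def cut (n : ℕ) (a : S2) : S2 :=
  ((Lp.memLp a).indicator (s := Metric.closedBall (0 : R3) n) measurableSet_closedBall).toLp _

theorem coeFn_cut (n : ℕ) (a : S2) :
    (cut n a : R3 → ℂ) =ᵐ[volume] (Metric.closedBall (0 : R3) n).indicator a := MemLp.coeFn_toLp _

theorem tame_indicator (n : ℕ) (a : S2) : Tame ((Metric.closedBall (0 : R3) n).indicator a) := by
  refine ⟨(Lp.memLp a).indicator measurableSet_closedBall, n, fun x hx => ?_⟩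
  rw [Set.indicator_of_notMem]
  simpa using hx

theorem tendsto_cut (a : S2) : Tendsto (fun n => cut n a) atTop (𝓝 a) := by
  rw [tendsto_iff_norm_sub_tendsto_zero]
  have h2 : Tendsto (fun n => ‖cut n a - a‖ ^ 2) atTop (𝓝 0) := by
    have e : ∀ n, ‖cut n a - a‖ ^ 2 =
        ∫ x, ‖(Metric.closedBall (0 : R3) n).indicator a x - a x‖ ^ 2 := by
      intro n
      rw [← integral_norm_sq_Lp]
      refine integral_congr_ae ?_
      filter_upwards [Lp.coeFn_sub (cut n a) a, coeFn_cut n a] with x h1 h2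
      rw [h1, Pi.sub_apply, h2]
    simp only [e]
    have h0 : (0 : ℝ) = ∫ x : R3, (0 : ℝ) := by simp
    rw [h0]
    refine tendsto_integral_of_dominated_convergence (fun x => ‖a x‖ ^ 2) (fun n => ?_)
      (integrable_sq_norm (Lp.memLp a)) (fun n => Eventually.of_forall fun x => ?_)
      (Eventually.of_forall fun x => ?_)
    · exact (((tame_indicator n a).1.1.sub (Lp.aestronglyMeasurable a)).norm.pow 2)
    · by_cases hx : x ∈ Metric.closedBall (0 : R3) n
      · simp [Set.indicator_of_mem hx]
      · simp [Set.indicator_of_notMem hx]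
    · refine tendsto_const_nhds.congr' ?_
      filter_upwards [eventually_ge_atTop ⌈‖x‖⌉₊] with n hn
      have : x ∈ Metric.closedBall (0 : R3) n := by
        simpa using Nat.ceil_le.1 hn
      simp [Set.indicator_of_mem this]
  have := h2.sqrt
  simpa [Real.sqrt_sq] using this

/-- The restriction of an `L²` function with values in `ℂ²` to a ball. -/
def trunc (n : ℕ) (u : L2) : L2 := emb 1 (cut n (cmp 1 u)) + emb (-1) (cut n (cmp (-1) u))

theorem cmp_trunc (n : ℕ) (u : L2) : cmp 1 (trunc n u) = cut n (cmp 1 u) ∧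
    cmp (-1) (trunc n u) = cut n (cmp (-1) u) := cmp_emb_add _ _

theorem tendsto_trunc (u : L2) : Tendsto (fun n => trunc n u) atTop (𝓝 u) := by
  have h : Tendsto (fun n => trunc n u) atTop (𝓝 (emb 1 (cmp 1 u) + emb (-1) (cmp (-1) u))) :=
    (((emb 1).continuous.tendsto _).comp (tendsto_cut _)).add
      (((emb (-1)).continuous.tendsto _).comp (tendsto_cut _))
  rwa [← eq_emb_add] at h

/-- `f` agrees almost everywhere with a tame function. -/
def AETame (f : R3 → ℂ) : Prop := ∃ f', Tame f' ∧ f =ᵐ[volume] f'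

theorem Tame.conj {f : R3 → ℂ} (h : Tame f) : Tame fun x => (starRingEnd ℂ) (f x) := by
  obtain ⟨h1, N, hN⟩ := h
  exact ⟨memLp_conj h1, N, fun x hx => by simp only [hN x hx, map_zero]⟩

theorem AETame.conj {f : R3 → ℂ} (h : AETame f) : AETame fun x => (starRingEnd ℂ) (f x) := by
  obtain ⟨f', h1, h2⟩ := h
  exact ⟨_, h1.conj, h2.mono fun x hx => by simp only [hx]⟩

theorem aeTame_trunc (n : ℕ) (u : L2) : AETame (cmp 1 (trunc n u)) ∧ AETame (cmp (-1) (trunc n u)) := by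
  obtain ⟨h1, h2⟩ := cmp_trunc n u
  rw [h1, h2]
  exact ⟨⟨_, tame_indicator n _, coeFn_cut n _⟩, ⟨_, tame_indicator n _, coeFn_cut n _⟩⟩

theorem Phi_congr {f f' : R3 → ℂ} (h : f =ᵐ[volume] f') : Phi f = Phi f' := by
  ext κ
  exact integral_congr_ae (h.mono fun x hx => by simp only [hx])

theorem sqn_congr {f f' : R3 → ℂ} (h : f =ᵐ[volume] f') : sqn f = sqn f' :=
  integral_congr_ae (h.mono fun x hx => by simp only [hx])

theorem singPart_congr (σ ω : ℝ) {F₁ F₂ G₁ G₂ F₁' F₂' G₁' G₂' : R3 → ℂ} (h1 : F₁ =ᵐ[volume] F₁')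
    (h2 : F₂ =ᵐ[volume] F₂') (h3 : G₁ =ᵐ[volume] G₁') (h4 : G₂ =ᵐ[volume] G₂') :
    singPart σ ω F₁ F₂ G₁ G₂ = singPart σ ω F₁' F₂' G₁' G₂' := by
  ext κ μ
  simp only [singPart, Phi_congr h1, Phi_congr h2, Phi_congr h3, Phi_congr h4]

end PointNLS
end

noncomputable section
namespace PointNLS

/-! ### The limit of the contour integral and the projection `Π⁺` -/

theorem axisForm_conj {ω : ℝ} (hω : 0 < ω) (σ : ℝ) (F₁ F₂ G₁ G₂ : R3 → ℂ) (t : ℝ) :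
    (starRingEnd ℂ) (axisForm σ ω (fun x => (starRingEnd ℂ) (F₁ x)) (fun x => (starRingEnd ℂ) (F₂ x))
      (fun x => (starRingEnd ℂ) (G₁ x)) (fun x => (starRingEnd ℂ) (G₂ x)) (t * Complex.I)) =
      -axisForm σ ω F₁ F₂ G₁ G₂ (((-t : ℝ) : ℂ) * Complex.I) := by
  have e1 : (((-t : ℝ) : ℂ) * Complex.I) = (starRingEnd ℂ) (t * Complex.I) := by simp
  have e2 : muK ω (((-t : ℝ) : ℂ) * Complex.I) = (starRingEnd ℂ) (muK ω (t * Complex.I)) := by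
    rw [muK_imaginary hω, muK_imaginary hω, Complex.conj_ofReal, neg_sq]
  rw [axisForm, axisForm, e2, e1, singPart_conj, map_mul]
  ring

theorem axisForm_congr (σ ω : ℝ) {F₁ F₂ G₁ G₂ F₁' F₂' G₁' G₂' : R3 → ℂ} (h1 : F₁ =ᵐ[volume] F₁')
    (h2 : F₂ =ᵐ[volume] F₂') (h3 : G₁ =ᵐ[volume] G₁') (h4 : G₂ =ᵐ[volume] G₂') :
    axisForm σ ω F₁ F₂ G₁ G₂ = axisForm σ ω F₁' F₂' G₁' G₂' := by
  ext κ
  simp only [axisForm, singPart_congr σ ω h1 h2 h3 h4]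

theorem singL_congr (σ ω : ℝ) {F₁ F₂ G₁ G₂ F₁' F₂' G₁' G₂' : R3 → ℂ} (h1 : F₁ =ᵐ[volume] F₁')
    (h2 : F₂ =ᵐ[volume] F₂') (h3 : G₁ =ᵐ[volume] G₁') (h4 : G₂ =ᵐ[volume] G₂') :
    singL σ ω F₁ F₂ G₁ G₂ = singL σ ω F₁' F₂' G₁' G₂' := by
  ext κ
  simp only [singL, singPart_congr σ ω h1 h2 h3 h4]

/-- The charge part of the matrix elements on the contour. -/
def axisF (σ ω : ℝ) (g f : L2) (t : ℝ) : ℂ :=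
  axisForm σ ω (cmp 1 f) (cmp (-1) f) (fun x => (starRingEnd ℂ) (cmp 1 g x))
    (fun x => (starRingEnd ℂ) (cmp (-1) g x)) (t * Complex.I)

/-- The components of `u` agree almost everywhere with tame functions. -/
def TamePair (u : L2) : Prop := AETame (cmp 1 u) ∧ AETame (cmp (-1) u)

theorem StripBounds.integrable_axisF {σ ω δ K : ℝ} (hB : StripBounds σ ω δ K) {g f : L2}
    (hg : TamePair g) (hf : TamePair f) : Integrable (axisF σ ω g f) volume ∧
    ∫ t : ℝ, ‖axisF σ ω g f t‖ ≤ 2 * Real.pi * (K ^ 3 * (1 + |dd σ ω|)) * (‖g‖ ^ 2 + ‖f‖ ^ 2) := by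
  obtain ⟨⟨F₁, a1, b1⟩, ⟨F₂, a2, b2⟩⟩ := hf
  obtain ⟨⟨G₁, a3, b3⟩, ⟨G₂, a4, b4⟩⟩ := AETame.conj hg.1, AETame.conj hg.2
  have e : axisF σ ω g f = fun t : ℝ => axisForm σ ω F₁ F₂ G₁ G₂ (t * Complex.I) := by
    ext t
    rw [axisF, axisForm_congr σ ω b1 b2 b3 b4]
  obtain ⟨h1, h2⟩ := hB.integral_axisForm_le a1 a2 a3 a4
  rw [e]
  refine ⟨h1, h2.trans (le_of_eq ?_)⟩
  have := sqn_sum_eq g f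
  rw [← sqn_congr b1, ← sqn_congr b2, ← sqn_congr b3, ← sqn_congr b4, sqn_conj, sqn_conj, this]
  ring

/-- The right side of the contour supplies the half axis `t > 0`; the left side, after conjugation,
supplies `t < 0`. Together they form one integral over a symmetric interval, to which contour
deformations can be applied. -/
theorem StripBounds.tendsto_sing {σ ω δ K : ℝ} (hB : StripBounds σ ω δ K) {M : ℝ} (hM : ω < M)
    {g f : L2} (hg : TamePair g) (hf : TamePair f) :
    Tendsto (fun ε : ℝ => (∫ η in ω..M, singR σ ω g f (ε + η * Complex.I)) +
        (starRingEnd ℂ) (∫ η in ω..M, singLf σ ω g f (ε + η * Complex.I))) (𝓝[>] 0)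
      (𝓝 (-(2 * Complex.I) * ∫ t in (-√(M - ω))..√(M - ω), axisF σ ω g f t)) := by
  have hi := fun a b => (hB.integrable_axisF hg hf).1.intervalIntegrable (a := a) (b := b)
  have key : ∀ {F₁ F₂ G₁ G₂ : R3 → ℂ}, AETame F₁ → AETame F₂ → AETame G₁ → AETame G₂ →
      Tendsto (fun ε : ℝ => ∫ η in ω..M, singL σ ω F₁ F₂ G₁ G₂ (ε + η * Complex.I)) (𝓝[>] 0)
        (𝓝 (-(2 * Complex.I) * ∫ t in (0 : ℝ)..√(M - ω), axisForm σ ω F₁ F₂ G₁ G₂ (t * Complex.I))) := by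
    rintro F₁ F₂ G₁ G₂ ⟨F₁', a1, b1⟩ ⟨F₂', a2, b2⟩ ⟨G₁', a3, b3⟩ ⟨G₂', a4, b4⟩
    rw [axisForm_congr σ ω b1 b2 b3 b4, singL_congr σ ω b1 b2 b3 b4,
      ← hB.integral_singL_boundary hM a1 a2 a3 a4]
    exact hB.tendsto_integral_singL hM a1 a2 a3 a4
  have k1 := key hf.1 hf.2 (AETame.conj hg.1) (AETame.conj hg.2)
  have k2 := key (AETame.conj hf.1) (AETame.conj hf.2) hg.1 hg.2
  have k3 := k1.add ((Complex.continuous_conj.tendsto _).comp k2)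
  refine Tendsto.congr' (Eventually.of_forall fun ε => rfl) (k3.trans_eq ?_)
  congr 1
  have e := intervalIntegral.integral_add_adjacent_intervals (hi (-√(M - ω)) 0) (hi 0 √(M - ω))
  have e2 : (starRingEnd ℂ) (-(2 * Complex.I) * ∫ t in (0 : ℝ)..√(M - ω), axisForm σ ω
      (fun x => (starRingEnd ℂ) (cmp 1 f x)) (fun x => (starRingEnd ℂ) (cmp (-1) f x))
      (cmp 1 g) (cmp (-1) g) (t * Complex.I)) =
      -(2 * Complex.I) * ∫ t in (-√(M - ω))..0, axisF σ ω g f t := by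
    have h0 := intervalIntegral.integral_comp_neg (a := 0) (b := √(M - ω)) (axisF σ ω g f)
    rw [neg_zero] at h0
    rw [← h0, map_mul, intervalIntegral.integral_of_le (Real.sqrt_nonneg _),
      intervalIntegral.integral_of_le (Real.sqrt_nonneg _), ← integral_conj]
    have h1 : ∀ t : ℝ, axisF σ ω g f (-t) = -(starRingEnd ℂ) (axisForm σ ω
        (fun x => (starRingEnd ℂ) (cmp 1 f x)) (fun x => (starRingEnd ℂ) (cmp (-1) f x))
        (cmp 1 g) (cmp (-1) g) (t * Complex.I)) := by
      intro t
      have := axisForm_conj hB.omega_pos σ (cmp 1 f) (cmp (-1) f)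
        (fun x => (starRingEnd ℂ) (cmp 1 g x)) (fun x => (starRingEnd ℂ) (cmp (-1) g x)) t
      simp only [Complex.conj_conj] at this
      rw [this, neg_neg]; rfl
    simp only [h1, integral_neg, map_neg, map_mul, map_ofNat, Complex.conj_I]
    ring
  rw [← e, mul_add, add_comm]
  exact congrArg₂ _ e2 rfl

theorem tendsto_arctan_div (y : ℝ) :
    Tendsto (fun ε : ℝ => Real.arctan (y / ε)) (𝓝[>] 0) (𝓝 (Real.pi / 2 * Real.sign y)) := by
  rcases lt_trichotomy y 0 with h | rfl | h
  · rw [Real.sign_of_neg h, mul_neg_one]; exact tendsto_arctan_div_neg h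
  · simp
  · rw [Real.sign_of_pos h, mul_one]; exact tendsto_arctan_div_pos h

/-- Convergence of the free part under convergence of the weights. -/
theorem tendsto_integral_weight {ι : Type*} {l : Filter ι} [l.IsCountablyGenerated] {m : ι → R3 → ℝ}
    {m₀ : R3 → ℝ} (hm : ∀ i ξ, |m i ξ| ≤ Real.pi) (hc : ∀ i, Measurable (m i))
    (hl : ∀ᵐ ξ, Tendsto (fun i => m i ξ) l (𝓝 (m₀ ξ))) (a b : S2) :
    Tendsto (fun i => ∫ ξ, (m i ξ : ℂ) * spec a b ξ) l (𝓝 (∫ ξ, (m₀ ξ : ℂ) * spec a b ξ)) := by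
  refine tendsto_integral_filter_of_dominated_convergence (fun ξ => Real.pi * ‖spec a b ξ‖)
    (Eventually.of_forall fun i => ?_)
    (Eventually.of_forall fun i => Eventually.of_forall fun ξ => norm_weight_mul_le (hm i ξ) _)
    ((integrable_spec a b).norm.const_mul _) ?_
  · exact (Complex.measurable_ofReal.comp (hc i)).aestronglyMeasurable.mul (integrable_spec a b).1
  · filter_upwards [hl] with ξ hξ
    exact ((Complex.continuous_ofReal.tendsto _).comp hξ).mul_const _

theorem measurable_sign : Measurable Real.sign := by
  unfold Real.sign
  exact Measurable.ite measurableSet_Iio measurable_const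
    (Measurable.ite measurableSet_Ioi measurable_const measurable_const)

/-- The limit of `cutP`. -/
def signP (ω M : ℝ) (ξ : R3) : ℝ := Real.pi / 2 * Real.sign (freq ξ) -
  Real.pi / 2 * Real.sign (freq ξ + ω - M)

theorem abs_sign_le (y : ℝ) : |Real.sign y| ≤ 1 := by
  rcases Real.sign_apply_eq y with h | h | h <;> simp [h]

theorem abs_signP_le (ω M : ℝ) (ξ : R3) : |signP ω M ξ| ≤ Real.pi := by
  have h1 := abs_le.1 (abs_sign_le (freq ξ))
  have h2 := abs_le.1 (abs_sign_le (freq ξ + ω - M))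
  have := Real.pi_pos
  rw [signP, abs_le]
  constructor <;> nlinarith

theorem measurable_signP (ω M : ℝ) : Measurable (signP ω M) := by
  have h1 := continuous_freq.measurable
  exact ((measurable_sign.comp h1).const_mul _).sub
    ((measurable_sign.comp ((h1.add_const _).sub_const _)).const_mul _)

/-- The arctangents tend to `(π/2) sign`. For the component along `(1, -i)` both arguments are
positive, because its free spectrum lies on the other branch, and the contribution vanishes. -/
theorem tendsto_integral_cut {ω : ℝ} (hω : 0 < ω) {M : ℝ} (hM : ω < M) (a b c d : S2) :
    Tendsto (fun ε : ℝ => (∫ ξ, (cutP ω ε M ξ : ℂ) * spec a b ξ) + ∫ ξ, (cutM ω ε M ξ : ℂ) * spec c d ξ)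
      (𝓝[>] 0) (𝓝 (∫ ξ, (signP ω M ξ : ℂ) * spec a b ξ)) := by
  have hf := continuous_freq
  have h1 : Tendsto (fun ε : ℝ => ∫ ξ, (cutP ω ε M ξ : ℂ) * spec a b ξ)
      (𝓝[>] 0) (𝓝 (∫ ξ, (signP ω M ξ : ℂ) * spec a b ξ)) :=
    tendsto_integral_weight (fun ε ξ => abs_arctan_sub_le _ _)
      (fun ε => Continuous.measurable (by fun_prop))
      (Eventually.of_forall fun ξ => (tendsto_arctan_div _).sub (tendsto_arctan_div _)) a b
  have h2 : Tendsto (fun ε : ℝ => ∫ ξ, (cutM ω ε M ξ : ℂ) * spec c d ξ)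
      (𝓝[>] 0) (𝓝 (∫ ξ, ((0 : ℝ) : ℂ) * spec c d ξ)) := by
    refine tendsto_integral_weight (m₀ := fun _ => 0) (fun ε ξ => abs_arctan_sub_le _ _)
      (fun ε => Continuous.measurable (by fun_prop))
      (Eventually.of_forall fun ξ => ?_) c d
    have hp : 0 ≤ freq ξ := by unfold freq; positivity
    have := (tendsto_arctan_div_pos (show 0 < freq ξ + ω + M by linarith)).sub
      (tendsto_arctan_div_pos (show 0 < freq ξ + ω + ω by linarith))
    rwa [sub_self] at this
  have := h1.add h2
  simpa using this

/-- The limit of the contour integral as `ε → 0`. -/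
def limForm (σ ω M : ℝ) (g f : L2) : ℂ :=
  2 / Real.pi * (∫ ξ, (signP ω M ξ : ℂ) * spec (cmp 1 g) (cmp 1 f) ξ) -
    1 / (2 * Real.pi) * (-(2 * Complex.I) * ∫ t in (-√(M - ω))..√(M - ω), axisF σ ω g f t)

theorem StripBounds.tendsto_contourIntegral {σ ω δ K : ℝ} (hB : StripBounds σ ω δ K) {M : ℝ}
    (hM : ω < M) {g f : L2} (hg : TamePair g) (hf : TamePair f) :
    Tendsto (fun ε : ℝ => contourIntegral σ ω ε ω M g f) (𝓝[>] 0) (𝓝 (limForm σ ω M g f)) := by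
  have h := ((tendsto_integral_cut hB.omega_pos hM (cmp 1 g) (cmp 1 f) (cmp (-1) g) (cmp (-1) f)).const_mul
    (2 / Real.pi : ℂ)).sub ((hB.tendsto_sing hM hg hf).const_mul (1 / (2 * Real.pi) : ℂ))
  refine h.congr' ?_
  have : Set.Ioo (0 : ℝ) (δ ^ 2) ∈ 𝓝[>] (0 : ℝ) :=
    Ioo_mem_nhdsGT (by have := hB.δ_pos; positivity)
  filter_upwards [this] with ε hε
  exact (hB.contourIntegral_eq hε.1 hε.2.le hM g f).symm

/-- The constant does not depend on `M`, unlike that of `exists_contourIntegral_bound`. It comes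
from the bound on the whole imaginary axis and allows `M → ∞`. -/
theorem StripBounds.norm_limForm_le {σ ω δ K : ℝ} (hB : StripBounds σ ω δ K) {M : ℝ}
    {g f : L2} (hg : TamePair g) (hf : TamePair f) :
    ‖limForm σ ω M g f‖ ≤ (1 + 2 * (K ^ 3 * (1 + |dd σ ω|))) * (‖g‖ ^ 2 + ‖f‖ ^ 2) := by
  have hpi := Real.pi_pos
  obtain ⟨h1, h2⟩ := hB.integrable_axisF hg hf
  have b1 := norm_integral_weight_le (m := signP ω M) (abs_signP_le ω M) (cmp 1 g) (cmp 1 f)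
  have b2 : ‖∫ t in (-√(M - ω))..√(M - ω), axisF σ ω g f t‖ ≤
      2 * Real.pi * (K ^ 3 * (1 + |dd σ ω|)) * (‖g‖ ^ 2 + ‖f‖ ^ 2) := by
    refine le_trans ?_ h2
    rw [intervalIntegral.integral_of_le (by have := Real.sqrt_nonneg (M - ω); linarith)]
    exact (norm_integral_le_integral_norm _).trans (setIntegral_le_integral h1.norm
      (Eventually.of_forall fun t => norm_nonneg _))
  have n1 := norm_sq_eq g
  have n2 := norm_sq_eq f
  rw [limForm]
  generalize (∫ t in (-√(M - ω))..√(M - ω), axisF σ ω g f t) = X at *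
  generalize (∫ ξ, (signP ω M ξ : ℂ) * spec (cmp 1 g) (cmp 1 f) ξ) = U at *
  have t1 : ‖(2 / Real.pi * U : ℂ)‖ ≤ ‖g‖ ^ 2 + ‖f‖ ^ 2 := by
    rw [norm_mul, norm_div, Complex.norm_real, Real.norm_of_nonneg hpi.le]
    rw [Complex.norm_ofNat, div_mul_eq_mul_div, div_le_iff₀ hpi]
    have h1 : Real.pi * (‖cmp 1 g‖ ^ 2 + ‖cmp 1 f‖ ^ 2) + Real.pi * (‖cmp (-1) g‖ ^ 2 + ‖cmp (-1) f‖ ^ 2) =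
        (‖g‖ ^ 2 + ‖f‖ ^ 2) * Real.pi / 2 := by rw [n1, n2]; ring
    have : 0 ≤ Real.pi * (‖cmp (-1) g‖ ^ 2 + ‖cmp (-1) f‖ ^ 2) := by positivity
    linarith
  have t2 : ‖(1 / (2 * Real.pi) * (-(2 * Complex.I) * X) : ℂ)‖ ≤
      2 * (K ^ 3 * (1 + |dd σ ω|)) * (‖g‖ ^ 2 + ‖f‖ ^ 2) := by
    have h1 : ‖(1 / (2 * Real.pi) : ℂ)‖ = 1 / (2 * Real.pi) := by
      rw [norm_div, norm_mul, Complex.norm_real, Real.norm_of_nonneg hpi.le]; simp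
    have h2 : ‖(-(2 * Complex.I) : ℂ)‖ = 2 := by simp
    rw [norm_mul, norm_mul, h1, h2, div_mul_eq_mul_div, div_le_iff₀ (by positivity)]
    linarith
  calc _ ≤ _ := norm_sub_le _ _
    _ ≤ _ := add_le_add t1 t2
    _ = _ := by ring

theorem emb_cmp_aux (g f : L2) : inner ℂ g (emb 1 (cmp 1 f)) = 2 * inner ℂ (cmp 1 g) (cmp 1 f) := by
  have := inner_emb g 1 (cmp 1 f)
  rwa [Complex.ofReal_one] at this

theorem freq_pos {ξ : R3} (h : ξ ≠ 0) : 0 < freq ξ := by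
  unfold freq
  have := norm_pos_iff.2 h
  have := Real.pi_pos
  positivity

/-- As `M → ∞` the weight `signP` tends to `π` off `ξ = 0`, so the free part becomes the projection
onto the line of `(1, i)`; the charge part becomes the integral over the full axis, with factor
`(-1/(2π))(-2i) = i/π`. -/
theorem StripBounds.tendsto_limForm {σ ω δ K : ℝ} (hB : StripBounds σ ω δ K)
    {g f : L2} (hg : TamePair g) (hf : TamePair f) :
    Tendsto (fun M => limForm σ ω M g f) atTop
      (𝓝 (inner ℂ g (emb 1 (cmp 1 f)) + Complex.I / Real.pi * ∫ t, axisF σ ω g f t)) := by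
  have hpi : (Real.pi : ℂ) ≠ 0 := by exact_mod_cast Real.pi_ne_zero
  have hs : Tendsto (fun M => √(M - ω)) atTop atTop :=
    Real.tendsto_sqrt_atTop.comp (tendsto_atTop_add_const_right _ _ tendsto_id)
  have h1 := intervalIntegral_tendsto_integral (hB.integrable_axisF hg hf).1
    (tendsto_neg_atTop_atBot.comp hs) hs
  have h2 : Tendsto (fun M => ∫ ξ, (signP ω M ξ : ℂ) * spec (cmp 1 g) (cmp 1 f) ξ) atTop
      (𝓝 (∫ ξ, (Real.pi : ℂ) * spec (cmp 1 g) (cmp 1 f) ξ)) := by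
    refine tendsto_integral_weight (m₀ := fun _ => Real.pi) (fun M => abs_signP_le ω M)
      (fun M => measurable_signP ω M) ?_ _ _
    filter_upwards [ae_ne_zero] with ξ hξ
    refine tendsto_const_nhds.congr' ?_
    filter_upwards [eventually_gt_atTop (freq ξ + ω)] with M hM
    rw [signP, Real.sign_of_pos (freq_pos hξ), Real.sign_of_neg (by linarith)]
    ring
  rw [integral_const_mul, integral_spec] at h2
  have h3 := (h2.const_mul (2 / Real.pi : ℂ)).sub
    ((h1.const_mul (-(2 * Complex.I))).const_mul (1 / (2 * Real.pi) : ℂ))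
  refine Tendsto.congr' (Eventually.of_forall fun ε => rfl) (h3.trans_eq ?_)
  congr 1
  rw [emb_cmp_aux]
  field_simp
  ring

theorem StripBounds.isForm_contourIntegral {σ ω δ K : ℝ} (hB : StripBounds σ ω δ K) {M : ℝ}
    (hM : ω < M) : ∃ C : ℝ, ∀ᶠ ε in 𝓝[>] (0 : ℝ), IsForm C (contourIntegral σ ω ε ω M) := by
  obtain ⟨C, hC, hb⟩ := hB.exists_contourIntegral_bound hM
  refine ⟨C, ?_⟩
  have : Set.Ioo (0 : ℝ) (δ ^ 2) ∈ 𝓝[>] (0 : ℝ) :=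
    Ioo_mem_nhdsGT (by have := hB.δ_pos; positivity)
  filter_upwards [this] with ε hε
  have hi := hB.intervalIntegrable_jump hε.1 hε.2.le hM
  refine ⟨fun g g' f => ?_, fun g f f' => ?_, fun c g f => ?_, fun c g f => ?_,
    fun g f => hb ε hε.1 hε.2.le g f⟩
  · simp only [contourIntegral, intervalIntegral.integral_mul_const, inner_add_left]
    rw [intervalIntegral.integral_add (hi g f) (hi g' f)]; ring
  · simp only [contourIntegral, intervalIntegral.integral_mul_const, map_add, inner_add_right]
    rw [intervalIntegral.integral_add (hi g f) (hi g f')]; ring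
  · simp only [contourIntegral, intervalIntegral.integral_mul_const, inner_smul_left]
    rw [intervalIntegral.integral_const_mul]; ring
  · simp only [contourIntegral, intervalIntegral.integral_mul_const, map_smul, inner_smul_right]
    rw [intervalIntegral.integral_const_mul]; ring

/-- Existence of `Π⁺`, and its matrix elements between truncated functions. -/
theorem StripBounds.exists_isPiPlus {σ ω δ K : ℝ} (hB : StripBounds σ ω δ K) :
    ∃ P, IsPiPlus σ ω P ∧ ∀ g f, TamePair g → TamePair f → inner ℂ g (P f) =
      inner ℂ g (emb 1 (cmp 1 f)) + Complex.I / Real.pi * ∫ t, axisF σ ω g f t := by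
  have ht : ∀ n u, TamePair (trunc n u) := fun n u => aeTame_trunc n u
  set C' := 1 + 2 * (K ^ 3 * (1 + |dd σ ω|))
  have step : ∀ M : ℝ, ∃ A : L2 → L2 → ℂ, IsForm C' A ∧ (ω < M → ∀ g f,
      Tendsto (fun ε => contourIntegral σ ω ε ω M g f) (𝓝[>] 0) (𝓝 (A g f))) := by
    intro M
    by_cases hM : ω < M
    · obtain ⟨C, hC⟩ := hB.isForm_contourIntegral hM
      obtain ⟨A, h1, h2⟩ := IsForm.exists_limit hC tendsto_trunc
        (fun n m g f => ⟨_, hB.tendsto_contourIntegral hM (ht n g) (ht m f)⟩)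
      refine ⟨A, h1.of_bound tendsto_trunc fun n m g f => ?_, fun _ => h2⟩
      rw [tendsto_nhds_unique (h2 (trunc n g) (trunc m f))
        (hB.tendsto_contourIntegral hM (ht n g) (ht m f))]
      exact hB.norm_limForm_le (ht n g) (ht m f)
    · have hC : 0 ≤ C' := by
        have := hB.K_ge
        positivity
      exact ⟨fun _ _ => 0, ⟨by simp, by simp, by simp, by simp, fun g f => by
        rw [norm_zero]; positivity⟩, fun h => absurd h hM⟩
  choose A hA hlim using step
  have hT : ∀ g f, TamePair g → TamePair f → Tendsto (fun M => A M g f) atTop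
      (𝓝 (inner ℂ g (emb 1 (cmp 1 f)) + Complex.I / Real.pi * ∫ t, axisF σ ω g f t)) := by
    intro g f hg hf
    refine (hB.tendsto_limForm hg hf).congr' ?_
    filter_upwards [eventually_gt_atTop ω] with M hM
    exact tendsto_nhds_unique (hB.tendsto_contourIntegral hM hg hf) (hlim M hM g f)
  obtain ⟨B, h1, h2⟩ := IsForm.exists_limit (l := atTop) (Eventually.of_forall hA) tendsto_trunc
    (fun n m g f => ⟨_, hT _ _ (ht n g) (ht m f)⟩)
  obtain ⟨P, hP⟩ := h1.exists_clm
  refine ⟨P, fun g f => ⟨fun M => A M g f, fun M hM => hlim M hM g f, ?_⟩, fun g f hg hf => ?_⟩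
  · rw [hP]; exact h2 g f
  · rw [hP]; exact tendsto_nhds_unique (h2 g f) (hT g f hg hf)

theorem IsPiPlus.unique {σ ω : ℝ} {P P' : L2 →L[ℂ] L2} (h : IsPiPlus σ ω P) (h' : IsPiPlus σ ω P') :
    P = P' := by
  ext1 f
  refine ext_inner_left ℂ fun g => ?_
  obtain ⟨I, h1, h2⟩ := h g f
  obtain ⟨I', h1', h2'⟩ := h' g f
  refine tendsto_nhds_unique h2 (h2'.congr' ?_)
  filter_upwards [eventually_gt_atTop ω] with M hM
  exact tendsto_nhds_unique (h1' M hM) (h1 M hM)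

end PointNLS
end

noncomputable section
namespace PointNLS

/-! ### Weighted bounds -/

/-- Both components of `u` are bounded by `A w`. -/
def WBound (A : ℝ) (u : L2) : Prop :=
  (∀ᵐ x, ‖cmp 1 u x‖ ≤ A * w x) ∧ ∀ᵐ x, ‖cmp (-1) u x‖ ≤ A * w x

theorem w_pos (x : R3) : 0 < w x := by unfold w; positivity

theorem measurable_w : Measurable w := by unfold w; fun_prop

theorem norm_cmp_le {c : ℂ} (hc : ‖c‖ = 1) (u : L2) : ∀ᵐ x, ‖cmp c u x‖ ≤ ‖u x‖ := by
  filter_upwards [coeFn_cmp c u] with x hx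
  rw [hx, norm_div, Complex.norm_ofNat, div_le_iff₀ (by norm_num)]
  have h1 := norm_sub_le (u x 0) (c * Complex.I * u x 1)
  rw [norm_mul, norm_mul, hc, Complex.norm_I, one_mul, one_mul] at h1
  have h2 := PiLp.norm_apply_le (u x) 0
  have h3 := PiLp.norm_apply_le (u x) 1
  linarith

theorem wBound_of_norm_le {A : ℝ} {u : L2} (h : ∀ᵐ x, ‖u x‖ ≤ A * w x) : WBound A u := by
  constructor
  · filter_upwards [norm_cmp_le (c := 1) (by simp) u, h] with x h1 h2 using h1.trans h2
  · filter_upwards [norm_cmp_le (c := -1) (by simp) u, h] with x h1 h2 using h1.trans h2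

theorem WBound.refl {A : ℝ} {u : L2} (h : WBound A u) : WBound A (refl u) := by
  obtain ⟨h1, h2⟩ := cmp_refl u
  rw [WBound, h1, h2]
  exact ⟨h.2, h.1⟩

theorem norm_cut_le {A : ℝ} {a : S2} (h : ∀ᵐ x, ‖a x‖ ≤ A * w x) (n : ℕ) :
    ∀ᵐ x, ‖(Metric.closedBall (0 : R3) n).indicator a x‖ ≤ A * w x := by
  filter_upwards [h] with x h1
  exact (norm_indicator_le_norm_self _ _).trans h1

/-- The explicit matrix elements are available for truncated functions, and the weighted bound of
the form is insensitive to truncation; continuity of the operator on `L²` then removes the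
truncation. -/
theorem StripBounds.exists_isPiPlus_bound {σ ω δ K : ℝ} (hB : StripBounds σ ω δ K) :
    ∃ C : ℝ, 0 ≤ C ∧ ∀ P, IsPiPlus σ ω P → ∀ (g f : L2) (A B : ℝ), 0 ≤ A → 0 ≤ B → WBound A f →
      WBound B g → ‖inner ℂ g (P f - emb 1 (cmp 1 f))‖ ≤ C * (A * B) := by
  obtain ⟨C, hC, hb⟩ := hB.exists_weighted_bound
  have hpi := Real.pi_pos
  refine ⟨1 / Real.pi * C, by positivity, fun P hP g f A B hA hB0 hf hg => ?_⟩
  obtain ⟨P', hP', hlim⟩ := hB.exists_isPiPlus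
  rw [hP.unique hP']
  set T : L2 →L[ℂ] L2 := P' - (emb 1).comp (cmp 1)
  have hT : ∀ u, T u = P' u - emb 1 (cmp 1 u) := fun u => rfl
  rw [← hT]
  have ht : Tendsto (fun n => inner ℂ (trunc n g) (T (trunc n f))) atTop (𝓝 (inner ℂ g (T f))) :=
    (tendsto_trunc g).inner ((T.continuous.tendsto f).comp (tendsto_trunc f))
  refine le_of_tendsto ht.norm (Eventually.of_forall fun n => ?_)
  obtain ⟨f1, f2⟩ := cmp_trunc n f
  obtain ⟨g1, g2⟩ := cmp_trunc n g
  have e : ∀ a : S2, (fun x => (starRingEnd ℂ) (cut n a x)) =ᵐ[volume]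
      fun x => (starRingEnd ℂ) ((Metric.closedBall (0 : R3) n).indicator a x) := fun a =>
    (coeFn_cut n a).mono fun x hx => by simp only [hx]
  have hax : ∀ t, axisF σ ω (trunc n g) (trunc n f) t = axisForm σ ω
      ((Metric.closedBall (0 : R3) n).indicator (cmp 1 f))
      ((Metric.closedBall (0 : R3) n).indicator (cmp (-1) f))
      (fun x => (starRingEnd ℂ) ((Metric.closedBall (0 : R3) n).indicator (cmp 1 g) x))
      (fun x => (starRingEnd ℂ) ((Metric.closedBall (0 : R3) n).indicator (cmp (-1) g) x))
      (t * Complex.I) := fun t => by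
    rw [axisF, f1, f2, g1, g2, axisForm_congr σ ω (coeFn_cut n _) (coeFn_cut n _) (e _) (e _)]
  rw [hT, inner_sub_right, hlim _ _ (aeTame_trunc n g) (aeTame_trunc n f), add_sub_cancel_left]
  simp only [hax]
  have h1 := hb _ _ _ _ A B (tame_indicator n (cmp 1 f)) (tame_indicator n (cmp (-1) f))
    (tame_indicator n (cmp 1 g)).conj (tame_indicator n (cmp (-1) g)).conj hA hB0
    (norm_cut_le hf.1 n) (norm_cut_le hf.2 n)
    (by simpa only [RCLike.norm_conj] using norm_cut_le hg.1 n)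
    (by simpa only [RCLike.norm_conj] using norm_cut_le hg.2 n)
  have h2 : ‖(Complex.I / Real.pi : ℂ)‖ = 1 / Real.pi := by
    rw [norm_div, Complex.norm_I, Complex.norm_real, Real.norm_of_nonneg hpi.le]
  rw [norm_mul, h2, mul_assoc]
  gcongr

/-! ### Duality for the weighted norms -/

/-- A bounded truncation of the weight. -/
def wcut (n : ℕ) : R3 → ℝ := (Metric.closedBall (0 : R3) n).indicator fun x => min (w x) n

theorem wcut_nonneg (n : ℕ) (x : R3) : 0 ≤ wcut n x :=
  Set.indicator_nonneg (fun x _ => le_min (w_pos x).le (Nat.cast_nonneg n)) x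

theorem wcut_le (n : ℕ) (x : R3) : wcut n x ≤ w x := by
  rw [wcut]
  exact Set.indicator_apply_le' (fun _ => min_le_left _ _) fun _ => (w_pos x).le

theorem measurable_wcut (n : ℕ) : Measurable (wcut n) :=
  (measurable_w.min measurable_const).indicator measurableSet_closedBall

theorem wcut_mono (x : R3) : Monotone fun n => wcut n x := by
  intro n m h
  have h' : (n : ℝ) ≤ m := by exact_mod_cast h
  refine (Set.indicator_le_indicator_of_subset (Metric.closedBall_subset_closedBall h')
    (fun x => le_min (w_pos x).le (Nat.cast_nonneg n)) x).trans ?_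
  exact Set.indicator_le_indicator (min_le_min_left _ h')

theorem wcut_eq {n : ℕ} {x : R3} (h1 : ‖x‖ ≤ n) (h2 : w x ≤ n) : wcut n x = w x := by
  rw [wcut, Set.indicator_of_mem (by simpa using h1), min_eq_left h2]

theorem memLp_wcut (n : ℕ) : MemLp (wcut n) 2 volume := by
  have h : MemLp ((Metric.closedBall (0 : R3) n).indicator fun _ => (n : ℝ)) 2 volume :=
    (memLp_indicator_const 2 measurableSet_closedBall _ (Or.inr measure_closedBall_lt_top.ne))
  refine h.mono (measurable_wcut n).aestronglyMeasurable (Eventually.of_forall fun x => ?_)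
  rw [Real.norm_of_nonneg (wcut_nonneg n x)]
  exact (Set.indicator_le_indicator (min_le_right _ _)).trans (le_abs_self _)

/-- The extremal test function is `w u/|u|`, which need not lie in `L²`. Replacing `w` by the
truncations `wcut n` makes it admissible, and monotone convergence recovers the full norm. -/
theorem normL1w_le_of_dual {u : L2} {C : ℝ} (h : ∀ g : L2, (∀ᵐ x, ‖g x‖ ≤ w x) → ‖inner ℂ g u‖ ≤ C) :
    normL1w u ≤ ENNReal.ofReal C := by
  have hu : AEStronglyMeasurable u volume := Lp.aestronglyMeasurable u
  have hum : AEMeasurable (fun x => ‖u x‖) volume := hu.norm.aemeasurable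
  have aux : ∀ a b : ℝ, b ≠ 0 → ((a / b : ℝ) : ℂ) * (b : ℂ) ^ 2 = ((a * b : ℝ) : ℂ) := fun a b hb => by
    have : (b : ℂ) ≠ 0 := by exact_mod_cast hb
    push_cast
    field_simp
  have key : ∀ n, ∫⁻ x, ENNReal.ofReal (wcut n x * ‖u x‖) ≤ ENNReal.ofReal C := by
    intro n
    -- Where `u` vanishes the quotient is `0` by convention, which is the right value for both the
    -- bound and the pairing.
    set G : R3 → C2 := fun x => ((wcut n x / ‖u x‖ : ℝ) : ℂ) • u x
    have hGn : ∀ x, ‖G x‖ ≤ wcut n x := fun x => by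
      rw [norm_smul, Complex.norm_real, Real.norm_of_nonneg (div_nonneg (wcut_nonneg n x) (norm_nonneg _))]
      rcases eq_or_ne ‖u x‖ 0 with h0 | h0
      · rw [h0, mul_zero]; exact wcut_nonneg n x
      · rw [div_mul_cancel₀ _ h0]
    have hGm : AEStronglyMeasurable G volume :=
      (Complex.measurable_ofReal.comp_aemeasurable
        ((measurable_wcut n).aemeasurable.div hum)).aestronglyMeasurable.smul hu
    have hG : MemLp G 2 volume := (memLp_wcut n).mono hGm (Eventually.of_forall fun x =>
      (hGn x).trans (le_abs_self _))
    have hi := h (hG.toLp G) (by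
      filter_upwards [hG.coeFn_toLp] with x hx
      rw [hx]; exact (hGn x).trans (wcut_le n x))
    have e : inner ℂ (hG.toLp G) u = ((∫ x, wcut n x * ‖u x‖ : ℝ) : ℂ) := by
      rw [L2.inner_def]
      refine Eq.trans (integral_congr_ae ?_) integral_ofReal
      filter_upwards [hG.coeFn_toLp] with x hx
      rw [hx, inner_smul_left, inner_self_eq_norm_sq_to_K, Complex.conj_ofReal]
      rcases eq_or_ne ‖u x‖ 0 with h0 | h0
      · simp [h0]
      · exact aux _ _ h0
    have hint : Integrable (fun x => wcut n x * ‖u x‖) volume :=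
      (memLp_wcut n).integrable_mul (Lp.memLp u).norm
    rw [e, Complex.norm_real] at hi
    rw [← ofReal_integral_eq_lintegral_ofReal hint
      (Eventually.of_forall fun x => mul_nonneg (wcut_nonneg n x) (norm_nonneg _))]
    exact ENNReal.ofReal_le_ofReal ((le_abs_self _).trans hi)
  rw [normL1w, eLpNorm_one_eq_lintegral_enorm]
  have hlim := lintegral_tendsto_of_tendsto_of_monotone (μ := (volume : Measure R3))
    (f := fun n x => ENNReal.ofReal (wcut n x * ‖u x‖)) (F := fun x => ‖w x • u x‖ₑ)
    (fun n => ((measurable_wcut n).aemeasurable.mul hum).ennreal_ofReal)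
    (Eventually.of_forall fun x n m hnm => ENNReal.ofReal_le_ofReal
      (mul_le_mul_of_nonneg_right (wcut_mono x hnm) (norm_nonneg _)))
    (Eventually.of_forall fun x => by
      refine tendsto_const_nhds.congr' ?_
      filter_upwards [eventually_ge_atTop ⌈max ‖x‖ (w x)⌉₊] with n hn
      have := Nat.ceil_le.1 hn
      rw [wcut_eq ((le_max_left _ _).trans this) ((le_max_right _ _).trans this),
        ← ofReal_norm, norm_smul, Real.norm_of_nonneg (w_pos x).le])
  exact le_of_tendsto' hlim key

theorem norm_le_normLinfw (h : L2) (hfin : normLinfw h < ⊤) :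
    ∀ᵐ x, ‖h x‖ ≤ (normLinfw h).toReal * w x := by
  have h1 := ae_le_eLpNormEssSup (f := fun x => (w x)⁻¹ • h x) (μ := (volume : Measure R3))
  filter_upwards [h1] with x hx
  rw [← eLpNorm_exponent_top] at hx
  change _ ≤ normLinfw h at hx
  have h2 := (ENNReal.toReal_le_toReal (by simp) hfin.ne).2 hx
  rw [toReal_enorm, norm_smul, norm_inv, Real.norm_of_nonneg (w_pos x).le,
    inv_mul_le_iff₀ (w_pos x)] at h2
  rwa [mul_comm]

end PointNLS
end

noncomputable section
namespace PointNLS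

/-! ### The bilinear pairing and the symplectic form -/

/-- The bilinear pairing `∫ a b`, as a functional of `b`. -/
def pairL (a : S2) : S2 →L[ℂ] ℂ := innerSL ℂ ((memLp_conj (Lp.memLp a)).toLp _)

theorem pairL_apply (a b : S2) : pairL a b = ∫ x, a x * b x := by
  rw [pairL, innerSL_apply_apply, L2.inner_def]
  refine integral_congr_ae ?_
  filter_upwards [(memLp_conj (Lp.memLp a)).coeFn_toLp] with x hx
  rw [hx, RCLike.inner_apply, Complex.conj_conj, mul_comm]

attribute [irreducible] pairL

theorem pairL_comm (a b : S2) : pairL a b = pairL b a := by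
  simp only [pairL_apply, mul_comm]

theorem pairL_smul_left (c : ℂ) (a b : S2) : pairL (c • a) b = c * pairL a b := by
  rw [pairL_comm, map_smul, pairL_comm b, smul_eq_mul]

/-- The symplectic form, as a functional of its first argument. -/
def OmL (v : L2) : L2 →L[ℂ] ℂ :=
  (2 * Complex.I) • ((pairL (cmp (-1) v)).comp (cmp 1) - (pairL (cmp 1 v)).comp (cmp (-1)))

theorem OmL_apply (v u : L2) : OmL v u =
    2 * Complex.I * (pairL (cmp (-1) v) (cmp 1 u) - pairL (cmp 1 v) (cmp (-1) u)) := rfl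

theorem Omega_eq (u v : L2) : Omega u v = OmL v u := by
  rw [OmL_apply, pairL_apply, pairL_apply, ← integral_sub
    ((Lp.memLp _).integrable_mul (Lp.memLp _)) ((Lp.memLp _).integrable_mul (Lp.memLp _)),
    ← integral_const_mul, Omega]
  refine integral_congr_ae ?_
  filter_upwards [coeFn_cmp 1 u, coeFn_cmp (-1) u, coeFn_cmp 1 v, coeFn_cmp (-1) v] with x a b c d
  rw [a, b, c, d]
  linear_combination ((u x 1 * v x 0) - u x 0 * v x 1) * Complex.I_sq

attribute [irreducible] OmL

theorem OmL_swap (u v : L2) : OmL v u = -OmL u v := by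
  rw [← Omega_eq, ← Omega_eq, Omega, Omega, ← integral_neg]
  refine integral_congr_ae (Eventually.of_forall fun x => ?_)
  simp only; ring

/-- The pair with components `p`, `q` along `(1, i)` and `(1, -i)`. -/
def E (p q : S2) : L2 := emb 1 p + emb (-1) q

theorem cmp_E (p q : S2) : cmp 1 (E p q) = p ∧ cmp (-1) (E p q) = q := cmp_emb_add p q

theorem OmL_E (p q p' q' : S2) :
    OmL (E p' q') (E p q) = 2 * Complex.I * (pairL p q' - pairL q p') := by
  rw [OmL_apply, (cmp_E p q).1, (cmp_E p q).2, (cmp_E p' q').1, (cmp_E p' q').2, pairL_comm p q',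
    pairL_comm q p']

/-! ### Projection along a symplectic subspace of dimension four -/

section Symplectic

/-- Two hyperbolic pairs for a form `B`, where `B v u` is the value at `(u, v)`. -/
structure Hyperbolic {V : Type*} [AddCommGroup V] [Module ℂ V] (B : V → V →ₗ[ℂ] ℂ)
    (e₁ e₂ e₃ e₄ : V) : Prop where
  swap : ∀ u v, B v u = -B u v
  h12 : B e₂ e₁ ≠ 0
  h34 : B e₄ e₃ ≠ 0
  h13 : B e₃ e₁ = 0
  h14 : B e₄ e₁ = 0
  h23 : B e₃ e₂ = 0
  h24 : B e₄ e₂ = 0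

/-- The projection onto the span of two hyperbolic pairs. -/
def symProj {V : Type*} [AddCommGroup V] [Module ℂ V] (B : V → V →ₗ[ℂ] ℂ) (e₁ e₂ e₃ e₄ f : V) : V :=
  ((B e₂ e₁)⁻¹ * B e₂ f) • e₁ - ((B e₂ e₁)⁻¹ * B e₁ f) • e₂ +
    (((B e₄ e₃)⁻¹ * B e₄ f) • e₃ - ((B e₄ e₃)⁻¹ * B e₃ f) • e₄)

namespace Hyperbolic

/-- On each basis vector only the partner in its own pair contributes, and the normalization
cancels; linearity in the first slot is borrowed from the second through antisymmetry. The
consequence is that `f - symProj f` lies in the symplectic complement. -/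
theorem apply_symProj {V : Type*} [AddCommGroup V] [Module ℂ V] {B : V → V →ₗ[ℂ] ℂ}
    {e₁ e₂ e₃ e₄ : V} (h : Hyperbolic B e₁ e₂ e₃ e₄) (f : V) {v : V}
    (hv : v ∈ Submodule.span ℂ {e₁, e₂, e₃, e₄}) : B v (symProj B e₁ e₂ e₃ e₄ f) = B v f := by
  obtain ⟨sw, a12, a34, a13, a14, a23, a24⟩ := h
  have b0 : ∀ u, B u u = 0 := fun u => by linear_combination (1 / 2) * sw u u
  have b21 := sw e₂ e₁
  have b43 := sw e₄ e₃
  have b31 : B e₁ e₃ = 0 := by rw [sw, a13, neg_zero]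
  have b41 : B e₁ e₄ = 0 := by rw [sw, a14, neg_zero]
  have b32 : B e₂ e₃ = 0 := by rw [sw, a23, neg_zero]
  have b42 : B e₂ e₄ = 0 := by rw [sw, a24, neg_zero]
  induction hv using Submodule.span_induction with
  | mem x hx =>
    rcases hx with rfl | rfl | rfl | rfl <;>
    · simp only [symProj, map_add, map_sub, map_smul, smul_eq_mul, b0, a13, a14, a23, a24, b31, b41,
        b32, b42, b21, b43]
      field_simp
      try ring
  | zero => rw [sw, sw _ 0, map_zero, map_zero]
  | add x y _ _ hx hy =>
    have e : ∀ z, B (x + y) z = B x z + B y z := fun z => by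
      rw [sw, map_add, neg_add, ← sw, ← sw]
    rw [e, e, hx, hy]
  | smul c x _ hx =>
    rw [sw, sw _ (c • x), map_smul, map_smul, ← smul_neg, ← smul_neg, ← sw, ← sw, hx]

theorem symProj_eq_self {V : Type*} [AddCommGroup V] [Module ℂ V] {B : V → V →ₗ[ℂ] ℂ}
    {e₁ e₂ e₃ e₄ : V} (h : Hyperbolic B e₁ e₂ e₃ e₄) {r : V}
    (hr : r ∈ Submodule.span ℂ {e₁, e₂, e₃, e₄}) : symProj B e₁ e₂ e₃ e₄ r = r := by
  obtain ⟨sw, a12, a34, a13, a14, a23, a24⟩ := h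
  have b0 : ∀ u, B u u = 0 := fun u => by linear_combination (1 / 2) * sw u u
  have b21 := sw e₂ e₁
  have b43 := sw e₄ e₃
  have b31 : B e₁ e₃ = 0 := by rw [sw, a13, neg_zero]
  have b41 : B e₁ e₄ = 0 := by rw [sw, a14, neg_zero]
  have b32 : B e₂ e₃ = 0 := by rw [sw, a23, neg_zero]
  have b42 : B e₂ e₄ = 0 := by rw [sw, a24, neg_zero]
  induction hr using Submodule.span_induction with
  | mem x hx =>
    rcases hx with rfl | rfl | rfl | rfl <;>
    simp [symProj, b0, a13, a14, a23, a24, b31, b41, b32, b42, b21, b43, a12, a34]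
  | zero => simp [symProj]
  | add x y _ _ hx hy =>
    nth_rewrite 2 [← hx]
    nth_rewrite 2 [← hy]
    simp only [symProj, map_add]
    module
  | smul c x _ hx =>
    nth_rewrite 2 [← hx]
    simp only [symProj, map_smul, smul_eq_mul]
    module

theorem symProj_mem {V : Type*} [AddCommGroup V] [Module ℂ V] (B : V → V →ₗ[ℂ] ℂ)
    (e₁ e₂ e₃ e₄ f : V) : symProj B e₁ e₂ e₃ e₄ f ∈ Submodule.span ℂ {e₁, e₂, e₃, e₄} := by
  have m : ∀ x ∈ ({e₁, e₂, e₃, e₄} : Set V), x ∈ Submodule.span ℂ {e₁, e₂, e₃, e₄} := fun x hx =>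
    Submodule.subset_span hx
  unfold symProj
  exact Submodule.add_mem _
    (Submodule.sub_mem _ (Submodule.smul_mem _ _ (m _ (by simp))) (Submodule.smul_mem _ _ (m _ (by simp))))
    (Submodule.sub_mem _ (Submodule.smul_mem _ _ (m _ (by simp))) (Submodule.smul_mem _ _ (m _ (by simp))))

end Hyperbolic

end Symplectic

/-- The symplectic form as an algebraic form. -/
def formL (v : L2) : L2 →ₗ[ℂ] ℂ := (OmL v).toLinearMap

theorem formL_apply (v u : L2) : formL v u = OmL v u := rfl

attribute [irreducible] formL

/-- The symplectic projection onto the span of two hyperbolic pairs. -/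
def Pd (e₁ e₂ e₃ e₄ : L2) : L2 →L[ℂ] L2 :=
  ((OmL e₂ e₁)⁻¹ • OmL e₂).smulRight e₁ - ((OmL e₂ e₁)⁻¹ • OmL e₁).smulRight e₂ +
    (((OmL e₄ e₃)⁻¹ • OmL e₄).smulRight e₃ - ((OmL e₄ e₃)⁻¹ • OmL e₃).smulRight e₄)

theorem Pd_apply (e₁ e₂ e₃ e₄ f : L2) : Pd e₁ e₂ e₃ e₄ f =
    ((OmL e₂ e₁)⁻¹ * OmL e₂ f) • e₁ - ((OmL e₂ e₁)⁻¹ * OmL e₁ f) • e₂ +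
    (((OmL e₄ e₃)⁻¹ * OmL e₄ f) • e₃ - ((OmL e₄ e₃)⁻¹ * OmL e₃ f) • e₄) := rfl

theorem Pd_eq (e₁ e₂ e₃ e₄ f : L2) : Pd e₁ e₂ e₃ e₄ f = symProj formL e₁ e₂ e₃ e₄ f := by
  rw [Pd_apply, symProj]
  simp only [formL_apply]

attribute [irreducible] Pd

/-- Nondegeneracy of `Ω` on the discrete subspace gives both existence and uniqueness of `Pᶜ`: the
part `f - P f` is fixed by `symProj`, and it has the same pairings with the basis as `f`. -/
theorem isPc_iff {σ ω : ℝ} {e₁ e₂ e₃ e₄ : L2} (h : Hyperbolic formL e₁ e₂ e₃ e₄)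
    (hX : X0 σ ω ⊔ X1 σ ω = Submodule.span ℂ {e₁, e₂, e₃, e₄}) (P : L2 →L[ℂ] L2) :
    IsPc σ ω P ↔ ∀ f, P f = f - Pd e₁ e₂ e₃ e₄ f := by
  constructor
  · intro hP f
    obtain ⟨h1, h2⟩ := hP f
    rw [hX] at h2
    have e := h.symProj_eq_self h2
    have m : ∀ x ∈ ({e₁, e₂, e₃, e₄} : Set L2), formL x (f - P f) = formL x f := fun x hx => by
      have := h1 x (by rw [hX]; exact Submodule.subset_span hx)
      rw [Omega_eq, ← formL_apply] at this
      rw [map_sub, this, sub_zero]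
    have e' : symProj formL e₁ e₂ e₃ e₄ (f - P f) = symProj formL e₁ e₂ e₃ e₄ f := by
      simp only [symProj]
      rw [m e₁ (by simp), m e₂ (by simp), m e₃ (by simp), m e₄ (by simp)]
    rw [Pd_eq, ← e', e, sub_sub_cancel]
  · intro hP f
    rw [hP, Pd_eq, sub_sub_cancel, MemXc, hX]
    refine ⟨fun v hv => ?_, Hyperbolic.symProj_mem _ _ _ _ _ _⟩
    rw [Omega_eq, ← formL_apply, map_sub, h.apply_symProj f hv, sub_self]

/-! ### Weighted bounds for the discrete projection -/

/-- `w |a|` is integrable. -/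
def Light (a : S2) : Prop := Integrable (fun x => w x * ‖a x‖) volume

theorem Light.add {a b : S2} (ha : Light a) (hb : Light b) : Light (a + b) := by
  refine (Integrable.add ha hb).mono' (measurable_w.aestronglyMeasurable.mul
    (Lp.aestronglyMeasurable _).norm) ?_
  filter_upwards [Lp.coeFn_add a b] with x hx
  have := w_pos x
  rw [hx, Pi.add_apply, Pi.add_apply, Real.norm_of_nonneg (by positivity), ← mul_add]
  gcongr
  exact norm_add_le _ _

theorem Light.smul {a : S2} (ha : Light a) (c : ℂ) : Light (c • a) := by
  refine (Integrable.const_mul ha ‖c‖).congr ?_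
  filter_upwards [Lp.coeFn_smul c a] with x hx
  rw [hx, Pi.smul_apply, norm_smul]; ring

theorem Light.norm_integral_le {a b : S2} (ha : Light a) {A : ℝ} (hb : ∀ᵐ x, ‖b x‖ ≤ A * w x)
    {f : R3 → ℂ} (hf : ∀ x, ‖f x‖ = ‖a x‖ * ‖b x‖) :
    ‖∫ x, f x‖ ≤ A * ∫ x, w x * ‖a x‖ := by
  rw [← integral_const_mul]
  refine norm_integral_le_of_norm_le (Integrable.const_mul ha A) ?_
  filter_upwards [hb] with x hx
  rw [hf x]
  calc ‖a x‖ * ‖b x‖ ≤ ‖a x‖ * (A * w x) := by gcongr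
    _ = _ := by ring

/-- Both components are light. -/
def Light2 (u : L2) : Prop := Light (cmp 1 u) ∧ Light (cmp (-1) u)

/-- The weighted `L¹` size of a light pair. -/
def lsize (u : L2) : ℝ := (∫ x, w x * ‖cmp 1 u x‖) + ∫ x, w x * ‖cmp (-1) u x‖

theorem lsize_nonneg (u : L2) : 0 ≤ lsize u :=
  add_nonneg (integral_nonneg fun x => mul_nonneg (w_pos x).le (norm_nonneg _))
    (integral_nonneg fun x => mul_nonneg (w_pos x).le (norm_nonneg _))

theorem Light2.norm_OmL_le {u : L2} (hu : Light2 u) {h : L2} {A : ℝ} (hh : WBound A h) :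
    ‖OmL u h‖ ≤ 2 * A * lsize u := by
  have h1 : ‖pairL (cmp (-1) u) (cmp 1 h)‖ ≤ A * ∫ x, w x * ‖cmp (-1) u x‖ := by
    rw [pairL_apply]; exact hu.2.norm_integral_le hh.1 fun x => norm_mul _ _
  have h2 : ‖pairL (cmp 1 u) (cmp (-1) h)‖ ≤ A * ∫ x, w x * ‖cmp 1 u x‖ := by
    rw [pairL_apply]; exact hu.1.norm_integral_le hh.2 fun x => norm_mul _ _
  rw [OmL_apply, norm_mul, norm_mul, Complex.norm_ofNat, Complex.norm_I, lsize]
  have := norm_sub_le (pairL (cmp (-1) u) (cmp 1 h)) (pairL (cmp 1 u) (cmp (-1) h))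
  linarith

theorem Light2.norm_inner_le {u : L2} (hu : Light2 u) {g : L2} {B : ℝ} (hg : WBound B g) :
    ‖inner ℂ g u‖ ≤ 2 * B * lsize u := by
  have h1 : ‖(inner ℂ (cmp 1 g) (cmp 1 u) : ℂ)‖ ≤ B * ∫ x, w x * ‖cmp 1 u x‖ := by
    rw [L2.inner_def]
    exact hu.1.norm_integral_le hg.1 fun x => by rw [RCLike.inner_apply, norm_mul, RCLike.norm_conj]
  have h2 : ‖(inner ℂ (cmp (-1) g) (cmp (-1) u) : ℂ)‖ ≤ B * ∫ x, w x * ‖cmp (-1) u x‖ := by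
    rw [L2.inner_def]
    exact hu.2.norm_integral_le hg.2 fun x => by rw [RCLike.inner_apply, norm_mul, RCLike.norm_conj]
  rw [eq_emb_add u, inner_emb_add, ← eq_emb_add u, norm_mul, Complex.norm_ofNat, lsize]
  have := norm_add_le (inner ℂ (cmp 1 g) (cmp 1 u) : ℂ) (inner ℂ (cmp (-1) g) (cmp (-1) u))
  linarith

/-- The projection is a finite sum of rank one operators built from vectors with finite `L¹_w` norm,
and such vectors pair boundedly with functions that are at most a multiple of `w`. -/
theorem exists_Pd_bound {e₁ e₂ e₃ e₄ : L2} (h1 : Light2 e₁) (h2 : Light2 e₂) (h3 : Light2 e₃)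
    (h4 : Light2 e₄) : ∃ C : ℝ, 0 ≤ C ∧ ∀ (g f : L2) (A B : ℝ), 0 ≤ A → 0 ≤ B → WBound A f →
      WBound B g → ‖inner ℂ g (Pd e₁ e₂ e₃ e₄ f)‖ ≤ C * (A * B) := by
  have n1 := lsize_nonneg e₁
  have n2 := lsize_nonneg e₂
  have n3 := lsize_nonneg e₃
  have n4 := lsize_nonneg e₄
  refine ⟨‖(OmL e₂ e₁)⁻¹‖ * (8 * lsize e₁ * lsize e₂) + ‖(OmL e₄ e₃)⁻¹‖ * (8 * lsize e₃ * lsize e₄),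
    by positivity, fun g f A B hA hB hf hg => ?_⟩
  have key : ∀ (m : ℂ) {u v : L2}, Light2 u → Light2 v →
      ‖inner ℂ g ((m * OmL u f) • v)‖ ≤ ‖m‖ * (4 * lsize u * lsize v) * (A * B) := by
    intro m u v hu hv
    have a1 := hu.norm_OmL_le hf
    have a2 := hv.norm_inner_le hg
    have := lsize_nonneg u
    have := lsize_nonneg v
    rw [inner_smul_right, norm_mul, norm_mul]
    calc _ ≤ ‖m‖ * (2 * A * lsize u) * (2 * B * lsize v) := by gcongr
      _ = _ := by ring
  rw [Pd_apply, inner_add_right, inner_sub_right, inner_sub_right]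
  have k1 := key (OmL e₂ e₁)⁻¹ h2 h1
  have k2 := key (OmL e₂ e₁)⁻¹ h1 h2
  have k3 := key (OmL e₄ e₃)⁻¹ h4 h3
  have k4 := key (OmL e₄ e₃)⁻¹ h3 h4
  refine (norm_add_le _ _).trans ((add_le_add (norm_sub_le _ _) (norm_sub_le _ _)).trans ?_)
  refine (add_le_add (add_le_add k1 k2) (add_le_add k3 k4)).trans (le_of_eq ?_)
  ring

end PointNLS
end

noncomputable section
namespace PointNLS

/-! ### Exponentials -/

theorem integrableOn_pow_mul_exp (n : ℕ) {a : ℝ} (ha : 0 < a) :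
    IntegrableOn (fun r : ℝ => r ^ n * Real.exp (-a * r)) (Set.Ioi 0) := by
  have h := integrableOn_rpow_mul_exp_neg_mul_rpow (p := 1) (s := n) (b := a)
    (by have : (0 : ℝ) ≤ n := Nat.cast_nonneg n; linarith) one_pos ha
  simpa using h

theorem norm_cexp_neg (s : ℝ) (x : R3) : ‖Complex.exp (-s * ‖x‖)‖ = Real.exp (-s * ‖x‖) := by
  rw [Complex.norm_exp]; simp

theorem measurable_cexp_neg (s : ℝ) : Measurable fun x : R3 => Complex.exp (-s * ‖x‖) := by fun_prop

theorem memLp_cexp_neg {s : ℝ} (hs : 0 < s) :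
    MemLp (fun x : R3 => Complex.exp (-s * ‖x‖)) 2 volume := by
  rw [memLp_two_iff_integrable_sq_norm (measurable_cexp_neg s).aestronglyMeasurable]
  simp only [norm_cexp_neg]
  rw [integrable_radial_iff (f := fun r => Real.exp (-s * r) ^ 2)]
  refine (integrableOn_pow_mul_exp 2 (a := 2 * s) (by positivity)).congr_fun (fun r _ => ?_)
    measurableSet_Ioi
  simp only [smul_eq_mul]
  rw [← Real.exp_nat_mul]
  congr 2; push_cast; ring

/-- Since `Δe^{-sr} = s²e^{-sr} - 2s e^{-sr}/r`, one has `(-Δ + s²)e^{-sr} = 8πs G_s`. This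
identifies the free resolvent applied to `G_s`, which is needed for the generalized eigenvector. -/
theorem hasCharge_cexp_neg {s : ℝ} (hs : 0 < s) :
    HasCharge 0 1 (fun x : R3 => Complex.exp (-s * ‖x‖))
      (fun x => 8 * Real.pi * s * Gs s x - (s : ℂ) ^ 2 * Complex.exp (-s * ‖x‖)) := by
  set F : ℂ → ℂ := fun z => Complex.exp (-s * z)
  have hF : Differentiable ℂ F := by fun_prop
  have d1 : deriv F = fun z => -s * F z := by
    ext z
    have := ((hasDerivAt_id z).const_mul (-(s : ℂ))).cexp
    rw [show F = fun z => Complex.exp (-(s : ℂ) * id z) from rfl, this.deriv]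
    ring
  have d2 : deriv (deriv F) = fun z => (s : ℂ) ^ 2 * F z := by
    rw [d1]
    ext z
    rw [deriv_const_mul _ (hF z), d1]; ring
  refine ⟨fun x => F ‖x‖, by fun_prop, by simp [F], Eventually.of_forall fun x => by simp [F], ?_⟩
  refine (isH2loc_radial hF).congr (ae_eq_refl _) ?_
  filter_upwards [coeFn_Gs (κ := s) (by simpa using hs), ae_ne_zero] with x h1 h2
  have hn : (‖x‖ : ℂ) ≠ 0 := by simpa using h2
  have hpi : (Real.pi : ℂ) ≠ 0 := by exact_mod_cast Real.pi_ne_zero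
  rw [d2, d1, h1, Gf]
  simp only [F]
  field_simp
  ring

/-- `e^{-s|x|}` as an element of `L²`. -/
def expS (s : ℝ) : S2 := open Classical in if h : 0 < s then (memLp_cexp_neg h).toLp _ else 0

theorem coeFn_expS {s : ℝ} (h : 0 < s) : expS s =ᵐ[volume] fun x => Complex.exp (-s * ‖x‖) := by
  rw [expS, dif_pos h]; exact (memLp_cexp_neg h).coeFn_toLp

attribute [irreducible] expS

theorem freeRes_Gs {s : ℝ} (hs : 0 < s) :
    (8 * Real.pi * s : ℂ) • freeRes ((s : ℂ) ^ 2) (Gs s) = expS s ∧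
      ell s (Gs s) = 1 / (8 * Real.pi * s) := by
  have hs0 : (s : ℂ) ≠ 0 := by exact_mod_cast hs.ne'
  have hpi : (Real.pi : ℂ) ≠ 0 := by exact_mod_cast Real.pi_ne_zero
  have h : HasCharge 0 1 (expS s) (fun x => ((8 * Real.pi * s : ℂ) • Gs s : S2) x -
      (s : ℂ) ^ 2 * expS s x) := by
    refine (hasCharge_cexp_neg hs).congr (coeFn_expS hs).symm ?_
    filter_upwards [coeFn_expS hs, Lp.coeFn_smul (8 * Real.pi * s : ℂ) (Gs s)] with x h1 h2
    rw [h1, h2, Pi.smul_apply, smul_eq_mul]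
  obtain ⟨h1, h2⟩ := (hasCharge_iff (κ := s) (by simpa using hs) 0 1 _ _).1 h
  rw [zero_smul, add_zero, map_smul] at h1
  rw [zero_mul, zero_div, sub_zero, map_smul, smul_eq_mul] at h2
  refine ⟨h1.symm, ?_⟩
  rw [eq_div_iff (by simp [hs0, hpi]), mul_comm, ← h2]

theorem pairL_Gs {κ κ' : ℝ} (hκ : 0 < κ) (hκ' : 0 < κ') :
    pairL (Gs κ) (Gs κ') = 1 / (4 * Real.pi * (κ + κ')) := by
  rw [pairL_apply, ← integral_Gf_mul_Gf (κ := κ) (κ' := κ') (by simpa using hκ) (by simpa using hκ')]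
  refine integral_congr_ae ?_
  filter_upwards [coeFn_Gs (κ := κ) (by simpa using hκ), coeFn_Gs (κ := κ') (by simpa using hκ')]
    with x h1 h2
  rw [h1, h2]

theorem pairL_expS {κ κ' : ℝ} (hκ : 0 < κ) (hκ' : 0 < κ') :
    pairL (expS κ) (Gs κ') = 1 / ((κ : ℂ) + κ') ^ 2 := by
  rw [pairL_apply, ← integral_exp_mul_Gf hκ hκ']
  refine integral_congr_ae ?_
  filter_upwards [coeFn_expS hκ, coeFn_Gs (κ := κ') (by simpa using hκ')] with x h1 h2
  rw [h1, h2]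

theorem ell_eq_pairL {κ : ℝ} (hκ : 0 < κ) (f : S2) : ell κ f = pairL f (Gs κ) := by
  rw [ell_apply (by simpa using hκ), pairL_apply]
  refine integral_congr_ae ?_
  filter_upwards [coeFn_Gs (κ := κ) (by simpa using hκ)] with x h1
  rw [h1, mul_comm]

theorem light_expS {s : ℝ} (hs : 0 < s) : Light (expS s) := by
  have h : Integrable (fun x : R3 => (1 + 1 / ‖x‖) * Real.exp (-s * ‖x‖)) volume := by
    rw [integrable_radial_iff (f := fun r => (1 + 1 / r) * Real.exp (-s * r))]
    refine ((integrableOn_pow_mul_exp 2 hs).add (integrableOn_pow_mul_exp 1 hs)).congr_fun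
      (fun r hr => ?_) measurableSet_Ioi
    have hr0 : r ≠ 0 := (Set.mem_Ioi.1 hr).ne'
    simp only [Pi.add_apply, smul_eq_mul]
    field_simp
  refine h.congr ?_
  filter_upwards [coeFn_expS hs] with x hx
  rw [hx, norm_cexp_neg, w]

theorem light_Gs {s : ℝ} (hs : 0 < s) : Light (Gs s) := by
  have h : Integrable (fun x : R3 => (1 + 1 / ‖x‖) * (Real.exp (-s * ‖x‖) / (4 * Real.pi * ‖x‖))) volume := by
    rw [integrable_radial_iff (f := fun r => (1 + 1 / r) * (Real.exp (-s * r) / (4 * Real.pi * r)))]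
    refine IntegrableOn.congr_fun (((integrableOn_pow_mul_exp 1 hs).add
      (integrableOn_pow_mul_exp 0 hs)).const_mul (1 / (4 * Real.pi))) (fun r hr => ?_)
      measurableSet_Ioi
    have hr0 : r ≠ 0 := (Set.mem_Ioi.1 hr).ne'
    have := Real.pi_ne_zero
    simp only [Pi.add_apply, smul_eq_mul]
    field_simp
  refine h.congr ?_
  filter_upwards [coeFn_Gs (κ := s) (by simpa using hs)] with x hx
  rw [hx, norm_Gf, w, Complex.ofReal_re]

/-! ### The generalized kernel -/

theorem eq_neg_add_smul_iff {V : Type*} [AddCommGroup V] [Module ℂ V] (a b g : V) (q : ℂ) :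
    a = -b + q • g ↔ a = q • g - b := by rw [neg_add_eq_sub]

theorem alpha1_mul_eq_iff (σ ω : ℝ) (q l : ℂ) :
    alpha1 σ ω * q = -l - q * (√ω : ℝ) / (4 * Real.pi) ↔ σ * (√ω : ℝ) * q = 2 * Real.pi * l := by
  have hpi : (Real.pi : ℂ) ≠ 0 := by exact_mod_cast Real.pi_ne_zero
  simp only [alpha1]
  push_cast
  generalize ((√ω : ℝ) : ℂ) = s
  constructor
  · intro h
    field_simp at h
    linear_combination (-1 / 2) * h
  · intro h
    field_simp
    linear_combination (-2) * h

theorem alpha2_mul_eq_iff (ω : ℝ) (q l : ℂ) :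
    alpha2 ω * q = l - q * (√ω : ℝ) / (4 * Real.pi) ↔ l = 0 := by
  simp only [alpha2]
  push_cast
  generalize ((√ω : ℝ) : ℂ) = s
  constructor
  · intro h
    linear_combination -h
  · intro h
    rw [h]; ring

/-- At `z = 0` the original coordinates decouple completely. Since `α₂ = -√ω/(4π)` is resonant with
`G_{√ω}`, the second coordinate leaves its charge free and imposes a solvability condition on `v₁`,
while the first determines its charge. -/
theorem isL_iff_coord {σ ω : ℝ} (hω : 0 < ω) (u v : L2) : IsL σ ω u v ↔
    (∃ q : ℂ, coord 0 u = q • Gs √ω - freeRes ((√ω : ℝ) ^ 2 : ℂ) (coord 1 v) ∧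
      σ * (√ω : ℝ) * q = 2 * Real.pi * ell √ω (coord 1 v)) ∧
    (∃ q : ℂ, coord 1 u = q • Gs √ω + freeRes ((√ω : ℝ) ^ 2 : ℂ) (coord 0 v)) ∧
      ell √ω (coord 0 v) = 0 := by
  have hs : 0 < √ω := Real.sqrt_pos.2 hω
  have hs2 : ((√ω : ℝ) : ℂ) ^ 2 = ω := by
    rw [← Complex.ofReal_pow, Real.sq_sqrt hω.le]
  have hre : 0 < ((√ω : ℝ) : ℂ).re := by simpa using hs
  have c1 : ∀ q : ℂ, HasCharge q (alpha1 σ ω * q) (coord 0 u) (fun x => - coord 1 v x - ω * coord 0 u x) ↔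
      coord 0 u = q • Gs √ω - freeRes ((√ω : ℝ) ^ 2 : ℂ) (coord 1 v) ∧
      σ * (√ω : ℝ) * q = 2 * Real.pi * ell √ω (coord 1 v) := by
    intro q
    have h := hasCharge_iff hre q (alpha1 σ ω * q) (coord 0 u) (-coord 1 v)
    have e : HasCharge q (alpha1 σ ω * q) (coord 0 u) (fun x => - coord 1 v x - ω * coord 0 u x) ↔
        HasCharge q (alpha1 σ ω * q) (coord 0 u)
          (fun x => (-coord 1 v : S2) x - ((√ω : ℝ) : ℂ) ^ 2 * coord 0 u x) := by
      constructor <;> intro h <;> refine h.congr (ae_eq_refl _) ?_ <;>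
      · filter_upwards [Lp.coeFn_neg (coord 1 v)] with x hx
        rw [hx, Pi.neg_apply, hs2]
    rw [map_neg (freeRes _), map_neg (ell _)] at h
    exact e.trans (h.trans (and_congr (eq_neg_add_smul_iff _ _ _ _) (alpha1_mul_eq_iff _ _ _ _)))
  have c2 : ∀ q : ℂ, HasCharge q (alpha2 ω * q) (coord 1 u) (fun x => coord 0 v x - ω * coord 1 u x) ↔
      coord 1 u = q • Gs √ω + freeRes ((√ω : ℝ) ^ 2 : ℂ) (coord 0 v) ∧
      ell √ω (coord 0 v) = 0 := by
    intro q
    have h := hasCharge_iff hre q (alpha2 ω * q) (coord 1 u) (coord 0 v)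
    have e : HasCharge q (alpha2 ω * q) (coord 1 u) (fun x => coord 0 v x - ω * coord 1 u x) ↔
        HasCharge q (alpha2 ω * q) (coord 1 u)
          (fun x => coord 0 v x - ((√ω : ℝ) : ℂ) ^ 2 * coord 1 u x) := by rw [hs2]
    exact e.trans (h.trans (and_congr (by rw [add_comm]) (alpha2_mul_eq_iff _ _ _)))
  rw [isL_iff]
  simp only [c1, c2]
  constructor
  · rintro ⟨q₁, q₂, h1, h2, h3⟩
    exact ⟨⟨q₁, h1⟩, ⟨q₂, h2⟩, h3⟩
  · rintro ⟨⟨q₁, h1⟩, ⟨q₂, h2⟩, h3⟩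
    exact ⟨q₁, q₂, h1, h2, h3⟩

theorem coord_E (p q : S2) : coord 0 (E p q) = p + q ∧ coord 1 (E p q) = Complex.I • (p - q) := by
  rw [coord_zero_eq, coord_one_eq, (cmp_E p q).1, (cmp_E p q).2]; exact ⟨rfl, rfl⟩

/-- The profile of the generalized eigenfunction. -/
def genP (σ ω : ℝ) : S2 :=
  (2 * Real.pi * ell √ω (Gs √ω) / (σ * (√ω : ℝ))) • Gs √ω - freeRes ((√ω : ℝ) ^ 2 : ℂ) (Gs √ω)

/-- The kernel of `L`. -/
def kerVec (ω : ℝ) : L2 := E (Gs √ω) (-Gs √ω)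

/-- A generalized eigenfunction for the eigenvalue `0`. -/
def genVec (σ ω : ℝ) : L2 := E (genP σ ω) (genP σ ω)

theorem genP_eq {σ ω : ℝ} (hω : 0 < ω) :
    genP σ ω = (1 / (4 * σ * (√ω : ℝ) ^ 2) : ℂ) • Gs √ω - (1 / (8 * Real.pi * (√ω : ℝ)) : ℂ) • expS √ω := by
  have hs : 0 < √ω := Real.sqrt_pos.2 hω
  have hs0 : ((√ω : ℝ) : ℂ) ≠ 0 := by exact_mod_cast hs.ne'
  have hpi : (Real.pi : ℂ) ≠ 0 := by exact_mod_cast Real.pi_ne_zero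
  obtain ⟨h1, h2⟩ := freeRes_Gs hs
  rw [genP, ← h1, h2, smul_smul]
  congr 1
  · congr 1
    field_simp
    ring
  · rw [one_div, inv_mul_cancel₀ (by simp [hs0, hpi]), one_smul]

theorem pairL_genP {σ ω : ℝ} (hω : 0 < ω) {κ : ℝ} (hκ : 0 < κ) :
    pairL (genP σ ω) (Gs κ) = 1 / (4 * σ * (√ω : ℝ) ^ 2) * (1 / (4 * Real.pi * ((√ω : ℝ) + κ))) -
      1 / (8 * Real.pi * (√ω : ℝ)) * (1 / (((√ω : ℝ) : ℂ) + κ) ^ 2) := by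
  have hs : 0 < √ω := Real.sqrt_pos.2 hω
  rw [genP_eq hω, pairL_comm, map_sub, map_smul, map_smul, pairL_comm _ (Gs √ω),
    pairL_comm _ (expS √ω), pairL_Gs hs hκ, pairL_expS hs hκ, smul_eq_mul, smul_eq_mul]

/-- The pairing equals `(1 - σ)/(32πσ ω^{3/2})`. It is the obstruction to prolonging the Jordan
chain at `0`, and it also makes the kernel vector and the generalized eigenvector a hyperbolic pair;
both fail at `σ = 1`. -/
theorem pairL_genP_ne {σ ω : ℝ} (hσ : 0 < σ) (hσ1 : σ < 1) (hω : 0 < ω) :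
    pairL (genP σ ω) (Gs √ω) ≠ 0 := by
  have hs : 0 < √ω := Real.sqrt_pos.2 hω
  rw [pairL_genP hω hs]
  have : (1 / (4 * σ * (√ω : ℝ) ^ 2) * (1 / (4 * Real.pi * ((√ω : ℝ) + (√ω : ℝ)))) -
      1 / (8 * Real.pi * (√ω : ℝ)) * (1 / (((√ω : ℝ) : ℂ) + (√ω : ℝ)) ^ 2) : ℂ) =
      (((1 - σ) / (32 * Real.pi * σ * √ω ^ 3) : ℝ) : ℂ) := by
    have hs0 : ((√ω : ℝ) : ℂ) ≠ 0 := by exact_mod_cast hs.ne'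
    have hpi : (Real.pi : ℂ) ≠ 0 := by exact_mod_cast Real.pi_ne_zero
    have hσ0 : (σ : ℂ) ≠ 0 := by exact_mod_cast hσ.ne'
    push_cast
    rw [← two_mul]
    field_simp
    ring
  rw [this]
  have hp := Real.pi_pos
  have : 0 < (1 - σ) / (32 * Real.pi * σ * √ω ^ 3) := by
    have : 0 < 1 - σ := by linarith
    positivity
  exact_mod_cast this.ne'

theorem isL_kerVec {σ ω : ℝ} (hω : 0 < ω) : IsL σ ω (kerVec ω) 0 := by
  obtain ⟨c0, c1⟩ := coord_E (Gs √ω) (-Gs √ω)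
  rw [isL_iff_coord hω, kerVec, c0, c1]
  simp only [map_zero, mul_zero, add_neg_cancel, sub_zero, add_zero, and_true]
  refine ⟨⟨0, by simp⟩, 2 * Complex.I, ?_⟩
  module

theorem two_mul_div_aux {a b : ℂ} (ha : a ≠ 0) (hb : b ≠ 0) (p l : ℂ) :
    a * b * (2 * (p * l / (a * b))) = p * (2 * l) := by
  field_simp

theorem charge_aux {a b p l q c : ℂ} (ha : a ≠ 0) (hb : b ≠ 0) (h : a * b * q = p * (c * l)) :
    q = c * (p * l / (a * b)) := by
  field_simp
  linear_combination h

theorem isL_smul {σ ω : ℝ} (hω : 0 < ω) (c : ℂ) {u v : L2} (h : IsL σ ω u v) :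
    IsL σ ω (c • u) (c • v) := by
  rw [isL_iff_coord hω] at h ⊢
  obtain ⟨⟨q₁, h1, h2⟩, ⟨q₂, h3⟩, h4⟩ := h
  simp only [map_smul]
  refine ⟨⟨c * q₁, ?_, ?_⟩, ⟨c * q₂, ?_⟩, ?_⟩
  · rw [h1, smul_sub, smul_smul]
  · rw [smul_eq_mul]; linear_combination c * h2
  · rw [h3, smul_add, smul_smul]
  · rw [h4, smul_zero]

set_option maxHeartbeats 2000000 in
theorem isL_genVec {σ ω : ℝ} (hσ : 0 < σ) (hω : 0 < ω) :
    IsL σ ω (genVec σ ω) (-Complex.I • kerVec ω) := by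
  obtain ⟨c0, c1⟩ := coord_E (Gs √ω) (-Gs √ω)
  obtain ⟨d0, d1⟩ := coord_E (genP σ ω) (genP σ ω)
  have hs : 0 < √ω := Real.sqrt_pos.2 hω
  have hs0 : ((√ω : ℝ) : ℂ) ≠ 0 := by exact_mod_cast hs.ne'
  have hσ0 : (σ : ℂ) ≠ 0 := by exact_mod_cast hσ.ne'
  have e0 : coord 0 (-Complex.I • kerVec ω) = 0 := by
    rw [kerVec, map_smul, c0, add_neg_cancel, smul_zero]
  have e1 : coord 1 (-Complex.I • kerVec ω) = (2 : ℂ) • Gs √ω := by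
    rw [kerVec, map_smul, c1, sub_neg_eq_add, smul_smul, ← two_smul ℂ, neg_mul, Complex.I_mul_I,
      neg_neg, one_smul]
  rw [isL_iff_coord hω, genVec, e0, e1, d0, d1]
  refine ⟨⟨2 * (2 * Real.pi * ell √ω (Gs √ω) / (σ * (√ω : ℝ))), ?_, ?_⟩, ⟨0, ?_⟩, ?_⟩
  · rw [genP, map_smul, ← two_smul ℂ, smul_sub, smul_smul]
  · rw [map_smul, smul_eq_mul]
    generalize ell √ω (Gs √ω) = l
    exact two_mul_div_aux hσ0 hs0 _ _
  · rw [sub_self, smul_zero, zero_smul, map_zero, add_zero]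
  · rw [map_zero]

set_option maxHeartbeats 2000000 in
/-- The span of the explicit vectors is closed under preimages by `L`. -/
theorem mem_span_of_isL {σ ω : ℝ} (hσ : 0 < σ) (hσ1 : σ < 1) (hω : 0 < ω) {u v : L2}
    (hv : v ∈ Submodule.span ℂ {kerVec ω, genVec σ ω}) (h : IsL σ ω u v) :
    u ∈ Submodule.span ℂ {kerVec ω, genVec σ ω} := by
  obtain ⟨a, b, rfl⟩ := Submodule.mem_span_pair.1 hv
  have hs : 0 < √ω := Real.sqrt_pos.2 hω
  have hs0 : ((√ω : ℝ) : ℂ) ≠ 0 := by exact_mod_cast hs.ne'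
  have hσ0 : (σ : ℂ) ≠ 0 := by exact_mod_cast hσ.ne'
  obtain ⟨c0, c1⟩ := coord_E (Gs √ω) (-Gs √ω)
  obtain ⟨d0, d1⟩ := coord_E (genP σ ω) (genP σ ω)
  have e0 : coord 0 (a • kerVec ω + b • genVec σ ω) = (2 * b) • genP σ ω := by
    rw [map_add, map_smul, map_smul, kerVec, genVec, c0, d0, add_neg_cancel, smul_zero, zero_add,
      ← two_smul ℂ, smul_smul, mul_comm]
  have e1 : coord 1 (a • kerVec ω + b • genVec σ ω) = (2 * Complex.I * a) • Gs √ω := by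
    rw [map_add, map_smul, map_smul, kerVec, genVec, c1, d1, sub_self, smul_zero, smul_zero,
      add_zero, sub_neg_eq_add, ← two_smul ℂ, smul_smul, smul_smul]
    congr 1; ring
  rw [isL_iff_coord hω, e0, e1] at h
  obtain ⟨⟨q₁, h1, h2⟩, ⟨q₂, h3⟩, h4⟩ := h
  rw [map_smul, smul_eq_mul, ell_eq_pairL hs] at h4
  -- The solvability condition on the first coordinate of `L u` excludes any component along
  -- `genVec`, so the chain has length two.
  have hb : 2 * b = 0 := (mul_eq_zero.1 h4).resolve_right (pairL_genP_ne hσ hσ1 hω)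
  rw [hb, zero_smul, map_zero, add_zero] at h3
  rw [map_smul] at h1 h2
  rw [smul_eq_mul] at h2
  have hq := charge_aux hσ0 hs0 h2
  have h1' : coord 0 u = (2 * Complex.I * a) • genP σ ω := by
    rw [h1, genP, smul_sub, smul_smul, ← hq]
  refine Submodule.mem_span_pair.2 ⟨-Complex.I / 2 * q₂, Complex.I * a, ext_coord ?_ ?_⟩
  · rw [map_add, map_smul, map_smul, kerVec, genVec, c0, d0, add_neg_cancel, smul_zero, zero_add,
      ← two_smul ℂ, smul_smul, h1']
    congr 1; ring
  · rw [map_add, map_smul, map_smul, kerVec, genVec, c1, d1, sub_self, smul_zero, smul_zero,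
      add_zero, sub_neg_eq_add, ← two_smul ℂ, smul_smul, smul_smul, h3]
    congr 1
    linear_combination (-q₂) * Complex.I_sq

theorem X0_eq {σ ω : ℝ} (hσ : 0 < σ) (hσ1 : σ < 1) (hω : 0 < ω) :
    X0 σ ω = Submodule.span ℂ {kerVec ω, genVec σ ω} := by
  apply le_antisymm
  · refine Submodule.span_le.2 ?_
    rintro u ⟨n, c, rfl, hc, hn⟩
    -- Induction from the end of the chain, where `c n = 0`, back to `c 0 = u`.
    have : ∀ k ≤ n, c (n - k) ∈ Submodule.span ℂ {kerVec ω, genVec σ ω} := by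
      intro k
      induction k with
      | zero => intro _; rw [Nat.sub_zero, hn]; exact Submodule.zero_mem _
      | succ k ih =>
        intro hk
        have h := hc (n - (k + 1)) (by omega)
        rw [show n - (k + 1) + 1 = n - k by omega] at h
        exact mem_span_of_isL hσ hσ1 hω (ih (by omega)) h
    simpa using this n le_rfl
  · refine Submodule.span_le.2 ?_
    rintro u (rfl | rfl)
    · refine Submodule.subset_span ⟨1, fun k => if k = 0 then kerVec ω else 0, rfl, ?_, rfl⟩
      intro k hk
      obtain rfl : k = 0 := by omega
      exact isL_kerVec hω
    · refine Submodule.subset_span ⟨2, fun k => if k = 0 then genVec σ ω else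
        if k = 1 then -Complex.I • kerVec ω else 0, rfl, ?_, rfl⟩
      intro k hk
      obtain rfl | rfl : k = 0 ∨ k = 1 := by omega
      · exact isL_genVec hσ hω
      · have := isL_smul hω (-Complex.I) (isL_kerVec (σ := σ) hω)
        rw [smul_zero] at this
        exact this

end PointNLS
end

noncomputable section
namespace PointNLS

/-! ### The eigenvectors for `±iξ` -/

/-- The decay rate of the first component of the eigenvector for `iξ`. -/
def rateSub (σ ω : ℝ) : ℝ := √ω * (σ - √(1 - σ ^ 2))

/-- The decay rate of the second component of the eigenvector for `iξ`. -/
def rateAdd (σ ω : ℝ) : ℝ := √ω * (σ + √(1 - σ ^ 2))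

/-- The eigenvector of `L` for `iξ`. -/
def eigVec (σ ω : ℝ) : L2 :=
  E ((σ : ℂ) • Gs (rateSub σ ω)) ((-(1 + (√(1 - σ ^ 2) : ℝ)) : ℂ) • Gs (rateAdd σ ω))

theorem sqrt_one_sub_sq_lt {σ : ℝ} (hσ : 1 / √2 < σ) : √(1 - σ ^ 2) < σ := by
  have h0 : (0 : ℝ) < 1 / √2 := by positivity
  have h1 : (1 / √2) ^ 2 < σ ^ 2 := by gcongr
  rw [div_pow, Real.sq_sqrt (by norm_num)] at h1
  rw [Real.sqrt_lt' (h0.trans hσ)]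
  linarith

theorem rateSub_pos {σ ω : ℝ} (hσ : 1 / √2 < σ) (hω : 0 < ω) : 0 < rateSub σ ω :=
  mul_pos (Real.sqrt_pos.2 hω) (sub_pos.2 (sqrt_one_sub_sq_lt hσ))

theorem rateAdd_pos {σ ω : ℝ} (hσ : 0 < σ) (hω : 0 < ω) : 0 < rateAdd σ ω :=
  mul_pos (Real.sqrt_pos.2 hω) (by positivity)

theorem rate_sq {σ ω : ℝ} (hσ : 0 < σ) (hσ1 : σ < 1) (hω : 0 < ω) :
    rateSub σ ω ^ 2 = ω - xi σ ω ∧ rateAdd σ ω ^ 2 = ω + xi σ ω := by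
  have h1 : √(1 - σ ^ 2) ^ 2 = 1 - σ ^ 2 := Real.sq_sqrt (by nlinarith)
  have h2 : √ω ^ 2 = ω := Real.sq_sqrt hω.le
  rw [rateSub, rateAdd, xi, mul_pow, mul_pow, h2]
  constructor
  · linear_combination ω * h1
  · linear_combination ω * h1

/-- At `κ = s(σ - τ)`, `μ = s(σ + τ)` the determinant is `s²(1 - τ² - σ²) = 0`, so the two charge
equations are proportional and their solutions are the multiples of `(σ, -(1 + τ))`. -/
theorem charges_iff {s σ τ : ℂ} (hs : s ≠ 0) (hσ : σ ≠ 0) (h : σ ^ 2 + τ ^ 2 = 1) (c c' : ℂ) :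
    ((s * (σ - τ) - (σ + 1) * s) * c - σ * s * c' = 0 ∧
      (s * (σ + τ) - (σ + 1) * s) * c' - σ * s * c = 0) ↔
    c = c / σ * σ ∧ c' = c / σ * -(1 + τ) := by
  constructor
  · rintro ⟨h1, -⟩
    refine ⟨by field_simp, ?_⟩
    have h1' : s * (σ * c' + (1 + τ) * c) = 0 := by linear_combination -h1
    have h2 := (mul_eq_zero.1 h1').resolve_left hs
    field_simp
    linear_combination h2
  · rintro ⟨-, h2⟩
    rw [h2]
    constructor
    · field_simp
      ring
    · field_simp
      linear_combination (-s * c) * h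

/-- For `z = iξ` the squares are `κ² = ω - ξ` and `μ² = ω + ξ`, with roots `√ω(σ ∓ √(1-σ²))`; the
smaller one is positive exactly because `σ > 1/√2`. The homogeneous charge system then gives a
one-dimensional eigenspace. -/
theorem isL_eig_iff {σ ω : ℝ} (hσ : 1 / √2 < σ) (hσ1 : σ < 1) (hω : 0 < ω) (u : L2) :
    IsL σ ω u ((Complex.I * (xi σ ω : ℂ)) • u) ↔ ∃ k : ℂ, k • eigVec σ ω = u := by
  have hσ0 : 0 < σ := lt_trans (by positivity) hσ
  obtain ⟨e1, e2⟩ := rate_sq hσ0 hσ1 hω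
  have hκ := rateSub_pos hσ hω
  have hμ := rateAdd_pos hσ0 hω
  have hτ : √(1 - σ ^ 2) ^ 2 = 1 - σ ^ 2 := Real.sq_sqrt (by nlinarith)
  have hcomp : ((σ : ℂ)) ^ 2 + ((√(1 - σ ^ 2) : ℝ) : ℂ) ^ 2 = 1 := by
    rw [← Complex.ofReal_pow, ← Complex.ofReal_pow, hτ]; push_cast; ring
  have hs0 : ((√ω : ℝ) : ℂ) ≠ 0 := by exact_mod_cast (Real.sqrt_pos.2 hω).ne'
  have hσc : (σ : ℂ) ≠ 0 := by exact_mod_cast hσ0.ne'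
  have key := isL_iff_cmp σ ω (z := Complex.I * (xi σ ω : ℂ)) (κ := (rateSub σ ω : ℝ))
    (μ := (rateAdd σ ω : ℝ)) (by simpa using hκ) (by simpa using hμ)
    (by rw [← Complex.ofReal_pow, e1]; push_cast; linear_combination -(xi σ ω : ℂ) * Complex.I_sq)
    (by rw [← Complex.ofReal_pow, e2]; push_cast; linear_combination (xi σ ω : ℂ) * Complex.I_sq)
    u 0
  rw [zero_add] at key
  simp only [map_zero, smul_zero, zero_add, mul_zero, neg_zero] at key
  rw [key]
  have hk := fun c c' => charges_iff (s := (√ω : ℝ)) (σ := σ) (τ := (√(1 - σ ^ 2) : ℝ)) hs0 hσc hcomp c c'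
  have hcast : ∀ c c' : ℂ, ((((rateSub σ ω : ℝ) : ℂ) - pp σ ω) * c - dd σ ω * c' = 0 ∧
      (((rateAdd σ ω : ℝ) : ℂ) - pp σ ω) * c' - dd σ ω * c = 0) ↔
      c = c / σ * σ ∧ c' = c / σ * -(1 + (√(1 - σ ^ 2) : ℝ)) := by
    intro c c'
    rw [← hk c c']
    simp only [rateSub, rateAdd, pp, dd]
    push_cast
    rfl
  obtain ⟨k1, k2⟩ := cmp_E ((σ : ℂ) • Gs (rateSub σ ω))
    ((-(1 + (√(1 - σ ^ 2) : ℝ)) : ℂ) • Gs (rateAdd σ ω))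
  constructor
  · rintro ⟨c, c', h1, h2, h3⟩
    obtain ⟨h3, h4⟩ := (hcast c c').1 h3
    refine ⟨c / σ, ext_cmp ?_ ?_⟩
    · rw [map_smul, eigVec, k1, h1, smul_smul, ← h3]
    · rw [map_smul, eigVec, k2, h2, smul_smul, ← h4]
  · rintro ⟨k, rfl⟩
    refine ⟨k * σ, k * -(1 + (√(1 - σ ^ 2) : ℝ)), ?_, ?_, ?_⟩
    · rw [map_smul, eigVec, k1, smul_smul]
    · rw [map_smul, eigVec, k2, smul_smul]
    · refine (hcast _ _).2 ⟨?_, ?_⟩ <;> rw [mul_div_cancel_right₀ _ hσc]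

theorem X1_eq {σ ω : ℝ} (hσ : 1 / √2 < σ) (hσ1 : σ < 1) (hω : 0 < ω) :
    X1 σ ω = Submodule.span ℂ {eigVec σ ω, refl (eigVec σ ω)} := by
  have h2 : ∀ u, IsL σ ω u ((-(Complex.I * (xi σ ω : ℂ))) • u) ↔
      ∃ k : ℂ, k • refl (eigVec σ ω) = u := by
    intro u
    have hr : ∀ (c : ℂ) (u : L2), IsL σ ω u (c • u) → IsL σ ω (refl u) ((-c) • refl u) := by
      intro c u h
      have := h.refl
      rwa [map_smul, ← neg_smul] at this
    constructor
    · intro h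
      have h' := hr _ _ h
      rw [neg_neg] at h'
      obtain ⟨k, hk⟩ := (isL_eig_iff hσ hσ1 hω _).1 h'
      exact ⟨k, by rw [← map_smul, hk, refl_refl]⟩
    · rintro ⟨k, rfl⟩
      rw [← map_smul]
      exact hr _ _ ((isL_eig_iff hσ hσ1 hω _).2 ⟨k, rfl⟩)
  simp only [X1, h2, isL_eig_iff hσ hσ1 hω]
  apply le_antisymm
  · refine Submodule.span_le.2 ?_
    rintro u (⟨k, rfl⟩ | ⟨k, rfl⟩)
    · exact Submodule.smul_mem _ _ (Submodule.subset_span (by simp))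
    · exact Submodule.smul_mem _ _ (Submodule.subset_span (by simp))
  · refine Submodule.span_mono ?_
    rintro u (rfl | rfl)
    · exact Or.inl ⟨1, one_smul _ _⟩
    · exact Or.inr ⟨1, one_smul _ _⟩

theorem refl_E (p q : S2) : refl (E p q) = E q p := by
  rw [refl_apply, (cmp_E p q).1, (cmp_E p q).2]; rfl

theorem X0_sup_X1 {σ ω : ℝ} (hσ : 1 / √2 < σ) (hσ1 : σ < 1) (hω : 0 < ω) :
    X0 σ ω ⊔ X1 σ ω =
      Submodule.span ℂ {kerVec ω, genVec σ ω, eigVec σ ω, refl (eigVec σ ω)} := by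
  rw [X0_eq (lt_trans (by positivity) hσ) hσ1 hω, X1_eq hσ hσ1 hω, ← Submodule.span_union]
  congr 1
  ext x
  simp only [Set.mem_union, Set.mem_insert_iff, Set.mem_singleton_iff]
  tauto

/-! ### The symplectic products -/

theorem kernel_orthogonality {s σ τ p : ℂ} (hs : s ≠ 0) (hp : p ≠ 0) (h1 : 1 + σ - τ ≠ 0)
    (h2 : 1 + σ + τ ≠ 0) (h : σ ^ 2 + τ ^ 2 = 1) :
    σ * (1 / (4 * p * (s + s * (σ - τ)))) + -(1 + τ) * (1 / (4 * p * (s + s * (σ + τ)))) = 0 := by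
  rw [show s + s * (σ - τ) = s * (1 + σ - τ) by ring, show s + s * (σ + τ) = s * (1 + σ + τ) by ring]
  field_simp
  linear_combination h

theorem genVec_orthogonality {s σ τ p : ℂ} (hs : s ≠ 0) (hσ : σ ≠ 0) (hp : p ≠ 0)
    (h1 : 1 + σ - τ ≠ 0) (h2 : 1 + σ + τ ≠ 0) (h : σ ^ 2 + τ ^ 2 = 1) :
    -(1 + τ) * (1 / (4 * σ * s ^ 2) * (1 / (4 * p * (s + s * (σ + τ)))) -
        1 / (8 * p * s) * (1 / (s + s * (σ + τ)) ^ 2)) -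
      σ * (1 / (4 * σ * s ^ 2) * (1 / (4 * p * (s + s * (σ - τ)))) -
        1 / (8 * p * s) * (1 / (s + s * (σ - τ)) ^ 2)) = 0 := by
  rw [show s + s * (σ - τ) = s * (1 + σ - τ) by ring, show s + s * (σ + τ) = s * (1 + σ + τ) by ring]
  have k : (1 + τ) * (1 + σ - τ) = σ * (1 + σ + τ) := by linear_combination -h
  have n : ∀ D : ℂ, D ≠ 0 → 1 / (4 * σ * s ^ 2) * (1 / (4 * p * (s * D))) -
      1 / (8 * p * s) * (1 / (s * D) ^ 2) = (D - 2 * σ) / (16 * p * σ * s ^ 3 * D ^ 2) := by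
    intro D hD
    field_simp
    ring
  rw [n _ h1, n _ h2]
  field_simp
  linear_combination (-(1 - σ + τ) * (1 + σ - τ)) * k + (2 * σ * (1 + σ + τ)) * h

theorem eig_pairing_ne_zero {σ τ κ μ p : ℂ} (hp : p ≠ 0) (hκ : κ ≠ 0) (hμ : μ ≠ 0)
    (h : σ ^ 2 * μ - (1 + τ) ^ 2 * κ ≠ 0) :
    2 * Complex.I * (σ • σ • (1 / (4 * p * (κ + κ))) -
      -(1 + τ) • -(1 + τ) • (1 / (4 * p * (μ + μ)))) ≠ 0 := by
  have e : 2 * Complex.I * (σ • σ • (1 / (4 * p * (κ + κ))) -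
      -(1 + τ) • -(1 + τ) • (1 / (4 * p * (μ + μ)))) =
      Complex.I / (4 * p * κ * μ) * (σ ^ 2 * μ - (1 + τ) ^ 2 * κ) := by
    simp only [smul_eq_mul, ← two_mul]
    field_simp
  rw [e]
  exact mul_ne_zero (div_ne_zero Complex.I_ne_zero (by simp [hp, hκ, hμ])) h

/-- The operator `L` is skew for `Ω`, so generalized eigenspaces are orthogonal unless their
eigenvalues add up to zero; the pairs are therefore `0` with `0` and `iξ` with `-iξ`. The
orthogonality relations are verified directly from the explicit pairings and `σ² + τ² = 1`, where `τ
= √(1-σ²)`. -/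
theorem hyperbolic_formL {σ ω : ℝ} (hσ : 1 / √2 < σ) (hσ1 : σ < 1) (hω : 0 < ω) :
    Hyperbolic formL (kerVec ω) (genVec σ ω) (eigVec σ ω) (refl (eigVec σ ω)) := by
  have hσ0 : 0 < σ := lt_trans (by positivity) hσ
  have hs := Real.sqrt_pos.2 hω
  have hκ := rateSub_pos hσ hω
  have hμ := rateAdd_pos hσ0 hω
  have hlt := sqrt_one_sub_sq_lt hσ
  have hτ0 : 0 < √(1 - σ ^ 2) := Real.sqrt_pos.2 (by nlinarith)
  have hτ : √(1 - σ ^ 2) ^ 2 = 1 - σ ^ 2 := Real.sq_sqrt (by nlinarith)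
  have hcomp : ((σ : ℂ)) ^ 2 + ((√(1 - σ ^ 2) : ℝ) : ℂ) ^ 2 = 1 := by
    rw [← Complex.ofReal_pow, ← Complex.ofReal_pow, hτ]; push_cast; ring
  have hs0 : ((√ω : ℝ) : ℂ) ≠ 0 := by exact_mod_cast hs.ne'
  have hσc : (σ : ℂ) ≠ 0 := by exact_mod_cast hσ0.ne'
  have hpi : (Real.pi : ℂ) ≠ 0 := by exact_mod_cast Real.pi_ne_zero
  have d1 : 1 + (σ : ℂ) - (√(1 - σ ^ 2) : ℝ) ≠ 0 := by
    have : 1 + σ - √(1 - σ ^ 2) ≠ 0 := by linarith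
    exact_mod_cast this
  have d2 : 1 + (σ : ℂ) + (√(1 - σ ^ 2) : ℝ) ≠ 0 := by
    have : 1 + σ + √(1 - σ ^ 2) ≠ 0 := by linarith
    exact_mod_cast this
  have k1 := kernel_orthogonality hs0 hpi d1 d2 hcomp
  have k2 := genVec_orthogonality hs0 hσc hpi d1 d2 hcomp
  have pKG := pairL_Gs hs hκ
  have pMG := pairL_Gs hs hμ
  have pKP := pairL_genP (σ := σ) hω hκ
  have pMP := pairL_genP (σ := σ) hω hμ
  have cK : ((rateSub σ ω : ℝ) : ℂ) = (√ω : ℝ) * (σ - (√(1 - σ ^ 2) : ℝ)) := by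
    rw [rateSub]; push_cast; rfl
  have cM : ((rateAdd σ ω : ℝ) : ℂ) = (√ω : ℝ) * (σ + (√(1 - σ ^ 2) : ℝ)) := by
    rw [rateAdd]; push_cast; rfl
  have neg_left : ∀ a b : S2, pairL (-a) b = -pairL a b := fun a b => by
    rw [pairL_comm, map_neg, pairL_comm]
  refine ⟨fun u v => by rw [formL_apply, formL_apply, OmL_swap], ?_, ?_, ?_, ?_, ?_, ?_⟩
  · rw [formL_apply, genVec, kerVec, OmL_E, neg_left, pairL_comm]
    have := pairL_genP_ne (σ := σ) hσ0 hσ1 hω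
    have e : ∀ x : ℂ, 2 * Complex.I * (x - -x) = 4 * Complex.I * x := fun x => by ring
    rw [e]
    simp [this]
  · rw [formL_apply, eigVec, refl_E, OmL_E, map_smul, map_smul, pairL_smul_left, pairL_smul_left,
      pairL_Gs hκ hκ, pairL_Gs hμ hμ]
    -- Up to a nonzero factor this is `Ω` of the two eigenvectors. It factors as `2√ω τ(1 + τ)(1 -
    -- σ)` with `τ = √(1-σ²)`, and is positive for `σ < 1`.
    have hpos : 0 < σ ^ 2 * rateAdd σ ω - (1 + √(1 - σ ^ 2)) ^ 2 * rateSub σ ω := by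
      have e : σ ^ 2 * rateAdd σ ω - (1 + √(1 - σ ^ 2)) ^ 2 * rateSub σ ω =
          √ω * (2 * √(1 - σ ^ 2) * (1 + √(1 - σ ^ 2)) * (1 - σ)) := by
        rw [rateAdd, rateSub]
        linear_combination (√ω * (σ + √(1 - σ ^ 2))) * hτ
      have := sub_pos.2 hσ1
      rw [e]; positivity
    have hKc : ((rateSub σ ω : ℝ) : ℂ) ≠ 0 := by exact_mod_cast hκ.ne'
    have hMc : ((rateAdd σ ω : ℝ) : ℂ) ≠ 0 := by exact_mod_cast hμ.ne'
    have hc : (σ : ℂ) ^ 2 * rateAdd σ ω - (1 + (√(1 - σ ^ 2) : ℝ)) ^ 2 * rateSub σ ω ≠ 0 := by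
      exact_mod_cast hpos.ne'
    exact eig_pairing_ne_zero hpi hKc hMc hc
  · rw [formL_apply, eigVec, kerVec, OmL_E, neg_left, map_smul, map_smul, pKG, pMG, cK, cM,
      smul_eq_mul, smul_eq_mul]
    linear_combination (2 * Complex.I) * k1
  · rw [formL_apply, eigVec, refl_E, kerVec, OmL_E, neg_left, map_smul, map_smul, pKG, pMG, cK, cM,
      smul_eq_mul, smul_eq_mul]
    linear_combination (2 * Complex.I) * k1
  · rw [formL_apply, eigVec, genVec, OmL_E, map_smul, map_smul, pKP, pMP, cK, cM,
      smul_eq_mul, smul_eq_mul]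
    linear_combination (2 * Complex.I) * k2
  · rw [formL_apply, eigVec, refl_E, genVec, OmL_E, map_smul, map_smul, pKP, pMP, cK, cM,
      smul_eq_mul, smul_eq_mul]
    linear_combination (-2 * Complex.I) * k2

theorem light2_E {p q : S2} (hp : Light p) (hq : Light q) : Light2 (E p q) := by
  rw [Light2, (cmp_E p q).1, (cmp_E p q).2]; exact ⟨hp, hq⟩

theorem light2_kerVec {ω : ℝ} (hω : 0 < ω) : Light2 (kerVec ω) := by
  have h := light_Gs (Real.sqrt_pos.2 hω)
  have h' := h.smul (-1)
  rw [neg_one_smul] at h'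
  exact light2_E h h'

theorem light2_genVec {σ ω : ℝ} (hω : 0 < ω) : Light2 (genVec σ ω) := by
  have hs := Real.sqrt_pos.2 hω
  have h : Light (genP σ ω) := by
    rw [genP_eq hω, sub_eq_add_neg, ← neg_smul]
    exact ((light_Gs hs).smul _).add ((light_expS hs).smul _)
  exact light2_E h h

theorem light2_eigVec {σ ω : ℝ} (hσ : 1 / √2 < σ) (hω : 0 < ω) :
    Light2 (eigVec σ ω) ∧ Light2 (refl (eigVec σ ω)) := by
  have h := (light_Gs (rateSub_pos hσ hω)).smul (σ : ℂ)
  have h' := (light_Gs (rateAdd_pos (lt_trans (by positivity) hσ) hω)).smul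
    ((-(1 + (√(1 - σ ^ 2) : ℝ)) : ℂ))
  rw [eigVec, refl_E]
  exact ⟨light2_E h h', light2_E h' h⟩

end PointNLS
end

noncomputable section
namespace PointNLS

/-! ### The matrix `J` -/

theorem coeFn_J (h : L2) : ∀ᵐ x, J h x 0 = h x 1 ∧ J h x 1 = -h x 0 := by
  filter_upwards [ContinuousLinearMap.coeFn_compLpL (p := 2) (μ := volume)
    (Matrix.toEuclideanCLM (n := Fin 2) (𝕜 := ℂ) !![0, 1; -1, 0]) h] with x hx
  rw [J, hx]
  rw [Matrix.ofLp_toEuclideanCLM]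
  constructor <;> simp [Matrix.mulVec, dotProduct]

theorem cmp_J (h : L2) : cmp 1 (J h) = Complex.I • cmp 1 h ∧
    cmp (-1) (J h) = (-Complex.I) • cmp (-1) h := by
  have key : ∀ c : ℂ, c * c = 1 → cmp c (J h) = (c * Complex.I) • cmp c h := by
    intro c hc
    refine Lp.ext ?_
    filter_upwards [coeFn_J h, coeFn_cmp c (J h), coeFn_cmp c h,
      Lp.coeFn_smul (c * Complex.I) (cmp c h)] with x h1 h2 h3 h4
    rw [h2, h4, Pi.smul_apply, h3, h1.1, h1.2, smul_eq_mul]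
    linear_combination (c * c * h x 1 / 2) * Complex.I_sq - (h x 1 / 2) * hc
  have e1 := key 1 (one_mul 1)
  have e2 := key (-1) (by norm_num)
  rw [one_mul] at e1
  rw [neg_one_mul] at e2
  exact ⟨e1, e2⟩

/-- This is the identity `J = i(Π⁺ - Π⁻)` for the operator without point interaction: `emb 1 ∘ cmp
1` is the free `Π⁺`, and its conjugate by the reflection is the free `Π⁻`. -/
theorem J_eq (h : L2) : J h = Complex.I • (emb 1 (cmp 1 h) - refl (emb 1 (cmp 1 (refl h)))) := by
  obtain ⟨h1, h2⟩ := cmp_J h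
  refine ext_cmp ?_ ?_
  · rw [h1, map_smul, map_sub, (cmp_refl _).1, cmp_emb, cmp_emb]
    norm_num
  · rw [h2, map_smul, map_sub, (cmp_refl _).2, cmp_emb, cmp_emb, (cmp_refl h).1, neg_smul]
    norm_num

theorem wBound_J {A : ℝ} {h : L2} (hh : ∀ᵐ x, ‖h x‖ ≤ A * w x) : WBound A (J h) := by
  refine wBound_of_norm_le ?_
  filter_upwards [hh, coeFn_J h] with x h1 h2
  rw [EuclideanSpace.norm_eq, Fin.sum_univ_two] at h1 ⊢
  rwa [h2.1, h2.2, norm_neg, add_comm]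

theorem combination_eq (D J' T T' a b : L2) (hJ : J' = Complex.I • (a - b)) :
    J' - D - Complex.I • (T - T') = -D - Complex.I • (T - a) + Complex.I • (T' - b) := by
  rw [hJ]; module

theorem norm_inner_combination_le {g D S S' : L2} {a b : ℝ} (h1 : ‖inner ℂ g D‖ ≤ a)
    (h2 : ‖inner ℂ g S‖ ≤ b) (h3 : ‖inner ℂ g S'‖ ≤ b) :
    ‖inner ℂ g (-D - Complex.I • S + Complex.I • S')‖ ≤ a + 2 * b := by
  rw [inner_add_right, inner_sub_right, inner_neg_right, inner_smul_right, inner_smul_right]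
  refine (norm_add_le _ _).trans ?_
  have := norm_sub_le (-inner ℂ g D) (Complex.I * inner ℂ g S)
  rw [norm_neg, norm_mul, Complex.norm_I, one_mul] at this
  rw [norm_mul, Complex.norm_I, one_mul]
  linarith

/-- The free parts cancel against `J` by `combination_eq`. What remains is tested against `g` with
`|g| ≤ w`: one discrete term, the correction to `Π⁺`, and the correction to `Π⁻`, which is that to
`Π⁺` with both arguments reflected. This accounts for the constant `Cd + 2 * Cp`. -/
theorem weighted_estimate {σ ω δ K : ℝ} (hB : StripBounds σ ω δ K) (hσ : 1 / √2 < σ) (hσ1 : σ < 1)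
    (hω : 0 < ω) : ∃ C : ℝ, 0 < C ∧ ∀ Pc Pp Pm : L2 →L[ℂ] L2, IsPc σ ω Pc → IsPiPlus σ ω Pp →
      IsPiMinus σ ω Pm → ∀ h : L2, normLinfw h < ⊤ →
        normL1w (Pc (J h) - Complex.I • (Pp h - Pm h)) ≤ ENNReal.ofReal C * normLinfw h := by
  obtain ⟨Cd, hCd, hd⟩ := exists_Pd_bound (light2_kerVec hω) (light2_genVec (σ := σ) hω)
    (light2_eigVec hσ hω).1 (light2_eigVec hσ hω).2
  obtain ⟨Cp, hCp, hp⟩ := hB.exists_isPiPlus_bound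
  refine ⟨Cd + 2 * Cp + 1, by positivity, fun Pc Pp Pm hPc hPp hPm h hfin => ?_⟩
  rw [isPc_iff (hyperbolic_formL hσ hσ1 hω) (X0_sup_X1 hσ hσ1 hω)] at hPc
  rw [isPiMinus_iff] at hPm
  set A := (normLinfw h).toReal
  have hA : 0 ≤ A := ENNReal.toReal_nonneg
  have hn := norm_le_normLinfw h hfin
  have hw := wBound_of_norm_le hn
  rw [show normLinfw h = ENNReal.ofReal A from (ENNReal.ofReal_toReal hfin.ne).symm,
    ← ENNReal.ofReal_mul (by positivity)]
  refine normL1w_le_of_dual fun g hg => ?_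
  have hg' : WBound 1 g := wBound_of_norm_le (by simpa using hg)
  have b1 := hd g (J h) A 1 hA one_pos.le (wBound_J hn) hg'
  have b2 := hp Pp hPp g h A 1 hA one_pos.le hw hg'
  have b3 := hp _ hPm (refl g) (refl h) A 1 hA one_pos.le hw.refl hg'.refl
  rw [← inner_refl, map_sub, ContinuousLinearMap.comp_apply, ContinuousLinearMap.comp_apply,
    refl_refl, refl_refl] at b3
  rw [hPc, combination_eq _ _ _ _ _ _ (J_eq h)]
  refine (norm_inner_combination_le b1 b2 b3).trans ?_
  rw [mul_one]
  linarith

end PointNLS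
end

/-! ### Existence of the projections and the weighted estimate. -/

theorem mainTheorem8 (σ ω : ℝ) (hσ : 1 / Real.sqrt 2 < σ) (hσ1 : σ < 1) (hω : 0 < ω) :
    (∃ Pc, IsPc σ ω Pc) ∧ (∃ Pp, IsPiPlus σ ω Pp) ∧ (∃ Pm, IsPiMinus σ ω Pm) ∧
    ∃ C : ℝ, 0 < C ∧
      ∀ Pc Pp Pm : L2 →L[ℂ] L2, IsPc σ ω Pc → IsPiPlus σ ω Pp → IsPiMinus σ ω Pm →
        ∀ h : L2, MemXc σ ω h → normLinfw h < ⊤ →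
          normL1w (Pc (PointNLS.J h) - Complex.I • (Pp h - Pm h))
            ≤ ENNReal.ofReal C * normLinfw h := by
  obtain ⟨δ, K, hB⟩ := exists_stripBounds hσ hω
  obtain ⟨Pp, hPp, -⟩ := hB.exists_isPiPlus
  refine ⟨⟨ContinuousLinearMap.id ℂ L2 - Pd _ _ _ _,
    (isPc_iff (hyperbolic_formL hσ hσ1 hω) (X0_sup_X1 hσ hσ1 hω) _).2 fun f => rfl⟩, ⟨Pp, hPp⟩,
    ⟨PointNLS.refl.comp (Pp.comp PointNLS.refl), ?_⟩, ?_⟩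
  · rw [isPiMinus_iff]
    convert hPp using 1
    ext1 f
    simp only [ContinuousLinearMap.comp_apply, refl_refl]
  · obtain ⟨C, hC, h⟩ := weighted_estimate hB hσ hσ1 hω
    exact ⟨C, hC, fun Pc Pp Pm h1 h2 h3 f _ hf => h Pc Pp Pm h1 h2 h3 f hf⟩
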